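/- All algebras are associative and unital over $\mathbb{C}$, and $\otimes=\otimes_{\mathbb C}$. Let $A$ be an algebra, $\mathcal Z$ its centre, $S\subset\mathcal Z$ a multiplicative subset with $1\in S$, $0\notin S$, let $\widehat{\mathcal Z}=\mathcal Z[S^{-1}]$, $\widehat A=A\otimes_{\mathcal Z}\widehat{\mathcal Z}$, and let $L:A\to\widehat A$ be the canonical map. $HH_*$ and $HH^*$ denote Hochschild homology and cohomology, computed by the complexes $A\otimes A^{\otimes n}$ and $\operatorname{Hom}(A^{\otimes n},A)$, with the operations $$(f\cup g)(a_1,\dots,a_{p+q})=f(a_1,\dots,a_p)\,g(a_{p+1},\dots,a_{p+q}),\qquad f\cap(a_0\otimes\dots\otimes a_n)=a_0f(a_1,\dots,a_p)\otimes a_{p+1}\otimes\dots\otimes a_n,$$ the Connes differential $B(a_0\otimes\dots\otimes a_n)=\sum_{i=0}^n(-1)^{ni}\,1\otimes a_i\otimes\dots\otimes a_{i-1}+\sum_{i=0}^n(-1)^{n(i+1)}a_{i-1}\otimes1\otimes a_i\otimes\dots\otimes a_{i-2}$ (indices mod $n+1$), and the Gerstenhaber bracket $\{f,g\}=f\circ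 g-(-1)^{(|f|+1)(|g|+1)}g\circ f$, where $(f\circ g)(a_1,\dots)=\sum_{j\ge0}(-1)^{j(|g|+1)}f(a_1,\dots,a_j,g(a_{j+1},\dots),\dots)$. Let $L_*:HH_*(A)\to HH_*(\widehat A)$ be $a_0\otimes\dots\otimes a_n\mapsto L(a_0)\otimes\dots\otimes L(a_n)$. Precomposition with $L^{\otimes n}$ induces isomorphisms $HH^n(\widehat A,\widehat A)\to HH^n(A,\widehat A)$; let $L^*:HH^*(A)\to HH^*(\widehat A)$ be $f\mapsto L\circ f$, with values in $HH^*(A,\widehat A)$, followed by the inverse of these isomorphisms. An algebra $A$ is homologically smooth if, as a module over $A^e=A\otimes A^{op}$, it has a bounded resolution by finitely generated projective modules. It is Calabi–Yau of dimension $n$ (CY-$n$) if moreover $\operatorname{Ext}^i_{A^e}(A,A\otimes A)=0$ for $i\ne n$ and there is an isomorphism of $A$-bimodules $A\cong\operatorname{Ext}^n_{A^e}(A,A\otimes A)$ (for the bimodule structure induced by the inner one of $A\otimes A$); the image $v$ of $1$ under such an isomorphism is called a volume. A class $\pi\in HH_n(A)$ is nondegenerate if it corresponds to a volume $v$: the map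 $\operatorname{Ext}^n_{A^e}(A,A\otimes A)\to HH_0(A,A\otimes A)\cong A$, $u\mapsto u\cap\pi$ (with $x\otimes y\mapsto yx$), is inverse to $a\mapsto a v$. In that case $\mathbb D_\pi:HH^*(A)\to HH_{n-*}(A)$, $f\mapsto f\cap\pi$, is an isomorphism, and $\Delta_\pi=\mathbb D_\pi^{-1}B\,\mathbb D_\pi:HH^*(A)\to HH^{*-1}(A)$ is the BV operator. **Theorem.** 1. The map $\widehat L^*:HH^*(A)\otimes_{\mathcal Z}\widehat{\mathcal Z}\to HH^*(\widehat A)$, $f\otimes z\mapsto L^*(f)\cup z$ for $z\in\widehat{\mathcal Z}$ (in particular for $z=s^{-1}$, $s\in S$), is a well-defined morphism of graded unital $\widehat{\mathcal Z}$-algebras. 2. If $A$ is homologically smooth, then $\widehat L^*$ is an isomorphism. 3. Suppose that $A$ is CY-$n$ and let $\pi\in HH_n(A)$ be a nondegenerate element. Then $\widehat A$ is CY-$n$, $L_*(\pi)$ is nondegenerate, $\mathbb D_\pi$ and $\mathbb D_{L_*(\pi)}$ are isomorphisms, and $\widehat L^*$ is an isomorphism of BV algebras: it is an isomorphism of graded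 algebras that intertwines $\Delta_{L_*(\pi)}$ with a well-defined additive operator $\widehat\Delta_\pi$ of square zero on $HH^*(A)\otimes_{\mathcal Z}\widehat{\mathcal Z}$, which satisfies $$\widehat\Delta_\pi(f\otimes s^{-1})=\Delta_\pi(f)\otimes s^{-1}+\{s,f\}\otimes s^{-2}\qquad\text{for all } f\in HH^*(A),\ s\in S.$$ (With the bracket of the opposite overall sign, for which $\Delta_\pi(s\cup f)=s\cup\Delta_\pi(f)+\{s,f\}$ holds for central $s$, the last formula reads $\Delta_\pi(f)\otimes s^{-1}-\{s,f\}\otimes s^{-2}$.) -/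

import Mathlib

open scoped TensorProduct
open Function (update)

universe u

set_option linter.unusedSectionVars false

noncomputable section

namespace Hoch

section Tensors

variable (k : Type*) [CommRing k] (A : Type*) [Ring A] [Algebra k A]

/-- The tensor power `A^{⊗ n}` over `k`. -/
abbrev T (n : ℕ) : Type _ := PiTensorProduct k (fun _ : Fin n => A)

variable {A}

/-- The pure tensor `a 0 ⊗ ⋯ ⊗ a (n-1)` built from the first `n` terms of a sequence. -/
def tp (n : ℕ) (a : ℕ → A) : T k A n := PiTensorProduct.tprod k (fun i : Fin n => a i)

/-- `(shift r a) i = a (r + i)`. -/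
def shift {X : Type*} (r : ℕ) (a : ℕ → X) : ℕ → X := fun i => a (r + i)

variable {k} {N N' N'' : Type*} [AddCommGroup N] [Module k N] [AddCommGroup N'] [Module k N']
  [AddCommGroup N''] [Module k N'']

theorem tp_congr {n : ℕ} {a b : ℕ → A} (h : ∀ i < n, a i = b i) : tp k n a = tp k n b := by
  unfold tp
  congr 1
  funext i
  exact h i i.2

theorem hom_ext {n : ℕ} {f g : T k A n →ₗ[k] N} (h : ∀ a : ℕ → A, f (tp k n a) = g (tp k n a)) :
    f = g := by
  apply PiTensorProduct.ext
  ext a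
  have := h (fun i => if hi : i < n then a ⟨i, hi⟩ else 0)
  simpa [tp] using this

theorem tp_update {n : ℕ} (a : ℕ → A) {i : ℕ} (hi : i < n) (x : A) :
    tp k n (update a i x) =
      PiTensorProduct.tprod k (update (fun j : Fin n => a j) ⟨i, hi⟩ x) := by
  unfold tp
  congr 1
  funext j
  simp only [Function.update_apply, Fin.ext_iff]

/-- `Φ a` depends only on `a 0, …, a (n-1)`, and is multilinear in these. -/
structure IsMulti (k : Type*) [CommRing k] {A : Type*} [Ring A] [Algebra k A] {N : Type*}
    [AddCommGroup N] [Module k N] (n : ℕ) (Φ : (ℕ → A) → N) : Prop where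
  congr : ∀ a b : ℕ → A, (∀ i < n, a i = b i) → Φ a = Φ b
  add : ∀ (a : ℕ → A) (i : ℕ), i < n → ∀ x y,
    Φ (update a i (x + y)) = Φ (update a i x) + Φ (update a i y)
  smul : ∀ (a : ℕ → A) (i : ℕ), i < n → ∀ (c : k) (x : A),
    Φ (update a i (c • x)) = c • Φ (update a i x)

/-- The linear map `A^{⊗ n} → N` with `a 0 ⊗ ⋯ ⊗ a (n-1) ↦ Φ a` (see `lift_tp`). -/
def lift {n : ℕ} {Φ : (ℕ → A) → N} (h : IsMulti k n Φ) : T k A n →ₗ[k] N :=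
  PiTensorProduct.lift
    { toFun := fun a => Φ (fun i => if hi : i < n then a ⟨i, hi⟩ else 0)
      map_update_add' := by
        intro _ a i x y
        have key : ∀ z : A, (fun j => if hj : j < n then update a i z ⟨j, hj⟩ else 0) =
            update (fun j => if hj : j < n then a ⟨j, hj⟩ else 0) i.1 z := by
          intro z
          funext j
          by_cases hj : j < n
          · by_cases hji : j = i.1
            · subst hji; simp
            · have : (⟨j, hj⟩ : Fin n) ≠ i := fun e => hji (by rw [← e])
              simp [hj, hji, this]
          · have : j ≠ i.1 := fun e => hj (e ▸ i.2)
            simp [hj, this]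
        rw [key, key, key, h.add _ _ i.2]
      map_update_smul' := by
        intro _ a i c x
        have key : ∀ z : A, (fun j => if hj : j < n then update a i z ⟨j, hj⟩ else 0) =
            update (fun j => if hj : j < n then a ⟨j, hj⟩ else 0) i.1 z := by
          intro z
          funext j
          by_cases hj : j < n
          · by_cases hji : j = i.1
            · subst hji; simp
            · have : (⟨j, hj⟩ : Fin n) ≠ i := fun e => hji (by rw [← e])
              simp [hj, hji, this]
          · have : j ≠ i.1 := fun e => hj (e ▸ i.2)
            simp [hj, this]
        rw [key, key, h.smul _ _ i.2] }

@[simp] theorem lift_tp {n : ℕ} {Φ : (ℕ → A) → N} (h : IsMulti k n Φ) (a : ℕ → A) :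
    lift h (tp k n a) = Φ a := by
  unfold lift tp
  rw [PiTensorProduct.lift.tprod]
  apply h.congr
  intro i hi
  simp [hi]

theorem isMulti_tp (n : ℕ) : IsMulti k n (fun a : ℕ → A => tp k n a) where
  congr a b h := tp_congr h
  add a i hi x y := by simp only [tp_update _ hi, MultilinearMap.map_update_add]
  smul a i hi c x := by simp only [tp_update _ hi, MultilinearMap.map_update_smul]

theorem IsMulti.comp {n : ℕ} {Φ : (ℕ → A) → N} (h : IsMulti k n Φ) (f : N →ₗ[k] N') :
    IsMulti k n (fun a => f (Φ a)) where
  congr a b hab := by rw [h.congr a b hab]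
  add a i hi x y := by rw [h.add a i hi, map_add]
  smul a i hi c x := by rw [h.smul a i hi, map_smul]

theorem IsMulti.plus {n : ℕ} {Φ Ψ : (ℕ → A) → N} (h : IsMulti k n Φ) (h' : IsMulti k n Ψ) :
    IsMulti k n (fun a => Φ a + Ψ a) where
  congr a b hab := by rw [h.congr a b hab, h'.congr a b hab]
  add a i hi x y := by rw [h.add a i hi, h'.add a i hi]; abel
  smul a i hi c x := by rw [h.smul a i hi, h'.smul a i hi, smul_add]

theorem IsMulti.zsmul {n : ℕ} {Φ : (ℕ → A) → N} (h : IsMulti k n Φ) (z : ℤ) :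
    IsMulti k n (fun a => z • Φ a) where
  congr a b hab := by rw [h.congr a b hab]
  add a i hi x y := by rw [h.add a i hi, smul_add]
  smul a i hi c x := by rw [h.smul a i hi, smul_comm]

theorem IsMulti.sum {n : ℕ} {ι : Type*} (s : Finset ι) {Φ : ι → (ℕ → A) → N}
    (h : ∀ i ∈ s, IsMulti k n (Φ i)) : IsMulti k n (fun a => ∑ i ∈ s, Φ i a) where
  congr a b hab := Finset.sum_congr rfl fun i hi => (h i hi).congr a b hab
  add a j hj x y := by
    rw [← Finset.sum_add_distrib]
    exact Finset.sum_congr rfl fun i hi => (h i hi).add a j hj x y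
  smul a j hj c x := by
    rw [Finset.smul_sum]
    exact Finset.sum_congr rfl fun i hi => (h i hi).smul a j hj c x

/-- Reindexing: each entry of `a` occurs in at most one entry of `Ψ a`, linearly. -/
theorem IsMulti.pull {m n : ℕ} {Φ : (ℕ → A) → N} (h : IsMulti k n Φ) (Ψ : (ℕ → A) → (ℕ → A))
    (hc : ∀ a b : ℕ → A, (∀ i < m, a i = b i) → ∀ i < n, Ψ a i = Ψ b i)
    (hu : ∀ (a : ℕ → A) (i : ℕ), i < m → ∃ j < n, ∃ l : A →ₗ[k] A, ∀ x,
      ∀ r < n, Ψ (update a i x) r = update (Ψ a) j (l x) r) :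
    IsMulti k m (fun a => Φ (Ψ a)) where
  congr a b hab := h.congr _ _ (hc a b hab)
  add a i hi x y := by
    obtain ⟨j, hj, l, hl⟩ := hu a i hi
    rw [h.congr _ _ (hl _), h.congr _ _ (hl x), h.congr _ _ (hl y), map_add, h.add _ _ hj]
  smul a i hi c x := by
    obtain ⟨j, hj, l, hl⟩ := hu a i hi
    rw [h.congr _ _ (hl _), h.congr _ _ (hl x), map_smul, h.smul _ _ hj]

/-- A bilinear expression in the first `p` and the following `q` entries. -/
theorem IsMulti.mul {p q n : ℕ} (hn : p + q = n) {Φ : (ℕ → A) → N} {Ψ : (ℕ → A) → N'}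
    (h : IsMulti k p Φ) (h' : IsMulti k q Ψ) (β : N →ₗ[k] N' →ₗ[k] N'') :
    IsMulti k n (fun a => β (Φ a) (Ψ (shift p a))) := by
  have e1 : ∀ (a : ℕ → A) (i : ℕ) (x : A), p ≤ i → Φ (update a i x) = Φ a := fun a i x hi =>
    h.congr _ _ fun j hj => Function.update_of_ne (by omega) _ _
  have e2 : ∀ (a : ℕ → A) (i : ℕ) (x : A), i < p → Ψ (shift p (update a i x)) = Ψ (shift p a) :=
    fun a i x hi => h'.congr _ _ fun j hj => Function.update_of_ne (by omega) _ _
  have e3 : ∀ (a : ℕ → A) (i : ℕ) (x : A), p ≤ i →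
      shift p (update a i x) = update (shift p a) (i - p) x := by
    intro a i x hi
    funext j
    unfold shift
    by_cases hj : j = i - p
    · subst hj; rw [Nat.add_sub_cancel' hi]; simp
    · rw [Function.update_of_ne hj, Function.update_of_ne (by omega)]
  refine ⟨?_, ?_, ?_⟩
  · intro a b hab
    rw [h.congr a b (fun i hi => hab i (by omega)),
      h'.congr (shift p a) (shift p b) (fun i hi => hab _ (by omega))]
  · intro a i hi x y
    rcases lt_or_ge i p with hp | hp
    · rw [h.add a i hp, e2 _ _ _ hp, e2 _ _ _ hp, e2 _ _ _ hp, map_add, LinearMap.add_apply]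
    · rw [e1 _ _ _ hp, e1 _ _ _ hp, e1 _ _ _ hp, e3 _ _ _ hp, e3 _ _ _ hp, e3 _ _ _ hp,
        h'.add _ _ (by omega), map_add]
  · intro a i hi c x
    rcases lt_or_ge i p with hp | hp
    · rw [h.smul a i hp, e2 _ _ _ hp, e2 _ _ _ hp, map_smul, LinearMap.smul_apply]
    · rw [e1 _ _ _ hp, e1 _ _ _ hp, e3 _ _ _ hp, e3 _ _ _ hp,
        h'.smul _ _ (by omega), map_smul]

theorem isMulti_head : IsMulti k 1 (fun a : ℕ → A => a 0) where
  congr a b h := h 0 Nat.one_pos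
  add a i hi x y := by obtain rfl : i = 0 := by omega
                       simp
  smul a i hi c x := by obtain rfl : i = 0 := by omega
                        simp

theorem isMulti_const (x : N) : IsMulti k 0 (fun _ : ℕ → A => x) where
  congr _ _ _ := rfl
  add _ _ hi := absurd hi (Nat.not_lt_zero _)
  smul _ _ hi := absurd hi (Nat.not_lt_zero _)

/-- Multiply two neighbours: `(a 0, …, a i * a (i+1), …)`. -/
def merge (i : ℕ) (a : ℕ → A) : ℕ → A := fun j =>
  if j < i then a j else if j = i then a i * a (i + 1) else a (j + 1)

/-- Put `x` in front. -/
def cons (x : A) (a : ℕ → A) : ℕ → A := fun j => if j = 0 then x else a (j - 1)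

/-- Cyclic rotation of the first `n + 1` terms: `(a i, …, a n, a 0, …, a (i-1))`. -/
def rot (n i : ℕ) (a : ℕ → A) : ℕ → A := fun j => a ((i + j) % (n + 1))

/-- Apply `g` to the `q` entries starting at place `j`:
`(a 0, …, a (j-1), g (a j ⊗ ⋯ ⊗ a (j+q-1)), a (j+q), …)`. -/
def ins (j q : ℕ) (g : T k A q →ₗ[k] A) (a : ℕ → A) : ℕ → A := fun i =>
  if i < j then a i else if i = j then g (tp k q (shift j a)) else a (i + q - 1)

theorem IsMulti.merge {n i : ℕ} (hi : i < n) {Φ : (ℕ → A) → N} (h : IsMulti k n Φ) :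
    IsMulti k (n + 1) (fun a => Φ (merge i a)) := by
  refine h.pull (Hoch.merge i) ?_ ?_
  · intro a b hab r hr
    unfold Hoch.merge
    rw [hab r (by omega), hab i (by omega), hab (i + 1) (by omega), hab (r + 1) (by omega)]
  · intro a j hj
    rcases lt_trichotomy j i with hji | rfl | hji
    · refine ⟨j, by omega, LinearMap.id, fun x r _ => ?_⟩
      simp only [Hoch.merge, Function.update_apply, LinearMap.id_apply]
      grind
    · refine ⟨j, by omega, LinearMap.mulRight k (a (j + 1)), fun x r _ => ?_⟩
      simp only [Hoch.merge, Function.update_apply, LinearMap.mulRight_apply]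
      grind
    · by_cases h1 : j = i + 1
      · subst h1
        refine ⟨i, by omega, LinearMap.mulLeft k (a i), fun x r _ => ?_⟩
        simp only [Hoch.merge, Function.update_apply, LinearMap.mulLeft_apply]
        grind
      · refine ⟨j - 1, by omega, LinearMap.id, fun x r _ => ?_⟩
        simp only [Hoch.merge, Function.update_apply, LinearMap.id_apply]
        grind

theorem IsMulti.cons {n : ℕ} (y : A) {Φ : (ℕ → A) → N} (h : IsMulti k (n + 1) Φ) :
    IsMulti k n (fun a => Φ (cons y a)) := by
  refine h.pull (Hoch.cons y) ?_ ?_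
  · intro a b hab r hr
    unfold Hoch.cons
    split_ifs
    · rfl
    · exact hab _ (by omega)
  · intro a j hj
    refine ⟨j + 1, by omega, LinearMap.id, fun x r _ => ?_⟩
    simp only [Hoch.cons, Function.update_apply, LinearMap.id_apply]
    grind

theorem IsMulti.rot {n i : ℕ} {Φ : (ℕ → A) → N} (h : IsMulti k (n + 1) Φ) (hi : i ≤ n) :
    IsMulti k (n + 1) (fun a => Φ (rot n i a)) := by
  have hm : ∀ r, r ≤ n → (i + r) % (n + 1) = if i + r ≤ n then i + r else i + r - (n + 1) := by
    intro r hr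
    split_ifs with h1
    · exact Nat.mod_eq_of_lt (by omega)
    · rw [Nat.mod_eq_sub_mod (by omega)]
      exact Nat.mod_eq_of_lt (by omega)
  refine h.pull (Hoch.rot n i) ?_ ?_
  · intro a b hab r hr
    exact hab _ (Nat.mod_lt _ (by omega))
  · intro a j hj
    refine ⟨if i ≤ j then j - i else j + (n + 1) - i, by split_ifs <;> omega, LinearMap.id,
      fun x r hr => ?_⟩
    simp only [Hoch.rot, Function.update_apply, LinearMap.id_apply, hm r (by omega)]
    grind

theorem IsMulti.ins {p q r j : ℕ} (hr : r + 1 = p + q) (hj : j < p) (g : T k A q →ₗ[k] A)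
    {Φ : (ℕ → A) → N} (h : IsMulti k p Φ) : IsMulti k r (fun a => Φ (ins j q g a)) := by
  have hg := (isMulti_tp (k := k) (A := A) q).comp g
  refine h.pull (Hoch.ins j q g) ?_ ?_
  · intro a b hab s hs
    unfold Hoch.ins
    split_ifs
    · exact hab _ (by omega)
    · exact hg.congr _ _ fun i hi => hab _ (by omega)
    · exact hab _ (by omega)
  · intro a i hi
    have hc : ∀ x, (i < j ∨ j + q ≤ i) →
        g (tp k q (shift j (update a i x))) = g (tp k q (shift j a)) := by
      intro x hx
      refine hg.congr _ _ fun s hs => Function.update_of_ne (by omega) _ _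
    rcases lt_or_ge i j with h1 | h1
    · refine ⟨i, by omega, LinearMap.id, fun x s _ => ?_⟩
      simp only [Hoch.ins, hc x (Or.inl h1)]
      simp only [Function.update_apply, Hoch.ins, LinearMap.id_apply]
      grind
    rcases lt_or_ge i (j + q) with h2 | h2
    · have e3 : ∀ x, shift j (update a i x) = update (shift j a) (i - j) x := by
        intro x
        funext s
        simp only [shift, Function.update_apply]
        grind
      refine ⟨j, hj, ⟨⟨fun x => g (tp k q (update (shift j a) (i - j) x)), fun x y => ?_⟩,
        fun c x => ?_⟩, fun x s _ => ?_⟩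
      · exact hg.add _ _ (by omega) x y
      · exact hg.smul _ _ (by omega) c x
      · simp only [Hoch.ins, e3]
        simp only [Function.update_apply, Hoch.ins, LinearMap.coe_mk, AddHom.coe_mk]
        grind
    · refine ⟨i + 1 - q, by omega, LinearMap.id, fun x s _ => ?_⟩
      simp only [Hoch.ins, hc x (Or.inr h2)]
      simp only [Function.update_apply, Hoch.ins, LinearMap.id_apply]
      grind

end Tensors

section Subquotients

variable {C C' C'' : Type*} [AddCommGroup C] [AddCommGroup C'] [AddCommGroup C'']

/-- The quotient `Z / (B ∩ Z)`; below `Z` are (co)cycles and `B ⊆ Z` (co)boundaries. -/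
def SQ (Z B : AddSubgroup C) : Type _ := Z ⧸ B.addSubgroupOf Z

namespace SQ

variable {Z B : AddSubgroup C} {Z' B' : AddSubgroup C'} {Z'' B'' : AddSubgroup C''}

instance : AddCommGroup (SQ Z B) := QuotientAddGroup.Quotient.addCommGroup (B.addSubgroupOf Z)

/-- The class of an element of `Z`. -/
def mk (x : C) (hx : x ∈ Z) : SQ Z B := QuotientAddGroup.mk (s := B.addSubgroupOf Z) ⟨x, hx⟩

theorem ind {P : SQ Z B → Prop} (h : ∀ x hx, P (mk x hx)) (y : SQ Z B) : P y := by
  induction y using QuotientAddGroup.induction_on with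
  | H z => exact h z.1 z.2

theorem mk_eq {x y : C} (hx : x ∈ Z) (hy : y ∈ Z) :
    (mk x hx : SQ Z B) = mk y hy ↔ -x + y ∈ B := by
  unfold mk
  exact QuotientAddGroup.eq.trans AddSubgroup.mem_addSubgroupOf

theorem mk_add {x y : C} (hx : x ∈ Z) (hy : y ∈ Z) :
    (mk x hx : SQ Z B) + mk y hy = mk (x + y) (Z.add_mem hx hy) := rfl

theorem mk_congr {x y : C} (hx : x ∈ Z) (h : x = y) : (mk x hx : SQ Z B) = mk y (h ▸ hx) := by
  subst h; rfl

/-- The map induced on subquotients. -/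
def map (φ : C →+ C') (hz : ∀ x ∈ Z, φ x ∈ Z') (hb : ∀ x ∈ B, φ x ∈ B') : SQ Z B →+ SQ Z' B' :=
  QuotientAddGroup.map _ _ ((φ.comp Z.subtype).codRestrict Z' fun x => hz x.1 x.2)
    (by
      intro x hx
      exact hb _ hx)

@[simp] theorem map_mk (φ : C →+ C') (hz : ∀ x ∈ Z, φ x ∈ Z') (hb : ∀ x ∈ B, φ x ∈ B')
    (x : C) (hx : x ∈ Z) : map (B := B) (B' := B') φ hz hb (mk x hx) = mk (φ x) (hz x hx) := rfl

/-- The biadditive map induced on subquotients. -/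
def map₂ (β : C →+ C' →+ C'') (hz : ∀ x ∈ Z, ∀ y ∈ Z', β x y ∈ Z'')
    (hb : ∀ x ∈ B, ∀ y ∈ Z', β x y ∈ B'') (hb' : ∀ x ∈ Z, ∀ y ∈ B', β x y ∈ B'') :
    SQ Z B →+ SQ Z' B' →+ SQ Z'' B'' :=
  QuotientAddGroup.lift _
    (AddMonoidHom.mk' (fun x : Z => map (β x) (hz x x.2) (hb' x x.2)) (by
      intro x y
      ext z
      induction z using ind with
      | h z hz => simp [mk_add]))
    (by
      intro x hx
      ext z
      induction z using ind with
      | h z hz' =>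
        have h0 : (0 : SQ Z'' B'') = mk 0 Z''.zero_mem := rfl
        simp only [AddMonoidHom.mk'_apply, map_mk, AddMonoidHom.zero_apply]
        rw [h0, mk_eq, add_zero]
        exact B''.neg_mem (hb x hx z hz'))

@[simp] theorem map₂_mk (β : C →+ C' →+ C'') (hz : ∀ x ∈ Z, ∀ y ∈ Z', β x y ∈ Z'')
    (hb : ∀ x ∈ B, ∀ y ∈ Z', β x y ∈ B'') (hb' : ∀ x ∈ Z, ∀ y ∈ B', β x y ∈ B'')
    (x : C) (hx : x ∈ Z) (y : C') (hy : y ∈ Z') :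
    map₂ β hz hb hb' (mk x hx) (mk y hy) = mk (β x y) (hz x hx y hy) := rfl

/-- Scalars that preserve `Z` and `B` act on the subquotient. -/
abbrev module (R : Type*) [Ring R] [Module R C] (hz : ∀ (r : R), ∀ x ∈ Z, r • x ∈ Z)
    (hb : ∀ (r : R), ∀ x ∈ B, r • x ∈ B) : Module R (SQ Z B) where
  smul r := map (DistribSMul.toAddMonoidHom C r) (hz r) (hb r)
  one_smul y := by
    induction y using ind with
    | h x hx => exact mk_congr _ (one_smul R x)
  mul_smul r s y := by
    induction y using ind with
    | h x hx => exact mk_congr _ (mul_smul r s x)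
  smul_zero r := map_zero _
  smul_add r := map_add _
  add_smul r s y := by
    induction y using ind with
    | h x hx => exact mk_congr _ (add_smul r s x)
  zero_smul y := by
    induction y using ind with
    | h x hx => exact mk_congr _ (zero_smul R x)

end SQ

end Subquotients

section Cohomology

variable (k : Type*) [CommRing k] (A : Type*) [Ring A] [Algebra k A]
  (M : Type*) [AddCommGroup M] [Module k M] [Module A M] [Module Aᵐᵒᵖ M]
  [SMulCommClass A Aᵐᵒᵖ M] [IsScalarTower k A M] [IsScalarTower k Aᵐᵒᵖ M]

/-- The bilinear left action of `A` on a bimodule. -/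
def lact : A →ₗ[k] M →ₗ[k] M := (Algebra.lsmul k k M).toLinearMap

/-- The bilinear right action of `A` on a bimodule. -/
def ract : A →ₗ[k] M →ₗ[k] M :=
  (Algebra.lsmul k k M : Aᵐᵒᵖ →ₐ[k] _).toLinearMap ∘ₗ (MulOpposite.opLinearEquiv k).toLinearMap

/-- Hochschild `n`-cochains with coefficients in the `A`-bimodule `M`
(the right action is given as an action of `Aᵐᵒᵖ`). -/
abbrev Cochain (n : ℕ) : Type _ := T k A n →ₗ[k] M

variable {k A M}

@[simp] theorem lact_apply (a : A) (m : M) : lact k A M a m = a • m := rfl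

@[simp] theorem ract_apply (a : A) (m : M) : ract k A M a m = MulOpposite.op a • m := rfl

theorem isMulti_d {n : ℕ} (f : Cochain k A M n) : IsMulti k (n + 1) (fun a : ℕ → A =>
    a 0 • f (tp k n (shift 1 a)) +
      ∑ i ∈ Finset.range n, (-1 : ℤ) ^ (i + 1) • f (tp k n (merge i a)) +
      (-1 : ℤ) ^ (n + 1) • (MulOpposite.op (a n) • f (tp k n a))) := by
  have hf := (isMulti_tp (k := k) (A := A) n).comp f
  refine ((IsMulti.mul (Nat.add_comm 1 n) isMulti_head hf (lact k A M)).plus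
    (IsMulti.sum _ fun i hi => (hf.merge (Finset.mem_range.1 hi)).zsmul _)).plus
    (IsMulti.zsmul ?_ _)
  exact IsMulti.mul rfl hf isMulti_head (ract k A M).flip

variable (k A M)

/-- The Hochschild differential on cochains (see `d_tp`). -/
def d (n : ℕ) : Cochain k A M n →+ Cochain k A M (n + 1) :=
  AddMonoidHom.mk' (fun f => lift (isMulti_d f)) (by
    intro f g
    apply hom_ext
    intro a
    simp only [lift_tp, LinearMap.add_apply, smul_add, Finset.sum_add_distrib]
    abel)

variable {k A M}

theorem d_tp {n : ℕ} (f : Cochain k A M n) (a : ℕ → A) : d k A M n f (tp k (n + 1) a) =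
    a 0 • f (tp k n (shift 1 a)) +
      ∑ i ∈ Finset.range n, (-1 : ℤ) ^ (i + 1) • f (tp k n (merge i a)) +
      (-1 : ℤ) ^ (n + 1) • (MulOpposite.op (a n) • f (tp k n a)) :=
  lift_tp (isMulti_d f) a

variable (k A M)

/-- Hochschild cocycles. -/
def cocycles (n : ℕ) : AddSubgroup (Cochain k A M n) := (d k A M n).ker

/-- Hochschild coboundaries. -/
def coboundaries : (n : ℕ) → AddSubgroup (Cochain k A M n)
  | 0 => ⊥
  | n + 1 => (d k A M n).range

/-- Hochschild cohomology `HHⁿ(A, M)`. -/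
abbrev HH (n : ℕ) : Type _ := SQ (cocycles k A M n) (coboundaries k A M n)

section Scalars

variable {k A M} {R : Type*} [CommRing R] [Module R M] [SMulCommClass k R M] [SMulCommClass R A M]
  [SMulCommClass R Aᵐᵒᵖ M]

theorem d_smul {n : ℕ} (r : R) (f : Cochain k A M n) :
    d k A M n (r • f) = r • d k A M n f := by
  apply hom_ext
  intro a
  simp only [d_tp, LinearMap.smul_apply, smul_add, Finset.smul_sum, smul_comm r]

/-- Every commutative ring `R` of endomorphisms of the bimodule `M` acts on `HHⁿ(A, M)`. -/
instance (n : ℕ) : Module R (HH k A M n) :=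
  SQ.module R
    (by
      intro r x hx
      have hx' : d k A M n x = 0 := hx
      show d k A M n (r • x) = 0
      rw [d_smul, hx', smul_zero])
    (by
      intro r x hx
      cases n with
      | zero =>
        have hx' : x = 0 := hx
        rw [hx', smul_zero]
        exact AddSubgroup.zero_mem _
      | succ n =>
        obtain ⟨y, rfl⟩ := hx
        exact ⟨r • y, d_smul r y⟩)

theorem HH.smul_mk {n : ℕ} (r : R) (f : Cochain k A M n) (hf : f ∈ cocycles k A M n) :
    ∃ h, r • (SQ.mk f hf : HH k A M n) = SQ.mk (r • f) h := ⟨_, rfl⟩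

instance {R' : Type*} [CommRing R'] [Module R' M] [SMulCommClass k R' M] [SMulCommClass R' A M]
    [SMulCommClass R' Aᵐᵒᵖ M] [SMul R R'] [IsScalarTower R R' M] (n : ℕ) :
    IsScalarTower R R' (HH k A M n) where
  smul_assoc r r' y := by
    induction y using SQ.ind with
    | h x hx => exact SQ.mk_congr _ (smul_assoc r r' x)

end Scalars

end Cohomology

section Homology

variable (k : Type*) [CommRing k] (A : Type*) [Ring A] [Algebra k A]
  (M : Type*) [AddCommGroup M] [Module k M] [Module A M] [Module Aᵐᵒᵖ M]
  [SMulCommClass A Aᵐᵒᵖ M] [IsScalarTower k A M] [IsScalarTower k Aᵐᵒᵖ M]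

/-- Hochschild `n`-chains `M ⊗ A^{⊗ n}`. -/
abbrev Chain (n : ℕ) : Type _ := M ⊗[k] T k A n

variable {k A M} {N : Type*} [AddCommGroup N] [Module k N]

theorem chain_hom_ext {n : ℕ} {f g : Chain k A M n →ₗ[k] N}
    (h : ∀ (m : M) (a : ℕ → A), f (m ⊗ₜ tp k n a) = g (m ⊗ₜ tp k n a)) : f = g := by
  apply TensorProduct.ext
  ext1 m
  apply hom_ext
  intro a
  exact h m a

/-- The linear map with `m ⊗ (a 0 ⊗ ⋯ ⊗ a (n-1)) ↦ Φ m a` (see `lift₂_tmul`). -/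
def lift₂ {n : ℕ} {Φ : M → (ℕ → A) → N} (h : ∀ m, IsMulti k n (Φ m))
    (hadd : ∀ m m' a, Φ (m + m') a = Φ m a + Φ m' a)
    (hsmul : ∀ (c : k) m a, Φ (c • m) a = c • Φ m a) : Chain k A M n →ₗ[k] N :=
  TensorProduct.lift
    { toFun := fun m => lift (h m)
      map_add' := fun m m' => hom_ext fun a => by simp [hadd]
      map_smul' := fun c m => hom_ext fun a => by simp [hsmul] }

@[simp] theorem lift₂_tmul {n : ℕ} {Φ : M → (ℕ → A) → N} (h : ∀ m, IsMulti k n (Φ m))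
    (hadd : ∀ m m' a, Φ (m + m') a = Φ m a + Φ m' a)
    (hsmul : ∀ (c : k) m a, Φ (c • m) a = c • Φ m a) (m : M) (a : ℕ → A) :
    lift₂ h hadd hsmul (m ⊗ₜ tp k n a) = Φ m a := by
  simp [lift₂]

theorem isMulti_b (n : ℕ) (m : M) : IsMulti k (n + 1) (fun a : ℕ → A =>
    (MulOpposite.op (a 0) • m) ⊗ₜ[k] tp k n (shift 1 a) +
      ∑ i ∈ Finset.range n, (-1 : ℤ) ^ (i + 1) • (m ⊗ₜ[k] tp k n (merge i a)) +
      (-1 : ℤ) ^ (n + 1) • ((a n • m) ⊗ₜ[k] tp k n a)) := by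
  have ht := isMulti_tp (k := k) (A := A) n
  refine ((IsMulti.mul (Nat.add_comm 1 n) isMulti_head ht
    ((TensorProduct.mk k M (T k A n)).comp ((ract k A M).flip m))).plus
    (IsMulti.sum _ fun i hi => IsMulti.zsmul (IsMulti.comp (ht.merge (Finset.mem_range.1 hi))
      (TensorProduct.mk k M (T k A n) m)) _)).plus (IsMulti.zsmul ?_ _)
  exact IsMulti.mul rfl ht isMulti_head
    ((TensorProduct.mk k M (T k A n)).comp ((lact k A M).flip m)).flip

variable (k A M)

/-- The Hochschild differential on chains (see `b_tmul`). -/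
def b (n : ℕ) : Chain k A M (n + 1) →ₗ[k] Chain k A M n :=
  lift₂ (isMulti_b n)
    (by
      intro m m' a
      simp only [smul_add, TensorProduct.add_tmul, Finset.sum_add_distrib]
      abel)
    (by
      intro c m a
      simp only [smul_add, Finset.smul_sum, smul_comm _ c, ← TensorProduct.smul_tmul'])

variable {k A M}

theorem b_tmul (n : ℕ) (m : M) (a : ℕ → A) : b k A M n (m ⊗ₜ[k] tp k (n + 1) a) =
    (MulOpposite.op (a 0) • m) ⊗ₜ[k] tp k n (shift 1 a) +
      ∑ i ∈ Finset.range n, (-1 : ℤ) ^ (i + 1) • (m ⊗ₜ[k] tp k n (merge i a)) +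
      (-1 : ℤ) ^ (n + 1) • ((a n • m) ⊗ₜ[k] tp k n a) :=
  lift₂_tmul _ _ _ m a

variable (k A M)

/-- Hochschild cycles. -/
def cycles : (n : ℕ) → AddSubgroup (Chain k A M n)
  | 0 => ⊤
  | n + 1 => (b k A M n).toAddMonoidHom.ker

/-- Hochschild boundaries. -/
def boundaries (n : ℕ) : AddSubgroup (Chain k A M n) := (b k A M n).toAddMonoidHom.range

/-- Hochschild homology `HHₙ(A, M)`. -/
abbrev Homology (n : ℕ) : Type _ := SQ (cycles k A M n) (boundaries k A M n)

end Homology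

section Connes

variable {k : Type*} [CommRing k] {A : Type*} [Ring A] [Algebra k A]
  {N : Type*} [AddCommGroup N] [Module k N]

variable (k) in
/-- The chain `c 0 ⊗ (c 1 ⊗ ⋯ ⊗ c n)`. -/
def ch (n : ℕ) (c : ℕ → A) : Chain k A A n := c 0 ⊗ₜ[k] tp k n (shift 1 c)

theorem shift_one_cons (x : A) (a : ℕ → A) : shift 1 (cons x a) = a := by
  funext i
  simp [shift, cons]

theorem ch_cons (n : ℕ) (x : A) (a : ℕ → A) : ch k n (cons x a) = x ⊗ₜ[k] tp k n a := by
  unfold ch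
  rw [shift_one_cons]
  rfl

theorem ch_congr {n : ℕ} {c c' : ℕ → A} (h : ∀ i ≤ n, c i = c' i) : ch k n c = ch k n c' := by
  unfold ch
  rw [h 0 (Nat.zero_le _), tp_congr (a := shift 1 c) (b := shift 1 c')
    (fun i hi => h _ (by omega))]

theorem isMulti_ch (n : ℕ) : IsMulti k (n + 1) (fun c : ℕ → A => ch k n c) :=
  IsMulti.mul (Nat.add_comm 1 n) isMulti_head (isMulti_tp n) (TensorProduct.mk k A (T k A n))

theorem ch_hom_ext {n : ℕ} {f g : Chain k A A n →ₗ[k] N}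
    (h : ∀ c : ℕ → A, f (ch k n c) = g (ch k n c)) : f = g := by
  apply chain_hom_ext
  intro m a
  rw [← ch_cons, h]

theorem cons_eq_update (x : A) (a : ℕ → A) : cons x a = update (cons 0 a) 0 x := by
  funext i
  by_cases hi : i = 0
  · simp [cons, hi]
  · simp [cons, hi, Function.update_of_ne]

/-- The linear map with `c 0 ⊗ (c 1 ⊗ ⋯ ⊗ c n) ↦ Φ c` (see `liftCyc_ch`). -/
def liftCyc {n : ℕ} {Φ : (ℕ → A) → N} (h : IsMulti k (n + 1) Φ) : Chain k A A n →ₗ[k] N :=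
  lift₂ (Φ := fun x a => Φ (cons x a)) (fun x => h.cons x)
    (by
      intro x y a
      rw [cons_eq_update, h.add _ _ (Nat.succ_pos n), ← cons_eq_update, ← cons_eq_update])
    (by
      intro c x a
      rw [cons_eq_update, h.smul _ _ (Nat.succ_pos n), ← cons_eq_update])

@[simp] theorem liftCyc_ch {n : ℕ} {Φ : (ℕ → A) → N} (h : IsMulti k (n + 1) Φ) (c : ℕ → A) :
    liftCyc h (ch k n c) = Φ c := by
  unfold liftCyc ch
  rw [lift₂_tmul]
  congr 1
  funext i
  unfold cons shift
  split_ifs with hi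
  · rw [hi]
  · congr 1; omega

theorem isMulti_connes (n : ℕ) : IsMulti k (n + 1) (fun c : ℕ → A =>
    (∑ i ∈ Finset.range (n + 1), (-1 : ℤ) ^ (n * i) • ch k (n + 1) (cons 1 (rot n i c))) +
    ∑ i ∈ Finset.range (n + 1), (-1 : ℤ) ^ (n * (i + 1)) •
      ch k (n + 1) (cons (rot n i c n) (cons 1 (rot n i c)))) := by
  refine (IsMulti.sum _ fun i hi => IsMulti.zsmul ?_ _).plus
    (IsMulti.sum _ fun i hi => IsMulti.zsmul ?_ _)
  · exact ((isMulti_ch (k := k) (A := A) (n + 1)).cons 1).rot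
      (Nat.lt_succ_iff.1 (Finset.mem_range.1 hi))
  · refine IsMulti.rot (Φ := fun e => ch k (n + 1) (cons (e n) (cons 1 e))) ?_
      (Nat.lt_succ_iff.1 (Finset.mem_range.1 hi))
    simp only [ch_cons]
    exact IsMulti.mul rfl ((isMulti_tp (k := k) (A := A) (n + 1)).cons 1) isMulti_head
      (TensorProduct.mk k A (T k A (n + 1))).flip

variable (k A)

/-- The Connes differential on chains:
`a₀ ⊗ ⋯ ⊗ aₙ ↦ ∑ᵢ (-1)^{ni} 1 ⊗ aᵢ ⊗ ⋯ ⊗ aₙ ⊗ a₀ ⊗ ⋯ ⊗ aᵢ₋₁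
  + ∑ᵢ (-1)^{n(i+1)} aᵢ₋₁ ⊗ 1 ⊗ aᵢ ⊗ ⋯ ⊗ aₙ ⊗ a₀ ⊗ ⋯ ⊗ aᵢ₋₂`, indices modulo `n + 1`. -/
def connes (n : ℕ) : Chain k A A n →ₗ[k] Chain k A A (n + 1) := liftCyc (isMulti_connes n)

variable {k A}

theorem connes_ch (n : ℕ) (c : ℕ → A) : connes k A n (ch k n c) =
    (∑ i ∈ Finset.range (n + 1), (-1 : ℤ) ^ (n * i) • ch k (n + 1) (cons 1 (rot n i c))) +
    ∑ i ∈ Finset.range (n + 1), (-1 : ℤ) ^ (n * (i + 1)) •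
      ch k (n + 1) (cons (rot n i c n) (cons 1 (rot n i c))) := liftCyc_ch _ c

/-- The `i`-th face of a cyclic word of length `n + 2`. -/
def face (n i : ℕ) (c : ℕ → A) : ℕ → A := fun j =>
  if i ≤ n then merge i c j else cons (c (n + 1) * c 0) (shift 1 c) j

theorem face_of_le {n i : ℕ} (hi : i ≤ n) (c : ℕ → A) : face n i c = merge i c := by
  funext j; exact if_pos hi

theorem face_last (n : ℕ) (c : ℕ → A) :
    face n (n + 1) c = cons (c (n + 1) * c 0) (shift 1 c) := by
  funext j; exact if_neg (by omega)

theorem isMulti_face (n i : ℕ) : IsMulti k (n + 2) (fun c : ℕ → A => ch k n (face n i c)) := by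
  by_cases hi : i ≤ n
  · simp only [face_of_le hi]
    exact (isMulti_ch (k := k) (A := A) n).merge (Nat.lt_succ_of_le hi)
  · have e : ∀ c : ℕ → A, face n i c = cons (c (n + 1) * c 0) (shift 1 c) := fun c =>
      funext fun j => if_neg hi
    simp only [e]
    have h : IsMulti k (n + 2) (fun c : ℕ → A =>
        ch k n (merge 0 (rot (n + 1) (n + 1) c))) :=
      ((isMulti_ch (k := k) (A := A) n).merge (Nat.succ_pos n)).rot le_rfl
    convert h using 2 with c
    apply ch_congr
    intro j hj
    unfold cons shift merge rot
    by_cases h0 : j = 0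
    · simp [h0]
    · have : (n + 1 + (j + 1)) % (n + 1 + 1) = j := by
        rw [show n + 1 + (j + 1) = j + (n + 1 + 1) by omega, Nat.add_mod_right]
        exact Nat.mod_eq_of_lt (by omega)
      simp only [h0, if_false, Nat.not_lt_zero, this]
      congr 1
      omega

/-- Signed face operators `∂ᵢ`. -/
def dl (n i : ℕ) : Chain k A A (n + 1) →ₗ[k] Chain k A A n :=
  (-1 : ℤ) ^ i • liftCyc (isMulti_face n i)

/-- Signed left rotation. -/
def U (n : ℕ) : Chain k A A n →ₗ[k] Chain k A A n :=
  (-1 : ℤ) ^ n • liftCyc ((isMulti_ch (k := k) (A := A) n).pull (rot n 1)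
    (fun a a' h i _ => h _ (Nat.mod_lt _ (Nat.succ_pos n)))
    (fun a i hi => by
      refine ⟨if i = 0 then n else i - 1, by split_ifs <;> omega, LinearMap.id, fun x r hr => ?_⟩
      have : (1 + r) % (n + 1) = if r = n then 0 else 1 + r := by
        split_ifs with h
        · rw [h, Nat.add_comm, Nat.mod_self]
        · exact Nat.mod_eq_of_lt (by omega)
      simp only [rot, Function.update_apply, LinearMap.id_apply, this]
      grind))

/-- Signed right rotation. -/
def V (n : ℕ) : Chain k A A n →ₗ[k] Chain k A A n :=
  (-1 : ℤ) ^ n • liftCyc ((isMulti_ch (k := k) (A := A) n).rot le_rfl)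

/-- The extra degeneracy. -/
def sg (n : ℕ) : Chain k A A n →ₗ[k] Chain k A A (n + 1) :=
  liftCyc ((isMulti_ch (k := k) (A := A) (n + 1)).cons 1)

theorem dl_ch (n i : ℕ) (c : ℕ → A) :
    dl (k := k) n i (ch k (n + 1) c) = (-1 : ℤ) ^ i • ch k n (face n i c) := by
  simp [dl]

theorem U_ch (n : ℕ) (c : ℕ → A) : U n (ch k n c) = (-1 : ℤ) ^ n • ch k n (rot n 1 c) := by
  simp [U]

theorem V_ch (n : ℕ) (c : ℕ → A) : V n (ch k n c) = (-1 : ℤ) ^ n • ch k n (rot n n c) := by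
  simp [V]

theorem sg_ch (n : ℕ) (c : ℕ → A) : sg n (ch k n c) = ch k (n + 1) (cons 1 c) := by
  simp [sg]

theorem b_eq_sum (n : ℕ) (x : Chain k A A (n + 1)) :
    b k A A n x = ∑ i ∈ Finset.range (n + 2), dl n i x := by
  suffices h : b k A A n = ∑ i ∈ Finset.range (n + 2), dl n i by
    rw [h, LinearMap.sum_apply]
  apply ch_hom_ext
  intro c
  simp only [LinearMap.sum_apply, dl_ch]
  rw [Finset.sum_range_succ, Finset.sum_range_succ']
  conv_lhs => unfold ch
  rw [b_tmul, add_comm (_ ⊗ₜ[k] _)]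
  congr 1
  · congr 1
    · refine Finset.sum_congr rfl fun i hi => ?_
      have hi' := Finset.mem_range.1 hi
      rw [face_of_le (by omega)]
      unfold ch
      congr 2
      apply tp_congr
      intro r _
      simp only [merge, shift]
      grind
    · rw [face_of_le (Nat.zero_le n), pow_zero, one_smul]
      unfold ch
      have e : tp k n (shift 1 (shift 1 c)) = tp k n (shift 1 (merge 0 c)) := by
        apply tp_congr
        intro r _
        simp only [merge, shift]
        grind
      rw [e]
      simp [merge, shift]
  · rw [face_last, ch_cons]
    simp [shift, Nat.add_comm]

theorem sg_neg (e : ℕ) : (-1 : ℤ) ^ e * (-1 : ℤ) ^ e = 1 := by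
  rw [← pow_add, ← two_mul]; simp

theorem UV (n : ℕ) (x : Chain k A A n) : U n (V n x) = x := by
  suffices h : (U n) ∘ₗ (V n) = (LinearMap.id : Chain k A A n →ₗ[k] _) from
    LinearMap.congr_fun h x
  apply ch_hom_ext
  intro c
  simp only [LinearMap.comp_apply, V_ch, map_zsmul, U_ch, LinearMap.id_apply, smul_smul, sg_neg,
    one_smul]
  apply ch_congr
  intro i hi
  unfold rot
  congr 1
  rw [Nat.add_mod_mod, show n + (1 + i) = i + (n + 1) by omega, Nat.add_mod_right]
  exact Nat.mod_eq_of_lt (by omega)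

theorem VU (n : ℕ) (x : Chain k A A n) : V n (U n x) = x := by
  suffices h : (V n) ∘ₗ (U n) = (LinearMap.id : Chain k A A n →ₗ[k] _) from
    LinearMap.congr_fun h x
  apply ch_hom_ext
  intro c
  simp only [LinearMap.comp_apply, V_ch, map_zsmul, U_ch, LinearMap.id_apply, smul_smul, sg_neg,
    one_smul]
  apply ch_congr
  intro i hi
  unfold rot
  congr 1
  rw [Nat.add_mod_mod, show 1 + (n + i) = i + (n + 1) by omega, Nat.add_mod_right]
  exact Nat.mod_eq_of_lt (by omega)

theorem U_pow_ch (n j : ℕ) (c : ℕ → A) :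
    (U n ^ j) (ch k n c) = (-1 : ℤ) ^ (n * j) • ch k n (rot n j c) := by
  induction j with
  | zero =>
    simp only [pow_zero, Module.End.one_apply, Nat.mul_zero, one_smul]
    apply ch_congr
    intro i hi
    unfold rot
    rw [Nat.zero_add, Nat.mod_eq_of_lt (by omega)]
  | succ j ih =>
    rw [pow_succ', Module.End.mul_apply, ih, map_zsmul, U_ch, smul_smul, ← pow_add]
    congr 1
    apply ch_congr
    intro i hi
    unfold rot
    congr 1
    rw [Nat.add_mod_mod, Nat.add_assoc]

theorem U_pow_succ (n : ℕ) (x : Chain k A A n) : (U n ^ (n + 1)) x = x := by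
  suffices h : U n ^ (n + 1) = (LinearMap.id : Chain k A A n →ₗ[k] _) by
    rw [h, LinearMap.id_apply]
  apply ch_hom_ext
  intro c
  rw [U_pow_ch, (Nat.even_mul_succ_self n).neg_one_pow, one_smul, LinearMap.id_apply]
  apply ch_congr
  intro i hi
  unfold rot
  congr 1
  rw [Nat.add_mod_left]
  exact Nat.mod_eq_of_lt (by omega)

theorem dl_U (n i : ℕ) (hi : i ≤ n) (x : Chain k A A (n + 1)) :
    dl n i (U (n + 1) x) = U n (dl n (i + 1) x) := by
  suffices h : (dl n i) ∘ₗ (U (n + 1)) = (U (k := k) (A := A) n) ∘ₗ (dl n (i + 1)) from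
    LinearMap.congr_fun h x
  apply ch_hom_ext
  intro c
  simp only [LinearMap.comp_apply, dl_ch, map_zsmul, U_ch, smul_smul, ← pow_add]
  have e : (-1 : ℤ) ^ (n + 1 + i) = (-1 : ℤ) ^ (i + 1 + n) := by congr 1; omega
  rw [e]
  congr 1
  apply ch_congr
  intro r hr
  have h1 : ∀ r, r ≤ n + 1 → (1 + r) % (n + 1 + 1) = if r = n + 1 then 0 else r + 1 := by
    intro r hr
    split_ifs with h
    · rw [h, Nat.add_comm, Nat.mod_self]
    · rw [Nat.mod_eq_of_lt (by omega), Nat.add_comm]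
  have h2 : (1 + r) % (n + 1) = if r = n then 0 else r + 1 := by
    split_ifs with h
    · rw [h, Nat.add_comm, Nat.mod_self]
    · rw [Nat.mod_eq_of_lt (by omega), Nat.add_comm]
  rw [face_of_le hi]
  unfold rot
  rw [h2]
  unfold merge
  beta_reduce
  rw [h1 r (by omega), h1 i (by omega), h1 (i + 1) (by omega), h1 (r + 1) (by omega)]
  unfold face merge cons shift
  grind

theorem dl_last_U (n : ℕ) (x : Chain k A A (n + 1)) :
    dl n (n + 1) (U (n + 1) x) = dl n 0 x := by
  suffices h : (dl n (n + 1)) ∘ₗ (U (k := k) (A := A) (n + 1)) = dl n 0 from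
    LinearMap.congr_fun h x
  apply ch_hom_ext
  intro c
  simp only [LinearMap.comp_apply, dl_ch, map_zsmul, U_ch, smul_smul, sg_neg, pow_zero]
  congr 1
  apply ch_congr
  intro r hr
  have h1 : ∀ r, r ≤ n + 1 → (1 + r) % (n + 1 + 1) = if r = n + 1 then 0 else r + 1 := by
    intro r hr
    split_ifs with h
    · rw [h, Nat.add_comm, Nat.mod_self]
    · rw [Nat.mod_eq_of_lt (by omega), Nat.add_comm]
  simp only [face, if_neg (show ¬ n + 1 ≤ n by omega), if_pos (Nat.zero_le n)]
  unfold cons shift rot merge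
  rw [h1 (n + 1) (by omega), h1 0 (by omega), h1 (1 + (r - 1)) (by omega)]
  grind

theorem dl_U_pow (n i j : ℕ) (h : i + j ≤ n + 1) (x : Chain k A A (n + 1)) :
    dl n i ((U (n + 1) ^ j) x) = (U n ^ j) (dl n (i + j) x) := by
  induction j generalizing i with
  | zero => simp
  | succ j ih =>
    rw [pow_succ', Module.End.mul_apply, dl_U n i (by omega), ih (i + 1) (by omega), pow_succ',
      Module.End.mul_apply, show i + 1 + j = i + (j + 1) by omega]

theorem dl_U_pow' (n i j : ℕ) (hi : i ≤ n) (hj : j ≤ n + 1) (h : n + 2 ≤ i + j)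
    (x : Chain k A A (n + 1)) :
    dl n i ((U (n + 1) ^ j) x) = (U n ^ (j - 1)) (dl n (i + j - (n + 2)) x) := by
  obtain ⟨r, rfl⟩ : ∃ r, j = (n + 1 - i) + (r + 1) := ⟨i + j - (n + 2), by omega⟩
  rw [pow_add, Module.End.mul_apply, dl_U_pow n i _ (by omega),
    show i + (n + 1 - i) = n + 1 by omega, pow_succ', Module.End.mul_apply, dl_last_U,
    dl_U_pow n 0 r (by omega), ← Module.End.mul_apply, ← pow_add]
  congr 3
  omega

/-- The norm operator. -/
def Nm (n : ℕ) : Chain k A A n →ₗ[k] Chain k A A n := ∑ j ∈ Finset.range (n + 1), U n ^ j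

/-- The sum of all faces but the last. -/
def bp (n : ℕ) : Chain k A A (n + 1) →ₗ[k] Chain k A A n := ∑ i ∈ Finset.range (n + 1), dl n i

theorem b_eq (n : ℕ) (x : Chain k A A (n + 1)) : b k A A n x = bp n x + dl n (n + 1) x := by
  rw [b_eq_sum, Finset.sum_range_succ, bp, LinearMap.sum_apply]

theorem bp_Nm (n : ℕ) (x : Chain k A A (n + 1)) : bp n (Nm (n + 1) x) = Nm n (b k A A n x) := by
  rw [b_eq_sum]
  simp only [bp, Nm, LinearMap.sum_apply, map_sum]
  rw [← Finset.sum_product', ← Finset.sum_product']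
  refine Finset.sum_nbij'
    (fun p => (if p.2 = 0 ∧ p.1 = n + 1 then n + 1 else
        if p.2 + p.1 ≤ n + 1 then p.2 + p.1 else p.2 + p.1 - (n + 2),
      if p.2 = 0 ∧ p.1 = n + 1 then 0 else if p.2 + p.1 ≤ n + 1 then p.1 else p.1 - 1))
    (fun p => (if p.2 = 0 ∧ p.1 = n + 1 then n + 1 else if p.2 ≤ p.1 then p.2 else p.2 + 1,
      if p.2 = 0 ∧ p.1 = n + 1 then 0 else if p.2 ≤ p.1 then p.1 - p.2 else p.1 + n + 1 - p.2))
    ?_ ?_ ?_ ?_ ?_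
  · rintro ⟨j, i⟩ h
    simp only [Finset.mem_product, Finset.mem_range] at h ⊢
    split_ifs <;> omega
  · rintro ⟨l, m⟩ h
    simp only [Finset.mem_product, Finset.mem_range] at h ⊢
    split_ifs <;> omega
  · rintro ⟨j, i⟩ h
    simp only [Finset.mem_product, Finset.mem_range, Prod.mk.injEq] at h ⊢
    grind
  · rintro ⟨l, m⟩ h
    simp only [Finset.mem_product, Finset.mem_range, Prod.mk.injEq] at h ⊢
    grind
  · rintro ⟨j, i⟩ h
    simp only [Finset.mem_product, Finset.mem_range] at h ⊢
    split_ifs with h1 h2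
    · obtain ⟨rfl, rfl⟩ := h1
      rw [dl_U_pow n 0 (n + 1) (by omega), U_pow_succ, pow_zero, Module.End.one_apply, Nat.zero_add]
    · exact dl_U_pow n i j h2 x
    · exact dl_U_pow' n i j (by omega) (by omega) (by omega) x

theorem Nm_fix (n : ℕ) (x : Chain k A A n) : U n (Nm n x) = Nm n x := by
  simp only [Nm, LinearMap.sum_apply, map_sum, ← Module.End.mul_apply, ← pow_succ']
  rw [Finset.sum_range_succ, U_pow_succ, Finset.sum_range_succ' _ n, pow_zero,
    Module.End.one_apply]

theorem b_sub_V (n : ℕ) (y : Chain k A A (n + 1)) :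
    b k A A n (y - V (n + 1) y) = bp n y - V n (bp n y) := by
  obtain ⟨z, rfl⟩ : ∃ z, y = U (n + 1) z := ⟨V (n + 1) y, (UV _ _).symm⟩
  rw [VU]
  have h : bp n (U (n + 1) z) = U n (b k A A n z - dl n 0 z) := by
    rw [b_eq_sum, Finset.sum_range_succ', add_sub_cancel_right, bp, LinearMap.sum_apply, map_sum]
    exact Finset.sum_congr rfl fun i hi => dl_U n i (by have := Finset.mem_range.1 hi; omega) z
  rw [map_sub, b_eq n (U (n + 1) z), dl_last_U, h, VU]
  abel

theorem dl_sg_zero (n : ℕ) (x : Chain k A A n) : dl n 0 (sg n x) = x := by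
  suffices h : (dl n 0) ∘ₗ (sg n) = (LinearMap.id : Chain k A A n →ₗ[k] _) from
    LinearMap.congr_fun h x
  apply ch_hom_ext
  intro c
  simp only [LinearMap.comp_apply, sg_ch, dl_ch, pow_zero, one_smul, LinearMap.id_apply]
  apply ch_congr
  intro r hr
  simp only [face, if_pos (Nat.zero_le n), merge, cons]
  grind

theorem dl_sg_succ (n i : ℕ) (hi : i ≤ n) (x : Chain k A A (n + 1)) :
    dl (n + 1) (i + 1) (sg (n + 1) x) = - sg n (dl n i x) := by
  suffices h : (dl (n + 1) (i + 1)) ∘ₗ (sg (n + 1)) = - (sg (k := k) (A := A) n ∘ₗ dl n i) from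
    LinearMap.congr_fun h x
  apply ch_hom_ext
  intro c
  simp only [LinearMap.comp_apply, LinearMap.neg_apply, sg_ch, dl_ch, map_zsmul, pow_succ,
    mul_neg, mul_one, neg_smul]
  congr 2
  apply ch_congr
  intro r hr
  simp only [face, if_pos hi, if_pos (Nat.succ_le_succ hi), merge, cons]
  grind

theorem bp_sg (n : ℕ) (x : Chain k A A (n + 1)) :
    bp (n + 1) (sg (n + 1) x) = x - sg n (bp n x) := by
  rw [bp, LinearMap.sum_apply, Finset.sum_range_succ', dl_sg_zero, bp, LinearMap.sum_apply,
    map_sum, sub_eq_add_neg, ← Finset.sum_neg_distrib]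
  refine (add_comm _ _).trans ?_
  congr 1
  exact Finset.sum_congr rfl fun i hi =>
    dl_sg_succ n i (by have := Finset.mem_range.1 hi; omega) x

theorem connes_eq (n : ℕ) (x : Chain k A A n) :
    connes k A n x = sg n (Nm n x) - V (n + 1) (sg n (Nm n x)) := by
  suffices h : connes k A n = sg n ∘ₗ Nm n - V (n + 1) ∘ₗ sg n ∘ₗ Nm n from
    LinearMap.congr_fun h x
  apply ch_hom_ext
  intro c
  simp only [LinearMap.comp_apply, LinearMap.sub_apply, Nm, LinearMap.sum_apply, U_pow_ch,
    map_sum, map_zsmul, sg_ch, V_ch, connes_ch]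
  rw [sub_eq_add_neg, ← Finset.sum_neg_distrib]
  congr 1
  refine Finset.sum_congr rfl fun i _ => ?_
  rw [smul_smul, ← neg_smul]
  congr 1
  · rw [← pow_add, Nat.mul_succ, ← Nat.add_assoc, pow_succ]
    ring
  · apply ch_congr
    intro r hr
    have h1 : (n + 1 + r) % (n + 1 + 1) = if r = 0 then n + 1 else r - 1 := by
      split_ifs with h
      · rw [h, Nat.mod_eq_of_lt (by omega), Nat.add_zero]
      · rw [show n + 1 + r = r - 1 + (n + 1 + 1) by omega, Nat.add_mod_right]
        exact Nat.mod_eq_of_lt (by omega)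
    conv_rhs => rw [rot, h1]
    unfold cons
    grind

theorem b_connes (n : ℕ) (x : Chain k A A (n + 1)) :
    b k A A (n + 1) (connes k A (n + 1) x) = - connes k A n (b k A A n x) := by
  rw [connes_eq, b_sub_V, bp_sg, bp_Nm, connes_eq, map_sub]
  have h : V (n + 1) (Nm (n + 1) x) = Nm (n + 1) x := by
    conv_lhs => rw [← Nm_fix, VU]
  rw [h]
  abel

theorem b_connes_zero (x : Chain k A A 0) : b k A A 0 (connes k A 0 x) = 0 := by
  have h : bp 0 (sg 0 (Nm 0 x)) = x := by
    simp [bp, Nm, dl_sg_zero]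
  have hV : V 0 x = x := by
    have := UV 0 x
    have h2 := U_pow_succ 0 (V 0 x)
    rw [zero_add, pow_one] at h2
    rw [← h2, this]
  rw [connes_eq, b_sub_V, h, hV, sub_self]

variable (k A)

/-- The Connes operator on Hochschild homology. -/
def connesHom (n : ℕ) : Homology k A A n →+ Homology k A A (n + 1) :=
  SQ.map (connes k A n).toAddMonoidHom
    (by
      intro x hx
      show b k A A n (connes k A n x) = 0
      cases n with
      | zero => exact b_connes_zero x
      | succ n =>
        have hx' : b k A A n x = 0 := hx
        rw [b_connes, hx', map_zero, neg_zero])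
    (by
      rintro _ ⟨y, rfl⟩
      exact ⟨- connes k A (n + 1) y, by
        show b k A A (n + 1) (- connes k A (n + 1) y) = connes k A n (b k A A n y)
        rw [map_neg, b_connes, neg_neg]⟩)

end Connes

section Functoriality

variable {k : Type*} [CommRing k] {A : Type*} [Ring A] [Algebra k A]
  {M : Type*} [AddCommGroup M] [Module k M] [Module A M] [Module Aᵐᵒᵖ M]
  [SMulCommClass A Aᵐᵒᵖ M] [IsScalarTower k A M] [IsScalarTower k Aᵐᵒᵖ M]
  {N : Type*} [AddCommGroup N] [Module k N] [Module A N] [Module Aᵐᵒᵖ N]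
  [SMulCommClass A Aᵐᵒᵖ N] [IsScalarTower k A N] [IsScalarTower k Aᵐᵒᵖ N]
  {B : Type*} [Ring B] [Algebra k B]

/-- The map `HHⁿ(A, M) → HHⁿ(A, N)` induced by a bimodule homomorphism `φ`, i.e. `f ↦ φ ∘ f`. -/
def coeffMap (φ : M →ₗ[k] N) (hl : ∀ (a : A) m, φ (a • m) = a • φ m)
    (hr : ∀ (a : Aᵐᵒᵖ) m, φ (a • m) = a • φ m) (n : ℕ) : HH k A M n →+ HH k A N n :=
  have key : ∀ n (f : Cochain k A M n), d k A N n (φ ∘ₗ f) = φ ∘ₗ d k A M n f := by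
    intro n f
    apply hom_ext
    intro a
    simp only [d_tp, LinearMap.comp_apply, map_add, map_sum, map_zsmul, hl, hr]
  SQ.map (AddMonoidHom.mk' (fun f => φ ∘ₗ f) fun f g => LinearMap.comp_add _ _ _)
    (by
      intro f hf
      have hf' : d k A M n f = 0 := hf
      show d k A N n (φ ∘ₗ f) = 0
      rw [key, hf', LinearMap.comp_zero])
    (by
      intro f hf
      cases n with
      | zero =>
        have hf' : f = 0 := hf
        rw [hf', map_zero]
        exact AddSubgroup.zero_mem _
      | succ n =>
        obtain ⟨y, rfl⟩ := hf
        exact ⟨φ ∘ₗ y, key n y⟩)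

/-- The algebra `B`, viewed as an `A`-bimodule through `L : A → B`. -/
def Via (_L : A →ₐ[k] B) : Type _ := B

section Via

variable (L : A →ₐ[k] B)

instance : AddCommGroup (Via L) := Ring.toAddCommGroup (R := B)
instance {R : Type*} [CommRing R] [Module R B] : Module R (Via L) := inferInstanceAs (Module R B)

/-- The left action `a • x = L a * x`. -/
instance : Module A (Via L) := Module.compHom B L.toRingHom

/-- The right action `x • a = x * L a`. -/
instance : Module Aᵐᵒᵖ (Via L) := Module.compHom B (RingHom.op L.toRingHom)

/-- The identity of `B`, as a map to `Via L`. -/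
def toVia : B →ₗ[k] Via L :=
  { toFun := fun x => x
    map_add' := fun _ _ => rfl
    map_smul' := fun _ _ => rfl }

theorem smul_toVia (a : A) (x : B) : a • toVia L x = toVia L (L a * x) := rfl

theorem op_smul_toVia (a : A) (x : B) : MulOpposite.op a • toVia L x = toVia L (x * L a) := rfl

instance : SMulCommClass A Aᵐᵒᵖ (Via L) where
  smul_comm a c x := by
    induction c using MulOpposite.rec'
    exact (mul_assoc (L a) (show B from x) _).symm

instance : IsScalarTower k A (Via L) where
  smul_assoc c a x := by
    show L (c • a) * (show B from x) = c • (L a * (show B from x))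
    rw [map_smul, smul_mul_assoc]

instance : IsScalarTower k Aᵐᵒᵖ (Via L) where
  smul_assoc c a x := by
    induction a using MulOpposite.rec' with
    | _ a =>
    show (show B from x) * L (c • a) = c • ((show B from x) * L a)
    rw [map_smul, mul_smul_comm]

variable {R : Type*} [CommRing R] [Algebra R B] [SMulCommClass k R B]

instance : SMulCommClass k R (Via L) := inferInstanceAs (SMulCommClass k R B)

instance : SMulCommClass R A (Via L) where
  smul_comm r a x := (mul_smul_comm r (L a) (show B from x)).symm

instance : SMulCommClass R Aᵐᵒᵖ (Via L) where
  smul_comm r a x := by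
    induction a using MulOpposite.rec' with
    | _ a => exact (smul_mul_assoc r (show B from x) (L a)).symm

end Via

/-- The map `A^{⊗ n} → B^{⊗ n}` induced by `L`. -/
def Tmap (L : A →ₐ[k] B) (n : ℕ) : T k A n →ₗ[k] T k B n :=
  PiTensorProduct.map fun _ => L.toLinearMap

@[simp] theorem Tmap_tp (L : A →ₐ[k] B) (n : ℕ) (a : ℕ → A) :
    Tmap L n (tp k n a) = tp k n (fun i => L (a i)) := by
  unfold Tmap tp
  rw [PiTensorProduct.map_tprod]
  rfl

theorem map_merge (L : A →ₐ[k] B) (i : ℕ) (a : ℕ → A) :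
    (fun j => L (merge i a j)) = merge i (fun j => L (a j)) := by
  funext j
  unfold merge
  split_ifs <;> simp

/-- The map `I : HHⁿ(A, A) → HHⁿ(A, B)`, `f ↦ L ∘ f`. -/
def pushForward (L : A →ₐ[k] B) (n : ℕ) : HH k A A n →+ HH k A (Via L) n :=
  coeffMap (toVia L ∘ₗ L.toLinearMap) (fun a m => map_mul L a m)
    (fun a m => by
      induction a using MulOpposite.rec' with
      | _ a => exact map_mul L m a) n

/-- The cochain `g ∘ L^{⊗ n}`, with values in `B` viewed as an `A`-bimodule. -/
def restrictC (L : A →ₐ[k] B) (n : ℕ) : Cochain k B B n →+ Cochain k A (Via L) n :=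
  AddMonoidHom.mk' (fun g => toVia L ∘ₗ g ∘ₗ Tmap L n) fun f g => by
    rw [LinearMap.add_comp, LinearMap.comp_add]

theorem restrictC_tp (L : A →ₐ[k] B) (n : ℕ) (g : Cochain k B B n) (a : ℕ → A) :
    restrictC L n g (tp k n a) = toVia L (g (tp k n fun i => L (a i))) :=
  congrArg (fun x => toVia L (g x)) (Tmap_tp L n a)

theorem d_restrictC (L : A →ₐ[k] B) (n : ℕ) (g : Cochain k B B n) :
    d k A (Via L) n (restrictC L n g) = restrictC L (n + 1) (d k B B n g) := by
  apply hom_ext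
  intro a
  have e := d_tp g (fun i => L (a i))
  simp only [← map_merge] at e
  rw [restrictC_tp, e, d_tp]
  simp only [restrictC_tp, map_add, map_sum, map_zsmul]
  rfl

/-- The map `HHⁿ(B, B) → HHⁿ(A, B)`, `g ↦ g ∘ L^{⊗ n}`. -/
def restrict (L : A →ₐ[k] B) (n : ℕ) : HH k B B n →+ HH k A (Via L) n :=
  SQ.map (restrictC L n)
    (by
      intro f hf
      have hf' : d k B B n f = 0 := hf
      show d k A (Via L) n _ = 0
      rw [d_restrictC, hf', map_zero])
    (by
      intro f hf
      cases n with
      | zero =>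
        have hf' : f = 0 := hf
        rw [hf', map_zero]
        exact AddSubgroup.zero_mem _
      | succ n =>
        obtain ⟨y, rfl⟩ := hf
        exact ⟨_, d_restrictC L n y⟩)

/-- The map `L_* : HHₙ(A) → HHₙ(B)`, `a₀ ⊗ ⋯ ⊗ aₙ ↦ L a₀ ⊗ ⋯ ⊗ L aₙ`. -/
def homologyMap (L : A →ₐ[k] B) (n : ℕ) : Homology k A A n →+ Homology k B B n :=
  have key : ∀ n (x : Chain k A A (n + 1)),
      TensorProduct.map L.toLinearMap (Tmap L n) (b k A A n x) =
        b k B B n (TensorProduct.map L.toLinearMap (Tmap L (n + 1)) x) := by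
    intro n x
    suffices h : TensorProduct.map L.toLinearMap (Tmap L n) ∘ₗ b k A A n =
        b k B B n ∘ₗ TensorProduct.map L.toLinearMap (Tmap L (n + 1)) from
      LinearMap.congr_fun h x
    apply chain_hom_ext
    intro m a
    simp only [LinearMap.comp_apply, b_tmul, map_add, map_sum, map_zsmul, TensorProduct.map_tmul,
      Tmap_tp, AlgHom.toLinearMap_apply, map_merge, MulOpposite.smul_eq_mul_unop, smul_eq_mul,
      MulOpposite.unop_op, map_mul]
    rfl
  SQ.map (TensorProduct.map L.toLinearMap (Tmap L n)).toAddMonoidHom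
    (by
      intro x hx
      cases n with
      | zero => exact AddSubgroup.mem_top _
      | succ n =>
        have hx' : b k A A n x = 0 := hx
        show b k B B n (TensorProduct.map L.toLinearMap (Tmap L (n + 1)) x) = 0
        rw [← key, hx', map_zero])
    (by
      rintro _ ⟨y, rfl⟩
      exact ⟨_, (key n y).symm⟩)

end Functoriality

section Products

variable {k : Type*} [CommRing k] {A : Type*} [Ring A] [Algebra k A]
  {M : Type*} [AddCommGroup M] [Module k M] [Module A M] [Module Aᵐᵒᵖ M]
  [SMulCommClass A Aᵐᵒᵖ M] [IsScalarTower k A M] [IsScalarTower k Aᵐᵒᵖ M]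

/-- Cup product of cochains (see `cupC_tp`). -/
def cupC {p q n : ℕ} (h : p + q = n) (f : Cochain k A A p) (g : Cochain k A A q) :
    Cochain k A A n :=
  lift (IsMulti.mul h ((isMulti_tp p).comp f) ((isMulti_tp q).comp g) (LinearMap.mul k A))

theorem cupC_tp {p q n : ℕ} (h : p + q = n) (f : Cochain k A A p) (g : Cochain k A A q)
    (a : ℕ → A) : cupC h f g (tp k n a) = f (tp k p a) * g (tp k q (shift p a)) :=
  lift_tp _ a

theorem tp_merge_low {n i : ℕ} (hi : n ≤ i) (a : ℕ → A) : tp k n (merge i a) = tp k n a :=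
  tp_congr fun j hj => if_pos (by omega)

theorem shift_merge {r i : ℕ} (hi : i < r) (a : ℕ → A) :
    shift r (merge i a) = shift (r + 1) a := by
  funext j
  unfold shift merge
  grind

theorem shift_merge' (r i : ℕ) (a : ℕ → A) : shift r (merge (r + i) a) = merge i (shift r a) := by
  funext j
  unfold shift merge
  grind

theorem shift_shift {X : Type*} (r s : ℕ) (a : ℕ → X) : shift r (shift s a) = shift (s + r) a := by
  funext j
  unfold shift
  rw [Nat.add_assoc]

theorem d_cupC {p q n : ℕ} (h : p + q = n) (h1 : p + 1 + q = n + 1) (h2 : p + (q + 1) = n + 1)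
    (f : Cochain k A A p) (g : Cochain k A A q) :
    d k A A n (cupC h f g) =
      cupC h1 (d k A A p f) g + (-1 : ℤ) ^ p • cupC h2 f (d k A A q g) := by
  subst h
  apply hom_ext
  intro a
  simp only [d_tp, LinearMap.add_apply, LinearMap.smul_apply, cupC_tp, Finset.sum_range_add,
    smul_eq_mul, MulOpposite.smul_eq_mul_unop, MulOpposite.unop_op]
  have e1 : ∀ i ∈ Finset.range p, (-1 : ℤ) ^ (i + 1) • (f (tp k p (merge i a)) *
      g (tp k q (shift p (merge i a)))) =
      ((-1 : ℤ) ^ (i + 1) • f (tp k p (merge i a))) * g (tp k q (shift (p + 1) a)) := by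
    intro i hi
    rw [shift_merge (Finset.mem_range.1 hi), smul_mul_assoc]
  have e2 : ∀ i ∈ Finset.range q, (-1 : ℤ) ^ (p + i + 1) • (f (tp k p (merge (p + i) a)) *
      g (tp k q (shift p (merge (p + i) a)))) =
      (-1 : ℤ) ^ p • (f (tp k p a) * ((-1 : ℤ) ^ (i + 1) • g (tp k q (merge i (shift p a))))) := by
    intro i hi
    rw [tp_merge_low (by omega), shift_merge', mul_smul_comm, smul_smul, ← pow_add, add_assoc]
  rw [Finset.sum_congr rfl e1, Finset.sum_congr rfl e2, ← Finset.sum_mul, ← Finset.smul_sum,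
    ← Finset.mul_sum, shift_shift, shift_shift, add_comm 1 p]
  have e3 : shift p a 0 = a p := rfl
  have e4 : shift p a q = a (p + q) := rfl
  rw [e3, e4]
  simp only [mul_add, add_mul, smul_add, smul_mul_assoc, mul_smul_comm, mul_assoc, pow_succ,
    pow_add, mul_neg, neg_mul, mul_one, neg_smul, smul_neg, smul_smul]
  abel

theorem cupC_add_left {p q n : ℕ} (h : p + q = n) (f f' : Cochain k A A p)
    (g : Cochain k A A q) : cupC h (f + f') g = cupC h f g + cupC h f' g :=
  hom_ext fun a => by simp only [cupC_tp, LinearMap.add_apply, add_mul]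

theorem cupC_add_right {p q n : ℕ} (h : p + q = n) (f : Cochain k A A p)
    (g g' : Cochain k A A q) : cupC h f (g + g') = cupC h f g + cupC h f g' :=
  hom_ext fun a => by simp only [cupC_tp, LinearMap.add_apply, mul_add]

theorem cupC_zero_left {p q n : ℕ} (h : p + q = n) (g : Cochain k A A q) :
    cupC h (0 : Cochain k A A p) g = 0 :=
  hom_ext fun a => by simp only [cupC_tp, LinearMap.zero_apply, zero_mul]

theorem cupC_zero_right {p q n : ℕ} (h : p + q = n) (f : Cochain k A A p) :
    cupC h f (0 : Cochain k A A q) = 0 :=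
  hom_ext fun a => by simp only [cupC_tp, LinearMap.zero_apply, mul_zero]

/-- The cup product on Hochschild cohomology, as a biadditive map. -/
def cupAdd {p q n : ℕ} (h : p + q = n) : HH k A A p →+ HH k A A q →+ HH k A A n :=
  SQ.map₂ (AddMonoidHom.mk' (fun f => AddMonoidHom.mk' (fun g => cupC h f g) (cupC_add_right h f))
      fun f f' => AddMonoidHom.ext fun g => cupC_add_left h f f' g)
    (by
      intro f hf g hg
      have hf' : d k A A p f = 0 := hf
      have hg' : d k A A q g = 0 := hg
      show d k A A n (cupC h f g) = 0
      rw [d_cupC h (by omega) (by omega), hf', hg', cupC_zero_left, cupC_zero_right, smul_zero,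
        add_zero])
    (by
      intro f hf g hg
      have hg' : d k A A q g = 0 := hg
      cases p with
      | zero =>
        have hf' : f = 0 := hf
        rw [hf', map_zero]
        exact AddSubgroup.zero_mem _
      | succ p =>
        obtain ⟨y, rfl⟩ := hf
        obtain ⟨n, rfl⟩ : ∃ n', n = n' + 1 := ⟨p + q, by omega⟩
        refine ⟨cupC (by omega : p + q = n) y g, ?_⟩
        rw [d_cupC _ h (by omega), hg', cupC_zero_right, smul_zero, add_zero]
        rfl)
    (by
      intro f hf g hg
      have hf' : d k A A p f = 0 := hf
      cases q with
      | zero =>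
        have hg' : g = 0 := hg
        rw [hg', map_zero]
        exact AddSubgroup.zero_mem _
      | succ q =>
        obtain ⟨y, rfl⟩ := hg
        obtain ⟨n, rfl⟩ : ∃ n', n = n' + 1 := ⟨p + q, by omega⟩
        refine ⟨(-1 : ℤ) ^ p • cupC (by omega : p + q = n) f y, ?_⟩
        rw [map_zsmul, d_cupC _ (by omega) h, hf', cupC_zero_left, zero_add, smul_smul, sg_neg,
          one_smul]
        rfl)

/-- The cup product on Hochschild cohomology, linear over any commutative ring `R` over which `A`
is an algebra. -/
def cup (R : Type*) [CommRing R] [Algebra R A] [SMulCommClass k R A] (p q : ℕ) :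
    HH k A A p →ₗ[R] HH k A A q →ₗ[R] HH k A A (p + q) :=
  LinearMap.mk₂ R (fun x y => cupAdd rfl x y)
    (fun x x' y => by rw [map_add, AddMonoidHom.add_apply])
    (fun r x y => by
      induction x using SQ.ind with
      | h f hf =>
      induction y using SQ.ind with
      | h g hg =>
      have e : cupC rfl (r • f) g = r • cupC rfl f g := hom_ext fun a => by
        simp only [cupC_tp, LinearMap.smul_apply, smul_mul_assoc]
      exact SQ.mk_congr _ e)
    (fun x y y' => map_add _ _ _)
    (fun r x y => by
      induction x using SQ.ind with
      | h f hf =>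
      induction y using SQ.ind with
      | h g hg =>
      have e : cupC rfl f (r • g) = r • cupC rfl f g := hom_ext fun a => by
        simp only [cupC_tp, LinearMap.smul_apply, mul_smul_comm]
      exact SQ.mk_congr _ e)

/-- The `0`-cochain with value `x`. -/
def constC (x : M) : Cochain k A M 0 := lift (isMulti_const x)

@[simp] theorem constC_tp (x : M) (a : ℕ → A) : constC x (tp k 0 a) = x := lift_tp _ a

/-- The class in `HH⁰(A)` of a scalar `r`, for any commutative ring `R` over which `A` is an
algebra; in particular for the centre of `A`. -/
def scalarClass (k : Type*) [CommRing k] {R : Type*} [CommRing R] (A : Type*) [Ring A]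
    [Algebra k A] [Algebra R A] (r : R) : HH k A A 0 :=
  SQ.mk (constC (algebraMap R A r)) (by
    show d k A A 0 _ = 0
    apply hom_ext
    intro a
    simp only [d_tp, constC_tp, Finset.range_zero, Finset.sum_empty, smul_eq_mul,
      MulOpposite.smul_eq_mul_unop, MulOpposite.unop_op, LinearMap.zero_apply,
      (Algebra.commutes r (a 0))]
    simp)

theorem isMulti_capC {p q n : ℕ} (h : p + q = n) (f : Cochain k A M p) (x : A) :
    IsMulti k n (fun a : ℕ → A => (x • f (tp k p a)) ⊗ₜ[k] tp k q (shift p a)) :=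
  IsMulti.mul h (((isMulti_tp p).comp f).comp (lact k A M x)) (isMulti_tp q)
    (TensorProduct.mk k M (T k A q))

/-- Cap product of a cochain with a chain (see `capC_tmul`). -/
def capC {p q n : ℕ} (h : p + q = n) (f : Cochain k A M p) :
    Chain k A A n →ₗ[k] Chain k A M q :=
  lift₂ (isMulti_capC h f)
    (fun x y a => by rw [add_smul, TensorProduct.add_tmul])
    (fun c x a => by rw [smul_assoc, TensorProduct.smul_tmul'])

theorem capC_tmul {p q n : ℕ} (h : p + q = n) (f : Cochain k A M p) (x : A) (a : ℕ → A) :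
    capC h f (x ⊗ₜ tp k n a) = (x • f (tp k p a)) ⊗ₜ[k] tp k q (shift p a) :=
  lift₂_tmul _ _ _ x a

theorem capC_add {p q n : ℕ} (h : p + q = n) (f f' : Cochain k A M p) :
    capC h (f + f') = capC h f + capC h f' :=
  chain_hom_ext fun x a => by
    simp only [capC_tmul, LinearMap.add_apply, smul_add, TensorProduct.add_tmul]

theorem capC_zero {p q n : ℕ} (h : p + q = n) : capC h (0 : Cochain k A M p) = 0 :=
  chain_hom_ext fun x a => by
    simp only [capC_tmul, LinearMap.zero_apply, smul_zero, TensorProduct.zero_tmul]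

theorem capC_b {p q n : ℕ} (h : p + q = n) (h1 : p + 1 + q = n + 1) (h2 : p + (q + 1) = n + 1)
    (f : Cochain k A M p) (x : Chain k A A (n + 1)) :
    capC h f (b k A A n x) =
      capC h1 (d k A M p f) x + (-1 : ℤ) ^ p • b k A M q (capC h2 f x) := by
  suffices hh : capC h f ∘ₗ b k A A n =
      capC h1 (d k A M p f) + (-1 : ℤ) ^ p • (b k A M q ∘ₗ capC h2 f) from
    LinearMap.congr_fun hh x
  subst h
  apply chain_hom_ext
  intro x a
  simp only [LinearMap.comp_apply, LinearMap.add_apply, LinearMap.smul_apply, capC_tmul, b_tmul,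
    map_add, map_sum, map_zsmul, d_tp, Finset.sum_range_add]
  have e1 : ∀ i ∈ Finset.range p, (-1 : ℤ) ^ (i + 1) • ((x • f (tp k p (merge i a))) ⊗ₜ[k]
      tp k q (shift p (merge i a))) =
      (x • ((-1 : ℤ) ^ (i + 1) • f (tp k p (merge i a)))) ⊗ₜ[k] tp k q (shift (p + 1) a) := by
    intro i hi
    rw [shift_merge (Finset.mem_range.1 hi), smul_comm x, TensorProduct.smul_tmul']
  have e2 : ∀ i ∈ Finset.range q, (-1 : ℤ) ^ (p + i + 1) • ((x • f (tp k p (merge (p + i) a))) ⊗ₜ[k]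
      tp k q (shift p (merge (p + i) a))) =
      (-1 : ℤ) ^ p • ((-1 : ℤ) ^ (i + 1) • ((x • f (tp k p a)) ⊗ₜ[k]
        tp k q (merge i (shift p a)))) := by
    intro i hi
    rw [tp_merge_low (by omega), shift_merge', smul_smul, ← pow_add, add_assoc]
  rw [Finset.sum_congr rfl e1, Finset.sum_congr rfl e2, ← TensorProduct.sum_tmul,
    ← Finset.smul_sum, ← Finset.smul_sum, shift_shift, shift_shift, add_comm 1 p]
  have e3 : shift p a 0 = a p := rfl
  have e4 : shift p a q = a (p + q) := rfl
  rw [e3, e4]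
  simp only [MulOpposite.smul_eq_mul_unop, MulOpposite.unop_op, smul_eq_mul, mul_smul, smul_add,
    TensorProduct.add_tmul, smul_comm x (MulOpposite.op (a p)), pow_succ, pow_add, mul_neg,
    mul_one, neg_smul, smul_neg, TensorProduct.neg_tmul, smul_comm x ((-1 : ℤ) ^ p),
    ← TensorProduct.smul_tmul']
  abel

/-- The cap product `HHᵖ(A, M) × HHₙ(A) → HH_q(A, M)`, `p + q = n`. -/
def cap {p q n : ℕ} (h : p + q = n) : HH k A M p →+ Homology k A A n →+ Homology k A M q :=
  SQ.map₂ (AddMonoidHom.mk' (fun f => (capC h f).toAddMonoidHom)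
      fun f f' => AddMonoidHom.ext fun x => LinearMap.congr_fun (capC_add h f f') x)
    (by
      intro f hf x hx
      have hf' : d k A M p f = 0 := hf
      cases q with
      | zero => exact AddSubgroup.mem_top _
      | succ q =>
        obtain ⟨n, rfl⟩ : ∃ n', n = n' + 1 := ⟨p + q, by omega⟩
        have hx' : b k A A n x = 0 := hx
        have := capC_b (by omega : p + q = n) (by omega) h f x
        rw [hx', map_zero, hf', capC_zero, LinearMap.zero_apply, zero_add] at this
        show b k A M q (capC h f x) = 0
        rw [← one_smul ℤ (b k A M q (capC h f x)), ← sg_neg p, mul_smul, ← this, smul_zero])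
    (by
      intro f hf x hx
      cases p with
      | zero =>
        have hf' : f = 0 := hf
        rw [hf', map_zero]
        exact AddSubgroup.zero_mem _
      | succ p =>
        obtain ⟨y, rfl⟩ := hf
        obtain ⟨n, rfl⟩ : ∃ n', n = n' + 1 := ⟨p + q, by omega⟩
        have hx' : b k A A n x = 0 := hx
        have := capC_b (by omega : p + q = n) h (by omega) y x
        rw [hx', map_zero] at this
        refine ⟨-((-1 : ℤ) ^ p • capC (by omega : p + (q + 1) = n + 1) y x), ?_⟩
        show b k A M q (-((-1 : ℤ) ^ p • capC _ y x)) = capC h (d k A M p y) x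
        rw [map_neg, map_zsmul]
        exact neg_eq_of_add_eq_zero_left this.symm)
    (by
      rintro f hf _ ⟨y, rfl⟩
      have hf' : d k A M p f = 0 := hf
      have := capC_b h (by omega) (by omega : p + (q + 1) = n + 1) f y
      rw [hf', capC_zero, LinearMap.zero_apply, zero_add] at this
      refine ⟨(-1 : ℤ) ^ p • capC (by omega : p + (q + 1) = n + 1) f y, ?_⟩
      show b k A M q ((-1 : ℤ) ^ p • capC _ f y) = capC h f (b k A A n y)
      rw [this, map_zsmul])

end Products

section Bracket

variable {k : Type*} [CommRing k] {A : Type*} [Ring A] [Algebra k A]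

theorem isMulti_circ {p q r : ℕ} (h : r + 1 = p + q) (f : Cochain k A A p)
    (g : Cochain k A A q) : IsMulti k r (fun a : ℕ → A =>
      ∑ j ∈ Finset.range p, (-1 : ℤ) ^ (j * (q + 1)) • f (tp k p (ins j q g a))) :=
  IsMulti.sum _ fun _ hj =>
    (((isMulti_tp p).comp f).ins h (Finset.mem_range.1 hj) g).zsmul _

/-- The insertion product
`(f ∘ g)(a₁, …) = ∑ⱼ (-1)^{j(|g|+1)} f(a₁, …, aⱼ, g(aⱼ₊₁, …, aⱼ₊q), …)`. -/
def circ {p q r : ℕ} (h : r + 1 = p + q) (f : Cochain k A A p) (g : Cochain k A A q) :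
    Cochain k A A r := lift (isMulti_circ h f g)

/-- The Gerstenhaber bracket of cochains, `f ∘ g - (-1)^{(|f|+1)(|g|+1)} g ∘ f`. -/
def gerstenhaber {p q r : ℕ} (h : r + 1 = p + q) (f : Cochain k A A p) (g : Cochain k A A q) :
    Cochain k A A r :=
  circ h f g - (-1 : ℤ) ^ ((p + 1) * (q + 1)) • circ (h.trans (Nat.add_comm p q)) g f

theorem circ_tp {p q r : ℕ} (h : r + 1 = p + q) (f : Cochain k A A p) (g : Cochain k A A q)
    (a : ℕ → A) : circ h f g (tp k r a) =
      ∑ j ∈ Finset.range p, (-1 : ℤ) ^ (j * (q + 1)) • f (tp k p (ins j q g a)) := lift_tp _ a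

/-- Insert `s` at place `j`. -/
def insS (j : ℕ) (s : A) (a : ℕ → A) : ℕ → A := fun i =>
  if i < j then a i else if i = j then s else a (i - 1)

/-- The cochain-level bracket `{s, f}` with the `0`-cochain `s`. -/
def bracketC (s : A) (p : ℕ) (f : Cochain k A A (p + 1)) : Cochain k A A p :=
  gerstenhaber (Nat.zero_add (p + 1)).symm (constC s) f

theorem bracketC_tp (s : A) (p : ℕ) (f : Cochain k A A (p + 1)) (a : ℕ → A) :
    bracketC s p f (tp k p a) = (-1 : ℤ) ^ (p + 1) •
      ∑ j ∈ Finset.range (p + 1), (-1 : ℤ) ^ j • f (tp k (p + 1) (insS j s a)) := by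
  have e : ∀ j, ins j 0 (constC s : Cochain k A A 0) a = insS j s a := by
    intro j
    funext i
    simp [ins, insS]
  have e2 : (-1 : ℤ) ^ ((0 + 1) * (p + 1 + 1)) = - (-1 : ℤ) ^ (p + 1) := by
    rw [Nat.zero_add, Nat.one_mul, pow_succ (-1 : ℤ) (p + 1), mul_neg_one]
  rw [bracketC, gerstenhaber, LinearMap.sub_apply, LinearMap.smul_apply, circ_tp, circ_tp, e2]
  simp only [Finset.range_zero, Finset.sum_empty, e, Nat.mul_one, neg_smul,
    sub_neg_eq_add, zero_add]

theorem sum_reindex {N : Type*} [AddCommGroup N] (n : ℕ) (H : ℕ → ℕ → N) :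
    ∑ j ∈ Finset.range (n + 2), ∑ i ∈ Finset.range (n + 1), H j i =
      ∑ i ∈ Finset.range (n + 1), (H i i + H (i + 1) i) +
      ∑ j ∈ Finset.range (n + 1), ∑ i ∈ Finset.range n,
        (if i < j then H (j + 1) i else H j (i + 1)) := by
  rw [← Finset.sum_product', ← Finset.sum_product', Finset.sum_add_distrib,
    ← Finset.sum_filter_add_sum_filter_not _ (fun x : ℕ × ℕ => x.1 = x.2 ∨ x.1 = x.2 + 1),
    ← Finset.sum_filter_add_sum_filter_not (Finset.filter _ _) (fun x : ℕ × ℕ => x.1 = x.2)]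
  congr 1
  · congr 1
    · refine Finset.sum_nbij' (fun x => x.2) (fun i => (i, i)) ?_ ?_ ?_ ?_ ?_
      · rintro ⟨j, i⟩ h
        simp only [Finset.mem_filter, Finset.mem_product, Finset.mem_range] at h ⊢
        omega
      · intro i h
        have := Finset.mem_range.1 h
        simp [Finset.mem_filter]
        omega
      · rintro ⟨j, i⟩ h
        simp only [Finset.mem_filter] at h
        rw [h.2]
      · intro i _
        rfl
      · rintro ⟨j, i⟩ h
        simp only [Finset.mem_filter] at h
        rw [h.2]
    · refine Finset.sum_nbij' (fun x => x.2) (fun i => (i + 1, i)) ?_ ?_ ?_ ?_ ?_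
      · rintro ⟨j, i⟩ h
        simp only [Finset.mem_filter, Finset.mem_product, Finset.mem_range] at h ⊢
        omega
      · intro i h
        have := Finset.mem_range.1 h
        simp [Finset.mem_filter]
        omega
      · rintro ⟨j, i⟩ h
        simp only [Finset.mem_filter, Prod.mk.injEq] at h ⊢
        exact ⟨by omega, trivial⟩
      · intro i _
        rfl
      · rintro ⟨j, i⟩ h
        simp only [Finset.mem_filter] at h
        have : j = i + 1 := by omega
        rw [this]
  · refine Finset.sum_nbij'
      (fun x => (if x.2 < x.1 then x.1 - 1 else x.1, if x.2 < x.1 then x.2 else x.2 - 1))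
      (fun x => (if x.2 < x.1 then x.1 + 1 else x.1, if x.2 < x.1 then x.2 else x.2 + 1))
      ?_ ?_ ?_ ?_ ?_
    · rintro ⟨j, i⟩ h
      simp only [Finset.mem_filter, Finset.mem_product, Finset.mem_range] at h ⊢
      split_ifs <;> omega
    · rintro ⟨j, i⟩ h
      simp only [Finset.mem_filter, Finset.mem_product, Finset.mem_range] at h ⊢
      split_ifs <;> omega
    · rintro ⟨j, i⟩ h
      simp only [Finset.mem_filter, Finset.mem_product, Finset.mem_range, Prod.mk.injEq] at h ⊢
      grind
    · rintro ⟨j, i⟩ h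
      simp only [Finset.mem_product, Finset.mem_range, Prod.mk.injEq] at h ⊢
      grind
    · rintro ⟨j, i⟩ h
      simp only [Finset.mem_filter, Finset.mem_product, Finset.mem_range] at h ⊢
      by_cases hij : i < j
      · rw [if_pos hij, if_pos hij, if_pos (by omega), Nat.sub_add_cancel (by omega)]
      · rw [if_neg hij, if_neg hij, if_neg (by omega), Nat.sub_add_cancel (by omega)]

theorem d_bracketC (s : A) (hs : ∀ a : A, s * a = a * s) (p : ℕ) (f : Cochain k A A (p + 1)) :
    d k A A p (bracketC s p f) = bracketC s (p + 1) (d k A A (p + 1) f) := by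
  apply hom_ext
  intro a
  rw [bracketC_tp]
  simp only [d_tp, bracketC_tp, smul_eq_mul, MulOpposite.smul_eq_mul_unop, MulOpposite.unop_op,
    smul_add, Finset.sum_add_distrib]
  have e1 : ∑ j ∈ Finset.range (p + 2), (-1 : ℤ) ^ j •
      (insS j s a 0 * f (tp k (p + 1) (shift 1 (insS j s a)))) =
      s * f (tp k (p + 1) a) - a 0 * ∑ j ∈ Finset.range (p + 1),
        (-1 : ℤ) ^ j • f (tp k (p + 1) (insS j s (shift 1 a))) := by
    rw [Finset.sum_range_succ', add_comm, sub_eq_add_neg, Finset.mul_sum,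
      ← Finset.sum_neg_distrib]
    congr 1
    · have : shift 1 (insS 0 s a) = a := by
        funext i
        simp [shift, insS]
      rw [this]
      simp [insS]
    · refine Finset.sum_congr rfl fun j _ => ?_
      have : shift 1 (insS (j + 1) s a) = insS j s (shift 1 a) := by
        funext i
        unfold shift insS
        grind
      rw [this, pow_succ, mul_neg_one, neg_smul, mul_smul_comm]
      simp [insS]
  have e3 : ∑ j ∈ Finset.range (p + 2), (-1 : ℤ) ^ j • (-1 : ℤ) ^ (p + 1 + 1) •
      (f (tp k (p + 1) (insS j s a)) * insS j s a (p + 1)) =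
      (-1 : ℤ) ^ p • ((∑ j ∈ Finset.range (p + 1),
        (-1 : ℤ) ^ j • f (tp k (p + 1) (insS j s a))) * a p) - f (tp k (p + 1) a) * s := by
    rw [Finset.sum_range_succ, sub_eq_add_neg, Finset.sum_mul, Finset.smul_sum]
    congr 1
    · refine Finset.sum_congr rfl fun j hj => ?_
      have hj' := Finset.mem_range.1 hj
      have : insS j s a (p + 1) = a p := by
        unfold insS
        grind
      rw [this, smul_mul_assoc, smul_comm, pow_succ, pow_succ, mul_neg_one, mul_neg_one, neg_neg]
    · have h1 : tp k (p + 1) (insS (p + 1) s a) = tp k (p + 1) a :=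
        tp_congr fun i hi => if_pos hi
      have h2 : insS (p + 1) s a (p + 1) = s := by simp [insS]
      rw [h1, h2, smul_smul, ← pow_add, (show (-1 : ℤ) ^ (p + 1 + (p + 1 + 1)) = -1 from
        Odd.neg_one_pow ⟨p + 1, by ring⟩), neg_smul, one_smul]
  have e2 : ∑ j ∈ Finset.range (p + 2), (-1 : ℤ) ^ j • ∑ i ∈ Finset.range (p + 1),
      (-1 : ℤ) ^ (i + 1) • f (tp k (p + 1) (merge i (insS j s a))) =
      - ∑ i ∈ Finset.range p, (-1 : ℤ) ^ (i + 1) • ∑ j ∈ Finset.range (p + 1),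
        (-1 : ℤ) ^ j • f (tp k (p + 1) (insS j s (merge i a))) := by
    simp only [Finset.smul_sum]
    rw [sum_reindex]
    have z : ∀ i ∈ Finset.range (p + 1),
        ((-1 : ℤ) ^ i • (-1 : ℤ) ^ (i + 1) • f (tp k (p + 1) (merge i (insS i s a))) +
        (-1 : ℤ) ^ (i + 1) • (-1 : ℤ) ^ (i + 1) •
          f (tp k (p + 1) (merge i (insS (i + 1) s a)))) = 0 := by
      intro i _
      have : merge i (insS i s a) = merge i (insS (i + 1) s a) := by
        funext r
        have := hs (a i)
        unfold merge insS
        grind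
      rw [this, pow_succ, mul_neg_one, neg_smul, neg_smul, smul_neg, neg_neg,
        neg_add_cancel]
    rw [Finset.sum_eq_zero z, zero_add, Finset.sum_comm, ← Finset.sum_neg_distrib]
    refine Finset.sum_congr rfl fun i _ => ?_
    rw [← Finset.sum_neg_distrib]
    refine Finset.sum_congr rfl fun j _ => ?_
    split_ifs with hij
    · have : merge i (insS (j + 1) s a) = insS j s (merge i a) := by
        funext r
        unfold merge insS
        grind
      rw [this, smul_comm, pow_succ (-1 : ℤ) j, mul_neg_one, neg_smul, smul_neg]
    · have : merge (i + 1) (insS j s a) = insS j s (merge i a) := by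
        funext r
        unfold merge insS
        grind
      rw [this, smul_comm, pow_succ (-1 : ℤ) (i + 1), mul_neg_one, neg_smul]
  have e2' : ∑ i ∈ Finset.range p, (-1 : ℤ) ^ (i + 1) • (-1 : ℤ) ^ (p + 1) •
      ∑ j ∈ Finset.range (p + 1), (-1 : ℤ) ^ j • f (tp k (p + 1) (insS j s (merge i a))) =
      (-1 : ℤ) ^ (p + 1) • ∑ i ∈ Finset.range p, (-1 : ℤ) ^ (i + 1) •
        ∑ j ∈ Finset.range (p + 1), (-1 : ℤ) ^ j • f (tp k (p + 1) (insS j s (merge i a))) := by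
    rw [Finset.smul_sum]
    exact Finset.sum_congr rfl fun i _ => smul_comm _ _ _
  rw [e2', e1, e2, e3, hs]
  generalize ∑ i ∈ Finset.range p, (-1 : ℤ) ^ (i + 1) •
    ∑ j ∈ Finset.range (p + 1), (-1 : ℤ) ^ j • f (tp k (p + 1) (insS j s (merge i a))) = S2
  generalize ∑ j ∈ Finset.range (p + 1), (-1 : ℤ) ^ j • f (tp k (p + 1) (insS j s a)) = S3
  generalize ∑ j ∈ Finset.range (p + 1), (-1 : ℤ) ^ j •
    f (tp k (p + 1) (insS j s (shift 1 a))) = S1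
  rcases neg_one_pow_eq_or ℤ p with h | h <;>
    simp only [pow_succ, h, neg_neg, one_smul, neg_smul, mul_neg, neg_mul, smul_neg] <;>
    abel_nf

/-- The Gerstenhaber bracket `{s, -} : HH^{p+1}(A) → HHᵖ(A)` with an element `s` of the centre
`HH⁰(A)`, induced by the bracket of cochains. -/
def bracketCenter (s : Subalgebra.center k A) (p : ℕ) : HH k A A (p + 1) →+ HH k A A p :=
  have hs : ∀ a : A, (s : A) * a = a * s := fun a =>
    (Subalgebra.mem_center_iff.1 s.2 a).symm
  SQ.map (AddMonoidHom.mk' (fun f => bracketC (s : A) p f) fun f g => hom_ext fun a => by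
      simp only [bracketC_tp, LinearMap.add_apply, smul_add, Finset.sum_add_distrib])
    (by
      intro f hf
      have hf' : d k A A (p + 1) f = 0 := hf
      show d k A A p (bracketC (s : A) p f) = 0
      rw [d_bracketC _ hs, hf']
      exact hom_ext fun a => by simp [bracketC_tp])
    (by
      rintro _ ⟨g, rfl⟩
      show bracketC (s : A) p (d k A A p g) ∈ coboundaries k A A p
      cases p with
      | zero =>
        have : bracketC (s : A) 0 (d k A A 0 g) = 0 := hom_ext fun a => by
          have h1 : tp k 0 (shift 1 (insS 0 (s : A) a)) = tp k 0 (insS 0 (s : A) a) :=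
            tp_congr fun i hi => absurd hi (Nat.not_lt_zero _)
          rw [bracketC_tp]
          simp [d_tp, h1, insS, hs]
        rw [this]
        exact AddSubgroup.zero_mem _
      | succ p =>
        rw [← d_bracketC _ hs]
        exact ⟨_, rfl⟩)

end Bracket

section CalabiYau

/-- The map induced on a subquotient by a map that kills `B`. -/
def SQ.desc {C D : Type*} [AddCommGroup C] [AddCommGroup D] {Z B : AddSubgroup C} (φ : C →+ D)
    (h : ∀ x ∈ B, φ x = 0) : SQ Z B →+ D :=
  QuotientAddGroup.lift _ (φ.comp Z.subtype) fun _ hx => h _ hx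

variable (k : Type*) [CommRing k] (A : Type u) [Ring A] [Algebra k A]

/-- `A ⊗ A` as an `A`-bimodule with the outer bimodule structure `a (x ⊗ y) a' = a x ⊗ y a'`. -/
def Out : Type u := A ⊗[k] A

instance : AddCommGroup (Out k A) := TensorProduct.addCommGroup (R := k) (M := A) (N := A)
instance : Module k (Out k A) := inferInstanceAs (Module k (A ⊗[k] A))
instance : Module A (Out k A) := inferInstanceAs (Module A (A ⊗[k] A))
instance : IsScalarTower k A (Out k A) := inferInstanceAs (IsScalarTower k A (A ⊗[k] A))

instance : Module Aᵐᵒᵖ (Out k A) :=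
  Module.compHom (A ⊗[k] A)
    ((Module.End.lTensorAlgHom k A A).comp (Algebra.lsmul k k A : Aᵐᵒᵖ →ₐ[k] _)).toRingHom

variable {A}

/-- The element `x ⊗ y`. -/
def Out.tmul (x y : A) : Out k A := x ⊗ₜ[k] y

variable {k}

theorem Out.smul_tmul (a x y : A) : a • Out.tmul k x y = Out.tmul k (a * x) y := rfl

theorem Out.op_smul_tmul (a : Aᵐᵒᵖ) (x y : A) :
    a • Out.tmul k x y = Out.tmul k x (y * a.unop) := rfl

theorem Out.hom_ext {N : Type*} [AddCommGroup N] (f g : Out k A →+ N)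
    (h : ∀ x y : A, f (Out.tmul k x y) = g (Out.tmul k x y)) (m : Out k A) : f m = g m := by
  induction m using TensorProduct.induction_on with
  | zero => exact (map_zero f).trans (map_zero g).symm
  | tmul x y => exact h x y
  | add x y hx hy => exact (map_add f x y).trans ((congrArg₂ _ hx hy).trans (map_add g x y).symm)

instance : IsScalarTower k Aᵐᵒᵖ (Out k A) where
  smul_assoc c a _ := by
    show ((Module.End.lTensorAlgHom k A A).comp (Algebra.lsmul k k A : Aᵐᵒᵖ →ₐ[k] _)) (c • a) _ =
      c • ((Module.End.lTensorAlgHom k A A).comp (Algebra.lsmul k k A : Aᵐᵒᵖ →ₐ[k] _)) a _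
    rw [map_smul]
    rfl

instance : SMulCommClass A Aᵐᵒᵖ (Out k A) where
  smul_comm a c := Out.hom_ext
    ((DistribSMul.toAddMonoidHom _ a).comp (DistribSMul.toAddMonoidHom _ c))
    ((DistribSMul.toAddMonoidHom _ c).comp (DistribSMul.toAddMonoidHom _ a)) fun _ _ => rfl

/-- The inner left action `a • (x ⊗ y) = x ⊗ a y`. -/
def innerL (a : A) : Out k A →ₗ[k] Out k A := LinearMap.lTensor A (LinearMap.mulLeft k a)

/-- The inner right action `(x ⊗ y) • a = x a ⊗ y`. -/
def innerR (a : A) : Out k A →ₗ[k] Out k A := LinearMap.rTensor A (LinearMap.mulRight k a)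

theorem innerL_tmul (a x y : A) : innerL a (Out.tmul k x y) = Out.tmul k x (a * y) := rfl

theorem innerR_tmul (a x y : A) : innerR a (Out.tmul k x y) = Out.tmul k (x * a) y := rfl

/-- The left action of `A` on `HHⁱ(A, A ⊗ A) = Extⁱ(A, A ⊗ A)` induced by the inner one. -/
def extL (i : ℕ) (a : A) : HH k A (Out k A) i →+ HH k A (Out k A) i :=
  coeffMap (innerL a)
    (fun c => Out.hom_ext ((innerL a).toAddMonoidHom.comp (DistribSMul.toAddMonoidHom _ c))
      ((DistribSMul.toAddMonoidHom _ c).comp (innerL a).toAddMonoidHom) fun _ _ => rfl)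
    (fun c => Out.hom_ext ((innerL a).toAddMonoidHom.comp (DistribSMul.toAddMonoidHom _ c))
      ((DistribSMul.toAddMonoidHom _ c).comp (innerL a).toAddMonoidHom)
      fun x y => congrArg (Out.tmul k x) (mul_assoc a y c.unop).symm) i

/-- The right action of `A` on `HHⁱ(A, A ⊗ A) = Extⁱ(A, A ⊗ A)` induced by the inner one. -/
def extR (i : ℕ) (a : A) : HH k A (Out k A) i →+ HH k A (Out k A) i :=
  coeffMap (innerR a)
    (fun c => Out.hom_ext ((innerR a).toAddMonoidHom.comp (DistribSMul.toAddMonoidHom _ c))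
      ((DistribSMul.toAddMonoidHom _ c).comp (innerR a).toAddMonoidHom)
      fun x y => congrArg (fun z => Out.tmul k z y) (mul_assoc c x a))
    (fun c => Out.hom_ext ((innerR a).toAddMonoidHom.comp (DistribSMul.toAddMonoidHom _ c))
      ((DistribSMul.toAddMonoidHom _ c).comp (innerR a).toAddMonoidHom) fun _ _ => rfl) i

/-- The multiplication `x ⊗ y ↦ y x`. -/
def mulSwap : Out k A →ₗ[k] A := LinearMap.mul' k A ∘ₗ (TensorProduct.comm k A A).toLinearMap

theorem mulSwap_tmul (x y : A) : mulSwap (Out.tmul k x y) = y * x := rfl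

theorem mulSwap_smul (a : A) (m : Out k A) : mulSwap (a • m) = mulSwap (MulOpposite.op a • m) :=
  Out.hom_ext ((mulSwap (k := k) (A := A)).toAddMonoidHom.comp (DistribSMul.toAddMonoidHom _ a))
    ((mulSwap (k := k) (A := A)).toAddMonoidHom.comp
      (DistribSMul.toAddMonoidHom _ (MulOpposite.op a)))
    (fun x y => (mul_assoc y a x).symm) m

/-- The isomorphism `HH₀(A, A ⊗ A) → A` induced by `x ⊗ y ↦ y x`. -/
def trOut : Homology k A (Out k A) 0 →+ A :=
  have key : lift₂ (fun m : Out k A => isMulti_const (A := A) (mulSwap m))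
      (fun m m' _ => map_add mulSwap m m') (fun c m _ => map_smul mulSwap c m) ∘ₗ
        b k A (Out k A) 0 = 0 := by
    apply chain_hom_ext
    intro m a
    simp [b_tmul, mulSwap_smul]
  SQ.desc (lift₂ (fun m : Out k A => isMulti_const (A := A) (mulSwap m))
      (fun m m' _ => map_add mulSwap m m') (fun c m _ => map_smul mulSwap c m)).toAddMonoidHom
    (by
      rintro _ ⟨y, rfl⟩
      exact LinearMap.congr_fun key y)

/-- `v` is a volume: `a ↦ a • v` is an isomorphism `A ≅ HHⁿ(A, A ⊗ A)` of `A`-bimodules. -/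
def IsVolume (n : ℕ) (v : HH k A (Out k A) n) : Prop :=
  (∀ a : A, extL n a v = extR n a v) ∧ Function.Bijective fun a : A => extL n a v

/-- `π ∈ HHₙ(A)` is nondegenerate: it corresponds to a volume `v` under
`HHₙ(A) ≅ Hom(Extⁿ(A, A ⊗ A), A)`, `π ↦ (u ↦ u ∩ π)`, that is, `u ↦ u ∩ π ∈ HH₀(A, A ⊗ A) = A` is
the inverse of the isomorphism `a ↦ a • v`. -/
def IsNondegenerate (n : ℕ) (π : Homology k A A n) : Prop :=
  ∃ v : HH k A (Out k A) n, IsVolume n v ∧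
    ∀ u : HH k A (Out k A) n, extL n (trOut (cap (Nat.add_zero n) u π)) v = u

section Smooth

attribute [local instance] TensorProduct.Algebra.module

variable (k A)

/-- `A` has a bounded resolution by finitely generated projective `A ⊗ Aᵒᵖ`-modules. -/
def HomologicallySmooth : Prop :=
  ∃ P : CategoryTheory.ProjectiveResolution (ModuleCat.of (A ⊗[k] Aᵐᵒᵖ) A),
    (∀ i, Module.Finite (A ⊗[k] Aᵐᵒᵖ) (P.complex.X i)) ∧
      ∃ N, ∀ i > N, CategoryTheory.Limits.IsZero (P.complex.X i)

/-- `A` is Calabi–Yau of dimension `n`: it is homologically smooth, `Extⁱ(A, A ⊗ A)` over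
`A ⊗ Aᵒᵖ` vanishes for `i ≠ n`, and there is an isomorphism of bimodules
`A ≅ Extⁿ(A, A ⊗ A)`. -/
def IsCY (n : ℕ) : Prop :=
  HomologicallySmooth k A ∧ (∀ i, i ≠ n → Subsingleton (HH k A (Out k A) i)) ∧
    ∃ v : HH k A (Out k A) n, IsVolume n v

end Smooth

end CalabiYau

section Duality

variable {k : Type*} [CommRing k] {A : Type*} [Ring A] [Algebra k A]

open Classical in
/-- The inverse of a bijective additive map (zero for other maps). -/
def invAdd {X Y : Type*} [AddCommGroup X] [AddCommGroup Y] (f : X →+ Y) : Y →+ X :=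
  if h : Function.Bijective f then (AddEquiv.ofBijective f h).symm.toAddMonoidHom else 0

/-- The duality map `HHᵖ(A) → HH_q(A)`, `f ↦ f ∩ π`, where `p + q = n`. -/
def dual {p q n : ℕ} (h : p + q = n) (π : Homology k A A n) : HH k A A p →+ Homology k A A q :=
  (cap h).flip π

/-- Capping with `π ∈ HHₙ(A)` is an isomorphism `HH^*(A) ≅ HH_{n-*}(A)` (in all degrees). -/
def IsDualizing (n : ℕ) (π : Homology k A A n) : Prop :=
  (∀ (p q : ℕ) (h : p + q = n), Function.Bijective (dual h π)) ∧
    (∀ p > n, Subsingleton (HH k A A p)) ∧ ∀ q > n, Subsingleton (Homology k A A q)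

/-- The BV operator `HH^{p+1}(A) → HHᵖ(A)`: the Connes differential transported through
`f ↦ f ∩ π`. It is zero in degrees above `n`, and on `HH⁰(A)`. -/
def bvOp (n : ℕ) (π : Homology k A A n) (p : ℕ) : HH k A A (p + 1) →+ HH k A A p :=
  if h : p + 1 ≤ n then
    (invAdd (dual (by omega : p + (n - (p + 1) + 1) = n) π)).comp
      ((connesHom k A (n - (p + 1))).comp (dual (Nat.add_sub_cancel' h) π))
  else 0

end Duality

section Transfer

variable {k : Type*} [CommRing k] {A : Type*} [Ring A] [Algebra k A] {B : Type*} [Ring B]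
  [Algebra k B]

/-- For an algebra map `L : A → B` such that `HHⁿ(B, B) → HHⁿ(A, B)` is bijective, the composite
`HHⁿ(A, A) → HHⁿ(A, B) ≅ HHⁿ(B, B)` of `f ↦ L ∘ f` and of the inverse of `g ↦ g ∘ L^{⊗ n}`. -/
def transfer (L : A →ₐ[k] B) (n : ℕ) : HH k A A n →+ HH k B B n :=
  (invAdd (restrict L n)).comp (pushForward L n)

theorem transfer_smul (L : A →ₐ[k] B) (n : ℕ) {R : Type*} [CommRing R] [Algebra R A]
    [Algebra R B] [SMulCommClass k R A] [SMulCommClass k R B]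
    (hL : ∀ (r : R) (a : A), L (r • a) = r • L a) (r : R) (f : HH k A A n) :
    transfer L n (r • f) = r • transfer L n f := by
  have h1 : pushForward L n (r • f) = r • pushForward L n f := by
    induction f using SQ.ind with
    | h f hf => exact SQ.mk_congr _ (LinearMap.ext fun x => hL r (f x))
  have h2 : ∀ g : HH k B B n, restrict L n (r • g) = r • restrict L n g := by
    intro g
    induction g using SQ.ind with
    | h g hg => exact SQ.mk_congr _ rfl
  unfold transfer
  rw [AddMonoidHom.comp_apply, AddMonoidHom.comp_apply, h1]
  by_cases h : Function.Bijective (restrict L n)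
  · rw [invAdd, dif_pos h]
    show (AddEquiv.ofBijective _ h).symm _ = r • (AddEquiv.ofBijective _ h).symm _
    rw [AddEquiv.symm_apply_eq]
    show _ = restrict L n _
    rw [h2]
    congr 1
    exact ((AddEquiv.ofBijective _ h).apply_symm_apply _).symm
  · rw [invAdd, dif_neg h, AddMonoidHom.zero_apply, AddMonoidHom.zero_apply, smul_zero]

end Transfer

section Localization

variable {k : Type*} [CommRing k] {A : Type u} [Ring A] [Algebra k A]

/-- `A` is an algebra over its centre. -/
instance centerAlgebra : Algebra (Subalgebra.center k A) A where
  algebraMap := (Subalgebra.center k A).val.toRingHom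
  commutes' r x := (Subalgebra.mem_center_iff.1 r.2 x).symm
  smul_def' _ _ := rfl

variable (S : Submonoid (Subalgebra.center k A))

/-- The localization `Â = Ẑ ⊗_Z A` of `A` at a multiplicative subset `S` of its centre `Z`, where
`Ẑ` is the localization of `Z` at `S`. -/
def Loc : Type u := Localization S ⊗[Subalgebra.center k A] A

instance : Ring (Loc S) :=
  inferInstanceAs (Ring (Localization S ⊗[Subalgebra.center k A] A))
instance : Algebra k (Loc S) :=
  inferInstanceAs (Algebra k (Localization S ⊗[Subalgebra.center k A] A))
instance : Algebra (Subalgebra.center k A) (Loc S) :=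
  inferInstanceAs (Algebra _ (Localization S ⊗[Subalgebra.center k A] A))
instance : Algebra (Localization S) (Loc S) :=
  inferInstanceAs (Algebra _ (Localization S ⊗[Subalgebra.center k A] A))
instance : SMulCommClass k (Subalgebra.center k A) (Loc S) :=
  inferInstanceAs (SMulCommClass k _ (Localization S ⊗[Subalgebra.center k A] A))
instance : SMulCommClass k (Localization S) (Loc S) :=
  inferInstanceAs (SMulCommClass k _ (Localization S ⊗[Subalgebra.center k A] A))
instance : IsScalarTower (Subalgebra.center k A) (Localization S) (Loc S) :=
  inferInstanceAs (IsScalarTower _ _ (Localization S ⊗[Subalgebra.center k A] A))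

/-- The canonical map `L : A → Â`, `a ↦ 1 ⊗ a`. -/
def locMap : A →ₐ[k] Loc S :=
  (Algebra.TensorProduct.includeRight :
    A →ₐ[Subalgebra.center k A] Localization S ⊗[Subalgebra.center k A] A).restrictScalars k

/-- The map `L^* : HHⁿ(A) → HHⁿ(Â)`. -/
def Lstar (n : ℕ) : HH k A A n →ₗ[Subalgebra.center k A] HH k (Loc S) (Loc S) n :=
  { transfer (locMap S) n with
    map_smul' := transfer_smul (locMap S) n fun z a =>
      (Algebra.TensorProduct.includeRight :
        A →ₐ[Subalgebra.center k A]
          Localization S ⊗[Subalgebra.center k A] A).toLinearMap.map_smul z a }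

/-- The degree `n` part of the localization of the graded algebra `HH^*(A)`. -/
abbrev HHLoc (n : ℕ) : Type _ := Localization S ⊗[Subalgebra.center k A] HH k A A n

/-- The degree `n` part of the map `L̂^* : Ẑ ⊗_Z HH^*(A) → HH^*(Â)`, the `Ẑ`-linear extension of
`L^*`. -/
def LHat (n : ℕ) : HHLoc S n →ₗ[Localization S] HH k (Loc S) (Loc S) n :=
  (Lstar S n).liftBaseChange (Localization S)

/-- The cup product of the localized algebra: `(z ⊗ f) ∪ (w ⊗ g) = z w ⊗ (f ∪ g)`. -/
def locCup (p q : ℕ) :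
    HHLoc S p →ₗ[Localization S] HHLoc S q →ₗ[Localization S] HHLoc S (p + q) :=
  LinearMap.liftBaseChange (Localization S)
    (LinearMap.baseChangeHom _ _ _ _ ∘ₗ cup (k := k) (A := A) (Subalgebra.center k A) p q)

theorem locCup_tmul (p q : ℕ) (z w : Localization S) (f : HH k A A p) (g : HH k A A q) :
    locCup S p q (z ⊗ₜ f) (w ⊗ₜ g) =
      (z * w) ⊗ₜ cup (k := k) (A := A) (Subalgebra.center k A) p q f g := by
  rw [locCup, LinearMap.liftBaseChange_tmul, LinearMap.smul_apply, LinearMap.comp_apply,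
    LinearMap.baseChangeHom_apply, LinearMap.baseChange_tmul, TensorProduct.smul_tmul', smul_eq_mul]

end Localization

end Hoch

end

open Hoch

/-!
The argument rests on three facts about a central localization `L : A → Â`.

*Hochschild cohomology does not change under restriction along `L`.* The complex of the
`Â`-bimodules `Â ⊗ A^{⊗ n} ⊗ Â` is the localization of the bar complex of `A` at the central
elements `s ⊗ t` of the enveloping algebra, and localization is exact. It is thus a projective
resolution of `Â` (`IsCentralLoc.barExact`), and homomorphisms from it to an `Â`-bimodule `N` form
the Hochschild complex of `A` with coefficients in `N`. Comparison with the bar resolution of `Â`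
shows that `HH^*(Â, N) → HH^*(A, N)` is bijective (`BarExact.restr_bijective`). This defines `L^*`,
and its multiplicativity follows from the Leibniz rule for the cup product with coefficients in `Â`
(`restrict_cup`).

*If `A` is homologically smooth, Hochschild cohomology commutes with localization of the
coefficients.* With a resolution by finitely generated projectives, a cochain with coefficients in
a localization has a common denominator, and a cochain that vanishes there is killed by a single
element (`Res.exists_cocycle_of_isLocal`, `Res.exists_isCob_of_isLocal`). Applied to `A → Â`, this
gives the bijectivity of `L̂^*` (`LHat_bijective`); applied to `A ⊗ A → Â ⊗ Â`, it gives the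
vanishing of `HH^i(Â, Â ⊗ Â)` for `i ≠ n`. A class `π` is nondegenerate if and only if
`u ↦ u ∩ π` is a bijection from `HH^n(A, A ⊗ A)` to `A` (`isNondegenerate_iff`); this map is natural
in `L`, so its bijectivity is inherited by `Â`. A resolution of `A` by finitely generated
projectives localizes to one of `Â` (`Res.localize`). Hence `Â` is Calabi–Yau and `L_*(π)` is
nondegenerate (`IsCentralLoc.isCY`, `IsCentralLoc.isNondegenerate`).

*Duality and the BV identity.* For a cycle representing a nondegenerate class the cone of the cap
product is exact with coefficients in `A ⊗ A` (`coneExact_out`), hence in every finitely generated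
projective bimodule, hence, along a bounded resolution, in `A` (`coneExact_of_smooth`); so `𝔻_π` is
an isomorphism (`IsNondegenerate.isDualizing`). For a central element `s` let `L_s` be the
alternating sum of all insertions of `s` into a chain. Then `B (s x) - s B x` is homologous to
`L_s x` on cycles (`cartan`), and `L_s` commutes with the cap product up to the bracket with `s`
(`lieS_capC`). As `HH_{n+1}(A) = 0`, this implies `Δ (s f) = s Δ f - {s, f}` (`bvOp_smul`).
The maps `L^*` and `L_*` intertwine the BV operators of `A` and `Â` (`bvOp_Lstar`), so that the
identity for `s` and `s⁻¹ L^* f` in `Â` is the asserted formula for `Δ̂_π (f ⊗ s⁻¹)`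
(`bvOp_mk_smul_Lstar`), where `Δ̂_π` is the BV operator of `Â` transported along `L̂^*` (`bvLoc`).
-/

set_option linter.unusedSectionVars false

noncomputable section

namespace Hoch

/-! ### The Cartan homotopy for a central element -/

section Cartan

variable {k : Type*} [CommRing k] {A : Type*} [Ring A] [Algebra k A]

theorem isMulti_insS (n j : ℕ) (hj : j < n + 1) (s : A) {N : Type*} [AddCommGroup N] [Module k N]
    {Φ : (ℕ → A) → N} (h : IsMulti k (n + 1) Φ) : IsMulti k n (fun c => Φ (insS j s c)) := by
  have e : ∀ c : ℕ → A, insS j s c = ins j 0 (constC s : Cochain k A A 0) c := by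
    intro c
    funext i
    simp [ins, insS]
  simp only [e]
  exact h.ins (Nat.add_zero _).symm hj _

/-- Insertion of `s` after the letter `c j` of a cyclic word `c 0 ⊗ ⋯ ⊗ c n`
(zero if there is no such letter). -/
def insertAfter (s : A) (n j : ℕ) : Chain k A A n →ₗ[k] Chain k A A (n + 1) :=
  if hj : j ≤ n then
    liftCyc (isMulti_insS (n + 1) (j + 1) (by omega) s (isMulti_ch (k := k) (n + 1)))
  else 0

theorem insertAfter_ch (s : A) {n j : ℕ} (hj : j ≤ n) (c : ℕ → A) :
    insertAfter s n j (ch k n c) = ch k (n + 1) (insS (j + 1) s c) := by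
  rw [insertAfter, dif_pos hj, liftCyc_ch]

/-- Multiplication of the coefficient by `s`. -/
def mulCoeff (s : A) (n : ℕ) : Chain k A A n →ₗ[k] Chain k A A n :=
  LinearMap.rTensor _ (LinearMap.mulLeft k s)

theorem mulCoeff_ch (s : A) (n : ℕ) (c : ℕ → A) :
    mulCoeff s n (ch k n c) = ch k n (update c 0 (s * c 0)) := by
  unfold mulCoeff ch
  rw [LinearMap.rTensor_tmul]
  have : tp k n (shift 1 (update c 0 (s * c 0))) = tp k n (shift 1 c) :=
    tp_congr fun i _ => Function.update_of_ne (by omega) _ _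
  rw [this]
  simp

theorem isMulti_consS (n : ℕ) (s : A) :
    IsMulti k (n + 1) (fun c : ℕ → A => ch k (n + 1) (cons s c)) :=
  (isMulti_ch (k := k) (A := A) (n + 1)).cons s

/-- Insertion of `s` in front of a word. -/
def consL (s : A) (n : ℕ) : Chain k A A n →ₗ[k] Chain k A A (n + 1) := liftCyc (isMulti_consS n s)

theorem consL_ch (s : A) (n : ℕ) (c : ℕ → A) :
    consL s n (ch k n c) = ch k (n + 1) (cons s c) := liftCyc_ch _ c

theorem mulCoeff_sg (s : A) (n : ℕ) (x : Chain k A A n) :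
    mulCoeff s (n + 1) (sg n x) = consL s n x := by
  suffices h : mulCoeff s (n + 1) ∘ₗ sg n = consL (k := k) s n from LinearMap.congr_fun h x
  apply ch_hom_ext
  intro c
  rw [LinearMap.comp_apply, sg_ch, mulCoeff_ch, consL_ch]
  apply ch_congr
  intro i _
  simp only [cons, Function.update_apply]
  grind

/-- The Lie derivative along the central element `s`: the alternating sum of all insertions. -/
def lieS (s : A) (n : ℕ) : Chain k A A n →ₗ[k] Chain k A A (n + 1) :=
  ∑ j ∈ Finset.range (n + 1), (-1 : ℤ) ^ j • insertAfter s n j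

/-- The sum of all signed words obtained from a cyclic word `c 0 ⊗ ⋯ ⊗ c n` by an insertion of
`s` followed by a rotation which moves `s` to the left but not beyond the front. -/
def rotS (s : A) (n : ℕ) : Chain k A A n →ₗ[k] Chain k A A (n + 1) :=
  ∑ j ∈ Finset.range (n + 1), (-1 : ℤ) ^ j •
    ∑ m ∈ Finset.range (j + 1), (U (n + 1) ^ (m + 1)) ∘ₗ insertAfter s n j

theorem rotS_apply (s : A) (n : ℕ) (x : Chain k A A n) :
    rotS s n x = ∑ j ∈ Finset.range (n + 1), (-1 : ℤ) ^ j •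
      ∑ m ∈ Finset.range (j + 1), (U (n + 1) ^ (m + 1)) (insertAfter s n j x) := by
  simp [rotS, LinearMap.sum_apply]

theorem lieS_apply (s : A) (n : ℕ) (x : Chain k A A n) :
    lieS s n x = ∑ j ∈ Finset.range (n + 1), (-1 : ℤ) ^ j • insertAfter s n j x := by
  simp [lieS, LinearMap.sum_apply]

theorem Nm_shift (n : ℕ) (x : Chain k A A n) :
    ∑ j ∈ Finset.range (n + 1), (U n ^ (j + 1)) x = Nm n x := by
  conv_rhs => rw [← Nm_fix]
  simp only [Nm, LinearMap.sum_apply, map_sum, ← Module.End.mul_apply, ← pow_succ']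

theorem U_pow_insertAfter (s : A) {n j : ℕ} (hj : j ≤ n) (x : Chain k A A n) :
    (-1 : ℤ) ^ j • (U (n + 1) ^ (j + 1)) (insertAfter s n j x) =
      - consL s n ((U n ^ (j + 1)) x) := by
  suffices h : (-1 : ℤ) ^ j • (U (n + 1) ^ (j + 1)) ∘ₗ insertAfter (k := k) s n j =
      - consL s n ∘ₗ (U n ^ (j + 1)) from LinearMap.congr_fun h x
  apply ch_hom_ext
  intro c
  simp only [LinearMap.smul_apply, LinearMap.neg_apply, LinearMap.comp_apply, insertAfter_ch s hj,
    U_pow_ch, map_zsmul, consL_ch, smul_smul]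
  rw [← neg_smul]
  congr 1
  · rw [← pow_add, show j + (n + 1) * (j + 1) = n * (j + 1) + 1 + 2 * j by ring, pow_add, pow_mul]
    simp [pow_succ]
  · apply ch_congr
    intro r hr
    have h1 : (j + 1 + r) % (n + 1 + 1) =
        if j + 1 + r < n + 2 then j + 1 + r else j + 1 + r - (n + 2) := by
      split_ifs with h
      · exact Nat.mod_eq_of_lt h
      · rw [Nat.mod_eq_sub_mod (by omega)]
        exact Nat.mod_eq_of_lt (by omega)
    have h2 : r ≠ 0 → (j + 1 + (r - 1)) % (n + 1) =
        if j + r < n + 1 then j + r else j + r - (n + 1) := by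
      intro h0
      rw [show j + 1 + (r - 1) = j + r by omega]
      split_ifs with h
      · exact Nat.mod_eq_of_lt h
      · rw [Nat.mod_eq_sub_mod (by omega)]
        exact Nat.mod_eq_of_lt (by omega)
    unfold rot
    rw [h1]
    unfold cons insS
    by_cases h0 : r = 0
    · subst h0
      grind
    · beta_reduce
      rw [if_neg h0, h2 h0]
      grind

/-- The powers of the rotation in `rotS` telescope under `1 - V`: only the two ends of each sum
remain, the letter `s` in front and the letter `s` at the place of its insertion. -/
theorem rotS_sub_V (s : A) (n : ℕ) (x : Chain k A A n) :
    rotS s n x - V (n + 1) (rotS s n x) = - consL s n (Nm n x) - lieS s n x := by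
  have hV : ∀ (m : ℕ) (y : Chain k A A (n + 1)),
      V (n + 1) ((U (n + 1) ^ (m + 1)) y) = (U (n + 1) ^ m) y := by
    intro m y
    rw [pow_succ', Module.End.mul_apply, VU]
  have e : rotS s n x - V (n + 1) (rotS s n x) = ∑ j ∈ Finset.range (n + 1),
      (- consL s n ((U n ^ (j + 1)) x) - (-1 : ℤ) ^ j • insertAfter s n j x) := by
    simp only [rotS_apply, map_sum, map_zsmul, hV]
    rw [← Finset.sum_sub_distrib]
    refine Finset.sum_congr rfl fun j hj => ?_
    refine (smul_sub ((-1 : ℤ) ^ j) _ _).symm.trans ?_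
    rw [← Finset.sum_sub_distrib,
      Finset.sum_range_sub (fun m => (U (n + 1) ^ m) (insertAfter s n j x)), smul_sub,
      U_pow_insertAfter s (Nat.lt_succ_iff.1 (Finset.mem_range.1 hj)), pow_zero,
      Module.End.one_apply]
  rw [e, Finset.sum_sub_distrib, Finset.sum_neg_distrib, ← map_sum, Nm_shift, ← lieS_apply]

theorem dl_insertAfter_lt (s : A) {n j l : ℕ} (hj : j ≤ n) (hl : l ≤ j)
    (x : Chain k A A (n + 1)) :
    dl (n + 1) l (insertAfter s (n + 1) (j + 1) x) = insertAfter s n j (dl n l x) := by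
  suffices h : dl (n + 1) l ∘ₗ insertAfter s (n + 1) (j + 1) =
      insertAfter (k := k) s n j ∘ₗ dl n l from LinearMap.congr_fun h x
  apply ch_hom_ext
  intro c
  simp only [LinearMap.comp_apply, dl_ch, map_zsmul, insertAfter_ch s hj,
    insertAfter_ch s (Nat.succ_le_succ hj)]
  congr 1
  apply ch_congr
  intro r hr
  rw [face_of_le (by omega), face_of_le (by omega)]
  unfold merge insS
  grind

theorem dl_insertAfter_gt (s : A) {n j l : ℕ} (hj : j < l) (hl : l ≤ n + 1)
    (x : Chain k A A (n + 1)) :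
    dl (n + 1) (l + 1) (insertAfter s (n + 1) j x) = - insertAfter s n j (dl n l x) := by
  suffices h : dl (n + 1) (l + 1) ∘ₗ insertAfter s (n + 1) j =
      - (insertAfter (k := k) s n j ∘ₗ dl n l) from LinearMap.congr_fun h x
  apply ch_hom_ext
  intro c
  simp only [LinearMap.comp_apply, LinearMap.neg_apply, dl_ch, map_zsmul,
    insertAfter_ch s (by omega : j ≤ n), insertAfter_ch s (by omega : j ≤ n + 1), pow_succ,
    mul_neg, mul_one, neg_smul]
  congr 2
  apply ch_congr
  intro r hr
  unfold face merge insS cons shift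
  grind

theorem dl_insertAfter_eq (s : A) (hs : ∀ a : A, s * a = a * s) {n j : ℕ} (hj : j < n)
    (x : Chain k A A n) :
    dl n (j + 1) (insertAfter s n j x) = dl n (j + 1) (insertAfter s n (j + 1) x) := by
  suffices h : dl n (j + 1) ∘ₗ insertAfter s n j =
      dl n (j + 1) ∘ₗ insertAfter (k := k) s n (j + 1) from LinearMap.congr_fun h x
  apply ch_hom_ext
  intro c
  simp only [LinearMap.comp_apply, dl_ch, insertAfter_ch s hj.le,
    insertAfter_ch s (Nat.succ_le_of_lt hj)]
  congr 1
  apply ch_congr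
  intro r hr
  have := hs (c (j + 1))
  rw [face_of_le (by omega), face_of_le (by omega)]
  unfold merge insS
  grind

theorem dl_insertAfter_last (s : A) (n : ℕ) (x : Chain k A A n) :
    dl n (n + 1) (insertAfter s n n x) = (-1 : ℤ) ^ (n + 1) • mulCoeff s n x := by
  suffices h : dl n (n + 1) ∘ₗ insertAfter s n n = (-1 : ℤ) ^ (n + 1) • mulCoeff (k := k) s n from
    LinearMap.congr_fun h x
  apply ch_hom_ext
  intro c
  simp only [LinearMap.comp_apply, LinearMap.smul_apply, dl_ch, insertAfter_ch s le_rfl,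
    mulCoeff_ch]
  congr 1
  apply ch_congr
  intro r hr
  rw [face_last]
  unfold cons insS shift
  simp only [Function.update_apply]
  grind

theorem sum_skip {N : Type*} [AddCommGroup N] (f : ℕ → N) (J l : ℕ) (hl : l ≤ J) :
    ∑ m ∈ Finset.range (J + 1), (if l < m then f m else if l = m then 0 else f (m + 1)) =
      ∑ m ∈ Finset.range J, f (m + 1) := by
  induction J with
  | zero =>
    obtain rfl : l = 0 := by omega
    simp
  | succ J ih =>
    rcases hl.lt_or_eq with h | rfl
    · rw [Finset.sum_range_succ, ih (by omega), if_pos h, ← Finset.sum_range_succ (fun m => f (m + 1))]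
    · rw [Finset.sum_range_succ, if_neg (lt_irrefl _), if_pos rfl, add_zero]
      refine Finset.sum_congr rfl fun m hm => ?_
      have := Finset.mem_range.1 hm
      rw [if_neg (by omega), if_neg (by omega)]

/-- The faces of a rotated word are rotations of the faces of the word; the face that joins its last
and first letters is the one omitted from `bp`, hence the middle case. -/
theorem bp_U_pow (n m : ℕ) (hm : m ≤ n) (z : Chain k A A (n + 1)) :
    bp n ((U (n + 1) ^ (m + 1)) z) = ∑ l ∈ Finset.range (n + 2),
      (if l < m then (U n ^ m) (dl n l z) else
        if l = m then 0 else (U n ^ (m + 1)) (dl n l z)) := by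
  have e : ∀ i ∈ Finset.range (n + 1), dl n i ((U (n + 1) ^ (m + 1)) z) =
      if i + (m + 1) ≤ n + 1 then (U n ^ (m + 1)) (dl n (i + (m + 1)) z) else
        (U n ^ m) (dl n (i + (m + 1) - (n + 2)) z) := by
    intro i hi
    have := Finset.mem_range.1 hi
    split_ifs with h
    · exact dl_U_pow n i _ h z
    · exact dl_U_pow' n i (m + 1) (by omega) (by omega) (by omega) z
  rw [bp, LinearMap.sum_apply, Finset.sum_congr rfl e]
  rw [← Finset.sum_erase_add _ _ (Finset.mem_range.2 (by omega : m < n + 2)), if_neg (lt_irrefl _),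
    if_pos rfl, add_zero]
  refine Finset.sum_nbij' (fun i => if i + (m + 1) ≤ n + 1 then i + (m + 1) else
      i + (m + 1) - (n + 2)) (fun l => if l < m then l + (n + 2) - (m + 1) else l - (m + 1))
      ?_ ?_ ?_ ?_ ?_
  · intro i hi
    simp only [Finset.mem_range, Finset.mem_erase] at hi ⊢
    split_ifs <;> omega
  · intro i hi
    simp only [Finset.mem_range, Finset.mem_erase] at hi ⊢
    split_ifs <;> omega
  · intro i hi
    simp only [Finset.mem_range] at hi
    grind
  · intro i hi
    simp only [Finset.mem_range, Finset.mem_erase] at hi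
    grind
  · intro i hi
    simp only [Finset.mem_range] at hi
    by_cases h : i + (m + 1) ≤ n + 1
    · simp only [if_pos h]
      rw [if_neg (by omega), if_neg (by omega)]
    · simp only [if_neg h]
      rw [if_pos (by omega)]

/-- Rotated insertions commute with the differential up to the norm of `s x`; the terms in which
`s` is multiplied with a neighbour telescope, because `s` is central. -/
theorem bp_rotS_of_cycle (s : A) (hs : ∀ a : A, s * a = a * s) (n : ℕ) (x : Chain k A A n)
    (hx : x ∈ cycles k A A n) : bp n (rotS s n x) = - Nm n (mulCoeff s n x) := by
  -- `H l j` collects the `l`-th faces of the rotations of the word with `s` after the letter `j`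
  set H : ℕ → ℕ → Chain k A A n := fun l j => (-1 : ℤ) ^ j • ∑ m ∈ Finset.range (j + 1),
      (if l < m then (U n ^ m) (dl n l (insertAfter s n j x)) else
        if l = m then 0 else (U n ^ (m + 1)) (dl n l (insertAfter s n j x))) with hH
  have e1 : bp n (rotS s n x) =
      ∑ l ∈ Finset.range (n + 2), ∑ j ∈ Finset.range (n + 1), H l j := by
    rw [rotS_apply, map_sum, Finset.sum_comm]
    refine Finset.sum_congr rfl fun j hj => ?_
    have hj' := Finset.mem_range.1 hj
    rw [map_zsmul, map_sum, hH, ← Finset.smul_sum, Finset.sum_comm]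
    congr 1
    refine Finset.sum_congr rfl fun m hm => ?_
    have hm' := Finset.mem_range.1 hm
    exact bp_U_pow n m (by omega) _
  -- the faces that multiply `s` with the letter `j`, up to rotation
  set F : ℕ → Chain k A A n := fun j => ∑ m ∈ Finset.range j, (U n ^ (m + 1))
    (if j ≤ n then (-1 : ℤ) ^ j • dl n j (insertAfter s n j x) else mulCoeff s n x) with hF
  have e2 : ∀ j ∈ Finset.range (n + 1), H j j + H (j + 1) j = F j - F (j + 1) := by
    intro j hj
    have hj' := Finset.mem_range.1 hj
    have h1 : H j j = F j := by
      simp only [hH, hF, if_pos (show j ≤ n by omega)]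
      rw [sum_skip (fun m => (U n ^ m) (dl n j (insertAfter s n j x))) j j le_rfl, Finset.smul_sum]
      exact Finset.sum_congr rfl fun m _ => (map_zsmul _ _ _).symm
    have h2 : H (j + 1) j = - F (j + 1) := by
      simp only [hH, hF]
      rw [Finset.smul_sum, ← Finset.sum_neg_distrib]
      refine Finset.sum_congr rfl fun m hm => ?_
      have hm' := Finset.mem_range.1 hm
      rw [if_neg (by omega), if_neg (by omega)]
      split_ifs with h
      · rw [dl_insertAfter_eq s hs (by omega), map_zsmul, pow_succ (-1 : ℤ) j, mul_neg_one,
          neg_smul, neg_neg]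
      · obtain rfl : j = n := by omega
        rw [dl_insertAfter_last, map_zsmul, smul_smul, ← pow_add,
          (show (-1 : ℤ) ^ (j + (j + 1)) = -1 from Odd.neg_one_pow ⟨j, by ring⟩), neg_smul,
          one_smul]
    rw [h1, h2, sub_eq_add_neg]
  -- the remaining faces do not involve `s` and add up to insertions in `b x = 0`
  have e3 : ∑ l ∈ Finset.range (n + 1), ∑ j ∈ Finset.range n,
      (if j < l then H (l + 1) j else H l (j + 1)) = 0 := by
    cases n with
    | zero => simp
    | succ n =>
      have hx' : b k A A n x = 0 := hx
      have e4 : ∀ l ∈ Finset.range (n + 2), ∀ j ∈ Finset.range (n + 1),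
          (if j < l then H (l + 1) j else H l (j + 1)) = - ((-1 : ℤ) ^ j •
            ∑ m ∈ Finset.range (j + 1), (U (n + 1) ^ (m + 1)) (insertAfter s n j (dl n l x))) := by
        intro l hl j hj
        have hl' := Finset.mem_range.1 hl
        have hj' := Finset.mem_range.1 hj
        split_ifs with h
        · simp only [hH]
          refine Eq.trans ?_ (smul_neg ((-1 : ℤ) ^ j) _)
          rw [← Finset.sum_neg_distrib]
          congr 1
          refine Finset.sum_congr rfl fun m hm => ?_
          have hm' := Finset.mem_range.1 hm
          rw [if_neg (by omega), if_neg (by omega), dl_insertAfter_gt s h (by omega), map_neg]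
        · simp only [hH]
          rw [sum_skip (fun m => (U (n + 1) ^ m) (dl (n + 1) l (insertAfter s (n + 1) (j + 1) x)))
            (j + 1) l (by omega), dl_insertAfter_lt s (by omega) (by omega), pow_succ, mul_neg_one,
            neg_smul]
      rw [Finset.sum_congr rfl fun l hl => Finset.sum_congr rfl (e4 l hl), Finset.sum_comm]
      have e5 : ∀ j ∈ Finset.range (n + 1), ∑ l ∈ Finset.range (n + 2), - ((-1 : ℤ) ^ j •
            ∑ m ∈ Finset.range (j + 1), (U (n + 1) ^ (m + 1)) (insertAfter s n j (dl n l x))) =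
          - ((-1 : ℤ) ^ j • ∑ m ∈ Finset.range (j + 1), (U (n + 1) ^ (m + 1)) (insertAfter s n j
            (b k A A n x))) := by
        intro j _
        rw [b_eq_sum, Finset.sum_neg_distrib, ← Finset.smul_sum, Finset.sum_comm]
        simp only [map_sum]
      rw [Finset.sum_congr rfl e5, hx']
      simp
  rw [e1, sum_reindex, e3, add_zero, Finset.sum_congr rfl e2, Finset.sum_range_sub', hF]
  simp only [Finset.range_zero, Finset.sum_empty, zero_sub, if_neg (show ¬ n + 1 ≤ n by omega)]
  rw [Nm_shift]

theorem dl_last_sg (n : ℕ) (x : Chain k A A n) : dl n (n + 1) (sg n x) = - V n x := by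
  suffices h : dl n (n + 1) ∘ₗ sg n = - V (k := k) (A := A) n from LinearMap.congr_fun h x
  apply ch_hom_ext
  intro c
  simp only [LinearMap.comp_apply, LinearMap.neg_apply, sg_ch, dl_ch, V_ch, pow_succ, mul_neg_one,
    neg_smul]
  congr 2
  apply ch_congr
  intro r hr
  rw [face_last]
  have h1 : (n + r) % (n + 1) = if r = 0 then n else r - 1 := by
    split_ifs with h
    · rw [h]; exact Nat.mod_eq_of_lt (by omega)
    · rw [show n + r = r - 1 + (n + 1) by omega, Nat.add_mod_right]
      exact Nat.mod_eq_of_lt (by omega)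
  unfold cons shift rot
  rw [h1]
  grind

theorem b_sg (n : ℕ) (x : Chain k A A (n + 1)) :
    b k A A (n + 1) (sg (n + 1) x) = x - sg n (bp n x) - V (n + 1) x := by
  rw [b_eq, bp_sg, dl_last_sg]
  abel

theorem bp_Nm_of_cycle (n : ℕ) (x : Chain k A A (n + 1)) (hx : x ∈ cycles k A A (n + 1)) :
    bp n (Nm (n + 1) x) = 0 := by
  have hx' : b k A A n x = 0 := hx
  rw [bp_Nm, hx', map_zero]

theorem V_Nm (n : ℕ) (x : Chain k A A n) : V n (Nm n x) = Nm n x := by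
  conv_lhs => rw [← Nm_fix, VU]

theorem bp_zero_sg (x : Chain k A A 0) : bp 0 (sg 0 x) = x := by
  simp [bp, dl_sg_zero]

theorem b_sg_Nm (n : ℕ) (x : Chain k A A n) (hx : x ∈ cycles k A A n) :
    b k A A n (sg n (Nm n x)) = 0 := by
  cases n with
  | zero => rw [b_eq, dl_last_sg, V_Nm, bp_zero_sg, add_neg_cancel]
  | succ n => rw [b_sg, bp_Nm_of_cycle n x hx, map_zero, V_Nm, sub_zero, sub_self]

/-- On cycles the second half of the Connes differential is a boundary. -/
theorem V_sg_Nm_mem (n : ℕ) (x : Chain k A A n) (hx : x ∈ cycles k A A n) :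
    V (n + 1) (sg n (Nm n x)) ∈ boundaries k A A (n + 1) := by
  have h1 : bp n (sg n (Nm n x)) = Nm n x := by
    cases n with
    | zero => rw [bp_zero_sg]
    | succ n => rw [bp_sg, bp_Nm_of_cycle n x hx, map_zero, sub_zero]
  have h2 := b_sub_V (n + 1) (sg (n + 1) (sg n (Nm n x)))
  rw [bp_sg, h1, sub_self, map_zero, sub_zero, map_sub, b_sg, h1] at h2
  refine ⟨- V (n + 2) (sg (n + 1) (sg n (Nm n x))), ?_⟩
  show b k A A (n + 1) (- V (n + 2) (sg (n + 1) (sg n (Nm n x)))) = _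
  rw [map_neg]
  have h3 := sub_eq_zero.1 h2
  rw [← h3]
  abel

/-- The homotopy behind the Cartan formula, for the half `s N` of the Connes differential. -/
theorem b_sg_rotS (s : A) (hs : ∀ a : A, s * a = a * s) (n : ℕ) (x : Chain k A A n)
    (hx : x ∈ cycles k A A n) : b k A A (n + 1) (sg (n + 1) (rotS s n x)) =
      sg n (Nm n (mulCoeff s n x)) - mulCoeff s (n + 1) (sg n (Nm n x)) - lieS s n x := by
  have h := rotS_sub_V s n x
  rw [b_sg, bp_rotS_of_cycle s hs n x hx, map_neg, mulCoeff_sg, sub_neg_eq_add]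
  rw [sub_eq_iff_eq_add] at h
  nth_rewrite 1 [h]
  abel

theorem mulCoeff_b (s : A) (hs : ∀ a : A, s * a = a * s) (n : ℕ) (x : Chain k A A (n + 1)) :
    b k A A n (mulCoeff s (n + 1) x) = mulCoeff s n (b k A A n x) := by
  suffices h : b k A A n ∘ₗ mulCoeff s (n + 1) = mulCoeff s n ∘ₗ b k A A n from
    LinearMap.congr_fun h x
  apply chain_hom_ext
  intro m a
  simp only [LinearMap.comp_apply, mulCoeff, LinearMap.rTensor_tmul, b_tmul, map_add, map_sum,
    map_zsmul, LinearMap.mulLeft_apply, MulOpposite.smul_eq_mul_unop, MulOpposite.unop_op,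
    smul_eq_mul, mul_assoc]
  rw [← mul_assoc s (a n), hs (a n), mul_assoc]

theorem mulCoeff_mem (s : A) (hs : ∀ a : A, s * a = a * s) (n : ℕ) (x : Chain k A A n)
    (hx : x ∈ cycles k A A n) : mulCoeff s n x ∈ cycles k A A n := by
  cases n with
  | zero => exact AddSubgroup.mem_top _
  | succ n =>
    have hx' : b k A A n x = 0 := hx
    show b k A A n (mulCoeff s (n + 1) x) = 0
    rw [mulCoeff_b s hs, hx', map_zero]

/-- The Cartan formula: on cycles, `B (s x) - s B x` is homologous to the Lie derivative of `x`
along the central element `s`. -/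
theorem cartan (s : A) (hs : ∀ a : A, s * a = a * s) (n : ℕ) (x : Chain k A A n)
    (hx : x ∈ cycles k A A n) :
    connes k A n (mulCoeff s n x) - mulCoeff s (n + 1) (connes k A n x) - lieS s n x ∈
      boundaries k A A (n + 1) := by
  have hm : ∀ y ∈ boundaries k A A (n + 1), mulCoeff s (n + 1) y ∈ boundaries k A A (n + 1) := by
    rintro _ ⟨y, rfl⟩
    exact ⟨_, mulCoeff_b s hs (n + 1) y⟩
  have e : connes k A n (mulCoeff s n x) - mulCoeff s (n + 1) (connes k A n x) - lieS s n x =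
      b k A A (n + 1) (sg (n + 1) (rotS s n x)) -
        V (n + 1) (sg n (Nm n (mulCoeff s n x))) +
        mulCoeff s (n + 1) (V (n + 1) (sg n (Nm n x))) := by
    rw [b_sg_rotS s hs n x hx, connes_eq, connes_eq, map_sub]
    abel
  rw [e]
  refine AddSubgroup.add_mem _ (AddSubgroup.sub_mem _ ⟨_, rfl⟩ ?_) (hm _ (V_sg_Nm_mem n x hx))
  exact V_sg_Nm_mem n _ (mulCoeff_mem s hs n x hx)

/-- Proved from the homotopy `b_sg_rotS`, whose other terms are cycles; this avoids a direct
computation of `b (lieS s n x)`. -/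
theorem lieS_mem (s : A) (hs : ∀ a : A, s * a = a * s) (n : ℕ) (x : Chain k A A n)
    (hx : x ∈ cycles k A A n) : lieS s n x ∈ cycles k A A (n + 1) := by
  show b k A A n (lieS s n x) = 0
  have h1 : lieS s n x = sg n (Nm n (mulCoeff s n x)) - mulCoeff s (n + 1) (sg n (Nm n x)) -
      b k A A (n + 1) (sg (n + 1) (rotS s n x)) := by
    rw [b_sg_rotS s hs n x hx]; abel
  have h2 : b k A A n (b k A A (n + 1) (sg (n + 1) (rotS s n x))) = 0 := by
    have h3 := rotS_sub_V s n x
    have h4 : b k A A n (rotS s n x - V (n + 1) (rotS s n x)) =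
        bp n (rotS s n x) - V n (bp n (rotS s n x)) := b_sub_V n _
    have h5 : b k A A n (sg n (bp n (rotS s n x))) = 0 := by
      rw [bp_rotS_of_cycle s hs n x hx, map_neg, map_neg, b_sg_Nm n _ (mulCoeff_mem s hs n x hx),
        neg_zero]
    have h6 : b k A A n (rotS s n x - V (n + 1) (rotS s n x)) = 0 := by
      rw [h4, bp_rotS_of_cycle s hs n x hx, map_neg, V_Nm, sub_self]
    rw [b_sg, sub_right_comm, map_sub, h5, sub_zero, h6]
  rw [h1, map_sub, map_sub, h2, b_sg_Nm n _ (mulCoeff_mem s hs n x hx), mulCoeff_b s hs,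
    b_sg_Nm n x hx]
  simp

/-- `B² = 0`: since `B = (1 - V) s N`, this follows from `N (1 - V) = 0`. -/
theorem connes_connes (n : ℕ) (x : Chain k A A n) : connes k A (n + 1) (connes k A n x) = 0 := by
  have h : ∀ z : Chain k A A (n + 1), Nm (n + 1) (V (n + 1) z) = Nm (n + 1) z := by
    intro z
    rw [← Nm_shift]
    simp only [Nm, LinearMap.sum_apply]
    refine Finset.sum_congr rfl fun j _ => ?_
    rw [pow_succ, Module.End.mul_apply, UV]
  have h2 : Nm (n + 1) (connes k A n x) = 0 := by
    rw [connes_eq, map_sub, h, sub_self]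
  rw [connes_eq (n + 1), h2]
  simp

end Cartan

/-! ### The BV identity for multiplication with a central element -/

section BVIdentity

variable {k : Type*} [CommRing k] {A : Type*} [Ring A] [Algebra k A]

theorem insertAfter_tmul (s : A) {n j : ℕ} (hj : j ≤ n) (m : A) (a : ℕ → A) :
    insertAfter s n j (m ⊗ₜ[k] tp k n a) = m ⊗ₜ[k] tp k (n + 1) (insS j s a) := by
  rw [← ch_cons, insertAfter_ch s hj, ← ch_cons]
  apply ch_congr
  intro i _
  unfold insS cons
  grind

/-- The Lie derivative along `s` and the cap product with `f` commute up to the bracket. -/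
theorem lieS_capC (s : A) {p q n : ℕ} (h : p + 1 + q = n) (h1 : p + 1 + (q + 1) = n + 1)
    (h2 : p + (q + 1) = n) (f : Cochain k A A (p + 1)) (x : Chain k A A n) :
    lieS s q (capC h f x) =
      (-1 : ℤ) ^ (p + 1) • capC h1 f (lieS s n x) - capC h2 (bracketC s p f) x := by
  suffices hh : lieS s q ∘ₗ capC h f = (-1 : ℤ) ^ (p + 1) • (capC h1 f ∘ₗ lieS s n) -
      capC h2 (bracketC s p f) from LinearMap.congr_fun hh x
  apply chain_hom_ext
  intro m a
  simp only [LinearMap.comp_apply, LinearMap.sub_apply, LinearMap.smul_apply, capC_tmul,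
    lieS_apply, map_sum, map_zsmul, bracketC_tp]
  -- insertions among the first letters give the bracket, those among the others `lieS (f ∩ x)`
  have e1 : ∀ j ∈ Finset.range (p + 1), (-1 : ℤ) ^ j •
      capC h1 f (insertAfter s n j (m ⊗ₜ[k] tp k n a)) =
      (m • ((-1 : ℤ) ^ j • f (tp k (p + 1) (insS j s a)))) ⊗ₜ[k] tp k (q + 1) (shift p a) := by
    intro j hj
    have hj' := Finset.mem_range.1 hj
    have e : shift (p + 1) (insS j s a) = shift p a := by
      funext i
      unfold shift insS
      grind
    rw [insertAfter_tmul s (by omega), capC_tmul, smul_comm m, e]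
    exact TensorProduct.smul_tmul' _ _ _
  have e2 : ∀ j ∈ Finset.range (q + 1), (-1 : ℤ) ^ (p + 1 + j) •
      capC h1 f (insertAfter s n (p + 1 + j) (m ⊗ₜ[k] tp k n a)) =
      (-1 : ℤ) ^ (p + 1) • ((-1 : ℤ) ^ j • ((m • f (tp k (p + 1) a)) ⊗ₜ[k]
        tp k (q + 1) (insS j s (shift (p + 1) a)))) := by
    intro j hj
    have hj' := Finset.mem_range.1 hj
    have e : shift (p + 1) (insS (p + 1 + j) s a) = insS j s (shift (p + 1) a) := by
      funext i
      unfold shift insS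
      grind
    have e' : tp k (p + 1) (insS (p + 1 + j) s a) = tp k (p + 1) a :=
      tp_congr fun i hi => if_pos (by omega)
    rw [insertAfter_tmul s (by omega), capC_tmul, pow_add, mul_smul, e, e']
  have e3 : ∀ j ∈ Finset.range (q + 1), (-1 : ℤ) ^ j •
      insertAfter s q j ((m • f (tp k (p + 1) a)) ⊗ₜ[k] tp k q (shift (p + 1) a)) =
      (-1 : ℤ) ^ j • ((m • f (tp k (p + 1) a)) ⊗ₜ[k]
        tp k (q + 1) (insS j s (shift (p + 1) a))) := by
    intro j hj
    have hj' := Finset.mem_range.1 hj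
    rw [insertAfter_tmul s (by omega)]
  have e0 : Finset.range (n + 1) = Finset.range (p + 1 + (q + 1)) := by rw [h1]
  rw [e0, Finset.sum_range_add _ (p + 1) (q + 1), Finset.sum_congr rfl e1, Finset.sum_congr rfl e2,
    Finset.sum_congr rfl e3,
    ← Finset.smul_sum, smul_add, smul_smul, sg_neg, one_smul, ← TensorProduct.sum_tmul,
    ← Finset.smul_sum, smul_comm m, TensorProduct.smul_tmul']
  abel

variable (s : Subalgebra.center k A)

theorem center_comm (a : A) : (s : A) * a = a * s := (Subalgebra.mem_center_iff.1 s.2 a).symm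

/-- Multiplication of the coefficient by a central element, on Hochschild homology. -/
def mulHom (n : ℕ) : Homology k A A n →+ Homology k A A n :=
  SQ.map (mulCoeff (s : A) n).toAddMonoidHom (mulCoeff_mem _ (center_comm s) n) (by
    rintro _ ⟨y, rfl⟩
    exact ⟨_, mulCoeff_b _ (center_comm s) n y⟩)

theorem capC_smul {p q n : ℕ} (h : p + q = n) (f : Cochain k A A p) (x : Chain k A A n) :
    capC h (s • f) x = mulCoeff (s : A) q (capC h f x) := by
  suffices hh : capC h (s • f) = mulCoeff (s : A) q ∘ₗ capC h f from LinearMap.congr_fun hh x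
  apply chain_hom_ext
  intro m a
  simp only [LinearMap.comp_apply, capC_tmul, LinearMap.smul_apply, mulCoeff,
    LinearMap.rTensor_tmul, LinearMap.mulLeft_apply]
  congr 1
  show m * ((s : A) * _) = (s : A) * (m * _)
  rw [← mul_assoc, ← mul_assoc, center_comm]

theorem cap_smul {p q n : ℕ} (h : p + q = n) (f : HH k A A p) (x : Homology k A A n) :
    cap h (s • f) x = mulHom s q (cap h f x) := by
  induction f using SQ.ind with
  | h f hf =>
  induction x using SQ.ind with
  | h x hx => exact SQ.mk_congr _ (capC_smul s h f x)

theorem connesHom_connesHom (n : ℕ) (x : Homology k A A n) :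
    connesHom k A (n + 1) (connesHom k A n x) = 0 := by
  induction x using SQ.ind with
  | h x hx => exact SQ.mk_congr _ (connes_connes n x)

/-- `B ((s f) ∩ π) = s B (f ∩ π) - {s, f} ∩ π`: the remaining term `f ∩ L_s π` of the Cartan
formula vanishes because `HH_{n+1}` does. -/
theorem connesHom_cap_smul {p q n : ℕ} (h : p + 1 + q = n) (h2 : p + (q + 1) = n)
    (hv : Subsingleton (Homology k A A (n + 1))) (f : HH k A A (p + 1)) (π : Homology k A A n) :
    connesHom k A q (cap h (s • f) π) =
      mulHom s (q + 1) (connesHom k A q (cap h f π)) - cap h2 (bracketCenter s p f) π := by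
  rw [cap_smul]
  induction f using SQ.ind with
  | h f hf =>
  induction π using SQ.ind with
  | h x hx =>
  have hz : cap (by omega : p + 1 + (q + 1) = n + 1) (SQ.mk f hf : HH k A A (p + 1))
      (SQ.mk (lieS (s : A) n x) (lieS_mem _ (center_comm s) n x hx) :
        Homology k A A (n + 1)) = 0 := by
    rw [Subsingleton.elim (SQ.mk (lieS (s : A) n x) _ : Homology k A A (n + 1)) 0, map_zero]
  have hz' : capC (by omega : p + 1 + (q + 1) = n + 1) f (lieS (s : A) n x) ∈
      boundaries k A A (q + 1) := by
    have := (SQ.mk_eq _ (cycles k A A (q + 1)).zero_mem).1 hz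
    rw [add_zero] at this
    exact (neg_mem_iff).1 this
  set y := capC h f x with hy
  have hyc : y ∈ cycles k A A q := by
    cases q with
    | zero => exact AddSubgroup.mem_top _
    | succ q =>
      obtain ⟨n, rfl⟩ : ∃ n', n = n' + 1 := ⟨p + 1 + q, by omega⟩
      have hf' : d k A A (p + 1) f = 0 := hf
      have hx' : b k A A n x = 0 := hx
      have := capC_b (by omega : p + 1 + q = n) (by omega) h f x
      rw [hx', map_zero, hf', capC_zero, LinearMap.zero_apply, zero_add] at this
      show b k A A q (capC h f x) = 0
      rw [← one_smul ℤ (b k A A q (capC h f x)), ← sg_neg (p + 1), mul_smul, ← this, smul_zero]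
  refine (SQ.mk_eq _ _).2 ?_
  have key := cartan (s : A) (center_comm s) q y hyc
  have e := lieS_capC (s : A) h (by omega) h2 f x
  show -(connes k A q (mulCoeff (s : A) q y)) + (mulCoeff (s : A) (q + 1) (connes k A q y) +
    -(capC h2 (bracketC (s : A) p f) x)) ∈ _
  rw [← hy] at e
  have e2 : -(connes k A q (mulCoeff (s : A) q y)) + (mulCoeff (s : A) (q + 1) (connes k A q y) +
      -(capC h2 (bracketC (s : A) p f) x)) =
      -(connes k A q (mulCoeff (s : A) q y) - mulCoeff (s : A) (q + 1) (connes k A q y) -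
        lieS (s : A) q y) - (-1 : ℤ) ^ (p + 1) •
          capC (by omega : p + 1 + (q + 1) = n + 1) f (lieS (s : A) n x) := by
    rw [e]; abel
  rw [e2]
  refine AddSubgroup.sub_mem _ (AddSubgroup.neg_mem _ key) (AddSubgroup.zsmul_mem _ hz' _)

theorem apply_invAdd_apply {X Y : Type*} [AddCommGroup X] [AddCommGroup Y] {f : X →+ Y}
    (h : Function.Bijective f) (y : Y) : f (invAdd f y) = y := by
  rw [invAdd, dif_pos h]
  exact (AddEquiv.ofBijective f h).apply_symm_apply y

variable {n : ℕ} {π : Homology k A A n}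

/-- The defining property of the BV operator. -/
theorem dual_bvOp (hπ : IsDualizing n π) {p q : ℕ} (h : p + 1 + q = n) (h2 : p + (q + 1) = n)
    (f : HH k A A (p + 1)) : cap h2 (bvOp n π p f) π = connesHom k A q (cap h f π) := by
  obtain rfl : q = n - (p + 1) := by omega
  rw [bvOp, dif_pos (by omega)]
  exact apply_invAdd_apply (hπ.1 _ _ _) _

theorem bvOp_bvOp (hπ : IsDualizing n π) (p : ℕ) (f : HH k A A (p + 2)) :
    bvOp n π p (bvOp n π (p + 1) f) = 0 := by
  by_cases h : p + 2 ≤ n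
  · apply (hπ.1 p (n - (p + 2) + 1 + 1) (by omega)).1
    show cap _ _ π = cap _ 0 π
    rw [dual_bvOp hπ (q := n - (p + 2) + 1) (by omega),
      dual_bvOp hπ (q := n - (p + 2)) (by omega) (by omega), connesHom_connesHom, map_zero,
      AddMonoidHom.zero_apply]
  · have := hπ.2.1 (p + 2) (by omega)
    rw [Subsingleton.elim f 0, map_zero, map_zero]

/-- The BV identity `Δ (s f) = s Δ f - {s, f}` for a central element `s`. -/
theorem bvOp_smul (hπ : IsDualizing n π) (p : ℕ) (f : HH k A A (p + 1)) :
    bvOp n π p (s • f) = s • bvOp n π p f - bracketCenter s p f := by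
  by_cases h : p + 1 ≤ n
  · obtain ⟨q, hq⟩ : ∃ q, p + 1 + q = n := ⟨n - (p + 1), by omega⟩
    apply (hπ.1 p (q + 1) (by omega)).1
    show cap _ _ π = cap _ _ π
    rw [dual_bvOp hπ hq, connesHom_cap_smul s hq (by omega) (hπ.2.2 _ (by omega)), map_sub,
      AddMonoidHom.sub_apply, cap_smul, dual_bvOp hπ hq]
  · have := hπ.2.1 (p + 1) (by omega)
    rw [Subsingleton.elim f 0, smul_zero, map_zero, map_zero, smul_zero, sub_zero]

end BVIdentity

/-! ### The bar resolution as the Hochschild complex of `A ⊗ A` -/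

section Bar

variable {k : Type*} [CommRing k] {A : Type*} [Ring A] [Algebra k A]
  {M : Type*} [AddCommGroup M] [Module k M] [Module A M] [Module Aᵐᵒᵖ M]
  [SMulCommClass A Aᵐᵒᵖ M] [IsScalarTower k A M] [IsScalarTower k Aᵐᵒᵖ M]
  {N : Type*} [AddCommGroup N] [Module k N] [Module A N] [Module Aᵐᵒᵖ N]
  [SMulCommClass A Aᵐᵒᵖ N] [IsScalarTower k A N] [IsScalarTower k Aᵐᵒᵖ N]

theorem b_rTensor (φ : M →ₗ[k] N) (hl : ∀ (a : A) m, φ (a • m) = a • φ m)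
    (hr : ∀ (a : Aᵐᵒᵖ) m, φ (a • m) = a • φ m) (n : ℕ) (x : Chain k A M (n + 1)) :
    b k A N n (φ.rTensor _ x) = φ.rTensor _ (b k A M n x) := by
  suffices h : b k A N n ∘ₗ φ.rTensor _ = φ.rTensor _ ∘ₗ b k A M n from LinearMap.congr_fun h x
  apply chain_hom_ext
  intro m a
  simp only [LinearMap.comp_apply, LinearMap.rTensor_tmul, b_tmul, map_add, map_sum, map_zsmul,
    hl, hr]

theorem d_comp (φ : M →ₗ[k] N) (hl : ∀ (a : A) m, φ (a • m) = a • φ m)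
    (hr : ∀ (a : Aᵐᵒᵖ) m, φ (a • m) = a • φ m) (n : ℕ) (f : Cochain k A M n) :
    d k A N n (φ ∘ₗ f) = φ ∘ₗ d k A M n f := by
  apply hom_ext
  intro a
  simp only [d_tp, LinearMap.comp_apply, map_add, map_sum, map_zsmul, hl, hr]

theorem capC_comp (φ : M →ₗ[k] N) (hl : ∀ (a : A) m, φ (a • m) = a • φ m)
    {p q n : ℕ} (h : p + q = n) (f : Cochain k A M p) (c : Chain k A A n) :
    capC h (φ ∘ₗ f) c = φ.rTensor _ (capC h f c) := by
  suffices hh : capC h (φ ∘ₗ f) = φ.rTensor _ ∘ₗ capC h f from LinearMap.congr_fun hh c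
  apply chain_hom_ext
  intro x a
  simp only [LinearMap.comp_apply, LinearMap.rTensor_tmul, capC_tmul, hl]

variable (k A) in
/-- `y ⊗ (a 0 ⊗ ⋯ ⊗ a (n-1)) ↦ y ⊗ a 0 ⊗ ⋯ ⊗ a (n-1)`. -/
def consT (n : ℕ) : A ⊗[k] T k A n →ₗ[k] T k A (n + 1) :=
  lift₂ (M := A) (Φ := fun y a => tp k (n + 1) (cons y a)) (fun y => (isMulti_tp (n + 1)).cons y)
    (fun y y' a => by
      rw [cons_eq_update, (isMulti_tp (k := k) (A := A) (n + 1)).add _ _ (Nat.succ_pos n),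
        ← cons_eq_update, ← cons_eq_update])
    (fun c y a => by
      rw [cons_eq_update, (isMulti_tp (k := k) (A := A) (n + 1)).smul _ _ (Nat.succ_pos n),
        ← cons_eq_update])

theorem consT_tmul (n : ℕ) (y : A) (a : ℕ → A) :
    consT k A n (y ⊗ₜ tp k n a) = tp k (n + 1) (cons y a) := lift₂_tmul _ _ _ y a

end Bar

section BarOut

variable {k : Type*} [CommRing k] {A : Type u} [Ring A] [Algebra k A]

theorem out_chain_ext {N : Type*} [AddCommGroup N] [Module k N] {n : ℕ}
    {f g : Chain k A (Out k A) n →ₗ[k] N}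
    (h : ∀ (x y : A) (a : ℕ → A), f (Out.tmul k x y ⊗ₜ tp k n a) = g (Out.tmul k x y ⊗ₜ tp k n a)) :
    f = g := by
  apply chain_hom_ext
  intro m a
  exact Out.hom_ext
    (f.toAddMonoidHom.comp
      ((TensorProduct.mk k (Out k A) (T k A n)).flip (tp k n a)).toAddMonoidHom)
    (g.toAddMonoidHom.comp
      ((TensorProduct.mk k (Out k A) (T k A n)).flip (tp k n a)).toAddMonoidHom)
    (fun x y => h x y a) m

variable (k A) in
/-- The contracting homotopy `(x ⊗ y) ⊗ a ↦ (x ⊗ 1) ⊗ (y ⊗ a)` of the bar complex. -/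
def barH (n : ℕ) : Chain k A (Out k A) n →ₗ[k] Chain k A (Out k A) (n + 1) :=
  LinearMap.rTensor (T k A (n + 1)) ((TensorProduct.mk k A A).flip 1 : A →ₗ[k] A ⊗[k] A) ∘ₗ
    LinearMap.lTensor A (consT k A n) ∘ₗ (TensorProduct.assoc k A A (T k A n)).toLinearMap

theorem barH_tmul (n : ℕ) (x y : A) (a : ℕ → A) :
    barH k A n (Out.tmul k x y ⊗ₜ tp k n a) = Out.tmul k x 1 ⊗ₜ tp k (n + 1) (cons y a) := by
  show (LinearMap.rTensor (T k A (n + 1)) ((TensorProduct.mk k A A).flip 1 : A →ₗ[k] A ⊗[k] A))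
    (x ⊗ₜ consT k A n (y ⊗ₜ tp k n a)) = _
  rw [consT_tmul]
  rfl

/-- `barH` is a contracting homotopy of the bar complex. -/
theorem b_barH (n : ℕ) (z : Chain k A (Out k A) (n + 1)) :
    b k A (Out k A) (n + 1) (barH k A (n + 1) z) = z - barH k A n (b k A (Out k A) n z) := by
  suffices h : b k A (Out k A) (n + 1) ∘ₗ barH k A (n + 1) =
      LinearMap.id - barH k A n ∘ₗ b k A (Out k A) n from LinearMap.congr_fun h z
  apply out_chain_ext
  intro x y a
  simp only [LinearMap.comp_apply, LinearMap.sub_apply, LinearMap.id_apply, barH_tmul, b_tmul,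
    map_add, map_sum, map_zsmul, Out.op_smul_tmul, Out.smul_tmul, MulOpposite.unop_op]
  rw [Finset.sum_range_succ']
  have e1 : merge 0 (cons y a) = cons (y * a 0) (shift 1 a) := by
    funext i
    unfold merge cons shift
    grind
  have e2 : ∀ i, merge (i + 1) (cons y a) = cons y (merge i a) := by
    intro i
    funext r
    unfold merge cons
    grind
  rw [shift_one_cons, e1]
  simp only [e2, pow_succ (-1 : ℤ) (_ + 1), mul_neg_one, neg_smul, Finset.sum_neg_distrib]
  simp [cons]
  abel

/-- The augmentation `x ⊗ y ↦ y x` of the bar complex. -/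
def barAug (k : Type*) [CommRing k] (A : Type u) [Ring A] [Algebra k A] :
    Chain k A (Out k A) 0 →ₗ[k] A :=
  lift₂ (fun m : Out k A => isMulti_const (A := A) (mulSwap m))
      (fun m m' _ => map_add mulSwap m m') (fun c m _ => map_smul mulSwap c m)

theorem barAug_tmul (m : Out k A) (a : ℕ → A) : barAug k A (m ⊗ₜ tp k 0 a) = mulSwap m :=
  lift₂_tmul _ _ _ m a

theorem barAug_b (z : Chain k A (Out k A) 1) : barAug k A (b k A (Out k A) 0 z) = 0 := by
  suffices h : barAug k A ∘ₗ b k A (Out k A) 0 = 0 from LinearMap.congr_fun h z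
  apply chain_hom_ext
  intro m a
  simp [b_tmul, barAug_tmul, mulSwap_smul]

theorem b_barH_zero (z : Chain k A (Out k A) 0) :
    b k A (Out k A) 0 (barH k A 0 z) =
      z - Out.tmul k (barAug k A z) 1 ⊗ₜ tp k 0 (fun _ => 0) := by
  suffices h : b k A (Out k A) 0 ∘ₗ barH k A 0 = LinearMap.id -
      ((TensorProduct.mk k (Out k A) (T k A 0)).flip (tp k 0 fun _ => 0)) ∘ₗ
        ((TensorProduct.mk k A A).flip 1 : A →ₗ[k] A ⊗[k] A) ∘ₗ barAug k A from
    LinearMap.congr_fun h z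
  apply out_chain_ext
  intro x y a
  simp only [LinearMap.comp_apply, LinearMap.sub_apply, LinearMap.id_apply, barH_tmul, b_tmul,
    Out.op_smul_tmul, Out.smul_tmul, MulOpposite.unop_op, shift_one_cons]
  have e : ∀ a' : ℕ → A, tp k 0 a' = tp k 0 (fun _ => 0) := fun a' =>
    tp_congr fun i hi => absurd hi (Nat.not_lt_zero _)
  rw [e (cons y a), e a]
  rw [Finset.range_zero, Finset.sum_empty, add_zero, zero_add, pow_one, neg_one_smul,
    sub_eq_add_neg, one_mul]
  congr 2
  show _ = (Out.tmul k (barAug k A (Out.tmul k x y ⊗ₜ[k] tp k 0 fun _ => 0)) 1) ⊗ₜ[k] _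
  rw [barAug_tmul]
  rfl

/-- The inner left multiplication on the bar complex. -/
theorem innerL_b (a : A) (n : ℕ) (z : Chain k A (Out k A) (n + 1)) :
    b k A (Out k A) n ((innerL a).rTensor _ z) = (innerL a).rTensor _ (b k A (Out k A) n z) :=
  b_rTensor (innerL a)
    (fun c => Out.hom_ext ((innerL a).toAddMonoidHom.comp (DistribSMul.toAddMonoidHom _ c))
      ((DistribSMul.toAddMonoidHom _ c).comp (innerL a).toAddMonoidHom) fun _ _ => rfl)
    (fun c => Out.hom_ext ((innerL a).toAddMonoidHom.comp (DistribSMul.toAddMonoidHom _ c))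
      ((DistribSMul.toAddMonoidHom _ c).comp (innerL a).toAddMonoidHom)
      fun x y => congrArg (Out.tmul k x) (mul_assoc a y c.unop).symm) n z

theorem Out.zero_tmul (y : A) : Out.tmul k 0 y = 0 := TensorProduct.zero_tmul A y

/-- The map `b²` commutes with the inner left multiplication, and the image of `barH` generates the
bar complex under it. -/
theorem b_b_of_barH (n : ℕ) (h : ∀ w : Chain k A (Out k A) (n + 1),
    b k A (Out k A) n (b k A (Out k A) (n + 1) (barH k A (n + 1) w)) = 0)
    (z : Chain k A (Out k A) (n + 2)) : b k A (Out k A) n (b k A (Out k A) (n + 1) z) = 0 := by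
  suffices hh : b k A (Out k A) n ∘ₗ b k A (Out k A) (n + 1) = 0 from LinearMap.congr_fun hh z
  apply out_chain_ext
  intro x y a
  have e : Out.tmul k x y ⊗ₜ[k] tp k (n + 2) a = (innerL y).rTensor _
      (barH k A (n + 1) (Out.tmul k x (a 0) ⊗ₜ tp k (n + 1) (shift 1 a))) := by
    rw [barH_tmul, LinearMap.rTensor_tmul, innerL_tmul, mul_one]
    congr 1
    apply tp_congr
    intro i _
    unfold cons shift
    grind
  rw [LinearMap.comp_apply, e, innerL_b, innerL_b, h, map_zero, LinearMap.zero_apply]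

/-- `b² = 0` on the bar complex: by the contracting homotopy `b²` vanishes on the chains
`(x ⊗ 1) ⊗ a`, and these generate. -/
theorem b_b_out (n : ℕ) (z : Chain k A (Out k A) (n + 2)) :
    b k A (Out k A) n (b k A (Out k A) (n + 1) z) = 0 := by
  induction n with
  | zero =>
    refine b_b_of_barH 0 (fun w => ?_) z
    rw [b_barH, map_sub, b_barH_zero, barAug_b, Out.zero_tmul, TensorProduct.zero_tmul, sub_zero,
      sub_self]
  | succ n ih =>
    refine b_b_of_barH (n + 1) (fun w => ?_) z
    rw [b_barH, map_sub, b_barH, ih, map_zero, sub_zero, sub_self]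

theorem bar_exact (n : ℕ) (z : Chain k A (Out k A) (n + 1)) (hz : b k A (Out k A) n z = 0) :
    ∃ w, b k A (Out k A) (n + 1) w = z :=
  ⟨barH k A (n + 1) z, by rw [b_barH, hz, map_zero, sub_zero]⟩

theorem bar_exact_zero (z : Chain k A (Out k A) 0) (hz : barAug k A z = 0) :
    ∃ w, b k A (Out k A) 0 w = z :=
  ⟨barH k A 0 z, by rw [b_barH_zero, hz, Out.zero_tmul, TensorProduct.zero_tmul, sub_zero]⟩

theorem barAug_surjective : Function.Surjective (barAug k A) := fun a =>
  ⟨Out.tmul k a 1 ⊗ₜ tp k 0 fun _ => 0, by rw [barAug_tmul, mulSwap_tmul, one_mul]⟩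

theorem trOut_mk (z : Chain k A (Out k A) 0) (hz : z ∈ cycles k A (Out k A) 0) :
    trOut (SQ.mk z hz) = barAug k A z := rfl

theorem trOut_bijective : Function.Bijective (trOut (k := k) (A := A)) := by
  constructor
  · rw [injective_iff_map_eq_zero]
    intro z hz
    induction z using SQ.ind with
    | h z hz' =>
      obtain ⟨w, rfl⟩ := bar_exact_zero z hz
      refine (SQ.mk_eq _ (AddSubgroup.zero_mem _)).2 ?_
      rw [add_zero]
      exact AddSubgroup.neg_mem _ ⟨w, rfl⟩
  · intro a
    obtain ⟨z, rfl⟩ := barAug_surjective (k := k) a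
    exact ⟨SQ.mk z (AddSubgroup.mem_top _), rfl⟩

end BarOut

section Squares

variable {k : Type*} [CommRing k] {A : Type u} [Ring A] [Algebra k A]
  {M : Type*} [AddCommGroup M] [Module k M] [Module A M] [Module Aᵐᵒᵖ M]
  [SMulCommClass A Aᵐᵒᵖ M] [IsScalarTower k A M] [IsScalarTower k Aᵐᵒᵖ M]

/-- The bimodule map `A ⊗ A → M`, `x ⊗ y ↦ x m y`. -/
def outTo (k : Type*) [CommRing k] {A : Type u} [Ring A] [Algebra k A]
    {M : Type*} [AddCommGroup M] [Module k M] [Module A M] [Module Aᵐᵒᵖ M]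
    [SMulCommClass A Aᵐᵒᵖ M] [IsScalarTower k A M] [IsScalarTower k Aᵐᵒᵖ M] (m : M) :
    Out k A →ₗ[k] M :=
  TensorProduct.lift ((lact k A M).compl₂ ((ract k A M).flip m))

theorem outTo_tmul (m : M) (x y : A) :
    outTo k m (Out.tmul k x y) = x • (MulOpposite.op y • m) := rfl

theorem outTo_smul (m : M) (a : A) (z : Out k A) : outTo k m (a • z) = a • outTo k m z :=
  Out.hom_ext ((outTo k m).toAddMonoidHom.comp (DistribSMul.toAddMonoidHom _ a))
    ((DistribSMul.toAddMonoidHom _ a).comp (outTo k m).toAddMonoidHom)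
    (fun x _ => mul_smul a x _) z

theorem outTo_op_smul (m : M) (a : Aᵐᵒᵖ) (z : Out k A) : outTo k m (a • z) = a • outTo k m z :=
  Out.hom_ext ((outTo k m).toAddMonoidHom.comp (DistribSMul.toAddMonoidHom _ a))
    ((DistribSMul.toAddMonoidHom _ a).comp (outTo k m).toAddMonoidHom)
    (fun x y => by
      show x • (MulOpposite.op (y * a.unop) • m) = a • x • MulOpposite.op y • m
      rw [MulOpposite.op_mul, mul_smul, ← smul_comm x a, MulOpposite.op_unop]) z

/-- Every chain is the image of a chain of the bar complex under a bimodule map. -/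
theorem b_b (n : ℕ) (z : Chain k A M (n + 2)) : b k A M n (b k A M (n + 1) z) = 0 := by
  suffices hh : b k A M n ∘ₗ b k A M (n + 1) = 0 from LinearMap.congr_fun hh z
  apply chain_hom_ext
  intro m a
  have e : m ⊗ₜ[k] tp k (n + 2) a =
      (outTo k m).rTensor _ (Out.tmul k (1 : A) 1 ⊗ₜ[k] tp k (n + 2) a) := by
    rw [LinearMap.rTensor_tmul, outTo_tmul, MulOpposite.op_one, one_smul, one_smul]
  rw [LinearMap.comp_apply, e, b_rTensor _ (outTo_smul m) (outTo_op_smul m),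
    b_rTensor _ (outTo_smul m) (outTo_op_smul m), b_b_out, map_zero, LinearMap.zero_apply]

/-- The action `x ⊗ y ↦ (m ↦ y m x)` of `A ⊗ A` on a bimodule. -/
def innerAct (k : Type*) [CommRing k] (A : Type u) [Ring A] [Algebra k A]
    (M : Type*) [AddCommGroup M] [Module k M] [Module A M] [Module Aᵐᵒᵖ M]
    [SMulCommClass A Aᵐᵒᵖ M] [IsScalarTower k A M] [IsScalarTower k Aᵐᵒᵖ M] :
    Out k A →ₗ[k] M →ₗ[k] M :=
  TensorProduct.lift ((LinearMap.mul k (Module.End k M)).flip.compl₁₂ (ract k A M) (lact k A M))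

/-- The linear map `(A ⊗ A) ⊗ A^{⊗ n} → M`, `(x ⊗ y) ⊗ a ↦ y f(a) x`, linear for the inner
bimodule structure. -/
def coev {n : ℕ} (f : Cochain k A M n) : Chain k A (Out k A) n →ₗ[k] M :=
  TensorProduct.lift (LinearMap.lcomp k M f ∘ₗ innerAct k A M)

theorem coev_tmul {n : ℕ} (f : Cochain k A M n) (x y : A) (t : T k A n) :
    coev f (Out.tmul k x y ⊗ₜ t) = y • (MulOpposite.op x • f t) := rfl

theorem coev_one {n : ℕ} (f : Cochain k A M n) (t : T k A n) :
    coev f (Out.tmul k 1 1 ⊗ₜ t) = f t := by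
  rw [coev_tmul, MulOpposite.op_one, one_smul, one_smul]

/-- The complex of cochains embeds in the dual of the bar complex, so that identities such as `d² =
0` follow from those of the bar complex. -/
theorem coev_d {n : ℕ} (f : Cochain k A M n) (z : Chain k A (Out k A) (n + 1)) :
    coev (d k A M n f) z = coev f (b k A (Out k A) n z) := by
  suffices h : coev (d k A M n f) = coev f ∘ₗ b k A (Out k A) n from LinearMap.congr_fun h z
  apply out_chain_ext
  intro x y a
  simp only [LinearMap.comp_apply, b_tmul, map_add, map_sum, map_zsmul, coev_tmul, d_tp,
    Out.op_smul_tmul, Out.smul_tmul, MulOpposite.unop_op, smul_add, Finset.smul_sum, mul_smul,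
    MulOpposite.op_mul]
  congr 1
  · congr 1
    · rw [← smul_comm (a 0)]
    · refine Finset.sum_congr rfl fun i _ => ?_
      rw [smul_comm (MulOpposite.op x), smul_comm y]
  · rw [smul_comm (MulOpposite.op x), smul_comm y]

theorem d_d (n : ℕ) (f : Cochain k A M n) : d k A M (n + 1) (d k A M n f) = 0 := by
  apply hom_ext
  intro a
  rw [← coev_one, coev_d, coev_d, b_b_out, map_zero, LinearMap.zero_apply]

end Squares

/-! ### Projective resolutions in terms of elements -/

section Resolutions

open CategoryTheory

/-- A projective resolution of the module `Y`, given by modules and linear maps. -/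
structure Res (R : Type u) [Ring R] (Y : Type u) [AddCommGroup Y] [Module R Y] where
  X : ℕ → Type u
  [grp : ∀ n, AddCommGroup (X n)]
  [mod : ∀ n, Module R (X n)]
  [proj : ∀ n, Module.Projective R (X n)]
  d : ∀ n, X (n + 1) →ₗ[R] X n
  ε : X 0 →ₗ[R] Y
  d_d : ∀ n x, d n (d (n + 1) x) = 0
  ε_d : ∀ x, ε (d 0 x) = 0
  exact : ∀ n x, d n x = 0 → ∃ y, d (n + 1) y = x
  exact₀ : ∀ x, ε x = 0 → ∃ y, d 0 y = x
  surj : Function.Surjective ε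

attribute [instance] Res.grp Res.mod Res.proj

namespace Res

variable {R : Type u} [Ring R] {Y : Type u} [AddCommGroup Y] [Module R Y]

/-- The underlying chain complex. -/
def complex (P : Res R Y) : ChainComplex (ModuleCat.{u} R) ℕ :=
  ChainComplex.of (fun n => ModuleCat.of R (P.X n)) (fun n => ModuleCat.ofHom (P.d n)) fun n => by
    ext x
    exact P.d_d n x

theorem complex_d (P : Res R Y) (n : ℕ) : P.complex.d (n + 1) n = ModuleCat.ofHom (P.d n) :=
  ChainComplex.of_d (fun n => ModuleCat.of R (P.X n)) (fun n => ModuleCat.ofHom (P.d n)) n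

/-- The augmentation as a map of complexes. -/
def augmentation (P : Res R Y) :
    P.complex ⟶ (ChainComplex.single₀ (ModuleCat.{u} R)).obj (ModuleCat.of R Y) :=
  (ChainComplex.toSingle₀Equiv P.complex _).symm ⟨ModuleCat.ofHom P.ε, by
    rw [complex_d]
    ext x
    exact P.ε_d x⟩

theorem augmentation_f (P : Res R Y) : P.augmentation.f 0 = ModuleCat.ofHom P.ε :=
  ChainComplex.toSingle₀Equiv_symm_apply_f_zero _ _

theorem augmentation_apply (P : Res R Y) (x : P.X 0) : P.augmentation.f 0 x = P.ε x :=
  ConcreteCategory.congr_hom P.augmentation_f x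

/-- The associated projective resolution in the category of modules. -/
def toPR (P : Res R Y) : ProjectiveResolution (ModuleCat.of R Y) where
  complex := P.complex
  projective n := by
    show Projective (ModuleCat.of R (P.X n))
    infer_instance
  π := P.augmentation
  quasiIso := ⟨fun n => by
    cases n with
    | zero =>
      rw [ChainComplex.quasiIsoAt₀_iff, ShortComplex.quasiIso_iff_of_zeros' _ rfl rfl rfl]
      constructor
      · rw [ShortComplex.moduleCat_exact_iff]
        intro x hx
        obtain ⟨y, hy⟩ := P.exact₀ x ((P.augmentation_apply x).symm.trans hx)
        exact ⟨y, (ConcreteCategory.congr_hom (P.complex_d 0) y).trans hy⟩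
      · rw [ModuleCat.epi_iff_surjective]
        intro y
        obtain ⟨x, hx⟩ := P.surj y
        exact ⟨x, (P.augmentation_apply x).trans hx⟩
    | succ n =>
      rw [quasiIsoAt_iff_exactAt']
      · rw [HomologicalComplex.exactAt_iff' _ (n + 1 + 1) (n + 1) n (by simp) (by simp),
          ShortComplex.moduleCat_exact_iff]
        intro x hx
        obtain ⟨y, hy⟩ := P.exact n x
          ((ConcreteCategory.congr_hom (P.complex_d n) x).symm.trans hx)
        exact ⟨y, (ConcreteCategory.congr_hom (P.complex_d (n + 1)) y).trans hy⟩
      · apply ChainComplex.exactAt_succ_single_obj⟩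

/-- The modules and linear maps of a projective resolution in the category of modules. -/
def ofPR (P : ProjectiveResolution (ModuleCat.of R Y)) : Res R Y where
  X n := P.complex.X n
  proj _ := ModuleCat.projective_of_module_projective _
  d n := (P.complex.d (n + 1) n).hom
  ε := (P.π.f 0).hom
  d_d n x := ConcreteCategory.congr_hom (P.complex.d_comp_d (n + 2) (n + 1) n) x
  ε_d x := ConcreteCategory.congr_hom P.complex_d_comp_π_f_zero x
  exact n := (ShortComplex.moduleCat_exact_iff _).1 (P.exact_succ n)
  exact₀ := (ShortComplex.moduleCat_exact_iff _).1 P.exact₀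
  surj := (ModuleCat.epi_iff_surjective (P.π.f 0)).1 inferInstance

/-- The comparison theorem for projective resolutions. -/
theorem exists_lift (P Q : Res R Y) : ∃ c : ∀ n, P.X n →ₗ[R] Q.X n,
    (∀ n x, Q.d n (c (n + 1) x) = c n (P.d n x)) ∧ ∀ x, Q.ε (c 0 x) = P.ε x := by
  let c := ProjectiveResolution.lift (𝟙 _) P.toPR Q.toPR
  refine ⟨fun n => (c.f n).hom, fun n x => ?_, fun x => ?_⟩
  · have h := ConcreteCategory.congr_hom (c.comm (n + 1) n) x
    have h1 := ConcreteCategory.congr_hom (P.complex_d n) x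
    have h2 := ConcreteCategory.congr_hom (Q.complex_d n) ((c.f (n + 1)).hom x)
    exact (h2.symm.trans h).trans (congrArg (c.f n).hom h1)
  · have h := ConcreteCategory.congr_hom (ProjectiveResolution.lift_commutes_zero (𝟙 _) P.toPR Q.toPR) x
    have h1 := P.augmentation_apply x
    have h2 := Q.augmentation_apply ((c.f 0).hom x)
    exact (h2.symm.trans h).trans h1

/-- Two chain maps of resolutions over the identity of `Y` are homotopic. -/
theorem exists_homotopy (P Q : Res R Y) (f g : ∀ n, P.X n →ₗ[R] Q.X n)
    (hf : ∀ n x, Q.d n (f (n + 1) x) = f n (P.d n x)) (hf₀ : ∀ x, Q.ε (f 0 x) = P.ε x)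
    (hg : ∀ n x, Q.d n (g (n + 1) x) = g n (P.d n x)) (hg₀ : ∀ x, Q.ε (g 0 x) = P.ε x) :
    ∃ h : ∀ n, P.X n →ₗ[R] Q.X (n + 1), (∀ x, f 0 x = Q.d 0 (h 0 x) + g 0 x) ∧
      ∀ n x, f (n + 1) x = h n (P.d n x) + Q.d (n + 1) (h (n + 1) x) + g (n + 1) x := by
  have mk : ∀ f : (∀ n, P.X n →ₗ[R] Q.X n), (∀ n x, Q.d n (f (n + 1) x) = f n (P.d n x)) →
      (∀ x, Q.ε (f 0 x) = P.ε x) → ∃ F : P.toPR.complex ⟶ Q.toPR.complex,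
        (∀ n, F.f n = ModuleCat.ofHom (f n)) ∧
        F ≫ Q.toPR.π = P.toPR.π ≫ (ChainComplex.single₀ _).map (𝟙 _) := by
    intro f hf hf₀
    let F : P.complex ⟶ Q.complex :=
      { f := fun n => ModuleCat.ofHom (f n)
        comm' := by
          rintro i j hij
          obtain rfl : j + 1 = i := hij
          rw [complex_d, complex_d]
          ext x
          exact hf j x }
    refine ⟨F, fun n => rfl, ?_⟩
    rw [CategoryTheory.Functor.map_id, Category.comp_id]
    apply HomologicalComplex.hom_ext
    intro n
    cases n with
    | zero =>
      ext x
      have h1 := P.augmentation_apply x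
      have h2 := Q.augmentation_apply (f 0 x)
      exact (h2.trans (hf₀ x)).trans h1.symm
    | succ n =>
      exact (HomologicalComplex.isZero_single_obj_X _ _ _ _ (Nat.succ_ne_zero n)).eq_of_tgt _ _
  obtain ⟨F, hF, hF'⟩ := mk f hf hf₀
  obtain ⟨G, hG, hG'⟩ := mk g hg hg₀
  let H := ProjectiveResolution.liftHomotopy (𝟙 _) F G hF' hG'
  refine ⟨fun n => (H.hom n (n + 1)).hom, fun x => ?_, fun n x => ?_⟩
  · have h := H.comm 0
    rw [Homotopy.dNext_zero_chainComplex, Homotopy.prevD_chainComplex, zero_add, hF, hG] at h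
    have h1 := ConcreteCategory.congr_hom h x
    have h2 := ConcreteCategory.congr_hom (Q.complex_d 0) ((H.hom 0 1).hom x)
    exact h1.trans (congrArg (· + g 0 x) h2)
  · have h := H.comm (n + 1)
    rw [Homotopy.dNext_succ_chainComplex, Homotopy.prevD_chainComplex, hF, hG] at h
    have h1 := ConcreteCategory.congr_hom h x
    have h2 := ConcreteCategory.congr_hom (Q.complex_d (n + 1)) ((H.hom (n + 1) (n + 2)).hom x)
    have h3 := ConcreteCategory.congr_hom (P.complex_d n) x
    exact h1.trans (congrArg₂ (fun a b => a + b + g (n + 1) x)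
      (congrArg (H.hom n (n + 1)).hom h3) h2)

/-- A chain map between resolutions of `Y` over the identity of `Y` has a homotopy inverse. -/
theorem exists_homotopy_inverse (P Q : Res R Y) (c : ∀ n, P.X n →ₗ[R] Q.X n)
    (hc : ∀ n x, Q.d n (c (n + 1) x) = c n (P.d n x)) (hc₀ : ∀ x, Q.ε (c 0 x) = P.ε x) :
    ∃ (c' : ∀ n, Q.X n →ₗ[R] P.X n) (h : ∀ n, P.X n →ₗ[R] P.X (n + 1)),
      (∀ n x, P.d n (c' (n + 1) x) = c' n (Q.d n x)) ∧
      (∀ x, c' 0 (c 0 x) = P.d 0 (h 0 x) + x) ∧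
      ∀ n x, c' (n + 1) (c (n + 1) x) = h n (P.d n x) + P.d (n + 1) (h (n + 1) x) + x := by
  obtain ⟨c', hc', hc'₀⟩ := exists_lift Q P
  obtain ⟨h, h1, h2⟩ := exists_homotopy P P (fun n => c' n ∘ₗ c n) (fun n => LinearMap.id)
    (fun n x => by simp [hc', hc]) (fun x => by simp [hc'₀, hc₀]) (fun _ _ => rfl) (fun _ => rfl)
  exact ⟨c', h, hc', h1, h2⟩

end Res

end Resolutions

/-! ### The cone of the cap product with a fundamental class -/

section Cone

variable {k : Type*} [CommRing k] {A : Type*} [Ring A] [Algebra k A]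
  (M : Type*) [AddCommGroup M] [Module k M] [Module A M] [Module Aᵐᵒᵖ M]
  [SMulCommClass A Aᵐᵒᵖ M] [IsScalarTower k A M] [IsScalarTower k Aᵐᵒᵖ M]
  {M' : Type*} [AddCommGroup M'] [Module k M'] [Module A M'] [Module Aᵐᵒᵖ M']
  [SMulCommClass A Aᵐᵒᵖ M'] [IsScalarTower k A M'] [IsScalarTower k Aᵐᵒᵖ M']
  {M'' : Type*} [AddCommGroup M''] [Module k M''] [Module A M''] [Module Aᵐᵒᵖ M'']
  [SMulCommClass A Aᵐᵒᵖ M''] [IsScalarTower k A M''] [IsScalarTower k Aᵐᵒᵖ M'']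
  {N : Type*} [AddCommGroup N] [Module k N] {N' : Type*} [AddCommGroup N'] [Module k N']

variable (k A) in
/-- Families of cochains and chains of all degrees: the total group of the cone of
`f ↦ f ∩ c`, without its grading. -/
abbrev Cone (M : Type*) [AddCommGroup M] [Module k M] : Type _ :=
  (∀ p, T k A p →ₗ[k] M) × ∀ q, M ⊗[k] T k A q

variable {M}

/-- The Hochschild differential of a family of cochains. -/
def dFam (f : ∀ p, Cochain k A M p) : ∀ p, Cochain k A M p
  | 0 => 0
  | p + 1 => d k A M p (f p)

/-- The chain `f_{n-q} ∩ c` of degree `q`, zero if `q > n`. -/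
def capFam {n : ℕ} (c : Chain k A A n) (f : ∀ p, Cochain k A M p) (q : ℕ) : Chain k A M q :=
  if h : q ≤ n then capC (Nat.sub_add_cancel h) (f (n - q)) c else 0

theorem capFam_eq {n p q : ℕ} (c : Chain k A A n) (f : ∀ p, Cochain k A M p) (h : p + q = n) :
    capFam c f q = capC h (f p) c := by
  obtain rfl : p = n - q := by omega
  exact dif_pos (by omega)

theorem capFam_of_lt {n q : ℕ} (c : Chain k A A n) (f : ∀ p, Cochain k A M p) (h : n < q) :
    capFam c f q = 0 := dif_neg (by omega)

theorem capFam_add {n : ℕ} (c : Chain k A A n) (f g : ∀ p, Cochain k A M p) (q : ℕ) :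
    capFam c (f + g) q = capFam c f q + capFam c g q := by
  by_cases h : q ≤ n
  · rw [capFam_eq c _ (Nat.sub_add_cancel h), capFam_eq c _ (Nat.sub_add_cancel h),
      capFam_eq c _ (Nat.sub_add_cancel h), Pi.add_apply, capC_add, LinearMap.add_apply]
  · rw [capFam_of_lt _ _ (by omega), capFam_of_lt _ _ (by omega), capFam_of_lt _ _ (by omega),
      add_zero]

theorem capFam_zero {n : ℕ} (c : Chain k A A n) (q : ℕ) :
    capFam c (0 : ∀ p, Cochain k A M p) q = 0 := by
  have h := capFam_add c (0 : ∀ p, Cochain k A M p) 0 q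
  rw [add_zero] at h
  exact left_eq_add.1 h

theorem capFam_single {n p q : ℕ} (c : Chain k A A n) (f : Cochain k A M p) (h : p + q = n) :
    capFam c (Pi.single p f) q = capC h f c := by
  rw [capFam_eq c _ h, Pi.single_eq_same]

theorem capFam_single_of_ne {n p q : ℕ} (c : Chain k A A n) (f : Cochain k A M p) (h : p + q ≠ n) :
    capFam c (Pi.single p f) q = 0 := by
  by_cases h' : q ≤ n
  · rw [capFam_eq c _ (Nat.sub_add_cancel h'), Pi.single_eq_of_ne (by omega), capC_zero,
      LinearMap.zero_apply]
  · rw [capFam_of_lt _ _ (by omega)]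

theorem dFam_single {p : ℕ} (f : Cochain k A M p) (hf : d k A M p f = 0) :
    dFam (Pi.single p f) = 0 := by
  funext r
  cases r with
  | zero => rfl
  | succ r =>
    show d k A M r _ = 0
    by_cases h : r = p
    · subst h
      rw [Pi.single_eq_same, hf]
    · rw [Pi.single_eq_of_ne h, map_zero]

/-- The differential of the cone of `f ↦ f ∩ c`. -/
def coneD {n : ℕ} (c : Chain k A A n) (M : Type*) [AddCommGroup M] [Module k M] [Module A M]
    [Module Aᵐᵒᵖ M] [SMulCommClass A Aᵐᵒᵖ M] [IsScalarTower k A M] [IsScalarTower k Aᵐᵒᵖ M] :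
    Cone k A M →+ Cone k A M :=
  AddMonoidHom.mk' (fun e =>
    (dFam e.1, fun q => capFam c e.1 q + (-1 : ℤ) ^ (n + q + 1) • b k A M q (e.2 (q + 1)))) (by
      intro e e'
      refine Prod.ext (funext fun p => ?_) (funext fun q => ?_)
      · cases p with
        | zero => exact (add_zero (0 : Cochain k A M 0)).symm
        | succ p => exact map_add (d k A M p) (e.1 p) (e'.1 p)
      · show capFam c (e.1 + e'.1) q + (-1 : ℤ) ^ (n + q + 1) • b k A M q (e.2 (q + 1) + e'.2 (q + 1)) =
          (capFam c e.1 q + (-1 : ℤ) ^ (n + q + 1) • b k A M q (e.2 (q + 1))) +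
          (capFam c e'.1 q + (-1 : ℤ) ^ (n + q + 1) • b k A M q (e'.2 (q + 1)))
        rw [capFam_add, map_add, smul_add]
        abel)

theorem coneD_fst {n : ℕ} (c : Chain k A A n) (e : Cone k A M) : (coneD c M e).1 = dFam e.1 := rfl

theorem coneD_snd {n : ℕ} (c : Chain k A A n) (e : Cone k A M) (q : ℕ) : (coneD c M e).2 q =
    capFam c e.1 q + (-1 : ℤ) ^ (n + q + 1) • b k A M q (e.2 (q + 1)) := rfl

theorem coneD_coneD {n : ℕ} {c : Chain k A A n} (hc : c ∈ cycles k A A n) (e : Cone k A M) :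
    coneD c M (coneD c M e) = 0 := by
  refine Prod.ext (funext fun p => ?_) (funext fun q => ?_)
  · rcases p with _ | _ | p
    · rfl
    · exact map_zero (d k A M 0)
    · exact d_d p (e.1 p)
  · rw [coneD_snd, coneD_fst, coneD_snd, map_add, map_zsmul, b_b, smul_zero, add_zero]
    show _ = (0 : Chain k A M q)
    rcases lt_trichotomy q n with h | h | h
    · obtain ⟨p, rfl⟩ : ∃ p, n = p + q + 1 := ⟨n - q - 1, by omega⟩
      have hb : b k A A (p + q) c = 0 := hc
      have := capC_b (rfl : p + q = p + q) (by omega) (by omega : p + (q + 1) = p + q + 1) (e.1 p) c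
      rw [hb, map_zero] at this
      rw [capFam_eq c _ (by omega : p + 1 + q = p + q + 1),
        capFam_eq c _ (by omega : p + (q + 1) = p + q + 1)]
      have hs : (-1 : ℤ) ^ (p + q + 1 + q + 1) = (-1 : ℤ) ^ p := by
        rw [show p + q + 1 + q + 1 = p + (q + 1 + (q + 1)) by omega, pow_add, pow_add, sg_neg,
          mul_one]
      rw [hs]
      exact this.symm
    · subst h
      rw [capFam_of_lt c _ (Nat.lt_succ_self q), map_zero, smul_zero, add_zero,
        capFam_eq c _ (Nat.zero_add q)]
      show capC _ (0 : Cochain k A M 0) c = 0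
      rw [capC_zero, LinearMap.zero_apply]
    · rw [capFam_of_lt c _ h, capFam_of_lt c _ (by omega), map_zero, smul_zero, add_zero]

variable (k A) in
/-- The map of cones induced by a linear map of coefficients. -/
def coneMap (φ : N →ₗ[k] N') : Cone k A N →+ Cone k A N' :=
  AddMonoidHom.mk' (fun e => (fun p => φ ∘ₗ e.1 p, fun q => φ.rTensor _ (e.2 q))) (by
    intro e e'
    refine Prod.ext (funext fun p => ?_) (funext fun q => ?_)
    · exact LinearMap.comp_add _ _ _
    · exact map_add (φ.rTensor _) (e.2 q) (e'.2 q))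

theorem coneMap_fst (φ : N →ₗ[k] N') (e : Cone k A N) (p : ℕ) :
    (coneMap k A φ e).1 p = φ ∘ₗ e.1 p := rfl

theorem coneMap_snd (φ : N →ₗ[k] N') (e : Cone k A N) (q : ℕ) :
    (coneMap k A φ e).2 q = φ.rTensor _ (e.2 q) := rfl

theorem coneMap_comp {N'' : Type*} [AddCommGroup N''] [Module k N''] (ψ : N' →ₗ[k] N'')
    (φ : N →ₗ[k] N') (e : Cone k A N) :
    coneMap k A (ψ ∘ₗ φ) e = coneMap k A ψ (coneMap k A φ e) :=
  Prod.ext rfl (funext fun q => LinearMap.congr_fun (LinearMap.rTensor_comp _ ψ φ) (e.2 q))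

theorem coneMap_id (e : Cone k A N) : coneMap k A (LinearMap.id : N →ₗ[k] N) e = e :=
  Prod.ext rfl (funext fun q => LinearMap.congr_fun (LinearMap.rTensor_id _ N) (e.2 q))

theorem coneMap_add (φ ψ : N →ₗ[k] N') (e : Cone k A N) :
    coneMap k A (φ + ψ) e = coneMap k A φ e + coneMap k A ψ e :=
  Prod.ext rfl (funext fun q => LinearMap.congr_fun (LinearMap.rTensor_add _ φ ψ) (e.2 q))

theorem coneMap_zero (e : Cone k A N) : coneMap k A (0 : N →ₗ[k] N') e = 0 :=
  Prod.ext rfl (funext fun q => LinearMap.congr_fun (LinearMap.rTensor_zero (P := N') _) (e.2 q))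

theorem coneMap_sum {ι : Type*} (s : Finset ι) (φ : ι → N →ₗ[k] N') (e : Cone k A N) :
    coneMap k A (∑ i ∈ s, φ i) e = ∑ i ∈ s, coneMap k A (φ i) e := by
  classical
  induction s using Finset.induction_on with
  | empty => rw [Finset.sum_empty, Finset.sum_empty, coneMap_zero]
  | insert a s ha ih => rw [Finset.sum_insert ha, Finset.sum_insert ha, coneMap_add, ih]

theorem coneMap_coneD (φ : M →ₗ[k] M') (hl : ∀ (a : A) m, φ (a • m) = a • φ m)
    (hr : ∀ (a : Aᵐᵒᵖ) m, φ (a • m) = a • φ m) {n : ℕ} (c : Chain k A A n) (e : Cone k A M) :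
    coneMap k A φ (coneD c M e) = coneD c M' (coneMap k A φ e) := by
  refine Prod.ext (funext fun p => ?_) (funext fun q => ?_)
  · cases p with
    | zero => exact LinearMap.comp_zero φ
    | succ p => exact (d_comp φ hl hr p (e.1 p)).symm
  · rw [coneMap_snd, coneD_snd, coneD_snd, map_add, map_zsmul, coneMap_snd, b_rTensor φ hl hr]
    congr 1
    by_cases h : q ≤ n
    · rw [capFam_eq c _ (Nat.sub_add_cancel h), capFam_eq c _ (Nat.sub_add_cancel h), coneMap_fst,
        capC_comp φ hl]
    · rw [capFam_of_lt _ _ (by omega), capFam_of_lt _ _ (by omega), map_zero]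

/-- Exactness of the cone of `f ↦ f ∩ c` with coefficients in `M`. -/
def ConeExact {n : ℕ} (c : Chain k A A n) (M : Type*) [AddCommGroup M] [Module k M] [Module A M]
    [Module Aᵐᵒᵖ M] [SMulCommClass A Aᵐᵒᵖ M] [IsScalarTower k A M] [IsScalarTower k Aᵐᵒᵖ M] : Prop :=
  ∀ e : Cone k A M, coneD c M e = 0 → ∃ e', coneD c M e' = e

/-- Exactness passes to `M` if the identity of `M` is a sum of bimodule maps factoring through `M'`,
in particular to a direct summand of a finite sum of copies of `M'`. -/
theorem ConeExact.of_sum_comp {n : ℕ} {c : Chain k A A n} (h : ConeExact c M') {ι : Type*}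
    (s : Finset ι) (α : ι → M →ₗ[k] M') (β : ι → M' →ₗ[k] M)
    (hαl : ∀ i (a : A) m, α i (a • m) = a • α i m)
    (hαr : ∀ i (a : Aᵐᵒᵖ) m, α i (a • m) = a • α i m)
    (hβl : ∀ i (a : A) m, β i (a • m) = a • β i m)
    (hβr : ∀ i (a : Aᵐᵒᵖ) m, β i (a • m) = a • β i m)
    (hid : ∑ i ∈ s, β i ∘ₗ α i = LinearMap.id) : ConeExact c M := by
  intro e he
  have h1 : ∀ i, ∃ e', coneD c M' e' = coneMap k A (α i) e := fun i => h _ (by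
    rw [← coneMap_coneD _ (hαl i) (hαr i), he, map_zero])
  choose g hg using h1
  refine ⟨∑ i ∈ s, coneMap k A (β i) (g i), ?_⟩
  rw [map_sum, ← coneMap_id e, ← hid, coneMap_sum]
  refine Finset.sum_congr rfl fun i _ => ?_
  rw [← coneMap_coneD _ (hβl i) (hβr i), hg, coneMap_comp]

theorem ConeExact.of_retract {n : ℕ} {c : Chain k A A n} (h : ConeExact c M')
    (α : M →ₗ[k] M') (β : M' →ₗ[k] M)
    (hαl : ∀ (a : A) m, α (a • m) = a • α m) (hαr : ∀ (a : Aᵐᵒᵖ) m, α (a • m) = a • α m)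
    (hβl : ∀ (a : A) m, β (a • m) = a • β m) (hβr : ∀ (a : Aᵐᵒᵖ) m, β (a • m) = a • β m)
    (hid : ∀ m, β (α m) = m) : ConeExact c M :=
  h.of_sum_comp {()} (fun _ => α) (fun _ => β) (fun _ => hαl) (fun _ => hαr) (fun _ => hβl)
    (fun _ => hβr) (by rw [Finset.sum_singleton]; exact LinearMap.ext hid)

theorem ConeExact.of_subsingleton [Subsingleton M] {n : ℕ} (c : Chain k A A n) :
    ConeExact c M := fun e _ =>
  ⟨0, by
    have h0 : ∀ e : Cone k A M, e = 0 := fun e => by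
      rw [← coneMap_id e, show (LinearMap.id : M →ₗ[k] M) = 0 from
        LinearMap.ext fun _ => Subsingleton.elim _ _, coneMap_zero]
    rw [map_zero, h0 e]⟩

/-- Exactness passes to the cokernel of an injective map of bimodules: over a field the sequence of
cones of a short exact sequence of bimodules is exact. -/
theorem ConeExact.of_shortExact {k : Type*} [Field k] {A : Type*} [Ring A] [Algebra k A]
    {M : Type*} [AddCommGroup M] [Module k M] [Module A M] [Module Aᵐᵒᵖ M]
    [SMulCommClass A Aᵐᵒᵖ M] [IsScalarTower k A M] [IsScalarTower k Aᵐᵒᵖ M]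
    {M' : Type*} [AddCommGroup M'] [Module k M'] [Module A M'] [Module Aᵐᵒᵖ M']
    [SMulCommClass A Aᵐᵒᵖ M'] [IsScalarTower k A M'] [IsScalarTower k Aᵐᵒᵖ M']
    {M'' : Type*} [AddCommGroup M''] [Module k M''] [Module A M''] [Module Aᵐᵒᵖ M'']
    [SMulCommClass A Aᵐᵒᵖ M''] [IsScalarTower k A M''] [IsScalarTower k Aᵐᵒᵖ M'']
    {n : ℕ} {c : Chain k A A n} (hc : c ∈ cycles k A A n)
    (h' : ConeExact c M') (h : ConeExact c M) (i : M' →ₗ[k] M) (g : M →ₗ[k] M'')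
    (hil : ∀ (a : A) m, i (a • m) = a • i m) (hir : ∀ (a : Aᵐᵒᵖ) m, i (a • m) = a • i m)
    (hgl : ∀ (a : A) m, g (a • m) = a • g m) (hgr : ∀ (a : Aᵐᵒᵖ) m, g (a • m) = a • g m)
    (hi : Function.Injective i) (hg : Function.Surjective g)
    (hex : ∀ m, g m = 0 ↔ ∃ m', i m' = m) : ConeExact c M'' := by
  obtain ⟨r, hr⟩ := LinearMap.exists_leftInverse_of_injective i (LinearMap.ker_eq_bot.2 hi)
  obtain ⟨s₀, hs₀⟩ := LinearMap.exists_rightInverse_of_surjective g (LinearMap.range_eq_top.2 hg)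
  have hr' : ∀ m, r (i m) = m := LinearMap.congr_fun hr
  have hs' : ∀ m, g (s₀ m) = m := LinearMap.congr_fun hs₀
  have hgi : ∀ m, g (i m) = 0 := fun m => (hex _).2 ⟨m, rfl⟩
  -- a linear section of `g` adapted to the retraction `r` of `i`
  obtain ⟨s, hsid⟩ : ∃ s : M'' →ₗ[k] M, i ∘ₗ r + s ∘ₗ g = LinearMap.id := by
    refine ⟨s₀ - i ∘ₗ r ∘ₗ s₀, LinearMap.ext fun m => ?_⟩
    obtain ⟨m', hm'⟩ := (hex (m - s₀ (g m))).1 (by rw [map_sub, hs', sub_self])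
    have h1 : i (r m) - i (r (s₀ (g m))) = m - s₀ (g m) := by
      rw [← map_sub, ← map_sub, ← hm', hr']
    simp only [LinearMap.add_apply, LinearMap.comp_apply, LinearMap.sub_apply, LinearMap.id_apply]
    calc i (r m) + (s₀ (g m) - i (r (s₀ (g m))))
        = (i (r m) - i (r (s₀ (g m)))) + s₀ (g m) := by abel
      _ = m := by rw [h1]; abel
  have key : ∀ e : Cone k A M, coneMap k A g e = 0 → coneMap k A i (coneMap k A r e) = e := by
    intro e he
    conv_rhs => rw [← coneMap_id e, ← hsid, coneMap_add, coneMap_comp, coneMap_comp s, he,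
      map_zero, add_zero]
  have hinj : ∀ e : Cone k A M', coneMap k A i e = 0 → e = 0 := by
    intro e he
    rw [← coneMap_id e, ← hr, coneMap_comp, he, map_zero]
  intro e he
  have hlift : coneMap k A g (coneMap k A s₀ e) = e := by rw [← coneMap_comp, hs₀, coneMap_id]
  have h1 : coneMap k A g (coneD c M (coneMap k A s₀ e)) = 0 := by
    rw [coneMap_coneD g hgl hgr, hlift, he]
  obtain ⟨κ', hκ'⟩ := h' (coneMap k A r (coneD c M (coneMap k A s₀ e))) (hinj _ (by
    rw [coneMap_coneD i hil hir, key _ h1, coneD_coneD hc]))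
  obtain ⟨η, hη⟩ := h (coneMap k A s₀ e - coneMap k A i κ') (by
    rw [map_sub, ← coneMap_coneD i hil hir, hκ', key _ h1, sub_self])
  refine ⟨coneMap k A g η, ?_⟩
  rw [← coneMap_coneD g hgl hgr, hη, map_sub, hlift, ← coneMap_comp,
    show g ∘ₗ i = 0 from LinearMap.ext hgi, coneMap_zero, sub_zero]

end Cone

section Cone

variable {k : Type*} [CommRing k] {A : Type u} [Ring A] [Algebra k A]

/-- The cone is exact with coefficients in `A ⊗ A`: the cohomology `HH^*(A, A ⊗ A)` is
concentrated in degree `n`, the homology `HH_*(A, A ⊗ A)` in degree `0`, and capping with the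
class of `c` is bijective between the two. -/
theorem coneExact_out {n : ℕ} {c : Chain k A A n} (hc : c ∈ cycles k A A n)
    (hv : ∀ i, i ≠ n → Subsingleton (HH k A (Out k A) i))
    (hπ : Function.Bijective fun u : HH k A (Out k A) n =>
      cap (Nat.add_zero n) u (SQ.mk c hc : Homology k A A n)) : ConeExact c (Out k A) := by
  intro e he
  have he1 : dFam e.1 = 0 := congrArg Prod.fst he
  have he2 : ∀ q, capFam c e.1 q + (-1 : ℤ) ^ (n + q + 1) • b k A _ q (e.2 (q + 1)) = 0 :=
    fun q => congrFun (congrArg Prod.snd he) q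
  have hcoc : ∀ p, e.1 p ∈ cocycles k A (Out k A) p := fun p => congrFun he1 (p + 1)
  -- the cochains of a cycle of the cone are coboundaries: in degree `n` because their cap product
  -- with the class of `c` is the boundary of the chain part
  have hzero : ∀ p, (SQ.mk (e.1 p) (hcoc p) : HH k A (Out k A) p) = 0 := by
    intro p
    by_cases hp : p = n
    · subst hp
      refine hπ.1 ?_
      have h0 : cap (Nat.add_zero p) (0 : HH k A (Out k A) p)
          (SQ.mk c hc : Homology k A A p) = 0 := by
        rw [map_zero, AddMonoidHom.zero_apply]
      refine Eq.trans ?_ h0.symm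
      refine (SQ.mk_eq _ (AddSubgroup.zero_mem _)).2 ?_
      have h1 := he2 0
      rw [capFam_eq c _ (Nat.add_zero p)] at h1
      refine ⟨(-1 : ℤ) ^ (p + 0 + 1) • e.2 1, ?_⟩
      show b k A _ 0 _ = -(capC (Nat.add_zero p) (e.1 p) c) + 0
      rw [map_zsmul]
      exact (eq_neg_of_add_eq_zero_right h1).trans (add_zero _).symm
    · have := hv p hp
      exact Subsingleton.elim _ _
  have hcob : ∀ p, e.1 p ∈ coboundaries k A (Out k A) p := by
    intro p
    have h1 := (SQ.mk_eq (hcoc p) (AddSubgroup.zero_mem _)).1 (hzero p)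
    rw [add_zero] at h1
    exact neg_mem_iff.1 h1
  have hg : ∀ p, ∃ g, d k A (Out k A) p g = e.1 (p + 1) := fun p => hcob (p + 1)
  choose g hg using hg
  have hfst : dFam g = e.1 := by
    funext p
    cases p with
    | zero => exact (show e.1 0 = 0 from hcob 0).symm
    | succ p => exact hg p
  -- subtracting the boundary of `(g, 0)` leaves a family of cycles
  set x : ∀ q, Chain k A (Out k A) q := fun q => e.2 q - capFam c g q with hx
  have hD : coneD c _ (g, 0) = (e.1, fun q => capFam c g q) := by
    refine Prod.ext hfst (funext fun q => ?_)
    rw [coneD_snd]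
    show _ + _ • b k A _ q 0 = _
    rw [map_zero, smul_zero, add_zero]
  have hbx : ∀ q, b k A (Out k A) q (x (q + 1)) = 0 := by
    intro q
    have h2 : coneD c _ ((0, x) : Cone k A (Out k A)) = 0 := by
      have : ((0, x) : Cone k A (Out k A)) = e - coneD c _ (g, 0) := by
        rw [hD]
        exact Prod.ext (sub_self e.1).symm rfl
      rw [this, map_sub, he, coneD_coneD hc, sub_zero]
    have h3 := congrFun (congrArg Prod.snd h2) q
    rw [coneD_snd] at h3
    have h4 : (-1 : ℤ) ^ (n + q + 1) • b k A (Out k A) q (x (q + 1)) = 0 := by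
      refine Eq.trans ?_ h3
      show _ = capFam c 0 q + _
      rw [capFam_zero, zero_add]
    rw [← one_smul ℤ (b k A _ q (x (q + 1))), ← sg_neg (n + q + 1), mul_smul, h4, smul_zero]
  -- in positive degrees these cycles bound; in degree `0` the cap product is surjective
  have hw : ∀ q, ∃ w, b k A (Out k A) (q + 1) w = x (q + 1) := fun q => bar_exact q _ (hbx q)
  choose w hw using hw
  obtain ⟨u, hu⟩ := hπ.2 (SQ.mk (x 0) (AddSubgroup.mem_top _))
  induction u using SQ.ind with
  | h f hf =>
  obtain ⟨y, hy⟩ := (SQ.mk_eq _ (AddSubgroup.mem_top _)).1 hu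
  have hy' : b k A _ 0 y = -(capC (Nat.add_zero n) f c) + x 0 := hy
  refine ⟨(g, 0) + (Pi.single n f, fun q => (-1 : ℤ) ^ (n + (q - 1) + 1) • match q with
    | 0 => 0
    | 1 => y
    | q + 2 => w q), ?_⟩
  rw [map_add, hD]
  refine Prod.ext ?_ (funext fun q => ?_)
  · show e.1 + dFam (Pi.single n f) = e.1
    rw [dFam_single f hf, add_zero]
  · show capFam c g q + (capFam c (Pi.single n f) q + (-1 : ℤ) ^ (n + q + 1) • b k A _ q _) = e.2 q
    have hsum : capFam c g q + x q = e.2 q := add_sub_cancel _ _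
    rw [← hsum]
    congr 1
    dsimp only
    rw [map_zsmul, smul_smul, Nat.add_sub_cancel, sg_neg, one_smul]
    cases q with
    | zero =>
      rw [capFam_single c f (Nat.add_zero n)]
      show _ + b k A _ 0 y = _
      rw [hy', add_neg_cancel_left]
    | succ q =>
      rw [capFam_single_of_ne c f (by omega), zero_add]
      exact hw q

end Cone

/-! ### Exact cones and duality -/

section DualityTheorem

variable {k : Type*} [CommRing k] {A : Type u} [Ring A] [Algebra k A]

theorem dFam_zero {M : Type*} [AddCommGroup M] [Module k M] [Module A M] [Module Aᵐᵒᵖ M]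
    [SMulCommClass A Aᵐᵒᵖ M] [IsScalarTower k A M] [IsScalarTower k Aᵐᵒᵖ M] :
    dFam (0 : ∀ p, Cochain k A M p) = 0 := by
  funext p
  cases p with
  | zero => rfl
  | succ p => exact map_zero (d k A M p)

/-- An element of the cone that is concentrated in a single cochain or chain degree is a cycle if it
comes from a cocycle whose cap product with `c` is a boundary, or from a cycle. Exactness of the
cone thus gives both the bijectivity of the cap product and the vanishing above degree `n`. -/
theorem isDualizing_of_coneExact {n : ℕ} {c : Chain k A A n} (hc : c ∈ cycles k A A n)
    (h : ConeExact c A) : IsDualizing n (SQ.mk c hc : Homology k A A n) := by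
  have hb0 : ∀ (q : ℕ) (z : Chain k A A q), z ∈ cycles k A A q → ∀ r,
      b k A A r ((Pi.single q z : ∀ r, Chain k A A r) (r + 1)) = 0 := by
    intro q z hz r
    by_cases hr : r + 1 = q
    · subst hr
      rw [Pi.single_eq_same]
      exact hz
    · rw [Pi.single_eq_of_ne hr, map_zero]
  have hz : ∀ (q : ℕ) (z : Chain k A A q), z ∈ cycles k A A q →
      ∃ e : Cone k A A, dFam e.1 = 0 ∧
        capFam c e.1 q + (-1 : ℤ) ^ (n + q + 1) • b k A A q (e.2 (q + 1)) = z := by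
    intro q z hz
    obtain ⟨e, he⟩ := h (0, Pi.single q z) (by
      refine Prod.ext dFam_zero (funext fun r => ?_)
      · rw [coneD_snd, hb0 q z hz, smul_zero, add_zero]
        exact capFam_zero c r)
    refine ⟨e, congrArg Prod.fst he, ?_⟩
    have := congrFun (congrArg Prod.snd he) q
    rw [coneD_snd] at this
    exact this.trans (Pi.single_eq_same (M := fun r => Chain k A A r) q z)
  refine ⟨fun p q hpq => ⟨?_, fun z => ?_⟩, fun p hp => ⟨fun f g => ?_⟩, fun q hq => ⟨fun z w => ?_⟩⟩
  · rw [injective_iff_map_eq_zero]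
    intro f hf
    induction f using SQ.ind with
    | h f hf' =>
    obtain ⟨y, hy⟩ := (SQ.mk_eq (Z := cycles k A A q) _ (AddSubgroup.zero_mem _)).1 hf
    have hy' : b k A A q y = -(capC hpq f c) := hy.trans (add_zero _)
    obtain ⟨e, he⟩ := h (Pi.single p f, Pi.single (q + 1) ((-1 : ℤ) ^ (n + q + 1) • y)) (by
      refine Prod.ext (dFam_single f hf') (funext fun r => ?_)
      rw [coneD_snd]
      show capFam c (Pi.single p f) r + _ • b k A A r
        ((Pi.single (q + 1) _ : ∀ r, Chain k A A r) (r + 1)) = 0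
      by_cases hr : r = q
      · subst hr
        rw [capFam_single c f hpq, Pi.single_eq_same, map_zsmul, smul_smul, sg_neg, one_smul, hy',
          add_neg_cancel]
      · rw [capFam_single_of_ne c f (by omega), Pi.single_eq_of_ne (by omega), map_zero, smul_zero,
          add_zero])
    have he1 : dFam e.1 p = f :=
      (congrFun (congrArg Prod.fst he) p).trans
        (Pi.single_eq_same (M := fun r => Cochain k A A r) p f)
    refine (SQ.mk_eq _ (AddSubgroup.zero_mem _)).2 ?_
    rw [add_zero, neg_mem_iff, ← he1]
    cases p with
    | zero => exact AddSubgroup.zero_mem _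
    | succ p => exact ⟨e.1 p, rfl⟩
  · induction z using SQ.ind with
    | h z hz' =>
    obtain ⟨e, he1, he2⟩ := hz q z hz'
    refine ⟨SQ.mk (e.1 p) (congrFun he1 (p + 1)), ?_⟩
    refine (SQ.mk_eq (Z := cycles k A A q) _ hz').2 ?_
    rw [capFam_eq c _ hpq] at he2
    refine ⟨(-1 : ℤ) ^ (n + q + 1) • e.2 (q + 1), ?_⟩
    show b k A A q _ = -(capC hpq (e.1 p) c) + z
    rw [← he2, neg_add_cancel_left, map_zsmul]
  · suffices hh : ∀ f : HH k A A p, f = 0 from (hh f).trans (hh g).symm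
    intro f
    induction f using SQ.ind with
    | h f hf' =>
    obtain ⟨e, he⟩ := h (Pi.single p f, 0) (by
      refine Prod.ext (dFam_single f hf') (funext fun r => ?_)
      rw [coneD_snd]
      show capFam c (Pi.single p f) r + _ • b k A A r 0 = 0
      rw [capFam_single_of_ne c f (by omega), map_zero, smul_zero, add_zero])
    have he1 : dFam e.1 p = f :=
      (congrFun (congrArg Prod.fst he) p).trans
        (Pi.single_eq_same (M := fun r => Cochain k A A r) p f)
    refine (SQ.mk_eq _ (AddSubgroup.zero_mem _)).2 ?_
    rw [add_zero, neg_mem_iff, ← he1]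
    cases p with
    | zero => exact AddSubgroup.zero_mem _
    | succ p => exact ⟨e.1 p, rfl⟩
  · suffices hh : ∀ z : Homology k A A q, z = 0 from (hh z).trans (hh w).symm
    intro z
    induction z using SQ.ind with
    | h z hz' =>
    obtain ⟨e, he1, he2⟩ := hz q z hz'
    rw [capFam_of_lt c _ hq, zero_add] at he2
    refine (SQ.mk_eq _ (AddSubgroup.zero_mem _)).2 ?_
    rw [add_zero, neg_mem_iff]
    exact ⟨(-1 : ℤ) ^ (n + q + 1) • e.2 (q + 1), (map_zsmul (b k A A q) _ _).trans he2⟩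

end DualityTheorem

/-! ### Modules over the enveloping algebra as bimodules -/

section Enveloping

/-- A module over `A ⊗ Aᵒᵖ`, viewed as an `A`-bimodule. -/
def Bim (k : Type*) [CommRing k] (A : Type*) [Ring A] [Algebra k A] (X : Type*) : Type _ := X

variable {k : Type*} [CommRing k] {A : Type*} [Ring A] [Algebra k A] {X : Type*} [AddCommGroup X]
  [Module (A ⊗[k] Aᵐᵒᵖ) X]

instance : AddCommGroup (Bim k A X) := inferInstanceAs (AddCommGroup X)
instance : Module (A ⊗[k] Aᵐᵒᵖ) (Bim k A X) := inferInstanceAs (Module (A ⊗[k] Aᵐᵒᵖ) X)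
instance : Module k (Bim k A X) :=
  Module.compHom X (algebraMap k (A ⊗[k] Aᵐᵒᵖ))
instance : Module A (Bim k A X) :=
  Module.compHom X (Algebra.TensorProduct.includeLeft : A →ₐ[k] A ⊗[k] Aᵐᵒᵖ).toRingHom
instance : Module Aᵐᵒᵖ (Bim k A X) :=
  Module.compHom X (Algebra.TensorProduct.includeRight : Aᵐᵒᵖ →ₐ[k] A ⊗[k] Aᵐᵒᵖ).toRingHom

theorem Bim.smul_def (a : A) (x : Bim k A X) : a • x = (a ⊗ₜ[k] (1 : Aᵐᵒᵖ)) • x := rfl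
theorem Bim.op_smul_def (a : Aᵐᵒᵖ) (x : Bim k A X) : a • x = ((1 : A) ⊗ₜ[k] a) • x := rfl
theorem Bim.base_smul_def (c : k) (x : Bim k A X) :
    c • x = algebraMap k (A ⊗[k] Aᵐᵒᵖ) c • x := rfl

instance : SMulCommClass A Aᵐᵒᵖ (Bim k A X) where
  smul_comm a c x := by
    rw [Bim.smul_def, Bim.op_smul_def, Bim.op_smul_def, Bim.smul_def, ← mul_smul, ← mul_smul,
      Algebra.TensorProduct.tmul_mul_tmul, Algebra.TensorProduct.tmul_mul_tmul, mul_one, one_mul,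
      one_mul, mul_one]

instance : IsScalarTower k A (Bim k A X) where
  smul_assoc c a x := by
    rw [Bim.smul_def, Bim.smul_def, Bim.base_smul_def, ← mul_smul, ← Algebra.smul_def,
      TensorProduct.smul_tmul']

instance : IsScalarTower k Aᵐᵒᵖ (Bim k A X) where
  smul_assoc c a x := by
    rw [Bim.op_smul_def, Bim.op_smul_def, Bim.base_smul_def, ← mul_smul, ← Algebra.smul_def,
      TensorProduct.tmul_smul]

/-- An `A ⊗ Aᵒᵖ`-linear map as a `k`-linear map. -/
def Bim.map {X' : Type*} [AddCommGroup X'] [Module (A ⊗[k] Aᵐᵒᵖ) X']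
    (φ : X →ₗ[A ⊗[k] Aᵐᵒᵖ] X') : Bim k A X →ₗ[k] Bim k A X' :=
  { toFun := φ
    map_add' := φ.map_add
    map_smul' := fun c x => φ.map_smul (algebraMap k (A ⊗[k] Aᵐᵒᵖ) c) x }

theorem Bim.map_smul {X' : Type*} [AddCommGroup X'] [Module (A ⊗[k] Aᵐᵒᵖ) X']
    (φ : X →ₗ[A ⊗[k] Aᵐᵒᵖ] X') (a : A) (x : Bim k A X) : Bim.map φ (a • x) = a • Bim.map φ x :=
  φ.map_smul _ x

theorem Bim.map_op_smul {X' : Type*} [AddCommGroup X'] [Module (A ⊗[k] Aᵐᵒᵖ) X']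
    (φ : X →ₗ[A ⊗[k] Aᵐᵒᵖ] X') (a : Aᵐᵒᵖ) (x : Bim k A X) :
    Bim.map φ (a • x) = a • Bim.map φ x :=
  φ.map_smul _ x

end Enveloping

section Enveloping

variable {k : Type*} [CommRing k] {A : Type u} [Ring A] [Algebra k A]

variable (k A) in
/-- The free bimodule `A ⊗ A` as the enveloping algebra. -/
def outEquiv : Out k A ≃ₗ[k] Bim k A (A ⊗[k] Aᵐᵒᵖ) :=
  { (TensorProduct.congr (LinearEquiv.refl k A) (MulOpposite.opLinearEquiv k) :
      A ⊗[k] A ≃ₗ[k] A ⊗[k] Aᵐᵒᵖ) with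
    map_smul' := fun c x => by
      refine ((TensorProduct.congr (LinearEquiv.refl k A) (MulOpposite.opLinearEquiv k) :
        A ⊗[k] A ≃ₗ[k] A ⊗[k] Aᵐᵒᵖ).map_smul c x).trans ?_
      exact Algebra.smul_def (A := A ⊗[k] Aᵐᵒᵖ) c _ }

theorem outEquiv_tmul (x y : A) :
    outEquiv k A (Out.tmul k x y) = (x ⊗ₜ[k] MulOpposite.op y : A ⊗[k] Aᵐᵒᵖ) := rfl

@[elab_as_elim]
theorem Out.induction {P : Out k A → Prop} (z : Out k A) (zero : P 0)
    (tmul : ∀ x y, P (Out.tmul k x y)) (add : ∀ z w, P z → P w → P (z + w)) : P z :=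
  TensorProduct.induction_on (motive := P) z zero tmul add

theorem outEquiv_smul (a : A) (z : Out k A) : outEquiv k A (a • z) = a • outEquiv k A z := by
  induction z using Out.induction with
  | zero => rw [smul_zero, map_zero, smul_zero]
  | tmul x y =>
    rw [Out.smul_tmul, outEquiv_tmul, outEquiv_tmul]
    exact ((Algebra.TensorProduct.tmul_mul_tmul a x 1 (MulOpposite.op y)).trans (by
      rw [one_mul])).symm
  | add x y hx hy => rw [smul_add, map_add, hx, hy, map_add, smul_add]

theorem outEquiv_op_smul (a : Aᵐᵒᵖ) (z : Out k A) :
    outEquiv k A (a • z) = a • outEquiv k A z := by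
  induction z using Out.induction with
  | zero => rw [smul_zero, map_zero, smul_zero]
  | tmul x y =>
    rw [Out.op_smul_tmul, outEquiv_tmul, outEquiv_tmul]
    exact ((Algebra.TensorProduct.tmul_mul_tmul 1 x a (MulOpposite.op y)).trans (by
      rw [one_mul, MulOpposite.op_mul, MulOpposite.op_unop])).symm
  | add x y hx hy => rw [smul_add, map_add, hx, hy, map_add, smul_add]

/-- The module `A ⊗ A` is free of rank one over the enveloping algebra, hence every finitely
generated projective module is a direct summand of a finite sum of copies of it. -/
theorem ConeExact.bim_of_finite_projective {n : ℕ} {c : Chain k A A n}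
    (h : ConeExact c (Out k A)) (X : Type*) [AddCommGroup X] [Module (A ⊗[k] Aᵐᵒᵖ) X]
    [Module.Finite (A ⊗[k] Aᵐᵒᵖ) X] [Module.Projective (A ⊗[k] Aᵐᵒᵖ) X] :
    ConeExact c (Bim k A X) := by
  have hR : ConeExact c (Bim k A (A ⊗[k] Aᵐᵒᵖ)) := by
    refine h.of_retract (outEquiv k A).symm.toLinearMap (outEquiv k A).toLinearMap ?_ ?_
      outEquiv_smul outEquiv_op_smul (outEquiv k A).apply_symm_apply
    · intro a m
      apply (outEquiv k A).injective
      show outEquiv k A ((outEquiv k A).symm _) = outEquiv k A (a • (outEquiv k A).symm m)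
      rw [outEquiv_smul, LinearEquiv.apply_symm_apply, LinearEquiv.apply_symm_apply]
    · intro a m
      apply (outEquiv k A).injective
      show outEquiv k A ((outEquiv k A).symm _) = outEquiv k A (a • (outEquiv k A).symm m)
      rw [outEquiv_op_smul, LinearEquiv.apply_symm_apply, LinearEquiv.apply_symm_apply]
  obtain ⟨m, f, g, -, -, hfg⟩ :=
    Module.Finite.exists_comp_eq_id_of_projective (A ⊗[k] Aᵐᵒᵖ) X
  refine hR.of_sum_comp Finset.univ (fun i : Fin m => Bim.map (LinearMap.proj i ∘ₗ g))
    (fun i => Bim.map (f ∘ₗ LinearMap.single (A ⊗[k] Aᵐᵒᵖ)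
      (fun _ : Fin m => A ⊗[k] Aᵐᵒᵖ) i)) (fun i => Bim.map_smul _)
    (fun i => Bim.map_op_smul _) (fun i => Bim.map_smul _) (fun i => Bim.map_op_smul _) ?_
  refine LinearMap.ext fun x => ?_
  rw [LinearMap.sum_apply]
  have h1 : f (g x) = x := LinearMap.congr_fun hfg x
  refine Eq.trans ?_ h1
  have h2 : g x = ∑ i, LinearMap.single (A ⊗[k] Aᵐᵒᵖ) (fun _ : Fin m => A ⊗[k] Aᵐᵒᵖ) i (g x i) :=
    (Finset.univ_sum_single (g x)).symm
  conv_rhs => rw [h2, map_sum]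
  rfl

end Enveloping

/-! ### Duality for Calabi–Yau algebras -/

section DualityTheorem

variable {k : Type*} [Field k] {A : Type u} [Ring A] [Algebra k A]

attribute [local instance] TensorProduct.Algebra.module

/-- Exactness of the cone with coefficients in `A ⊗ A` propagates along a bounded resolution of `A`
by finitely generated projective bimodules. -/
theorem coneExact_of_smooth (hA : HomologicallySmooth k A) {n : ℕ} {c : Chain k A A n}
    (hc : c ∈ cycles k A A n) (h : ConeExact c (Out k A)) : ConeExact c A := by
  obtain ⟨P, hfin, N, hN⟩ := hA
  let Q := Res.ofPR P
  have hX : ∀ i, ConeExact c (Bim k A (Q.X i)) := fun i => by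
    have : Module.Finite (A ⊗[k] Aᵐᵒᵖ) (Q.X i) := hfin i
    exact h.bim_of_finite_projective (Q.X i)
  -- descending induction over the syzygies of `A`, starting where the resolution vanishes
  have hK : ∀ j i, j + i = N → ConeExact c (Bim k A (LinearMap.range (Q.d i))) := by
    intro j
    induction j with
    | zero =>
      intro i hi
      have h0 : Subsingleton (Q.X (i + 1)) :=
        ModuleCat.subsingleton_of_isZero (hN (i + 1) (by omega))
      have : Subsingleton (Bim k A (LinearMap.range (Q.d i))) :=
        (LinearMap.surjective_rangeRestrict (Q.d i)).subsingleton
      exact ConeExact.of_subsingleton c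
    | succ j ih =>
      intro i hi
      refine ConeExact.of_shortExact hc (ih (i + 1) (by omega)) (hX (i + 1))
        (Bim.map (X' := Q.X (i + 1)) (LinearMap.range (Q.d (i + 1))).subtype)
        (Bim.map (X := Q.X (i + 1)) (Q.d i).rangeRestrict)
        (Bim.map_smul _) (Bim.map_op_smul _) (Bim.map_smul _) (Bim.map_op_smul _)
        Subtype.val_injective (LinearMap.surjective_rangeRestrict (Q.d i)) fun x => ?_
      constructor
      · intro hx
        obtain ⟨y, hy⟩ := Q.exact i x (congrArg Subtype.val hx)
        exact ⟨⟨x, y, hy⟩, rfl⟩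
      · rintro ⟨⟨_, y, rfl⟩, rfl⟩
        exact Subtype.ext (Q.d_d i y)
  have hε : ∀ (r : A ⊗[k] Aᵐᵒᵖ) x, Q.ε (r • x) = r • Q.ε x := Q.ε.map_smul
  have hact : ∀ (a : A) (c : Aᵐᵒᵖ) (y : A), (a ⊗ₜ[k] c) • y = a • c • y := fun a c y =>
    TensorProduct.Algebra.smul_def a c y
  refine ConeExact.of_shortExact hc (hK N 0 (by omega)) (hX 0)
    (Bim.map (X' := Q.X 0) (LinearMap.range (Q.d 0)).subtype)
    (⟨⟨fun x => Q.ε x, Q.ε.map_add⟩, fun r x => ?_⟩ : Bim k A (Q.X 0) →ₗ[k] A)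
    (Bim.map_smul _) (Bim.map_op_smul _) (fun a x => ?_) (fun a x => ?_)
    Subtype.val_injective Q.surj fun x => ?_
  · refine (hε _ _).trans ?_
    show (algebraMap k A r ⊗ₜ[k] (1 : Aᵐᵒᵖ)) • Q.ε x = r • Q.ε x
    rw [hact, one_smul, algebraMap_smul]
  · refine (hε _ _).trans ?_
    refine (hact _ _ _).trans ?_
    rw [one_smul]
    rfl
  · refine (hε _ _).trans ?_
    refine (hact _ _ _).trans ?_
    rw [one_smul]
    rfl
  · constructor
    · intro hx
      obtain ⟨y, hy⟩ := Q.exact₀ x hx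
      exact ⟨⟨x, y, hy⟩, rfl⟩
    · rintro ⟨⟨_, y, rfl⟩, rfl⟩
      exact Q.ε_d y

/-- On a Calabi–Yau algebra a nondegenerate class is dualizing. -/
theorem IsNondegenerate.isDualizing {n : ℕ} {π : Homology k A A n} (hA : IsCY k A n)
    (hπ : IsNondegenerate n π) : IsDualizing n π := by
  induction π using SQ.ind with
  | h c hc =>
  refine isDualizing_of_coneExact hc (coneExact_of_smooth hA.1 hc (coneExact_out hc hA.2.1 ?_))
  obtain ⟨v, hv, hinv⟩ := hπ
  have h1 : Function.Bijective fun u : HH k A (Out k A) n =>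
      trOut (cap (Nat.add_zero n) u (SQ.mk c hc : Homology k A A n)) := by
    have h2 : Function.RightInverse (fun u : HH k A (Out k A) n =>
      trOut (cap (Nat.add_zero n) u (SQ.mk c hc : Homology k A A n))) (fun a : A => extL n a v) :=
      hinv
    have h3 : Function.LeftInverse (fun u : HH k A (Out k A) n =>
      trOut (cap (Nat.add_zero n) u (SQ.mk c hc : Homology k A A n))) (fun a : A => extL n a v) :=
      h2.leftInverse_of_injective hv.2.1
    exact ⟨h2.injective, h3.surjective⟩
  exact (Function.Bijective.of_comp_iff' (trOut_bijective (k := k) (A := A)) _).1 h1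

end DualityTheorem

/-! ### Cohomology of `Hom` out of a resolution -/

namespace Res

variable {R : Type u} [Ring R] {Y : Type u} [AddCommGroup Y] [Module R Y]
  {N : Type*} [AddCommGroup N] [Module R N]

/-- The map `f : P_n → N` is a coboundary of the complex `Hom(P, N)`. -/
def IsCob (P : Res R Y) : ∀ n, (P.X n →ₗ[R] N) → Prop
  | 0, f => f = 0
  | n + 1, f => ∃ g : P.X n →ₗ[R] N, f = g ∘ₗ P.d n

theorem IsCob.comp {P : Res R Y} {n : ℕ} {f : P.X n →ₗ[R] N} (hf : P.IsCob n f)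
    {N' : Type*} [AddCommGroup N'] [Module R N'] (φ : N →ₗ[R] N') : P.IsCob n (φ ∘ₗ f) := by
  cases n with
  | zero =>
    have hf' : f = 0 := hf
    show φ ∘ₗ f = 0
    rw [hf', LinearMap.comp_zero]
  | succ n =>
    obtain ⟨u, rfl⟩ := hf
    exact ⟨φ ∘ₗ u, rfl⟩

theorem IsCob.precomp {P Q : Res R Y} {n : ℕ} {f : Q.X n →ₗ[R] N} (hf : Q.IsCob n f)
    (c : ∀ n, P.X n →ₗ[R] Q.X n) (hc : ∀ n x, Q.d n (c (n + 1) x) = c n (P.d n x)) :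
    P.IsCob n (f ∘ₗ c n) := by
  cases n with
  | zero =>
    have hf' : f = 0 := hf
    show f ∘ₗ c 0 = 0
    rw [hf', LinearMap.zero_comp]
  | succ n =>
    obtain ⟨u, rfl⟩ := hf
    exact ⟨u ∘ₗ c n, LinearMap.ext fun x => congrArg u (hc n x)⟩

/-- A comparison map of resolutions is surjective on the cohomology of `Hom(-, N)`. -/
theorem exists_cocycle (P Q : Res R Y) (c : ∀ n, P.X n →ₗ[R] Q.X n)
    (hc : ∀ n x, Q.d n (c (n + 1) x) = c n (P.d n x)) (hc₀ : ∀ x, Q.ε (c 0 x) = P.ε x) (n : ℕ)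
    (f : P.X n →ₗ[R] N) (hf : f ∘ₗ P.d n = 0) :
    ∃ g : Q.X n →ₗ[R] N, g ∘ₗ Q.d n = 0 ∧ P.IsCob n (g ∘ₗ c n - f) := by
  obtain ⟨c', h, hc', h0, h1⟩ := exists_homotopy_inverse P Q c hc hc₀
  have hf' : ∀ x, f (P.d n x) = 0 := LinearMap.congr_fun hf
  refine ⟨f ∘ₗ c' n, LinearMap.ext fun x => ?_, ?_⟩
  · show f (c' n (Q.d n x)) = 0
    rw [← hc', hf']
  · cases n with
    | zero =>
      refine LinearMap.ext fun x => ?_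
      show f (c' 0 (c 0 x)) - f x = 0
      rw [h0, map_add, hf', zero_add, sub_self]
    | succ n =>
      refine ⟨f ∘ₗ h n, LinearMap.ext fun x => ?_⟩
      show f (c' (n + 1) (c (n + 1) x)) - f x = f (h n (P.d n x))
      rw [h1, map_add, map_add, hf', add_zero, add_sub_cancel_right]

/-- A comparison map of resolutions is injective on the cohomology of `Hom(-, N)`. -/
theorem isCob_of_comp (P Q : Res R Y) (c : ∀ n, P.X n →ₗ[R] Q.X n)
    (hc : ∀ n x, Q.d n (c (n + 1) x) = c n (P.d n x)) (hc₀ : ∀ x, Q.ε (c 0 x) = P.ε x) (n : ℕ)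
    (g : Q.X n →ₗ[R] N) (hg : g ∘ₗ Q.d n = 0) (h : P.IsCob n (g ∘ₗ c n)) : Q.IsCob n g := by
  obtain ⟨c', hc', hc'₀⟩ := exists_lift Q P
  obtain ⟨h', h1, h2⟩ := exists_homotopy Q Q (fun n => c n ∘ₗ c' n) (fun n => LinearMap.id)
    (fun n x => by simp [hc', hc]) (fun x => by simp [hc'₀, hc₀]) (fun _ _ => rfl) (fun _ => rfl)
  have hg' : ∀ x, g (Q.d n x) = 0 := LinearMap.congr_fun hg
  cases n with
  | zero =>
    refine LinearMap.ext fun x => ?_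
    have e1 : g (c 0 (c' 0 x)) = g (Q.d 0 (h' 0 x) + x) := congrArg g (h1 x)
    have e2 : g (c 0 (c' 0 x)) = 0 := LinearMap.congr_fun (show g ∘ₗ c 0 = 0 from h) (c' 0 x)
    rw [e2, map_add, hg', zero_add] at e1
    exact e1.symm
  | succ n =>
    obtain ⟨v, hv⟩ := h
    refine ⟨v ∘ₗ c' n - g ∘ₗ h' n, LinearMap.ext fun x => ?_⟩
    have e1 : g (c (n + 1) (c' (n + 1) x)) =
        g (h' n (Q.d n x) + Q.d (n + 1) (h' (n + 1) x) + x) := congrArg g (h2 n x)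
    have e2 : g (c (n + 1) (c' (n + 1) x)) = v (P.d n (c' (n + 1) x)) :=
      LinearMap.congr_fun hv (c' (n + 1) x)
    rw [e2, map_add, map_add, hg', add_zero, hc'] at e1
    show g x = v (c' n (Q.d n x)) - g (h' n (Q.d n x))
    rw [e1, add_sub_cancel_left]

end Res

/-! ### Central localization over noncommutative rings -/

section CentralLocalization

variable {G : Type*} [CommMonoid G] {R : Type u} [Ring R] {R' : Type u} [Ring R']
  {ι : R →+* R'} {ρ : G →* R}
  {M : Type*} [AddCommGroup M] [Module R M] {N : Type*} [AddCommGroup N] [Module R' N]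
  {M₁ : Type*} [AddCommGroup M₁] [Module R M₁] {N₁ : Type*} [AddCommGroup N₁] [Module R' N₁]
  {M₂ : Type*} [AddCommGroup M₂] [Module R M₂] {N₂ : Type*} [AddCommGroup N₂] [Module R' N₂]

/-- A semilinear map that has the properties of a localization at the elements `ρ g`, except for
their invertibility. -/
structure IsLocal (ρ : G →* R) (φ : M →ₛₗ[ι] N) : Prop where
  surj : ∀ y, ∃ g x, ι (ρ g) • y = φ x
  inj : ∀ x, φ x = 0 → ∃ g, ρ g • x = 0

/-- The elements `ρ g` are central. -/
def IsCentral (ρ : G →* R) : Prop := ∀ g r, ρ g * r = r * ρ g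

/-- Multiplication by a central element. -/
def IsCentral.smul (hρ : IsCentral ρ) (g : G) (M : Type*) [AddCommGroup M] [Module R M] :
    M →ₗ[R] M where
  toFun x := ρ g • x
  map_add' := smul_add _
  map_smul' r x := by rw [← mul_smul, hρ, mul_smul, RingHom.id_apply]

theorem IsLocal.exists_finite {φ : M →ₛₗ[ι] N} (hφ : IsLocal ρ φ) (m : ℕ) (y : Fin m → N) :
    ∃ g, ∃ x : Fin m → M, ∀ i, ι (ρ g) • y i = φ (x i) := by
  choose g x hx using fun i => hφ.surj (y i)
  refine ⟨∏ i, g i, fun i => ρ (∏ j ∈ Finset.univ.erase i, g j) • x i, fun i => ?_⟩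
  rw [LinearMap.map_smulₛₗ, ← hx, ← mul_smul, ← map_mul, ← map_mul,
    Finset.prod_erase_mul _ _ (Finset.mem_univ i)]

theorem exists_smul_eq_zero_of_finite (m : ℕ) (x : Fin m → M) (hx : ∀ i, ∃ g, ρ g • x i = 0) :
    ∃ g, ∀ i, ρ g • x i = 0 := by
  choose g hg using hx
  refine ⟨∏ i, g i, fun i => ?_⟩
  rw [← Finset.prod_erase_mul _ _ (Finset.mem_univ i), map_mul, mul_smul, hg, smul_zero]

theorem IsLocal.pi {φ : M →ₛₗ[ι] N} (hφ : IsLocal ρ φ) (m : ℕ)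
    (ψ : (Fin m → M) →ₛₗ[ι] (Fin m → N)) (hψ : ∀ x i, ψ x i = φ (x i)) : IsLocal ρ ψ where
  surj y := by
    obtain ⟨g, x, hx⟩ := hφ.exists_finite m y
    exact ⟨g, x, funext fun i => (hx i).trans (hψ x i).symm⟩
  inj x hx := by
    obtain ⟨g, hg⟩ := exists_smul_eq_zero_of_finite (ρ := ρ) m x fun i =>
      hφ.inj _ ((hψ x i).symm.trans (congrFun hx i))
    exact ⟨g, funext hg⟩

/-- Localization is exact. -/
theorem IsLocal.exact (hι : ∀ g, IsUnit (ι (ρ g))) (φ : M →ₛₗ[ι] N)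
    {φ₁ : M₁ →ₛₗ[ι] N₁} (hφ₁ : IsLocal ρ φ₁) {φ₂ : M₂ →ₛₗ[ι] N₂} (hφ₂ : IsLocal ρ φ₂)
    (f : M →ₗ[R] M₁) (h : M₁ →ₗ[R] M₂) (f' : N →ₗ[R'] N₁) (h' : N₁ →ₗ[R'] N₂)
    (hf : ∀ x, f' (φ x) = φ₁ (f x)) (hh : ∀ x, h' (φ₁ x) = φ₂ (h x))
    (hex : ∀ x, h x = 0 → ∃ w, f w = x) (y : N₁) (hy : h' y = 0) : ∃ w, f' w = y := by
  obtain ⟨g, x, hx⟩ := hφ₁.surj y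
  obtain ⟨g', hg'⟩ := hφ₂.inj (h x) (by rw [← hh, ← hx, map_smul, hy, smul_zero])
  obtain ⟨w, hw⟩ := hex (ρ g' • x) (by rw [map_smul, hg'])
  obtain ⟨v, hv⟩ := (hι (g' * g)).exists_left_inv
  refine ⟨v • φ w, ?_⟩
  rw [map_smul, hf, hw, LinearMap.map_smulₛₗ, ← hx, ← mul_smul (ι (ρ g')), ← map_mul, ← map_mul,
    ← mul_smul, hv, one_smul]

/-- A linear map out of a localization is determined on the image of the localization map. -/
theorem IsLocal.hom_ext (hι : ∀ g, IsUnit (ι (ρ g))) {φ : M →ₛₗ[ι] N} (hφ : IsLocal ρ φ)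
    {f f' : N →ₗ[R'] N₁} (h : ∀ x, f (φ x) = f' (φ x)) : f = f' := by
  refine LinearMap.ext fun y => ?_
  obtain ⟨g, x, hx⟩ := hφ.surj y
  obtain ⟨v, hv⟩ := (hι g).exists_left_inv
  have e : y = v • φ x := by rw [← hx, ← mul_smul, hv, one_smul]
  rw [e, map_smul, map_smul, h]

section Hat

variable (ι)

/-- The entrywise map `Rᵐ → R'ᵐ`. -/
def powMap (m : ℕ) : (Fin m → R) →ₛₗ[ι] (Fin m → R') where
  toFun x i := ι (x i)
  map_add' _ _ := funext fun _ => map_add ι _ _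
  map_smul' _ _ := funext fun _ => map_mul ι _ _

variable {ι}

/-- The extension of scalars of a linear map with free source, along a semilinear map `φ` of the
targets. -/
def hat (φ : M →ₛₗ[ι] N) {m : ℕ} (f : (Fin m → R) →ₗ[R] M) : (Fin m → R') →ₗ[R'] N :=
  Fintype.linearCombination R' fun i => φ (f (Pi.single i 1))

theorem hat_powMap (φ : M →ₛₗ[ι] N) {m : ℕ} (f : (Fin m → R) →ₗ[R] M) (x : Fin m → R) :
    hat φ f (powMap ι m x) = φ (f x) := by
  have hx : x = ∑ i, x i • (Pi.single i 1 : Fin m → R) := by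
    conv_lhs => rw [← Finset.univ_sum_single x]
    refine Finset.sum_congr rfl fun i _ => ?_
    rw [← Pi.single_smul, smul_eq_mul, mul_one]
  conv_rhs => rw [hx, map_sum, map_sum]
  simp only [map_smul, LinearMap.map_smulₛₗ]
  exact Fintype.linearCombination_apply R' _ _

variable (R) (X : Type*) [AddCommGroup X] [Module R X] [Module.Finite R X] [Module.Projective R X]

/-- The rank of a free module that has `X` as a direct summand. -/
def sumRank : ℕ := (Module.Finite.exists_comp_eq_id_of_projective R X).choose

/-- The projection of a free module onto its direct summand `X`. -/
def sumProj : (Fin (sumRank R X) → R) →ₗ[R] X :=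
  (Module.Finite.exists_comp_eq_id_of_projective R X).choose_spec.choose

/-- The inclusion of the direct summand `X` into a free module. -/
def sumIncl : X →ₗ[R] (Fin (sumRank R X) → R) :=
  (Module.Finite.exists_comp_eq_id_of_projective R X).choose_spec.choose_spec.choose

variable {X}

theorem sumProj_sumIncl (x : X) : sumProj R X (sumIncl R X x) = x :=
  LinearMap.congr_fun
    (Module.Finite.exists_comp_eq_id_of_projective R X).choose_spec.choose_spec.choose_spec.2.2 x

variable (X) (ι)

variable {R}

/-- The idempotent of `R'ᵐ` obtained by extension of scalars from the one of `Rᵐ` with image `X`. -/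
def hatIdem : (Fin (sumRank R X) → R') →ₗ[R'] (Fin (sumRank R X) → R') :=
  hat (powMap ι _) (sumIncl R X ∘ₗ sumProj R X)

/-- The extension of scalars of the finitely generated projective module `X`. -/
def hatMod : Type u := LinearMap.range (hatIdem ι X)

instance : AddCommGroup (hatMod ι X) := inferInstanceAs (AddCommGroup (LinearMap.range (hatIdem ι X)))
instance : Module R' (hatMod ι X) := inferInstanceAs (Module R' (LinearMap.range (hatIdem ι X)))

/-- The inclusion of `hatMod ι X` in a free module. -/
def hatVal : hatMod ι X →ₗ[R'] (Fin (sumRank R X) → R') := (LinearMap.range (hatIdem ι X)).subtype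

theorem hatVal_injective : Function.Injective (hatVal ι X) := Subtype.val_injective

theorem hatIdem_powMap (v : Fin (sumRank R X) → R) :
    hatIdem ι X (powMap ι _ v) = powMap ι _ (sumIncl R X (sumProj R X v)) := hat_powMap _ _ v

/-- The semilinear map from `X` to its extension of scalars. -/
def toHat : X →ₛₗ[ι] hatMod ι X where
  toFun x := (⟨powMap ι _ (sumIncl R X x), powMap ι _ (sumIncl R X x), by
    rw [hatIdem_powMap, sumProj_sumIncl]⟩ : LinearMap.range (hatIdem ι X))
  map_add' x y := Subtype.ext (by
    show powMap ι _ (sumIncl R X (x + y)) = powMap ι _ (sumIncl R X x) + powMap ι _ (sumIncl R X y)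
    rw [map_add, map_add])
  map_smul' r x := Subtype.ext (by
    show powMap ι _ (sumIncl R X (r • x)) = ι r • powMap ι _ (sumIncl R X x)
    rw [map_smul, LinearMap.map_smulₛₗ])

theorem hatVal_toHat (x : X) : hatVal ι X (toHat ι X x) = powMap ι _ (sumIncl R X x) := rfl

/-- The linear extension of a map on `X` to its extension of scalars. -/
def hatDesc (φ : M →ₛₗ[ι] N) (f : X →ₗ[R] M) : hatMod ι X →ₗ[R'] N :=
  hat φ (f ∘ₗ sumProj R X) ∘ₗ hatVal ι X

theorem hatDesc_toHat (φ : M →ₛₗ[ι] N) (f : X →ₗ[R] M) (x : X) :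
    hatDesc ι X φ f (toHat ι X x) = φ (f x) := by
  unfold hatDesc
  rw [LinearMap.comp_apply, hatVal_toHat, hat_powMap, LinearMap.comp_apply, sumProj_sumIncl]

/-- The localization of the localized ring, seen as a semilinear map. -/
def ringSemilinear : R →ₛₗ[ι] R' where
  toFun := ι
  map_add' := map_add ι
  map_smul' := map_mul ι

variable {ι}

theorem isLocal_powMap (hR : IsLocal ρ (ringSemilinear ι)) (m : ℕ) :
    IsLocal ρ (powMap ι m) := hR.pi m _ fun _ _ => rfl

theorem hatIdem_hatIdem (hι : ∀ g, IsUnit (ι (ρ g))) (hR : IsLocal ρ (ringSemilinear ι))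
    (y : Fin (sumRank R X) → R') : hatIdem ι X (hatIdem ι X y) = hatIdem ι X y := by
  suffices h : hatIdem ι X ∘ₗ hatIdem ι X = hatIdem ι X from LinearMap.congr_fun h y
  refine (isLocal_powMap hR _).hom_ext hι fun v => ?_
  rw [LinearMap.comp_apply, hatIdem_powMap, hatIdem_powMap, sumProj_sumIncl]

theorem hatIdem_hatVal (hι : ∀ g, IsUnit (ι (ρ g))) (hR : IsLocal ρ (ringSemilinear ι))
    (y : hatMod ι X) : hatIdem ι X (hatVal ι X y) = hatVal ι X y := by
  obtain ⟨_, w, rfl⟩ := y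
  exact hatIdem_hatIdem X hι hR w

/-- If `ι` itself is a localization, so is the extension of scalars of a finitely generated
projective module, as a direct summand of the map `Rᵐ → R'ᵐ`. -/
theorem isLocal_toHat (hι : ∀ g, IsUnit (ι (ρ g)))
    (hR : IsLocal ρ (ringSemilinear ι)) : IsLocal ρ (toHat ι X) where
  surj y := by
    obtain ⟨g, v, hv⟩ := (isLocal_powMap hR _).surj (hatVal ι X y)
    refine ⟨g, sumProj R X v, hatVal_injective ι X ?_⟩
    rw [hatVal_toHat, ← hatIdem_powMap, ← hv, map_smul, map_smul, hatIdem_hatVal X hι hR]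
  inj x hx := by
    obtain ⟨g, hg⟩ := (isLocal_powMap hR _).inj (sumIncl R X x)
      ((hatVal_toHat ι X x).symm.trans (by rw [hx, map_zero]))
    refine ⟨g, ?_⟩
    rw [← sumProj_sumIncl R x, ← map_smul, hg, map_zero]

theorem hatMod_projective (hι : ∀ g, IsUnit (ι (ρ g))) (hR : IsLocal ρ (ringSemilinear ι)) :
    Module.Projective R' (hatMod ι X) :=
  Module.Projective.of_split (hatVal ι X) (LinearMap.rangeRestrict (hatIdem ι X))
    (LinearMap.ext fun y => hatVal_injective ι X (hatIdem_hatVal X hι hR y))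

instance : Module.Finite R' (hatMod ι X) :=
  Module.Finite.of_surjective (LinearMap.rangeRestrict (hatIdem ι X))
    (LinearMap.surjective_rangeRestrict _)

end Hat

namespace Res

variable {Y : Type u} [AddCommGroup Y] [Module R Y] {Y' : Type u} [AddCommGroup Y'] [Module R' Y']

/-- The localization of a resolution by finitely generated projective modules. -/
def localize (P : Res R Y) [∀ n, Module.Finite R (P.X n)]
    (hι : ∀ g, IsUnit (ι (ρ g))) (hR : IsLocal ρ (ringSemilinear ι)) (φ : Y →ₛₗ[ι] Y')
    (hφ : IsLocal ρ φ) : Res R' Y' where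
  X n := hatMod ι (P.X n)
  proj n := hatMod_projective (P.X n) hι hR
  d n := hatDesc ι _ (toHat ι (P.X n)) (P.d n)
  ε := hatDesc ι _ φ P.ε
  d_d n := by
    refine LinearMap.congr_fun (f := hatDesc ι _ (toHat ι (P.X n)) (P.d n) ∘ₗ
      hatDesc ι _ (toHat ι (P.X (n + 1))) (P.d (n + 1))) (g := 0)
      ((isLocal_toHat (P.X (n + 2)) hι hR).hom_ext hι fun x => ?_)
    rw [LinearMap.comp_apply, hatDesc_toHat, hatDesc_toHat, P.d_d, map_zero, LinearMap.zero_apply]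
  ε_d := by
    refine LinearMap.congr_fun (f := hatDesc ι _ φ P.ε ∘ₗ
      hatDesc ι _ (toHat ι (P.X 0)) (P.d 0)) (g := 0)
      ((isLocal_toHat (P.X 1) hι hR).hom_ext hι fun x => ?_)
    rw [LinearMap.comp_apply, hatDesc_toHat, hatDesc_toHat, P.ε_d, map_zero, LinearMap.zero_apply]
  exact n := IsLocal.exact hι (toHat ι (P.X (n + 2))) (isLocal_toHat (P.X (n + 1)) hι hR)
    (isLocal_toHat (P.X n) hι hR) (P.d (n + 1)) (P.d n) _ _ (hatDesc_toHat ι _ _ _)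
    (hatDesc_toHat ι _ _ _) (P.exact n)
  exact₀ := IsLocal.exact hι (toHat ι (P.X 1)) (isLocal_toHat (P.X 0) hι hR) hφ
    (P.d 0) P.ε _ _ (hatDesc_toHat ι _ _ _) (hatDesc_toHat ι _ _ _) P.exact₀
  surj y := by
    obtain ⟨g, a, ha⟩ := hφ.surj y
    obtain ⟨x, rfl⟩ := P.surj a
    obtain ⟨v, hv⟩ := (hι g).exists_left_inv
    refine ⟨v • toHat ι (P.X 0) x, ?_⟩
    rw [map_smul, hatDesc_toHat, ← ha, ← mul_smul, hv, one_smul]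

end Res

end CentralLocalization

/-! ### Cohomology with localized coefficients -/

section LocalCoefficients

variable {G : Type*} [CommMonoid G] {R : Type u} [Ring R] {ρ : G →* R}
  {M : Type*} [AddCommGroup M] [Module R M] {N : Type*} [AddCommGroup N] [Module R N]

/-- A common denominator exists for the finitely many images of generators. -/
theorem IsLocal.exists_hom (hρ : IsCentral ρ) {φ : M →ₗ[R] N} (hφ : IsLocal ρ φ)
    (X : Type*) [AddCommGroup X] [Module R X] [Module.Finite R X] [Module.Projective R X]
    (v : X →ₗ[R] N) : ∃ (g : G) (w : X →ₗ[R] M), hρ.smul g N ∘ₗ v = φ ∘ₗ w := by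
  obtain ⟨g, x, hx⟩ := hφ.exists_finite _ fun i => v (sumProj R X (Pi.single i 1))
  refine ⟨g, Fintype.linearCombination R x ∘ₗ sumIncl R X, ?_⟩
  have h1 : hρ.smul g N ∘ₗ v ∘ₗ sumProj R X = φ ∘ₗ Fintype.linearCombination R x := by
    refine LinearMap.pi_ext' fun i => LinearMap.ext_ring ?_
    refine (hx i).trans ?_
    rw [LinearMap.comp_apply, LinearMap.comp_apply, LinearMap.single_apply,
      Fintype.linearCombination_apply_single, one_smul]
  refine LinearMap.ext fun z => ?_
  have h2 := LinearMap.congr_fun h1 (sumIncl R X z)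
  simp only [LinearMap.comp_apply, sumProj_sumIncl] at h2
  exact h2

theorem IsLocal.exists_hom_eq_zero (hρ : IsCentral ρ) {φ : M →ₗ[R] N} (hφ : IsLocal ρ φ)
    (X : Type*) [AddCommGroup X] [Module R X] [Module.Finite R X]
    (w : X →ₗ[R] M) (hw : φ ∘ₗ w = 0) : ∃ g : G, hρ.smul g M ∘ₗ w = 0 := by
  obtain ⟨m, p, hp⟩ := Module.Finite.exists_fin' R X
  obtain ⟨g, hg⟩ := exists_smul_eq_zero_of_finite (ρ := ρ) m
    (fun i => w (p (Pi.single i 1))) fun i => hφ.inj _ (LinearMap.congr_fun hw _)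
  refine ⟨g, ?_⟩
  have h1 : (hρ.smul g M ∘ₗ w) ∘ₗ p = 0 :=
    LinearMap.pi_ext' fun i => LinearMap.ext_ring (hg i)
  refine LinearMap.ext fun z => ?_
  obtain ⟨y, rfl⟩ := hp z
  exact LinearMap.congr_fun h1 y

variable {Y : Type u} [AddCommGroup Y] [Module R Y]

/-- Every class with coefficients in the localization `N` of `M` becomes, after multiplication by
some `ρ g`, the image of a class with coefficients in `M`. -/
theorem Res.exists_cocycle_of_isLocal (P Q : Res R Y) [∀ n, Module.Finite R (P.X n)]
    (hρ : IsCentral ρ) {φ : M →ₗ[R] N} (hφ : IsLocal ρ φ) (n : ℕ) (F : Q.X n →ₗ[R] N)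
    (hF : F ∘ₗ Q.d n = 0) : ∃ (g : G) (U : Q.X n →ₗ[R] M), U ∘ₗ Q.d n = 0 ∧
      Q.IsCob n (φ ∘ₗ U - hρ.smul g N ∘ₗ F) := by
  -- the denominators are cleared on the finitely generated resolution `P`
  obtain ⟨c, hc, hc₀⟩ := exists_lift P Q
  obtain ⟨g, w, hw⟩ := hφ.exists_hom hρ (P.X n) (F ∘ₗ c n)
  have hFd : ∀ x, F (Q.d n x) = 0 := LinearMap.congr_fun hF
  obtain ⟨g', hg'⟩ := hφ.exists_hom_eq_zero hρ (P.X (n + 1)) (w ∘ₗ P.d n) (by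
    rw [← LinearMap.comp_assoc, ← hw]
    refine LinearMap.ext fun x => ?_
    show ρ g • F (c n (P.d n x)) = 0
    rw [← hc, hFd, smul_zero])
  obtain ⟨U, hU, hU'⟩ := exists_cocycle P Q c hc hc₀ n (hρ.smul g' M ∘ₗ w) hg'
  refine ⟨g' * g, U, hU, isCob_of_comp P Q c hc hc₀ n _ ?_ ?_⟩
  · refine LinearMap.ext fun x => ?_
    have := LinearMap.congr_fun hU x
    show φ (U (Q.d n x)) - ρ _ • F (Q.d n x) = 0
    rw [hFd, smul_zero, show U (Q.d n x) = 0 from this, map_zero, sub_zero]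
  · convert hU'.comp φ using 1
    refine LinearMap.ext fun x => ?_
    have h1 : ρ g • F (c n x) = φ (w x) := LinearMap.congr_fun hw x
    show φ (U (c n x)) - ρ (g' * g) • F (c n x) = φ (U (c n x) - ρ g' • w x)
    rw [map_sub, map_smul, ← h1, map_mul, mul_smul]

/-- A class with coefficients in `M` that vanishes in the localization `N` of `M` is killed by some
`ρ g`. -/
theorem Res.exists_isCob_of_isLocal (P Q : Res R Y) [∀ n, Module.Finite R (P.X n)]
    (hρ : IsCentral ρ) {φ : M →ₗ[R] N} (hφ : IsLocal ρ φ) (n : ℕ) (F : Q.X n →ₗ[R] M)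
    (hF : F ∘ₗ Q.d n = 0) (h : Q.IsCob n (φ ∘ₗ F)) :
    ∃ g : G, Q.IsCob n (hρ.smul g M ∘ₗ F) := by
  obtain ⟨c, hc, hc₀⟩ := exists_lift P Q
  have hFd : ∀ x, F (Q.d n x) = 0 := LinearMap.congr_fun hF
  have hcoc : ∀ g, (hρ.smul g M ∘ₗ F) ∘ₗ Q.d n = 0 := fun g => LinearMap.ext fun x => by
    show ρ g • F (Q.d n x) = 0
    rw [hFd, smul_zero]
  have h' := h.precomp c hc
  suffices hh : ∃ g : G, P.IsCob n ((hρ.smul g M ∘ₗ F) ∘ₗ c n) by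
    obtain ⟨g, hg⟩ := hh
    exact ⟨g, isCob_of_comp P Q c hc hc₀ n _ (hcoc g) hg⟩
  cases n with
  | zero =>
    obtain ⟨g, hg⟩ := hφ.exists_hom_eq_zero hρ (P.X 0) (F ∘ₗ c 0) h'
    exact ⟨g, hg⟩
  | succ n =>
    obtain ⟨v, hv⟩ := h'
    obtain ⟨g, w, hw⟩ := hφ.exists_hom hρ (P.X n) v
    obtain ⟨g', hg'⟩ := hφ.exists_hom_eq_zero hρ (P.X (n + 1))
      (hρ.smul g M ∘ₗ F ∘ₗ c (n + 1) - w ∘ₗ P.d n) (LinearMap.ext fun x => by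
        have h1 : φ (F (c (n + 1) x)) = v (P.d n x) := LinearMap.congr_fun hv x
        have h2 : ρ g • v (P.d n x) = φ (w (P.d n x)) := LinearMap.congr_fun hw _
        show φ (ρ g • F (c (n + 1) x) - w (P.d n x)) = 0
        rw [map_sub, map_smul, h1, h2, sub_self])
    refine ⟨g' * g, hρ.smul g' M ∘ₗ w, LinearMap.ext fun x => ?_⟩
    have h3 : ρ g' • (ρ g • F (c (n + 1) x) - w (P.d n x)) = 0 := LinearMap.congr_fun hg' x
    show ρ (g' * g) • F (c (n + 1) x) = ρ g' • w (P.d n x)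
    rw [map_mul, mul_smul, ← sub_eq_zero, ← smul_sub, h3]

end LocalCoefficients

/-! ### Restriction of bimodules along an algebra map -/

section Pull

/-- A `B`-bimodule `N`, viewed as an `A`-bimodule through `L : A → B`. -/
def Pull {k : Type*} [CommRing k] {A : Type*} [Ring A] [Algebra k A] {B : Type*} [Ring B]
    [Algebra k B] (_L : A →ₐ[k] B) (N : Type*) : Type _ := N

variable {k : Type*} [CommRing k] {A : Type*} [Ring A] [Algebra k A] {B : Type*} [Ring B]
  [Algebra k B] (L : A →ₐ[k] B)
  {N : Type*} [AddCommGroup N] [Module k N] [Module B N] [Module Bᵐᵒᵖ N]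
  [SMulCommClass B Bᵐᵒᵖ N] [IsScalarTower k B N] [IsScalarTower k Bᵐᵒᵖ N]

instance : AddCommGroup (Pull L N) := inferInstanceAs (AddCommGroup N)
instance : Module k (Pull L N) := inferInstanceAs (Module k N)
instance : Module A (Pull L N) := Module.compHom N L.toRingHom
instance : Module Aᵐᵒᵖ (Pull L N) := Module.compHom N (RingHom.op L.toRingHom)

variable (N) in
/-- The identity of `N`, as a map to `Pull L N`. -/
def toPull : N ≃ₗ[k] Pull L N := LinearEquiv.refl k N

theorem smul_toPull (a : A) (x : N) : a • toPull L N x = toPull L N (L a • x) := rfl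

theorem op_smul_toPull (a : A) (x : N) :
    MulOpposite.op a • toPull L N x = toPull L N (MulOpposite.op (L a) • x) := rfl

theorem toPull_symm_smul (a : A) (x : Pull L N) :
    (toPull L N).symm (a • x) = L a • (toPull L N).symm x := rfl

theorem toPull_symm_op_smul (a : A) (x : Pull L N) :
    (toPull L N).symm (MulOpposite.op a • x) = MulOpposite.op (L a) • (toPull L N).symm x := rfl

instance : SMulCommClass A Aᵐᵒᵖ (Pull L N) where
  smul_comm a c x := smul_comm (L a) (MulOpposite.op (L c.unop)) (show N from x)

instance : IsScalarTower k A (Pull L N) where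
  smul_assoc c a x := by
    show L (c • a) • (show N from x) = c • (L a • (show N from x))
    rw [map_smul, smul_assoc]

instance : IsScalarTower k Aᵐᵒᵖ (Pull L N) where
  smul_assoc c a x := by
    show MulOpposite.op (L (c • a.unop)) • (show N from x) =
      c • (MulOpposite.op (L a.unop) • (show N from x))
    rw [map_smul, MulOpposite.op_smul, smul_assoc]

/-- The cochain `g ∘ L^{⊗ n}`, with values in `N` viewed as an `A`-bimodule. -/
def pullC (n : ℕ) (g : Cochain k B N n) : Cochain k A (Pull L N) n :=
  (toPull L N).toLinearMap ∘ₗ g ∘ₗ Tmap L n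

theorem pullC_tp (n : ℕ) (g : Cochain k B N n) (a : ℕ → A) :
    pullC L n g (tp k n a) = toPull L N (g (tp k n fun i => L (a i))) :=
  congrArg (fun x => toPull L N (g x)) (Tmap_tp L n a)

theorem d_pullC (n : ℕ) (g : Cochain k B N n) :
    d k A (Pull L N) n (pullC L n g) = pullC L (n + 1) (d k B N n g) := by
  apply hom_ext
  intro a
  have e := d_tp g (fun i => L (a i))
  simp only [← map_merge] at e
  rw [pullC_tp, e, d_tp]
  simp only [pullC_tp, map_add, map_sum, map_zsmul]
  rfl

end Pull

/-! ### The bar resolution relative to an algebra map -/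

section BarModule

/-- `B ⊗ B` as a module over `B ⊗ Bᵒᵖ`, acting through the inner bimodule structure. -/
def Inn (k : Type*) [CommRing k] (B : Type u) [Ring B] [Algebra k B] : Type u := Out k B

variable {k : Type*} [CommRing k] {B : Type u} [Ring B] [Algebra k B]

instance : AddCommGroup (Inn k B) := inferInstanceAs (AddCommGroup (Out k B))
instance : Module k (Inn k B) := inferInstanceAs (Module k (Out k B))

/-- The element `x ⊗ y`. -/
def Inn.tmul (k : Type*) [CommRing k] {B : Type u} [Ring B] [Algebra k B] (x y : B) : Inn k B :=
  Out.tmul k x y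

theorem commute_lTensor_rTensor (a : B) (c : Bᵐᵒᵖ) :
    Commute (((Module.End.lTensorAlgHom k B B).comp (Algebra.lmul k B)) a)
      (((Module.End.rTensorAlgHom k B B).comp (Algebra.lsmul k k B : Bᵐᵒᵖ →ₐ[k] _)) c) :=
  TensorProduct.ext' fun _ _ => rfl

variable (k B) in
/-- The action of `B ⊗ Bᵒᵖ` on `B ⊗ B`: `(a ⊗ c) (x ⊗ y) = x c ⊗ a y`. -/
def innHom : B ⊗[k] Bᵐᵒᵖ →ₐ[k] Module.End k (B ⊗[k] B) :=
  Algebra.TensorProduct.lift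
    ((Module.End.lTensorAlgHom k B B).comp (Algebra.lmul k B))
    ((Module.End.rTensorAlgHom k B B).comp (Algebra.lsmul k k B : Bᵐᵒᵖ →ₐ[k] _))
    commute_lTensor_rTensor

theorem innHom_tmul (a : B) (c : Bᵐᵒᵖ) : innHom k B (a ⊗ₜ[k] c) =
    ((Module.End.lTensorAlgHom k B B).comp (Algebra.lmul k B)) a *
      ((Module.End.rTensorAlgHom k B B).comp (Algebra.lsmul k k B : Bᵐᵒᵖ →ₐ[k] _)) c :=
  Algebra.TensorProduct.lift_tmul _ _ _ _ _

instance : Module (B ⊗[k] Bᵐᵒᵖ) (Inn k B) := Module.compHom (B ⊗[k] B) (innHom k B).toRingHom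

/-- The action of `a ⊗ c` on `B ⊗ B`. -/
def innSmul (a : B) (c : Bᵐᵒᵖ) : Inn k B →ₗ[k] Inn k B :=
  (innerL a ∘ₗ innerR c.unop : Out k B →ₗ[k] Out k B)

theorem innSmul_tmul (a : B) (c : Bᵐᵒᵖ) (x y : B) :
    innSmul a c (Inn.tmul k x y) = Inn.tmul k (x * c.unop) (a * y) := rfl

theorem Inn.smul_eq (a : B) (c : Bᵐᵒᵖ) (m : Inn k B) : (a ⊗ₜ[k] c) • m = innSmul a c m :=
  LinearMap.congr_fun (innHom_tmul a c) m

instance : IsScalarTower k (B ⊗[k] Bᵐᵒᵖ) (Inn k B) where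
  smul_assoc c r m := LinearMap.congr_fun (map_smul (innHom k B) c r) m

theorem Inn.smul_one_tmul_one (r : B ⊗[k] Bᵐᵒᵖ) : r • Inn.tmul k (1 : B) 1 =
    ((TensorProduct.congr (LinearEquiv.refl k B) (MulOpposite.opLinearEquiv k).symm).trans
      (TensorProduct.comm k B B) : B ⊗[k] Bᵐᵒᵖ ≃ₗ[k] B ⊗[k] B) r := by
  induction r using TensorProduct.induction_on with
  | zero => exact (zero_smul (B ⊗[k] Bᵐᵒᵖ) (Inn.tmul k (1 : B) 1)).trans (LinearEquiv.map_zero _).symm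
  | tmul a c =>
    refine (Inn.smul_eq a c _).trans ?_
    rw [innSmul_tmul, mul_one, one_mul]
    rfl
  | add r s hr hs =>
    exact (add_smul r s (Inn.tmul k (1 : B) 1)).trans
      ((congrArg₂ _ hr hs).trans (LinearEquiv.map_add _ r s).symm)

variable (k B) in
/-- `B ⊗ B` with its inner structure is free of rank one. -/
def innEquiv : (B ⊗[k] Bᵐᵒᵖ) ≃ₗ[B ⊗[k] Bᵐᵒᵖ] Inn k B :=
  LinearEquiv.ofBijective (LinearMap.toSpanSingleton (B ⊗[k] Bᵐᵒᵖ) (Inn k B) (Inn.tmul k 1 1)) (by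
    have h := funext (Inn.smul_one_tmul_one (k := k) (B := B))
    have h' : ⇑(LinearMap.toSpanSingleton (B ⊗[k] Bᵐᵒᵖ) (Inn k B) (Inn.tmul k 1 1)) =
      fun r => r • Inn.tmul k (1 : B) 1 := rfl
    rw [h', h]
    exact LinearEquiv.bijective _)

instance : Module.Projective (B ⊗[k] Bᵐᵒᵖ) (Inn k B) :=
  Module.Projective.of_equiv (innEquiv k B)

@[elab_as_elim]
theorem Inn.induction {P : Inn k B → Prop} (z : Inn k B) (zero : P 0)
    (tmul : ∀ x y, P (Inn.tmul k x y)) (add : ∀ z w, P z → P w → P (z + w)) : P z :=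
  TensorProduct.induction_on (motive := P) z zero tmul add

/-- A `k`-linear map commuting with the pure tensors of `B ⊗ Bᵒᵖ` is linear over `B ⊗ Bᵒᵖ`. -/
def linearOfTmul {M N : Type*} [AddCommGroup M] [Module k M] [AddCommGroup N] [Module k N]
    [Module (B ⊗[k] Bᵐᵒᵖ) M] [Module (B ⊗[k] Bᵐᵒᵖ) N] (f : M →ₗ[k] N)
    (h : ∀ (a : B) (c : Bᵐᵒᵖ) m, f ((a ⊗ₜ[k] c) • m) = (a ⊗ₜ[k] c) • f m) :
    M →ₗ[B ⊗[k] Bᵐᵒᵖ] N where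
  toFun := f
  map_add' := f.map_add
  map_smul' r m := by
    rw [RingHom.id_apply]
    induction r using TensorProduct.induction_on with
    | zero =>
      exact (congrArg f (zero_smul (B ⊗[k] Bᵐᵒᵖ) m)).trans
        ((map_zero f).trans (zero_smul (B ⊗[k] Bᵐᵒᵖ) (f m)).symm)
    | tmul a c => exact h a c m
    | add r s hr hs => rw [add_smul, add_smul, map_add, hr, hs]

end BarModule

section BarComplex

variable {k : Type} [CommRing k] {A : Type u} [Ring A] [Algebra k A] {B : Type u} [Ring B]
  [Algebra k B] (L : A →ₐ[k] B)

/-- The modules `(B ⊗ B) ⊗ A^{⊗ n}` of the bar resolution of `B` relative to `L : A → B`. -/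
abbrev BarX (_L : A →ₐ[k] B) (n : ℕ) : Type u := Inn k B ⊗[k] T k A n

variable {L}

theorem BarX.smul_eq {n : ℕ} (a : B) (c : Bᵐᵒᵖ) (z : BarX L n) :
    (a ⊗ₜ[k] c) • z = LinearMap.rTensor (T k A n) (innSmul a c) z := by
  induction z using TensorProduct.induction_on with
  | zero => rw [smul_zero, map_zero]
  | tmul m t => rw [TensorProduct.smul_tmul', Inn.smul_eq, LinearMap.rTensor_tmul]
  | add z w hz hw => rw [smul_add, map_add, hz, hw]

theorem BarX.hom_ext {N : Type*} [AddCommGroup N] [Module k N] {n : ℕ} {f g : BarX L n →ₗ[k] N}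
    (h : ∀ (x y : B) (a : ℕ → A),
      f (Inn.tmul k x y ⊗ₜ tp k n a) = g (Inn.tmul k x y ⊗ₜ tp k n a)) : f = g := by
  apply TensorProduct.ext
  refine LinearMap.ext fun m => Hoch.hom_ext fun a => ?_
  show f (m ⊗ₜ tp k n a) = g (m ⊗ₜ tp k n a)
  induction m using Inn.induction with
  | zero => rw [TensorProduct.zero_tmul, map_zero, map_zero]
  | tmul x y => exact h x y a
  | add z w hz hw => rw [TensorProduct.add_tmul, map_add, map_add, hz, hw]

variable (L)

/-- The differential of the bar resolution relative to `L`, as a `k`-linear map. -/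
def barB (n : ℕ) : BarX L (n + 1) →ₗ[k] BarX L n := b k A (Pull L (Out k B)) n

theorem barB_tmul (n : ℕ) (x y : B) (a : ℕ → A) : barB L n (Inn.tmul k x y ⊗ₜ tp k (n + 1) a) =
    Inn.tmul k x (y * L (a 0)) ⊗ₜ[k] tp k n (shift 1 a) +
      ∑ i ∈ Finset.range n, (-1 : ℤ) ^ (i + 1) • (Inn.tmul k x y ⊗ₜ[k] tp k n (merge i a)) +
      (-1 : ℤ) ^ (n + 1) • (Inn.tmul k (L (a n) * x) y ⊗ₜ[k] tp k n a) :=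
  b_tmul n (toPull L (Out k B) (Out.tmul k x y)) a

/-- The differential of the bar resolution relative to `L`. -/
def barD (n : ℕ) : BarX L (n + 1) →ₗ[B ⊗[k] Bᵐᵒᵖ] BarX L n :=
  linearOfTmul (barB L n) fun a c z => by
    rw [BarX.smul_eq, BarX.smul_eq]
    suffices h : barB L n ∘ₗ LinearMap.rTensor _ (innSmul a c) =
        LinearMap.rTensor _ (innSmul a c) ∘ₗ barB L n from LinearMap.congr_fun h z
    apply BarX.hom_ext
    intro x y t
    simp only [LinearMap.comp_apply, LinearMap.rTensor_tmul, innSmul_tmul, barB_tmul, map_add,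
      map_sum, map_zsmul, mul_assoc]

theorem barD_barD (n : ℕ) (z : BarX L (n + 2)) : barD L n (barD L (n + 1) z) = 0 := by
  have h : ∀ z : Chain k A (Pull L (Out k B)) (n + 2),
      b k A (Pull L (Out k B)) n (b k A (Pull L (Out k B)) (n + 1) z) = 0 := fun z => b_b n z
  exact h z

attribute [local instance] TensorProduct.Algebra.module

variable {N : Type*} [AddCommGroup N] [Module k N] [Module B N] [Module Bᵐᵒᵖ N]
  [SMulCommClass B Bᵐᵒᵖ N] [IsScalarTower k B N] [IsScalarTower k Bᵐᵒᵖ N]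

/-- The linear map `(x ⊗ y) ⊗ a ↦ y f(a) x` as a `k`-linear map. -/
def barHomK {n : ℕ} (f : Cochain k A (Pull L N) n) : BarX L n →ₗ[k] N :=
  TensorProduct.lift (LinearMap.lcomp k N ((toPull L N).symm.toLinearMap ∘ₗ f) ∘ₗ innerAct k B N)

theorem barHomK_tmul {n : ℕ} (f : Cochain k A (Pull L N) n) (x y : B) (t : T k A n) :
    barHomK L f (Inn.tmul k x y ⊗ₜ t) =
      y • (MulOpposite.op x • (toPull L N).symm (f t)) := rfl

/-- The linear map `(x ⊗ y) ⊗ a ↦ y f(a) x` on the bar resolution. -/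
def barHom {n : ℕ} (f : Cochain k A (Pull L N) n) : BarX L n →ₗ[B ⊗[k] Bᵐᵒᵖ] N :=
  linearOfTmul (barHomK L f) fun a c z => by
    rw [BarX.smul_eq]
    suffices h : barHomK L f ∘ₗ LinearMap.rTensor _ (innSmul a c) =
        ((Algebra.lsmul k k N a : N →ₗ[k] N) ∘ₗ (Algebra.lsmul k k N c : N →ₗ[k] N)) ∘ₗ
          barHomK L f from
      (LinearMap.congr_fun h z).trans (TensorProduct.Algebra.smul_def a c _).symm
    apply BarX.hom_ext
    intro x y t
    simp only [LinearMap.comp_apply, LinearMap.rTensor_tmul, innSmul_tmul, barHomK_tmul,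
      Algebra.lsmul_coe, mul_smul, MulOpposite.op_mul, MulOpposite.op_unop]
    rw [smul_comm y c]

theorem barHom_tmul {n : ℕ} (f : Cochain k A (Pull L N) n) (x y : B) (t : T k A n) :
    barHom L f (Inn.tmul k x y ⊗ₜ t) = y • (MulOpposite.op x • (toPull L N).symm (f t)) := rfl

theorem barHom_one {n : ℕ} (f : Cochain k A (Pull L N) n) (t : T k A n) :
    barHom L f (Inn.tmul k 1 1 ⊗ₜ t) = (toPull L N).symm (f t) := by
  rw [barHom_tmul, MulOpposite.op_one, one_smul, one_smul]

theorem barHom_ext {n : ℕ} {F F' : BarX L n →ₗ[B ⊗[k] Bᵐᵒᵖ] N}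
    (h : ∀ t, F (Inn.tmul k 1 1 ⊗ₜ t) = F' (Inn.tmul k 1 1 ⊗ₜ t)) : F = F' := by
  refine LinearMap.ext fun z => ?_
  induction z using TensorProduct.induction_on with
  | zero => rw [map_zero, map_zero]
  | tmul m t =>
    obtain ⟨r, rfl⟩ := (innEquiv k B).surjective m
    have e : innEquiv k B r ⊗ₜ[k] t = r • (Inn.tmul k 1 1 ⊗ₜ[k] t : BarX L n) :=
      (TensorProduct.smul_tmul' r _ t).symm
    rw [e, map_smul, map_smul, h]
  | add z w hz hw => rw [map_add, map_add, hz, hw]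

theorem barHom_injective {n : ℕ} {f g : Cochain k A (Pull L N) n} (h : barHom L f = barHom L g) :
    f = g := by
  refine LinearMap.ext fun t => (toPull L N).symm.injective ?_
  rw [← barHom_one, h, barHom_one]

theorem barHom_sub {n : ℕ} (f g : Cochain k A (Pull L N) n) :
    barHom L (f - g) = barHom L f - barHom L g :=
  barHom_ext L fun t => by
    rw [LinearMap.sub_apply, barHom_one, barHom_one, barHom_one, LinearMap.sub_apply, map_sub]

theorem barHom_zero {n : ℕ} : barHom L (0 : Cochain k A (Pull L N) n) = 0 :=
  barHom_ext L fun t => by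
    rw [LinearMap.zero_apply, barHom_one, LinearMap.zero_apply, map_zero]

/-- Cochains are the same as bimodule maps out of the bar resolution, being determined on `(1 ⊗ 1) ⊗
a`. -/
theorem exists_barHom {n : ℕ} (F : BarX L n →ₗ[B ⊗[k] Bᵐᵒᵖ] N) :
    ∃ f : Cochain k A (Pull L N) n, barHom L f = F := by
  have hF : ∀ (c : k) z, F (c • z) = c • F z := by
    intro c z
    have h1 : c • z = (algebraMap k (B ⊗[k] Bᵐᵒᵖ) c) • z := by
      rw [algebraMap_smul]
    rw [h1, map_smul, Algebra.TensorProduct.algebraMap_apply, TensorProduct.Algebra.smul_def,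
      one_smul, algebraMap_smul]
  refine ⟨(toPull L N).toLinearMap ∘ₗ ⟨⟨fun t => F (Inn.tmul k 1 1 ⊗ₜ t), fun t t' => ?_⟩,
    fun c t => ?_⟩, barHom_ext L fun t => ?_⟩
  · rw [TensorProduct.tmul_add, map_add]
  · show F (Inn.tmul k 1 1 ⊗ₜ[k] (c • t)) = c • F (Inn.tmul k 1 1 ⊗ₜ[k] t)
    rw [TensorProduct.tmul_smul, hF]
  · exact barHom_one L _ t

/-- The Hochschild complex of `A` with coefficients in `N` is `Hom(P, N)` for the bar resolution `P`
of `B` relative to `L`. -/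
theorem barHom_d {n : ℕ} (f : Cochain k A (Pull L N) n) :
    barHom L (d k A (Pull L N) n f) = barHom L f ∘ₗ barD L n := by
  refine LinearMap.ext fun z => ?_
  show barHomK L (d k A (Pull L N) n f) z = barHomK L f (barB L n z)
  suffices h : barHomK L (d k A (Pull L N) n f) = barHomK L f ∘ₗ barB L n from
    LinearMap.congr_fun h z
  apply BarX.hom_ext
  intro x y a
  simp only [LinearMap.comp_apply, barB_tmul, map_add, map_sum, map_zsmul, barHomK_tmul, d_tp,
    smul_add, Finset.smul_sum, mul_smul, MulOpposite.op_mul, toPull_symm_smul,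
    toPull_symm_op_smul]
  congr 1
  · congr 1
    · rw [← smul_comm (L (a 0))]
    · refine Finset.sum_congr rfl fun i _ => ?_
      rw [smul_comm (MulOpposite.op x), smul_comm y]
  · rw [smul_comm (MulOpposite.op x), smul_comm y]

/-- The augmentation `(x ⊗ y) ↦ y x`. -/
def barε : BarX L 0 →ₗ[B ⊗[k] Bᵐᵒᵖ] B := barHom L (constC (toPull L B 1))

theorem barε_tmul (x y : B) (t : ℕ → A) : barε L (Inn.tmul k x y ⊗ₜ tp k 0 t) = y * x := by
  rw [barε, barHom_tmul, constC_tp, LinearEquiv.symm_apply_apply, smul_eq_mul,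
    MulOpposite.smul_eq_mul_unop, MulOpposite.unop_op, one_mul]

theorem barε_barD (z : BarX L 1) : barε L (barD L 0 z) = 0 := by
  have h : d k A (Pull L B) 0 (constC (toPull L B 1)) = 0 := by
    apply hom_ext
    intro a
    have e : L (a 0) • (1 : B) = MulOpposite.op (L (a 0)) • (1 : B) := by
      rw [smul_eq_mul, mul_one, MulOpposite.smul_eq_mul_unop, MulOpposite.unop_op, one_mul]
    rw [d_tp, constC_tp, constC_tp, smul_toPull, op_smul_toPull, e]
    simp
  have := LinearMap.congr_fun (barHom_d L (constC (toPull L B 1))) z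
  rw [h, barHom_zero] at this
  exact this.symm

theorem barε_surjective : Function.Surjective (barε L) := fun x =>
  ⟨Inn.tmul k x 1 ⊗ₜ tp k 0 fun _ => 0, by rw [barε_tmul, one_mul]⟩

end BarComplex

section BarRes

variable {k : Type} [Field k] {A : Type u} [Ring A] [Algebra k A] {B : Type u} [Ring B]
  [Algebra k B] (L : A →ₐ[k] B)

attribute [local instance] TensorProduct.Algebra.module

/-- Exactness of the bar complex relative to `L`. -/
structure BarExact : Prop where
  exact : ∀ n z, barD L n z = 0 → ∃ w, barD L (n + 1) w = z
  exact₀ : ∀ z, barε L z = 0 → ∃ w, barD L 0 w = z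

/-- The bar resolution of `B` relative to `L : A → B`. -/
def barRes (h : BarExact L) : Res (B ⊗[k] Bᵐᵒᵖ) B where
  X := BarX L
  proj n := inferInstanceAs (Module.Projective (B ⊗[k] Bᵐᵒᵖ) (Inn k B ⊗[k] T k A n))
  d := barD L
  ε := barε L
  d_d := barD_barD L
  ε_d := barε_barD L
  exact := h.exact
  exact₀ := h.exact₀
  surj := barε_surjective L

/-- Relative to the identity, the complex is the bar complex of `A`, which is contractible. -/
theorem barExact_id : BarExact (AlgHom.id k A) where
  exact n z hz := bar_exact n z hz
  exact₀ z hz := by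
    refine bar_exact_zero z (Eq.trans ?_ hz)
    suffices h : barAug k A = barHomK (AlgHom.id k A) (constC (toPull (AlgHom.id k A) A 1)) from
      LinearMap.congr_fun h z
    apply out_chain_ext
    intro x y a
    exact (barAug_tmul _ a).trans (barε_tmul (AlgHom.id k A) x y a).symm

end BarRes

/-! ### Localization of tensor products -/

section LocMap

variable {k : Type*} [Field k] {G : Type*} [CommMonoid G] {H : Type*} [CommMonoid H]
  {M : Type*} [AddCommGroup M] [Module k M] {N : Type*} [AddCommGroup N] [Module k N]
  {M' : Type*} [AddCommGroup M'] [Module k M'] {N' : Type*} [AddCommGroup N'] [Module k N']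

/-- A linear map, equivariant for the actions of a commutative monoid `G`, which up to the action
of `G` is surjective and injective. -/
structure LocMap (e : G →* Module.End k M) (e' : G →* Module.End k N) (φ : M →ₗ[k] N) : Prop where
  comm : ∀ g m, φ (e g m) = e' g (φ m)
  surj : ∀ y, ∃ g x, e' g y = φ x
  inj : ∀ x, φ x = 0 → ∃ g, e g x = 0

theorem LocMap.refl (M : Type*) [AddCommGroup M] [Module k M] :
    LocMap (1 : G →* Module.End k M) 1 (LinearMap.id : M →ₗ[k] M) where
  comm _ _ := rfl
  surj y := ⟨1, y, rfl⟩
  inj _ hx := ⟨1, hx⟩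

/-- An element of the kernel of `φ ⊗ C` involves finitely many elements of the kernel of `φ`; one
`g` kills them all. -/
theorem exists_rTensor_eq_zero (e : G →* Module.End k M) {φ : M →ₗ[k] N}
    (h : ∀ m, φ m = 0 → ∃ g, e g m = 0) (C : Type*) [AddCommGroup C] [Module k C] (x : M ⊗[k] C)
    (hx : φ.rTensor C x = 0) : ∃ g, (e g).rTensor C x = 0 := by
  -- over a field the kernel of `φ ⊗ C` is spanned by the tensors `m ⊗ c` with `φ m = 0`
  obtain ⟨y, rfl⟩ := (Module.Flat.rTensor_exact C
    (f := (LinearMap.ker φ).subtype) (g := φ) (LinearMap.exact_subtype_ker_map φ) x).1 hx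
  clear hx
  induction y using TensorProduct.induction_on with
  | zero => exact ⟨1, by rw [map_zero, map_zero]⟩
  | tmul m c =>
    obtain ⟨g, hg⟩ := h m m.2
    exact ⟨g, by rw [LinearMap.rTensor_tmul, LinearMap.rTensor_tmul, Submodule.subtype_apply, hg,
      TensorProduct.zero_tmul]⟩
  | add y z hy hz =>
    obtain ⟨g, hg⟩ := hy
    obtain ⟨g', hg'⟩ := hz
    refine ⟨g * g', ?_⟩
    rw [map_add, map_add]
    conv_lhs => enter [2]; rw [map_mul, Module.End.mul_eq_comp, LinearMap.rTensor_comp_apply, hg',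
      map_zero]
    rw [mul_comm, map_mul, Module.End.mul_eq_comp, LinearMap.rTensor_comp_apply, hg, map_zero,
      add_zero]

/-- The action of a product of monoids on a tensor product. -/
def tensorEnd (e : G →* Module.End k M) (f : H →* Module.End k M') :
    G × H →* Module.End k (M ⊗[k] M') where
  toFun g := TensorProduct.map (e g.1) (f g.2)
  map_one' := by
    rw [Prod.fst_one, Prod.snd_one, map_one, map_one]
    exact TensorProduct.map_id
  map_mul' g h := by
    rw [Prod.fst_mul, Prod.snd_mul, map_mul, map_mul]
    exact TensorProduct.map_comp _ _ _ _

theorem tensorEnd_tmul (e : G →* Module.End k M) (f : H →* Module.End k M') (g : G × H) (m : M)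
    (m' : M') : tensorEnd e f g (m ⊗ₜ m') = e g.1 m ⊗ₜ f g.2 m' := rfl

theorem LocMap.map_tensorEnd {e : G →* Module.End k M} {e' : G →* Module.End k N} {φ : M →ₗ[k] N}
    (hφ : LocMap e e' φ) {f : H →* Module.End k M'} {f' : H →* Module.End k N'} {ψ : M' →ₗ[k] N'}
    (hψ : LocMap f f' ψ) (g : G × H) (m : M ⊗[k] M') :
    TensorProduct.map φ ψ (tensorEnd e f g m) = tensorEnd e' f' g (TensorProduct.map φ ψ m) := by
  suffices h : TensorProduct.map φ ψ ∘ₗ tensorEnd e f g =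
      tensorEnd e' f' g ∘ₗ TensorProduct.map φ ψ from LinearMap.congr_fun h m
  refine TensorProduct.ext' fun x y => ?_
  simp only [LinearMap.comp_apply, tensorEnd_tmul, TensorProduct.map_tmul, hφ.comm, hψ.comm]

theorem LocMap.tensor {e : G →* Module.End k M} {e' : G →* Module.End k N} {φ : M →ₗ[k] N}
    (hφ : LocMap e e' φ) {f : H →* Module.End k M'} {f' : H →* Module.End k N'} {ψ : M' →ₗ[k] N'}
    (hψ : LocMap f f' ψ) : LocMap (tensorEnd e f) (tensorEnd e' f') (TensorProduct.map φ ψ) where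
  comm := hφ.map_tensorEnd hψ
  surj z := by
    induction z using TensorProduct.induction_on with
    | zero => exact ⟨1, 0, by rw [map_zero, map_zero]⟩
    | tmul x y =>
      obtain ⟨g, m, hm⟩ := hφ.surj x
      obtain ⟨h, m', hm'⟩ := hψ.surj y
      exact ⟨(g, h), m ⊗ₜ m', by rw [tensorEnd_tmul, hm, hm', TensorProduct.map_tmul]⟩
    | add z w hz hw =>
      obtain ⟨g, x, hx⟩ := hz
      obtain ⟨h, y, hy⟩ := hw
      have hc := hφ.map_tensorEnd hψ
      refine ⟨h * g, tensorEnd e f h x + tensorEnd e f g y, ?_⟩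
      rw [map_add, map_add, hc, hc, ← hx, ← hy]
      congr 1
      · rw [map_mul]
        rfl
      · rw [mul_comm, map_mul]
        rfl
  inj x hx := by
    have h1 : φ.rTensor N' (ψ.lTensor M x) = 0 := by
      rw [← LinearMap.comp_apply, LinearMap.rTensor_comp_lTensor]
      exact hx
    obtain ⟨g, hg⟩ := exists_rTensor_eq_zero e hφ.inj N' _ h1
    have h2 : ψ.lTensor M ((e g).rTensor M' x) = 0 := by
      rw [← LinearMap.comp_apply, LinearMap.lTensor_comp_rTensor,
        ← LinearMap.rTensor_comp_lTensor]
      exact hg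
    have h3 : ψ.rTensor M (TensorProduct.comm k M M' ((e g).rTensor M' x)) = 0 := by
      rw [LinearMap.rTensor_comm, h2, map_zero]
    obtain ⟨h, hh⟩ := exists_rTensor_eq_zero f hψ.inj M _ h3
    refine ⟨(g, h), ?_⟩
    rw [LinearMap.rTensor_comm] at hh
    have h4 := (TensorProduct.comm k M M').map_eq_zero_iff.1 hh
    rw [← LinearMap.comp_apply, LinearMap.lTensor_comp_rTensor] at h4
    exact h4

end LocMap

/-! ### Restriction of cochains is an isomorphism in cohomology -/

section Comparison

variable {k : Type} [Field k] {A : Type u} [Ring A] [Algebra k A] {B : Type u} [Ring B]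
  [Algebra k B] {L : A →ₐ[k] B}
  {N : Type*} [AddCommGroup N] [Module k N] [Module B N] [Module Bᵐᵒᵖ N]
  [SMulCommClass B Bᵐᵒᵖ N] [IsScalarTower k B N] [IsScalarTower k Bᵐᵒᵖ N]

attribute [local instance] TensorProduct.Algebra.module

theorem isCob_barHom_iff (h : BarExact L) {n : ℕ} (f : Cochain k A (Pull L N) n) :
    (barRes L h).IsCob n (barHom L f) ↔ f ∈ coboundaries k A (Pull L N) n := by
  cases n with
  | zero =>
    constructor
    · intro hf
      exact barHom_injective L (hf.trans (barHom_zero L).symm)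
    · intro hf
      have hf' : f = 0 := hf
      show barHom L f = 0
      rw [hf', barHom_zero]
  | succ n =>
    constructor
    · rintro ⟨v, hv⟩
      obtain ⟨g, rfl⟩ := exists_barHom L v
      exact ⟨g, barHom_injective L ((barHom_d L g).trans hv.symm)⟩
    · rintro ⟨g, rfl⟩
      exact ⟨barHom L g, barHom_d L g⟩

theorem barHom_comp_barD_eq_zero_iff {n : ℕ} (f : Cochain k A (Pull L N) n) :
    barHom L f ∘ₗ barD L n = 0 ↔ d k A (Pull L N) n f = 0 := by
  rw [← barHom_d]
  exact ⟨fun h => barHom_injective L (h.trans (barHom_zero L).symm), fun h => by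
    rw [h, barHom_zero]⟩

variable (L) in
/-- The map of bar resolutions induced by `L^{⊗ n}`. -/
def barMap (n : ℕ) : BarX L n →ₗ[B ⊗[k] Bᵐᵒᵖ] BarX (AlgHom.id k B) n :=
  linearOfTmul ((Tmap L n).lTensor (Inn k B)) fun a c z => by
    rw [BarX.smul_eq, BarX.smul_eq, ← LinearMap.comp_apply, ← LinearMap.comp_apply,
      LinearMap.lTensor_comp_rTensor, LinearMap.rTensor_comp_lTensor]

theorem barMap_tmul (n : ℕ) (m : Inn k B) (t : T k A n) :
    barMap L n (m ⊗ₜ t) = m ⊗ₜ Tmap L n t := rfl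

theorem barD_barMap (n : ℕ) (z : BarX L (n + 1)) :
    barD (AlgHom.id k B) n (barMap L (n + 1) z) = barMap L n (barD L n z) := by
  show barB (AlgHom.id k B) n ((Tmap L (n + 1)).lTensor (Inn k B) z) =
    (Tmap L n).lTensor (Inn k B) (barB L n z)
  suffices h : barB (AlgHom.id k B) n ∘ₗ (Tmap L (n + 1)).lTensor (Inn k B) =
      (Tmap L n).lTensor (Inn k B) ∘ₗ barB L n from LinearMap.congr_fun h z
  apply BarX.hom_ext
  intro x y a
  simp only [LinearMap.comp_apply, LinearMap.lTensor_tmul, Tmap_tp, barB_tmul, map_add, map_sum,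
    map_zsmul, map_merge, AlgHom.id_apply]
  rfl

theorem barε_barMap (z : BarX L 0) : barε (AlgHom.id k B) (barMap L 0 z) = barε L z := by
  show barHomK (AlgHom.id k B) (constC (toPull (AlgHom.id k B) B 1))
    ((Tmap L 0).lTensor (Inn k B) z) = barHomK L (constC (toPull L B 1)) z
  suffices h : barHomK (AlgHom.id k B) (constC (toPull (AlgHom.id k B) B 1)) ∘ₗ
      (Tmap L 0).lTensor (Inn k B) = barHomK L (constC (toPull L B 1)) from
    LinearMap.congr_fun h z
  apply BarX.hom_ext
  intro x y a
  simp only [LinearMap.comp_apply, LinearMap.lTensor_tmul, Tmap_tp]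
  exact (barε_tmul (AlgHom.id k B) x y _).trans (barε_tmul L x y a).symm

/-- A cochain with coefficients in `N`, seen as one with coefficients in `N` restricted along the
identity. -/
def idC {n : ℕ} (g : Cochain k B N n) : Cochain k B (Pull (AlgHom.id k B) N) n :=
  (toPull (AlgHom.id k B) N).toLinearMap ∘ₗ g

theorem d_idC {n : ℕ} (g : Cochain k B N n) :
    d k B (Pull (AlgHom.id k B) N) n (idC g) = idC (d k B N n g) :=
  d_comp _ (fun _ _ => rfl) (fun _ _ => rfl) n g

theorem idC_injective {n : ℕ} : Function.Injective (idC : Cochain k B N n → _) := fun _ _ h =>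
  LinearMap.ext fun t => (toPull (AlgHom.id k B) N).injective (LinearMap.congr_fun h t)

theorem exists_idC {n : ℕ} (f : Cochain k B (Pull (AlgHom.id k B) N) n) : ∃ g, idC g = f :=
  ⟨(toPull (AlgHom.id k B) N).symm.toLinearMap ∘ₗ f, rfl⟩

theorem idC_mem_coboundaries_iff {n : ℕ} (g : Cochain k B N n) :
    idC g ∈ coboundaries k B (Pull (AlgHom.id k B) N) n ↔ g ∈ coboundaries k B N n := by
  cases n with
  | zero => exact ⟨fun h => idC_injective (show idC g = idC 0 from h), fun h => congrArg idC h⟩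
  | succ n =>
    constructor
    · rintro ⟨v, hv⟩
      obtain ⟨v, rfl⟩ := exists_idC v
      exact ⟨v, idC_injective ((d_idC v).symm.trans hv)⟩
    · rintro ⟨v, rfl⟩
      exact ⟨idC v, d_idC v⟩

theorem d_idC_eq_zero_iff {n : ℕ} (g : Cochain k B N n) :
    d k B (Pull (AlgHom.id k B) N) n (idC g) = 0 ↔ d k B N n g = 0 := by
  rw [d_idC]
  exact ⟨fun h => idC_injective h, fun h => congrArg idC h⟩

theorem barHom_idC_comp_barMap {n : ℕ} (g : Cochain k B N n) :
    barHom (AlgHom.id k B) (idC g) ∘ₗ barMap L n = barHom L (pullC L n g) :=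
  barHom_ext L fun t => by
    rw [LinearMap.comp_apply, barMap_tmul, barHom_one, barHom_one]
    rfl

/-- Surjectivity of `HHⁿ(B, N) → HHⁿ(A, N)`: the bar resolution of `B` relative to `L` and the one
relative to the identity both resolve `B`. -/
theorem exists_pullC (h : BarExact L) {n : ℕ} (f : Cochain k A (Pull L N) n)
    (hf : d k A (Pull L N) n f = 0) : ∃ g : Cochain k B N n, d k B N n g = 0 ∧
      pullC L n g - f ∈ coboundaries k A (Pull L N) n := by
  obtain ⟨F, hF, hF'⟩ := Res.exists_cocycle (barRes L h) (barRes _ barExact_id) (barMap L)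
    barD_barMap barε_barMap n (barHom L f) ((barHom_comp_barD_eq_zero_iff f).2 hf)
  obtain ⟨g, rfl⟩ := exists_barHom (AlgHom.id k B) F
  obtain ⟨g, rfl⟩ := exists_idC g
  refine ⟨g, (d_idC_eq_zero_iff g).1 ((barHom_comp_barD_eq_zero_iff _).1 hF), ?_⟩
  rw [← isCob_barHom_iff h, barHom_sub, ← barHom_idC_comp_barMap]
  exact hF'

/-- Injectivity of `HHⁿ(B, N) → HHⁿ(A, N)`, by the same comparison of resolutions. -/
theorem mem_coboundaries_of_pullC (h : BarExact L) {n : ℕ} (g : Cochain k B N n)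
    (hg : d k B N n g = 0) (hg' : pullC L n g ∈ coboundaries k A (Pull L N) n) :
    g ∈ coboundaries k B N n := by
  rw [← idC_mem_coboundaries_iff, ← isCob_barHom_iff barExact_id]
  refine Res.isCob_of_comp (barRes L h) (barRes _ barExact_id) (barMap L) barD_barMap barε_barMap
    n _ ((barHom_comp_barD_eq_zero_iff _).2 ((d_idC_eq_zero_iff g).2 hg)) ?_
  exact (congrArg ((barRes L h).IsCob n) (barHom_idC_comp_barMap (L := L) g)).mpr
    ((isCob_barHom_iff h _).2 hg')

end Comparison

/-! ### Localization of an algebra at central elements -/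

section CentralAlgebra

variable {k : Type} [Field k] {A : Type u} [Ring A] [Algebra k A] {B : Type u} [Ring B]
  [Algebra k B] {S : Submonoid (Subalgebra.center k A)} {L : A →ₐ[k] B}

/-- The algebra map `L` is the localization at the multiplicative subset `S` of the centre. -/
structure IsCentralLoc (S : Submonoid (Subalgebra.center k A)) (L : A →ₐ[k] B) : Prop where
  isUnit : ∀ s : S, IsUnit (L ((s : Subalgebra.center k A) : A))
  comm : ∀ (s : S) (b : B), L ((s : Subalgebra.center k A) : A) * b =
    b * L ((s : Subalgebra.center k A) : A)
  surj : ∀ b : B, ∃ (s : S) (a : A), L ((s : Subalgebra.center k A) : A) * b = L a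
  inj : ∀ a : A, L a = 0 → ∃ s : S, ((s : Subalgebra.center k A) : A) * a = 0

variable (S) in
/-- The elements of `S`, in the opposite algebra. -/
def opElt : S →* Aᵐᵒᵖ where
  toFun s := MulOpposite.op ((s : Subalgebra.center k A) : A)
  map_one' := rfl
  map_mul' s t := by
    rw [← MulOpposite.op_mul, ← center_comm]
    rfl

variable (S) in
/-- The elements `s ⊗ t`, `s, t ∈ S`, of the enveloping algebra. -/
def envElt : S × S →* A ⊗[k] Aᵐᵒᵖ where
  toFun g := ((g.1 : Subalgebra.center k A) : A) ⊗ₜ opElt S g.2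
  map_one' := by
    rw [Prod.snd_one, map_one]
    rfl
  map_mul' g h := by
    rw [Algebra.TensorProduct.tmul_mul_tmul, ← map_mul]
    rfl

theorem envElt_apply (g : S × S) : envElt S g =
    ((g.1 : Subalgebra.center k A) : A) ⊗ₜ
      MulOpposite.op ((g.2 : Subalgebra.center k A) : A) := rfl

theorem isCentral_envElt : IsCentral (envElt S) := fun g r => by
  induction r using TensorProduct.induction_on with
  | zero => rw [mul_zero, zero_mul]
  | tmul a c =>
    rw [envElt_apply, Algebra.TensorProduct.tmul_mul_tmul, Algebra.TensorProduct.tmul_mul_tmul,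
      center_comm]
    congr 1
    exact congrArg MulOpposite.op (center_comm _ c.unop).symm
  | add r r' h h' => rw [mul_add, add_mul, h, h']

variable (L) in
/-- The map of enveloping algebras induced by `L`. -/
def envMap : A ⊗[k] Aᵐᵒᵖ →+* B ⊗[k] Bᵐᵒᵖ := (Algebra.TensorProduct.map L (AlgHom.op L)).toRingHom

theorem envMap_tmul (a : A) (c : Aᵐᵒᵖ) :
    envMap L (a ⊗ₜ[k] c) = L a ⊗ₜ[k] MulOpposite.op (L c.unop) := rfl

theorem envMap_id (r : A ⊗[k] Aᵐᵒᵖ) : envMap (AlgHom.id k A) r = r := by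
  induction r using TensorProduct.induction_on with
  | zero => exact map_zero _
  | tmul a c => rfl
  | add x y hx hy => rw [map_add, hx, hy]

theorem IsCentralLoc.isUnit_env (h : IsCentralLoc S L) (g : S × S) :
    IsUnit (envMap L (envElt S g)) := by
  rw [envElt_apply, envMap_tmul]
  obtain ⟨u, hu⟩ := h.isUnit g.1
  obtain ⟨v, hv⟩ := h.isUnit g.2
  refine ⟨⟨L ((g.1 : Subalgebra.center k A) : A) ⊗ₜ[k]
    MulOpposite.op (L ((g.2 : Subalgebra.center k A) : A)),
    (↑u⁻¹ : B) ⊗ₜ[k] MulOpposite.op (↑v⁻¹ : B), ?_, ?_⟩, rfl⟩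
  · rw [Algebra.TensorProduct.tmul_mul_tmul, ← MulOpposite.op_mul, ← hu, ← hv, Units.mul_inv,
      Units.inv_mul]
    rfl
  · rw [Algebra.TensorProduct.tmul_mul_tmul, ← MulOpposite.op_mul, ← hu, ← hv, Units.mul_inv,
      Units.inv_mul]
    rfl

variable (S L) in
/-- The action of `S` on `B` by multiplication. -/
def mulEnd : S →* Module.End k B where
  toFun s := Algebra.lmul k B (L ((s : Subalgebra.center k A) : A))
  map_one' := by
    rw [← map_one (Algebra.lmul k B), ← map_one L]
    rfl
  map_mul' s t := by
    rw [← map_mul, ← map_mul]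
    rfl

variable (S L) in
/-- The action of `S` on the opposite algebra of `B` by multiplication. -/
def opMulEnd : S →* Module.End k Bᵐᵒᵖ where
  toFun s := Algebra.lmul k Bᵐᵒᵖ (AlgHom.op L (opElt S s))
  map_one' := by rw [map_one, map_one, map_one]
  map_mul' s t := by rw [map_mul, map_mul, map_mul]

theorem IsCentralLoc.locMap (h : IsCentralLoc S L) :
    LocMap (mulEnd S (AlgHom.id k A)) (mulEnd S L) L.toLinearMap where
  comm _ a := map_mul L _ a
  surj := h.surj
  inj := h.inj

theorem IsCentralLoc.opLocMap (h : IsCentralLoc S L) :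
    LocMap (opMulEnd S (AlgHom.id k A)) (opMulEnd S L) (AlgHom.op L).toLinearMap where
  comm _ a := congrArg MulOpposite.op (map_mul L a.unop _)
  surj b := by
    obtain ⟨s, a, ha⟩ := h.surj b.unop
    exact ⟨s, MulOpposite.op a, congrArg MulOpposite.op ((h.comm s b.unop).symm.trans ha)⟩
  inj a ha := by
    obtain ⟨s, hs⟩ := h.inj a.unop (congrArg MulOpposite.unop ha)
    exact ⟨s, congrArg MulOpposite.op ((center_comm _ a.unop).symm.trans hs)⟩

/-- The enveloping algebra of the localization is the localization of the enveloping algebra at the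
elements `s ⊗ t`. -/
theorem IsCentralLoc.isLocal_env (h : IsCentralLoc S L) :
    IsLocal (envElt S) (ringSemilinear (envMap L)) := by
  have key : ∀ {C : Type u} [Ring C] [Algebra k C] (L : A →ₐ[k] C) (g : S × S) (x : C ⊗[k] Cᵐᵒᵖ),
      tensorEnd (mulEnd S L) (opMulEnd S L) g x = envMap L (envElt S g) * x := by
    intro C _ _ L g x
    induction x using TensorProduct.induction_on with
    | zero => rw [map_zero, mul_zero]
    | tmul a c =>
      rw [tensorEnd_tmul, envElt_apply, envMap_tmul, Algebra.TensorProduct.tmul_mul_tmul]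
      rfl
    | add x y hx hy => rw [map_add, mul_add, hx, hy]
  have hl := h.locMap.tensor h.opLocMap
  constructor
  · intro y
    obtain ⟨g, x, hx⟩ := hl.surj y
    exact ⟨g, x, (key L g y).symm.trans hx⟩
  · intro x hx
    obtain ⟨g, hg⟩ := hl.inj x hx
    exact ⟨g, by rw [smul_eq_mul, ← envMap_id (envElt S g), ← key, hg]⟩

/-- A `k`-linear map that intertwines the pure tensors of the enveloping algebras is semilinear. -/
def semilinearOfTmul {M N : Type*} [AddCommGroup M] [Module k M] [AddCommGroup N] [Module k N]
    [Module (A ⊗[k] Aᵐᵒᵖ) M] [Module (B ⊗[k] Bᵐᵒᵖ) N] (f : M →ₗ[k] N)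
    (h : ∀ (a : A) (c : Aᵐᵒᵖ) m, f ((a ⊗ₜ[k] c) • m) =
      (L a ⊗ₜ[k] MulOpposite.op (L c.unop)) • f m) : M →ₛₗ[envMap L] N where
  toFun := f
  map_add' := f.map_add
  map_smul' r m := by
    induction r using TensorProduct.induction_on with
    | zero =>
      rw [map_zero]
      exact (congrArg f (zero_smul (A ⊗[k] Aᵐᵒᵖ) m)).trans
        ((map_zero f).trans (zero_smul (B ⊗[k] Bᵐᵒᵖ) (f m)).symm)
    | tmul a c => exact h a c m
    | add r s hr hs => rw [map_add, add_smul, add_smul, map_add, hr, hs]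

variable (L) in
/-- The map `L ⊗ L`. -/
def innMap : Inn k A →ₗ[k] Inn k B :=
  (TensorProduct.map L.toLinearMap L.toLinearMap : A ⊗[k] A →ₗ[k] B ⊗[k] B)

theorem innMap_tmul (x y : A) : innMap L (Inn.tmul k x y) = Inn.tmul k (L x) (L y) := rfl

theorem innMap_innSmul (a : A) (c : Aᵐᵒᵖ) (m : Inn k A) :
    innMap L (innSmul a c m) = innSmul (L a) (MulOpposite.op (L c.unop)) (innMap L m) := by
  induction m using Inn.induction with
  | zero => rw [map_zero, map_zero, map_zero]
  | tmul x y => rw [innSmul_tmul, innMap_tmul, innMap_tmul, innSmul_tmul, map_mul, map_mul]; rfl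
  | add z w hz hw => rw [map_add, map_add, map_add, map_add, hz, hw]

variable (L) in
/-- The localization map of bar resolutions. -/
def barLoc (n : ℕ) : BarX (AlgHom.id k A) n →ₛₗ[envMap L] BarX L n :=
  semilinearOfTmul ((innMap L).rTensor (T k A n)) fun a c m => by
    rw [BarX.smul_eq, BarX.smul_eq]
    induction m using TensorProduct.induction_on with
    | zero => simp only [map_zero]
    | tmul m t => simp only [LinearMap.rTensor_tmul, innMap_innSmul]
    | add z w hz hw => simp only [map_add, hz, hw]

theorem barD_barLoc (n : ℕ) (z : BarX (AlgHom.id k A) (n + 1)) :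
    barD L n (barLoc L (n + 1) z) = barLoc L n (barD (AlgHom.id k A) n z) := by
  show barB L n ((innMap L).rTensor _ z) = (innMap L).rTensor _ (barB (AlgHom.id k A) n z)
  suffices h : barB L n ∘ₗ (innMap L).rTensor _ =
      (innMap L).rTensor _ ∘ₗ barB (AlgHom.id k A) n from LinearMap.congr_fun h z
  apply BarX.hom_ext
  intro x y a
  simp only [LinearMap.comp_apply, LinearMap.rTensor_tmul, innMap_tmul, barB_tmul, map_add,
    map_sum, map_zsmul, AlgHom.id_apply, map_mul]

theorem barε_barLoc (z : BarX (AlgHom.id k A) 0) :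
    barε L (barLoc L 0 z) = L (barε (AlgHom.id k A) z) := by
  show barHomK L (constC (toPull L B 1)) ((innMap L).rTensor _ z) =
    L.toLinearMap (barHomK (AlgHom.id k A) (constC (toPull (AlgHom.id k A) A 1)) z)
  suffices h : barHomK L (constC (toPull L B 1)) ∘ₗ (innMap L).rTensor _ =
      L.toLinearMap ∘ₗ barHomK (AlgHom.id k A) (constC (toPull (AlgHom.id k A) A 1)) from
    LinearMap.congr_fun h z
  apply BarX.hom_ext
  intro x y a
  simp only [LinearMap.comp_apply, LinearMap.rTensor_tmul, innMap_tmul]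
  refine (barε_tmul L (L x) (L y) a).trans ?_
  rw [← map_mul]
  exact congrArg L (barε_tmul (AlgHom.id k A) x y a).symm

/-- The action of `s ⊗ t` on `x ⊗ y` is `t` on `x` and `s` on `y`, the bimodule structure being the
inner one; hence the exchange of the components of `g`. -/
theorem IsCentralLoc.isLocal_barLoc (h : IsCentralLoc S L) (n : ℕ) :
    IsLocal (envElt S) (barLoc L n) := by
  have key : ∀ {C : Type u} [Ring C] [Algebra k C] (L : A →ₐ[k] C)
      (hL : ∀ (s : S) (b : C), L ((s : Subalgebra.center k A) : A) * b =
        b * L ((s : Subalgebra.center k A) : A)) (g : (S × S) × Unit) (x : BarX L n),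
      tensorEnd (tensorEnd (mulEnd S L) (mulEnd S L)) (1 : Unit →* Module.End k (T k A n)) g x =
        envMap L (envElt S (g.1.2, g.1.1)) • x := by
    intro C _ _ L hL g x
    rw [envElt_apply, envMap_tmul, BarX.smul_eq]
    refine LinearMap.congr_fun (f := (tensorEnd (tensorEnd (mulEnd S L) (mulEnd S L))
      (1 : Unit →* Module.End k (T k A n)) g : BarX L n →ₗ[k] BarX L n)) ?_ x
    apply BarX.hom_ext (L := L)
    intro x y a
    refine (tensorEnd_tmul _ _ _ _ _).trans (congrArg (· ⊗ₜ[k] tp k n a) ?_)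
    exact congrArg (· ⊗ₜ[k] (L ((g.1.2 : Subalgebra.center k A) : A) * y)) (hL g.1.1 x)
  have hl := (h.locMap.tensor h.locMap).tensor (LocMap.refl (G := Unit) (k := k) (T k A n))
  constructor
  · intro y
    obtain ⟨g, x, hx⟩ := hl.surj y
    exact ⟨(g.1.2, g.1.1), x, (key L h.comm g y).symm.trans hx⟩
  · intro x hx
    obtain ⟨g, hg⟩ := hl.inj x hx
    refine ⟨(g.1.2, g.1.1), ?_⟩
    rw [← envMap_id (envElt S (g.1.2, g.1.1))]
    exact (key (AlgHom.id k A) (fun s b => center_comm _ b) g x).symm.trans hg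

attribute [local instance] TensorProduct.Algebra.module

variable (L) in
/-- `L` as a semilinear map of modules over the enveloping algebras. -/
def envSemilinear : A →ₛₗ[envMap L] B :=
  semilinearOfTmul L.toLinearMap fun a c m => by
    rw [TensorProduct.Algebra.smul_def, TensorProduct.Algebra.smul_def]
    exact (map_mul L a _).trans (congrArg (L a * ·) (map_mul L m c.unop))

theorem IsCentralLoc.isLocal (h : IsCentralLoc S L) : IsLocal (envElt S) (envSemilinear L) where
  surj y := by
    obtain ⟨s, a, ha⟩ := h.surj y
    refine ⟨(s, 1), a, ?_⟩
    rw [envElt_apply, envMap_tmul, TensorProduct.Algebra.smul_def]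
    refine Eq.trans ?_ ha
    show L s * (y * L 1) = L s * y
    rw [map_one, mul_one]
  inj x hx := by
    obtain ⟨s, hs⟩ := h.inj x hx
    refine ⟨(s, 1), ?_⟩
    rw [envElt_apply, TensorProduct.Algebra.smul_def]
    refine Eq.trans ?_ hs
    show (s : A) * (x * 1) = (s : A) * x
    rw [mul_one]

/-- The bar complex relative to a central localization is a localization of the bar complex of `A`,
hence exact. -/
theorem IsCentralLoc.barExact (h : IsCentralLoc S L) : BarExact L where
  exact n := IsLocal.exact h.isUnit_env (barLoc L (n + 2)) (h.isLocal_barLoc (n + 1))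
    (h.isLocal_barLoc n) (barD _ (n + 1)) (barD _ n) _ _ (barD_barLoc (n + 1)) (barD_barLoc n)
    (barExact_id.exact n)
  exact₀ := IsLocal.exact h.isUnit_env (barLoc L 1) (h.isLocal_barLoc 0) h.isLocal
    (barD _ 0) (barε _) _ _ (barD_barLoc 0) barε_barLoc barExact_id.exact₀

/-- A finite projective resolution of `A` localizes to one of `B`. -/
theorem IsCentralLoc.homologicallySmooth (h : IsCentralLoc S L) (hA : HomologicallySmooth k A) :
    HomologicallySmooth k B := by
  obtain ⟨P, hP, m, hm⟩ := hA
  have : ∀ i, Module.Finite (A ⊗[k] Aᵐᵒᵖ) ((Res.ofPR P).X i) := hP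
  refine ⟨((Res.ofPR P).localize h.isUnit_env h.isLocal_env _ h.isLocal).toPR, fun i => ?_, m,
    fun i hi => ?_⟩
  · exact inferInstanceAs (Module.Finite (B ⊗[k] Bᵐᵒᵖ) (hatMod (envMap L) ((Res.ofPR P).X i)))
  · have h1 : Subsingleton ((Res.ofPR P).X i) := ModuleCat.subsingleton_of_isZero (hm i hi)
    have h2 : Subsingleton (hatMod (envMap L) ((Res.ofPR P).X i)) := by
      have h0 : ∀ y : hatMod (envMap L) ((Res.ofPR P).X i), y = 0 := fun y => by
        obtain ⟨g, x, hx⟩ := (isLocal_toHat ((Res.ofPR P).X i) h.isUnit_env h.isLocal_env).surj y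
        rw [Subsingleton.elim x 0, map_zero] at hx
        exact (h.isUnit_env g).smul_eq_zero.1 hx
      exact ⟨fun y z => (h0 y).trans (h0 z).symm⟩
    exact ModuleCat.isZero_of_subsingleton (M := ModuleCat.of (B ⊗[k] Bᵐᵒᵖ)
      (hatMod (envMap L) ((Res.ofPR P).X i)))

end CentralAlgebra

/-! ### Hochschild cohomology and central localization of the coefficients -/

theorem SQ.mk_eq_zero_iff {C : Type*} [AddCommGroup C] {Z B : AddSubgroup C} {x : C} (hx : x ∈ Z) :
    (SQ.mk x hx : SQ Z B) = 0 ↔ x ∈ B := by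
  have h0 : (0 : SQ Z B) = SQ.mk 0 Z.zero_mem := rfl
  rw [h0, SQ.mk_eq, add_zero, neg_mem_iff]

section CentralAction

variable {k : Type*} [CommRing k] {A : Type*} [Ring A] [Algebra k A]
  {M : Type*} [AddCommGroup M] [Module k M] [Module A M] [Module Aᵐᵒᵖ M]
  [SMulCommClass A Aᵐᵒᵖ M] [IsScalarTower k A M] [IsScalarTower k Aᵐᵒᵖ M]

/-- The endomorphism `x ↦ s x t` of a bimodule, for central `s` and `t`. -/
def centAct (s t : Subalgebra.center k A) (M : Type*) [AddCommGroup M] [Module k M] [Module A M]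
    [Module Aᵐᵒᵖ M] [SMulCommClass A Aᵐᵒᵖ M] [IsScalarTower k A M] [IsScalarTower k Aᵐᵒᵖ M] :
    M →ₗ[k] M := lact k A M s ∘ₗ ract k A M t

theorem centAct_apply (s t : Subalgebra.center k A) (x : M) :
    centAct s t M x = (s : A) • (MulOpposite.op (t : A) • x) := rfl

theorem centAct_smul (s t : Subalgebra.center k A) (a : A) (x : M) :
    centAct s t M (a • x) = a • centAct s t M x := by
  rw [centAct_apply, centAct_apply, ← smul_comm a, ← mul_smul, center_comm, mul_smul]

theorem centAct_op_smul (s t : Subalgebra.center k A) (a : Aᵐᵒᵖ) (x : M) :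
    centAct s t M (a • x) = a • centAct s t M x := by
  have e : MulOpposite.op (t : A) * a = a * MulOpposite.op (t : A) :=
    congrArg MulOpposite.op (center_comm t a.unop).symm
  rw [centAct_apply, centAct_apply, ← mul_smul, e, mul_smul]
  exact smul_comm (s : A) a _

theorem centAct_centAct (s t s' t' : Subalgebra.center k A) (x : M) :
    centAct s t M (centAct s' t' M x) = centAct (s * s') (t * t') M x := by
  rw [centAct_apply, centAct_apply, centAct_apply, ← smul_comm (s' : A), ← mul_smul, ← mul_smul,
    ← MulOpposite.op_mul]
  rw [mul_comm t t']
  rfl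

theorem centAct_one (x : M) : centAct (1 : Subalgebra.center k A) 1 M x = x :=
  (one_smul A (MulOpposite.op (1 : A) • x)).trans (one_smul Aᵐᵒᵖ x)

/-- The action of a pair of central elements on Hochschild cohomology, through the coefficients. -/
def HH.act (s t : Subalgebra.center k A) (n : ℕ) : HH k A M n →+ HH k A M n :=
  coeffMap (centAct s t M) (centAct_smul s t) (centAct_op_smul s t) n

theorem HH.act_act (s t s' t' : Subalgebra.center k A) (n : ℕ) (x : HH k A M n) :
    HH.act s t n (HH.act s' t' n x) = HH.act (s * s') (t * t') n x := by
  induction x using SQ.ind with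
  | h f hf => exact SQ.mk_congr _ (LinearMap.ext fun z => centAct_centAct s t s' t' (f z))

theorem HH.act_one (n : ℕ) (x : HH k A M n) :
    HH.act (1 : Subalgebra.center k A) 1 n x = x := by
  induction x using SQ.ind with
  | h f hf => exact SQ.mk_congr _ (LinearMap.ext fun z => centAct_one (f z))

theorem HH.act_bijective {s t s' t' : Subalgebra.center k A} (h : s' * s = 1) (h' : t' * t = 1)
    (n : ℕ) : Function.Bijective (HH.act s t n : HH k A M n →+ HH k A M n) := by
  refine Function.bijective_iff_has_inverse.2 ⟨HH.act s' t' n, fun x => ?_, fun x => ?_⟩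
  · rw [HH.act_act, h, h', HH.act_one]
  · rw [HH.act_act, mul_comm s, mul_comm t, h, h', HH.act_one]

end CentralAction

section Coefficients

variable {k : Type} [Field k] {A : Type u} [Ring A] [Algebra k A]
  {S : Submonoid (Subalgebra.center k A)}
  {M : Type*} [AddCommGroup M] [Module k M] [Module A M] [Module Aᵐᵒᵖ M]
  [SMulCommClass A Aᵐᵒᵖ M] [IsScalarTower k A M] [IsScalarTower k Aᵐᵒᵖ M]
  {N : Type*} [AddCommGroup N] [Module k N] [Module A N] [Module Aᵐᵒᵖ N]
  [SMulCommClass A Aᵐᵒᵖ N] [IsScalarTower k A N] [IsScalarTower k Aᵐᵒᵖ N]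

/-- A bimodule map that has the properties of a localization at `S` on both sides, except for the
invertibility of `S` on the target. -/
structure IsBimLocal (S : Submonoid (Subalgebra.center k A)) (φ : M →ₗ[k] N) : Prop where
  smul : ∀ (a : A) m, φ (a • m) = a • φ m
  op_smul : ∀ (a : Aᵐᵒᵖ) m, φ (a • m) = a • φ m
  surj : ∀ y, ∃ s ∈ S, ∃ t ∈ S, ∃ x, centAct s t N y = φ x
  inj : ∀ x, φ x = 0 → ∃ s ∈ S, ∃ t ∈ S, centAct s t M x = 0

attribute [local instance] TensorProduct.Algebra.module

/-- A map of bimodules is linear over the enveloping algebra. -/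
def IsBimLocal.env {φ : M →ₗ[k] N} (h : IsBimLocal S φ) : M →ₗ[A ⊗[k] Aᵐᵒᵖ] N :=
  linearOfTmul φ fun a c m => by
    rw [TensorProduct.Algebra.smul_def, TensorProduct.Algebra.smul_def, h.smul, h.op_smul]

theorem envElt_smul (g : S × S) (x : M) : envElt S g • x = centAct g.1.1 g.2.1 M x :=
  TensorProduct.Algebra.smul_def _ _ x

theorem IsBimLocal.isLocal {φ : M →ₗ[k] N} (h : IsBimLocal S φ) :
    IsLocal (envElt S) h.env where
  surj y := by
    obtain ⟨s, hs, t, ht, x, hx⟩ := h.surj y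
    exact ⟨(⟨s, hs⟩, ⟨t, ht⟩), x, (envElt_smul _ y).trans hx⟩
  inj x hx := by
    obtain ⟨s, hs, t, ht, hx⟩ := h.inj x hx
    exact ⟨(⟨s, hs⟩, ⟨t, ht⟩), (envElt_smul _ x).trans hx⟩

theorem barHom_comp_idC {n : ℕ} (F : M →ₗ[A ⊗[k] Aᵐᵒᵖ] N) (φ : M →ₗ[k] N) (h : ∀ x, F x = φ x)
    (f : Cochain k A M n) : F ∘ₗ barHom (AlgHom.id k A) (idC f) =
      barHom (AlgHom.id k A) (idC (φ ∘ₗ f)) :=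
  barHom_ext _ fun t => by
    rw [LinearMap.comp_apply, barHom_one, barHom_one, h]
    rfl

/-- Hochschild cohomology of a homologically smooth algebra commutes with localization of the
coefficients: surjectivity up to the action of `S`. -/
theorem IsBimLocal.exists_coeffMap (hA : HomologicallySmooth k A) {φ : M →ₗ[k] N}
    (h : IsBimLocal S φ) (n : ℕ) (y : HH k A N n) :
    ∃ s ∈ S, ∃ t ∈ S, ∃ x, HH.act s t n y = coeffMap φ h.smul h.op_smul n x := by
  obtain ⟨P, hP, -⟩ := hA
  have : ∀ i, Module.Finite (A ⊗[k] Aᵐᵒᵖ) ((Res.ofPR P).X i) := hP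
  induction y using SQ.ind with
  | h f hf =>
  have hf' : d k A N n f = 0 := hf
  obtain ⟨g, U, hU, hU'⟩ := Res.exists_cocycle_of_isLocal (Res.ofPR P)
    (barRes (AlgHom.id k A) barExact_id) isCentral_envElt h.isLocal n
    (barHom _ (idC f)) ((barHom_comp_barD_eq_zero_iff _).2 ((d_idC_eq_zero_iff f).2 hf'))
  obtain ⟨u, rfl⟩ := exists_barHom (AlgHom.id k A) U
  obtain ⟨u, rfl⟩ := exists_idC u
  have e : h.env ∘ₗ barHom (AlgHom.id k A) (idC u) -
      isCentral_envElt.smul g N ∘ₗ barHom (AlgHom.id k A) (idC f) =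
      barHom (AlgHom.id k A) (idC (φ ∘ₗ u - centAct g.1.1 g.2.1 N ∘ₗ f)) := by
    rw [barHom_comp_idC h.env φ (fun _ => rfl), barHom_comp_idC _ (centAct g.1.1 g.2.1 N)
      (fun x => envElt_smul g x), ← barHom_sub]
    rfl
  replace hU' := (congrArg ((barRes (AlgHom.id k A) barExact_id).IsCob n) e).mp hU'
  refine ⟨_, g.1.2, _, g.2.2, SQ.mk u
    ((d_idC_eq_zero_iff u).1 ((barHom_comp_barD_eq_zero_iff _).1 hU)), ?_⟩
  refine (SQ.mk_eq _ _).2 ?_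
  rw [neg_add_eq_sub]
  exact (idC_mem_coboundaries_iff _).1 ((isCob_barHom_iff barExact_id _).1 hU')

/-- Hochschild cohomology of a homologically smooth algebra commutes with localization of the
coefficients: injectivity up to the action of `S`. -/
theorem IsBimLocal.exists_act_eq_zero (hA : HomologicallySmooth k A) {φ : M →ₗ[k] N}
    (h : IsBimLocal S φ) (n : ℕ) (x : HH k A M n) (hx : coeffMap φ h.smul h.op_smul n x = 0) :
    ∃ s ∈ S, ∃ t ∈ S, HH.act s t n x = 0 := by
  obtain ⟨P, hP, -⟩ := hA
  have : ∀ i, Module.Finite (A ⊗[k] Aᵐᵒᵖ) ((Res.ofPR P).X i) := hP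
  induction x using SQ.ind with
  | h f hf =>
  have hf' : d k A M n f = 0 := hf
  have hx' : φ ∘ₗ f ∈ coboundaries k A N n := (SQ.mk_eq_zero_iff _).1 hx
  rw [← idC_mem_coboundaries_iff, ← isCob_barHom_iff barExact_id,
    ← barHom_comp_idC h.env φ (fun _ => rfl)] at hx'
  obtain ⟨g, hg⟩ := Res.exists_isCob_of_isLocal (Res.ofPR P)
    (barRes (AlgHom.id k A) barExact_id) isCentral_envElt h.isLocal n
    (barHom _ (idC f)) ((barHom_comp_barD_eq_zero_iff _).2 ((d_idC_eq_zero_iff f).2 hf')) hx'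
  replace hg := (congrArg ((barRes (AlgHom.id k A) barExact_id).IsCob n)
    (barHom_comp_idC (isCentral_envElt.smul g M) (centAct g.1.1 g.2.1 M)
      (fun x => envElt_smul g x) f)).mp hg
  refine ⟨_, g.1.2, _, g.2.2, (SQ.mk_eq_zero_iff _).2 ?_⟩
  exact (idC_mem_coboundaries_iff _).1 ((isCob_barHom_iff barExact_id _).1 hg)

end Coefficients

/-! ### Transfer of Hochschild classes along an algebra map -/

section Semi

variable {k : Type*} [CommRing k] {A : Type*} [Ring A] [Algebra k A] {B : Type*} [Ring B]
  [Algebra k B]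
  {M : Type*} [AddCommGroup M] [Module k M] [Module A M] [Module Aᵐᵒᵖ M]
  [SMulCommClass A Aᵐᵒᵖ M] [IsScalarTower k A M] [IsScalarTower k Aᵐᵒᵖ M]
  {N : Type*} [AddCommGroup N] [Module k N] [Module B N] [Module Bᵐᵒᵖ N]
  [SMulCommClass B Bᵐᵒᵖ N] [IsScalarTower k B N] [IsScalarTower k Bᵐᵒᵖ N]

/-- A linear map from an `A`-bimodule to a `B`-bimodule is compatible with `L : A → B`. -/
structure IsSemi (L : A →ₐ[k] B) (φ : M →ₗ[k] N) : Prop where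
  smul : ∀ (a : A) m, φ (a • m) = L a • φ m
  op_smul : ∀ (a : A) m, φ (MulOpposite.op a • m) = MulOpposite.op (L a) • φ m

theorem isSemi_toLinearMap (L : A →ₐ[k] B) : IsSemi L L.toLinearMap where
  smul a m := map_mul L a m
  op_smul a m := map_mul L m a

theorem isSemi_toPull_symm (L : A →ₐ[k] B) : IsSemi L (toPull L N).symm.toLinearMap where
  smul _ _ := rfl
  op_smul _ _ := rfl

variable {L : A →ₐ[k] B}

theorem IsSemi.b_map {φ : M →ₗ[k] N} (hφ : IsSemi L φ) (n : ℕ) (x : Chain k A M (n + 1)) :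
    TensorProduct.map φ (Tmap L n) (b k A M n x) =
      b k B N n (TensorProduct.map φ (Tmap L (n + 1)) x) := by
  suffices h : TensorProduct.map φ (Tmap L n) ∘ₗ b k A M n =
      b k B N n ∘ₗ TensorProduct.map φ (Tmap L (n + 1)) from LinearMap.congr_fun h x
  apply chain_hom_ext
  intro m a
  simp only [LinearMap.comp_apply, b_tmul, map_add, map_sum, map_zsmul, TensorProduct.map_tmul,
    Tmap_tp, map_merge, hφ.smul, hφ.op_smul]
  rfl

/-- The map `HHₙ(A, M) → HHₙ(B, N)` induced by a bimodule map compatible with `L`. -/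
def IsSemi.homologyMap {φ : M →ₗ[k] N} (hφ : IsSemi L φ) (n : ℕ) :
    Homology k A M n →+ Homology k B N n :=
  SQ.map (TensorProduct.map φ (Tmap L n)).toAddMonoidHom
    (by
      intro x hx
      cases n with
      | zero => exact AddSubgroup.mem_top _
      | succ n =>
        have hx' : b k A M n x = 0 := hx
        show b k B N n (TensorProduct.map φ (Tmap L (n + 1)) x) = 0
        rw [← hφ.b_map, hx', map_zero])
    (by
      rintro _ ⟨y, rfl⟩
      exact ⟨_, (hφ.b_map n y).symm⟩)

theorem connesHom_homologyMap (n : ℕ) (x : Homology k A A n) :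
    connesHom k B n (Hoch.homologyMap L n x) = Hoch.homologyMap L (n + 1) (connesHom k A n x) := by
  induction x using SQ.ind with
  | h x hx =>
  refine SQ.mk_congr _ ?_
  show connes k B n (TensorProduct.map L.toLinearMap (Tmap L n) x) =
    TensorProduct.map L.toLinearMap (Tmap L (n + 1)) (connes k A n x)
  have hch : ∀ m (c : ℕ → A), TensorProduct.map L.toLinearMap (Tmap L m) (ch k m c) =
      ch k m (fun i => L (c i)) := by
    intro m c
    rw [ch, TensorProduct.map_tmul, Tmap_tp]
    rfl
  have hcons : ∀ (y : A) (c : ℕ → A), (fun i => L (cons y c i)) = cons (L y) fun i => L (c i) := by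
    intro y c
    funext i
    unfold cons
    split_ifs <;> rfl
  suffices h : connes k B n ∘ₗ TensorProduct.map L.toLinearMap (Tmap L n) =
      TensorProduct.map L.toLinearMap (Tmap L (n + 1)) ∘ₗ connes k A n from LinearMap.congr_fun h x
  apply ch_hom_ext
  intro c
  simp only [LinearMap.comp_apply, hch, connes_ch, map_add, map_sum, map_zsmul, hcons, map_one]
  rfl

variable (N L) in
/-- The map `HHⁿ(B, N) → HHⁿ(A, N)`, `g ↦ g ∘ L^{⊗ n}`. -/
def restr (n : ℕ) : HH k B N n →+ HH k A (Pull L N) n :=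
  SQ.map (AddMonoidHom.mk' (pullC L n) fun f g => by
      unfold pullC
      rw [LinearMap.add_comp, LinearMap.comp_add])
    (by
      intro f hf
      have hf' : d k B N n f = 0 := hf
      show d k A (Pull L N) n (pullC L n f) = 0
      rw [d_pullC, hf']
      rfl)
    (by
      intro f hf
      cases n with
      | zero =>
        have hf' : f = 0 := hf
        rw [hf', map_zero]
        exact AddSubgroup.zero_mem _
      | succ n =>
        obtain ⟨y, rfl⟩ := hf
        exact ⟨_, d_pullC L n y⟩)

/-- The map `HHⁿ(A, M) → HHⁿ(A, N)` induced by a bimodule map compatible with `L`. -/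
def IsSemi.push {φ : M →ₗ[k] N} (hφ : IsSemi L φ) (n : ℕ) :
    HH k A M n →+ HH k A (Pull L N) n :=
  coeffMap ((toPull L N).toLinearMap ∘ₗ φ) hφ.smul (fun a => hφ.op_smul a.unop) n

/-- The composite of `HHⁿ(A, M) → HHⁿ(A, N)` with the inverse of `HHⁿ(B, N) → HHⁿ(A, N)`. -/
def IsSemi.transfer {φ : M →ₗ[k] N} (hφ : IsSemi L φ) (n : ℕ) : HH k A M n →+ HH k B N n :=
  (invAdd (restr N L n)).comp (hφ.push n)

theorem IsSemi.restr_transfer {φ : M →ₗ[k] N} (hφ : IsSemi L φ) {n : ℕ}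
    (h : Function.Bijective (restr (k := k) N L n)) (x : HH k A M n) :
    restr N L n (hφ.transfer n x) = hφ.push n x :=
  apply_invAdd_apply h _

/-- The projection formula `L^*(x) ∩ L_*(π) = φ_*(x ∩ π)`, with `hφ.transfer` in the place of `L^*`.
-/
theorem cap_homologyMap {φ : M →ₗ[k] N} (hφ : IsSemi L φ) {p q n : ℕ} (h : p + q = n)
    (hb : Function.Bijective (restr (k := k) N L p)) (x : HH k A M p) (π : Homology k A A n) :
    cap h (hφ.transfer p x) (homologyMap L n π) = hφ.homologyMap q (cap h x π) := by
  have e1 : ∀ y : HH k B N p, cap h y (homologyMap L n π) =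
      (isSemi_toPull_symm L).homologyMap q (cap h (restr N L p y) π) := by
    intro y
    induction y using SQ.ind with
    | h g hg =>
    induction π using SQ.ind with
    | h c hc =>
    refine SQ.mk_congr _ ?_
    show capC h g (TensorProduct.map L.toLinearMap (Tmap L n) c) =
      TensorProduct.map (toPull L N).symm.toLinearMap (Tmap L q) (capC h (pullC L p g) c)
    suffices hh : capC h g ∘ₗ TensorProduct.map L.toLinearMap (Tmap L n) =
      TensorProduct.map (toPull L N).symm.toLinearMap (Tmap L q) ∘ₗ capC h (pullC L p g) from
      LinearMap.congr_fun hh c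
    apply chain_hom_ext
    intro m a
    rw [LinearMap.comp_apply, LinearMap.comp_apply, TensorProduct.map_tmul, Tmap_tp, capC_tmul,
      capC_tmul, TensorProduct.map_tmul, Tmap_tp, pullC_tp]
    rfl
  rw [e1, hφ.restr_transfer hb]
  induction x using SQ.ind with
  | h f hf =>
  induction π using SQ.ind with
  | h c hc =>
  refine SQ.mk_congr _ ?_
  show TensorProduct.map (toPull L N).symm.toLinearMap (Tmap L q)
      (capC h ((toPull L N).toLinearMap ∘ₗ φ ∘ₗ f) c) =
    TensorProduct.map φ (Tmap L q) (capC h f c)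
  suffices hh : TensorProduct.map (toPull L N).symm.toLinearMap (Tmap L q) ∘ₗ
      capC h ((toPull L N).toLinearMap ∘ₗ φ ∘ₗ f) =
    TensorProduct.map φ (Tmap L q) ∘ₗ capC h f from LinearMap.congr_fun hh c
  apply chain_hom_ext
  intro m a
  rw [LinearMap.comp_apply, LinearMap.comp_apply, capC_tmul, capC_tmul, TensorProduct.map_tmul,
    TensorProduct.map_tmul, hφ.smul]
  rfl

end Semi

/-! ### Transfer along a central localization -/

section CentralTransfer

variable {k : Type} [Field k] {A : Type u} [Ring A] [Algebra k A] {B : Type u} [Ring B]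
  [Algebra k B] {S : Submonoid (Subalgebra.center k A)} {L : A →ₐ[k] B}
  {M : Type*} [AddCommGroup M] [Module k M] [Module A M] [Module Aᵐᵒᵖ M]
  [SMulCommClass A Aᵐᵒᵖ M] [IsScalarTower k A M] [IsScalarTower k Aᵐᵒᵖ M]
  {N : Type*} [AddCommGroup N] [Module k N] [Module B N] [Module Bᵐᵒᵖ N]
  [SMulCommClass B Bᵐᵒᵖ N] [IsScalarTower k B N] [IsScalarTower k Bᵐᵒᵖ N]

theorem BarExact.restr_bijective (h : BarExact L) (n : ℕ) :
    Function.Bijective (restr (k := k) N L n) := by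
  constructor
  · rw [injective_iff_map_eq_zero]
    intro y hy
    induction y using SQ.ind with
    | h g hg =>
      have h0 : pullC L n g ∈ coboundaries k A (Pull L N) n := (SQ.mk_eq_zero_iff _).1 hy
      exact (SQ.mk_eq_zero_iff _).2 (mem_coboundaries_of_pullC h g hg h0)
  · intro x
    induction x using SQ.ind with
    | h f hf =>
    obtain ⟨g, hg, hg'⟩ := exists_pullC h f hf
    refine ⟨SQ.mk g hg, (SQ.mk_eq _ _).2 ?_⟩
    rw [neg_add_eq_sub, ← neg_mem_iff, neg_sub]
    exact hg'

/-- The bimodules `Via L` and `Pull L B` and the maps `restrict` and `restr` agree by definition. -/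
theorem BarExact.restrict_bijective (h : BarExact L) (n : ℕ) :
    Function.Bijective (restrict L n) := h.restr_bijective (N := B) n

/-- The image of an element of `S` in the centre of the localization. -/
def IsCentralLoc.cent (h : IsCentralLoc S L) (s : S) : Subalgebra.center k B :=
  ⟨L ((s : Subalgebra.center k A) : A), Subalgebra.mem_center_iff.2 fun b => (h.comm s b).symm⟩

theorem IsCentralLoc.exists_cent_inv (h : IsCentralLoc S L) (s : S) :
    ∃ c, c * h.cent s = 1 := by
  obtain ⟨u, hu⟩ := h.isUnit s
  refine ⟨⟨↑u⁻¹, Subalgebra.mem_center_iff.2 fun b => ?_⟩, Subtype.ext ?_⟩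
  · have := h.comm s b
    rw [← hu] at this
    rw [Units.eq_inv_mul_iff_mul_eq, ← mul_assoc, this, mul_assoc, Units.mul_inv, mul_one]
  · show (↑u⁻¹ : B) * L ((s : Subalgebra.center k A) : A) = 1
    rw [← hu, Units.inv_mul]

theorem IsCentralLoc.act_bijective (h : IsCentralLoc S L) (s t : S) (n : ℕ) :
    Function.Bijective (HH.act (h.cent s) (h.cent t) n : HH k B N n →+ HH k B N n) := by
  obtain ⟨c, hc⟩ := h.exists_cent_inv s
  obtain ⟨e, he⟩ := h.exists_cent_inv t
  exact HH.act_bijective hc he n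

theorem IsCentralLoc.transfer_act (h : IsCentralLoc S L) {φ : M →ₗ[k] N} (hφ : IsSemi L φ)
    (s t : S) (n : ℕ) (x : HH k A M n) :
    hφ.transfer n (HH.act (s : Subalgebra.center k A) t n x) =
      HH.act (h.cent s) (h.cent t) n (hφ.transfer n x) := by
  have hb := h.barExact.restr_bijective (N := N) n
  have e : ∀ y : HH k B N n, restr N L n (HH.act (h.cent s) (h.cent t) n y) =
      HH.act (s : Subalgebra.center k A) t n (restr N L n y) := by
    intro y
    induction y using SQ.ind with
    | h g hg => rfl
  apply hb.1
  rw [e, hφ.restr_transfer hb, hφ.restr_transfer hb]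
  induction x using SQ.ind with
  | h f hf =>
    refine SQ.mk_congr _ (LinearMap.ext fun z => ?_)
    exact (hφ.smul _ _).trans (congrArg (L ((s : Subalgebra.center k A) : A) • ·)
      (hφ.op_smul ((t : Subalgebra.center k A) : A) (f z)))

/-- Up to the action of `S`, every class over the localization comes from `A`. -/
theorem IsCentralLoc.exists_transfer (h : IsCentralLoc S L) (hA : HomologicallySmooth k A)
    {φ : M →ₗ[k] N} (hφ : IsSemi L φ) (hl : IsBimLocal S ((toPull L N).toLinearMap ∘ₗ φ)) (n : ℕ)
    (y : HH k B N n) :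
    ∃ (s t : S) (x : HH k A M n), HH.act (h.cent s) (h.cent t) n y = hφ.transfer n x := by
  obtain ⟨s, hs, t, ht, x, hx⟩ := hl.exists_coeffMap hA n (restr N L n y)
  refine ⟨⟨s, hs⟩, ⟨t, ht⟩, x, ?_⟩
  have hb := h.barExact.restr_bijective (N := N) n
  apply hb.1
  rw [hφ.restr_transfer hb]
  refine Eq.trans ?_ hx
  induction y using SQ.ind with
  | h g hg => rfl

/-- Up to the action of `S`, classes that vanish over the localization vanish over `A`. -/
theorem IsCentralLoc.exists_act_eq_zero (h : IsCentralLoc S L) (hA : HomologicallySmooth k A)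
    {φ : M →ₗ[k] N} (hφ : IsSemi L φ) (hl : IsBimLocal S ((toPull L N).toLinearMap ∘ₗ φ)) (n : ℕ)
    (x : HH k A M n) (hx : hφ.transfer n x = 0) :
    ∃ s t : S, HH.act (s : Subalgebra.center k A) t n x = 0 := by
  have hb := h.barExact.restr_bijective (N := N) n
  obtain ⟨s, hs, t, ht, hx⟩ := hl.exists_act_eq_zero hA n x (by
    have := hφ.restr_transfer hb x
    rw [hx, map_zero] at this
    exact this.symm)
  exact ⟨⟨s, hs⟩, ⟨t, ht⟩, hx⟩

theorem IsCentralLoc.isBimLocal (h : IsCentralLoc S L) :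
    IsBimLocal S ((toPull L B).toLinearMap ∘ₗ L.toLinearMap) where
  smul := (isSemi_toLinearMap L).smul
  op_smul a m := (isSemi_toLinearMap L).op_smul a.unop m
  surj y := by
    obtain ⟨s, a, ha⟩ := h.surj ((toPull L B).symm y)
    refine ⟨s, s.2, 1, S.one_mem, a, ?_⟩
    refine Eq.trans ?_ ha
    have e : ∀ b : B, L s * (b * L 1) = L s * b := fun b => by rw [map_one, mul_one]
    exact e y
  inj x hx := by
    obtain ⟨s, hs⟩ := h.inj x hx
    refine ⟨s, s.2, 1, S.one_mem, Eq.trans ?_ hs⟩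
    show (s : A) * (x * 1) = (s : A) * x
    rw [mul_one]

variable (L) in
/-- The map `L ⊗ L` of outer bimodules. -/
def outMap : Out k A →ₗ[k] Out k B :=
  (TensorProduct.map L.toLinearMap L.toLinearMap : A ⊗[k] A →ₗ[k] B ⊗[k] B)

theorem outMap_tmul (x y : A) : outMap L (Out.tmul k x y) = Out.tmul k (L x) (L y) := rfl

theorem isSemi_outMap (L : A →ₐ[k] B) : IsSemi L (outMap L) where
  smul a := Out.hom_ext ((outMap L).toAddMonoidHom.comp (DistribSMul.toAddMonoidHom _ a))
    ((DistribSMul.toAddMonoidHom _ (L a)).comp (outMap L).toAddMonoidHom)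
    fun x y => congrArg (fun z => Out.tmul k z (L y)) (map_mul L a x)
  op_smul a := Out.hom_ext
    ((outMap L).toAddMonoidHom.comp (DistribSMul.toAddMonoidHom _ (MulOpposite.op a)))
    ((DistribSMul.toAddMonoidHom _ (MulOpposite.op (L a))).comp (outMap L).toAddMonoidHom)
    fun x y => congrArg (Out.tmul k (L x)) (map_mul L y a)

theorem centAct_out (L : A →ₐ[k] B)
    (hL : ∀ (s : S) (b : B), L ((s : Subalgebra.center k A) : A) * b =
      b * L ((s : Subalgebra.center k A) : A)) (g : S × S) (z : Out k B) :
    centAct (g.1 : Subalgebra.center k A) g.2 (Pull L (Out k B)) (toPull L (Out k B) z) =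
      toPull L (Out k B) (tensorEnd (mulEnd S L) (mulEnd S L) g z) :=
  Out.hom_ext ((centAct (g.1 : Subalgebra.center k A) g.2 (Pull L (Out k B))).toAddMonoidHom.comp
      (toPull L (Out k B)).toLinearMap.toAddMonoidHom)
    ((toPull L (Out k B)).toLinearMap.toAddMonoidHom.comp
      (tensorEnd (mulEnd S L) (mulEnd S L) g).toAddMonoidHom)
    (fun x y => congrArg (Out.tmul k (L ((g.1 : Subalgebra.center k A) : A) * x))
      (hL g.2 y).symm) z

/-- The map `L ⊗ L` is a localization on both sides for the outer bimodule structure. -/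
theorem IsCentralLoc.isBimLocal_out (h : IsCentralLoc S L) :
    IsBimLocal S ((toPull L (Out k B)).toLinearMap ∘ₗ outMap L) where
  smul := (isSemi_outMap L).smul
  op_smul a m := (isSemi_outMap L).op_smul a.unop m
  surj y := by
    obtain ⟨g, x, hx⟩ := (h.locMap.tensor h.locMap).surj ((toPull L (Out k B)).symm y)
    exact ⟨g.1, g.1.2, g.2, g.2.2, x,
      (centAct_out L h.comm g ((toPull L (Out k B)).symm y)).trans hx⟩
  inj x hx := by
    obtain ⟨g, hg⟩ := (h.locMap.tensor h.locMap).inj x hx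
    exact ⟨g.1, g.1.2, g.2, g.2.2,
      (centAct_out (AlgHom.id k A) (fun s b => center_comm _ b) g x).trans hg⟩

end CentralTransfer

/-! ### Central localization of Calabi–Yau algebras -/

section Nondegenerate

variable {k : Type*} [CommRing k] {A : Type u} [Ring A] [Algebra k A] {n : ℕ}

/-- The map `u ↦ u ∩ π`, `HHⁿ(A, A ⊗ A) → HH₀(A, A ⊗ A) ≅ A`. -/
def outPairing (π : Homology k A A n) : HH k A (Out k A) n →+ A :=
  trOut.comp ((cap (Nat.add_zero n)).flip π)

theorem outPairing_coeffMap (π : Homology k A A n) (ψ : Out k A →ₗ[k] Out k A)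
    (hl : ∀ (a : A) m, ψ (a • m) = a • ψ m) (hr : ∀ (a : Aᵐᵒᵖ) m, ψ (a • m) = a • ψ m)
    (χ : A →ₗ[k] A) (h : ∀ x y : A, mulSwap (ψ (Out.tmul k x y)) = χ (y * x))
    (u : HH k A (Out k A) n) : outPairing π (coeffMap ψ hl hr n u) = χ (outPairing π u) := by
  have h' : ∀ m, mulSwap (ψ m) = χ (mulSwap m) :=
    Out.hom_ext ((mulSwap (k := k) (A := A)).toAddMonoidHom.comp ψ.toAddMonoidHom)
      ((χ ∘ₗ mulSwap (k := k) (A := A)).toAddMonoidHom) h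
  have h'' : barAug k A ∘ₗ ψ.rTensor _ = χ ∘ₗ barAug k A :=
    out_chain_ext fun x y a => by
      rw [LinearMap.comp_apply, LinearMap.comp_apply, LinearMap.rTensor_tmul, barAug_tmul,
        barAug_tmul, h']
  induction u using SQ.ind with
  | h f hf =>
  induction π using SQ.ind with
  | h c hc =>
  refine (trOut_mk (capC (Nat.add_zero n) (ψ ∘ₗ f) c) _).trans ?_
  rw [capC_comp ψ hl]
  exact (LinearMap.congr_fun h'' _).trans (congrArg χ (trOut_mk (capC _ f c) _).symm)

theorem outPairing_extL (π : Homology k A A n) (a : A) (u : HH k A (Out k A) n) :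
    outPairing π (extL n a u) = a * outPairing π u :=
  outPairing_coeffMap π _ _ _ (LinearMap.mulLeft k a) (fun x y => mul_assoc a y x) u

theorem outPairing_extR (π : Homology k A A n) (a : A) (u : HH k A (Out k A) n) :
    outPairing π (extR n a u) = outPairing π u * a :=
  outPairing_coeffMap π _ _ _ (LinearMap.mulRight k a) (fun x y => (mul_assoc y x a).symm) u

/-- The outer actions of the centre on `A ⊗ A` become the multiplication of `A`. -/
theorem outPairing_act (π : Homology k A A n) (s t : Subalgebra.center k A)
    (u : HH k A (Out k A) n) : outPairing π (HH.act s t n u) = s * t * outPairing π u :=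
  outPairing_coeffMap π _ _ _ (LinearMap.mulLeft k ((s : A) * t)) (fun x y => by
    show (y * t) * (s * x) = s * t * (y * x)
    rw [mul_assoc y, ← mul_assoc (t : A), ← mul_assoc y, center_comm t s, ← mul_assoc,
      ← center_comm s y, mul_assoc (s : A), ← center_comm t y]
    simp only [mul_assoc]) u

/-- Nondegeneracy of `π` means that `u ↦ u ∩ π` is bijective: the volume is the preimage of `1`. -/
theorem isNondegenerate_iff (π : Homology k A A n) :
    IsNondegenerate n π ↔ Function.Bijective (outPairing π) := by
  constructor
  · rintro ⟨v, ⟨-, hv⟩, h⟩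
    have h1 : ∀ a, outPairing π (extL n a v) = a := fun a => hv.1 (h (extL n a v))
    exact ⟨Function.LeftInverse.injective (g := fun a => extL n a v) h, fun a => ⟨_, h1 a⟩⟩
  · intro h
    obtain ⟨v, hv⟩ := h.2 1
    have h1 : ∀ a, outPairing π (extL n a v) = a := fun a => by
      rw [outPairing_extL, hv, mul_one]
    have h2 : ∀ u, extL n (outPairing π u) v = u := fun u => h.1 (h1 _)
    refine ⟨v, ⟨fun a => h.1 ?_, ?_⟩, h2⟩
    · rw [h1, outPairing_extR, hv, one_mul]
    · exact Function.bijective_iff_has_inverse.2 ⟨outPairing π, h1, h2⟩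

end Nondegenerate

section LocalCY

variable {k : Type} [Field k] {A : Type u} [Ring A] [Algebra k A] {B : Type u} [Ring B]
  [Algebra k B] {S : Submonoid (Subalgebra.center k A)} {L : A →ₐ[k] B} {n : ℕ}

theorem trOut_homologyMap (L : A →ₐ[k] B) (x : Homology k A (Out k A) 0) :
    trOut ((isSemi_outMap L).homologyMap 0 x) = L (trOut x) := by
  induction x using SQ.ind with
  | h z hz =>
  refine (trOut_mk (TensorProduct.map (outMap L) (Tmap L 0) z) _).trans
    (Eq.trans ?_ (congrArg L (trOut_mk z hz)).symm)
  suffices h : barAug k B ∘ₗ TensorProduct.map (outMap L) (Tmap L 0) =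
      L.toLinearMap ∘ₗ barAug k A from LinearMap.congr_fun h z
  apply out_chain_ext
  intro x y a
  rw [LinearMap.comp_apply, LinearMap.comp_apply, TensorProduct.map_tmul, Tmap_tp, barAug_tmul,
    barAug_tmul, outMap_tmul, mulSwap_tmul, mulSwap_tmul]
  exact (map_mul L y x).symm

theorem IsCentralLoc.outPairing_transfer (h : IsCentralLoc S L) (π : Homology k A A n)
    (u : HH k A (Out k A) n) :
    outPairing (homologyMap L n π) ((isSemi_outMap L).transfer n u) = L (outPairing π u) :=
  (congrArg trOut (cap_homologyMap (isSemi_outMap L) (Nat.add_zero n)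
    (h.barExact.restr_bijective n) u π)).trans (trOut_homologyMap L _)

/-- The bijectivity of the pairing passes to the localization, since both its source and its target
are localized and the pairing is natural by `outPairing_transfer`. -/
theorem IsCentralLoc.isNondegenerate (h : IsCentralLoc S L) (hA : HomologicallySmooth k A)
    {π : Homology k A A n} (hπ : IsNondegenerate n π) :
    IsNondegenerate n (homologyMap L n π) := by
  rw [isNondegenerate_iff] at hπ ⊢
  constructor
  · rw [injective_iff_map_eq_zero]
    intro y hy
    obtain ⟨s, t, x, hx⟩ := h.exists_transfer hA (isSemi_outMap L) h.isBimLocal_out n y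
    have h1 : L (outPairing π x) = 0 := by
      rw [← h.outPairing_transfer, ← hx, outPairing_act, hy, mul_zero]
    obtain ⟨r, hr⟩ := h.inj _ h1
    have h2 : HH.act (r : Subalgebra.center k A) (1 : S) n x = 0 := by
      apply hπ.1
      rw [outPairing_act, map_zero, OneMemClass.coe_one, OneMemClass.coe_one, mul_one, hr]
    apply (h.act_bijective s t n).1
    apply (h.act_bijective r 1 n).1
    rw [map_zero, map_zero, hx, ← h.transfer_act, h2, map_zero]
  · intro b
    obtain ⟨s, a, ha⟩ := h.surj b
    obtain ⟨u, rfl⟩ := hπ.2 a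
    obtain ⟨y, hy⟩ := (h.act_bijective (N := Out k B) s 1 n).2 ((isSemi_outMap L).transfer n u)
    refine ⟨y, ?_⟩
    have h1 := h.outPairing_transfer π u
    have h2 : ((h.cent 1 : Subalgebra.center k B) : B) = 1 := map_one L
    rw [← hy, outPairing_act, ← ha, h2, mul_one] at h1
    exact (h.isUnit s).mul_left_cancel h1

/-- The volume is the one belonging to the image of `π`. -/
theorem IsCentralLoc.isCY (h : IsCentralLoc S L) (hA : IsCY k A n) {π : Homology k A A n}
    (hπ : IsNondegenerate n π) : IsCY k B n := by
  refine ⟨h.homologicallySmooth hA.1, fun i hi => ?_, ?_⟩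
  · have := hA.2.1 i hi
    have h0 : ∀ y : HH k B (Out k B) i, y = 0 := fun y => by
      obtain ⟨s, t, x, hx⟩ := h.exists_transfer hA.1 (isSemi_outMap L) h.isBimLocal_out i y
      apply (h.act_bijective s t i).1
      rw [hx, Subsingleton.elim x 0, map_zero, map_zero]
    exact ⟨fun y z => (h0 y).trans (h0 z).symm⟩
  · obtain ⟨v, hv, -⟩ := h.isNondegenerate hA.1 hπ
    exact ⟨v, hv⟩

end LocalCY

/-! ### Transfer is multiplicative -/

section CupPairing

variable {k : Type*} [CommRing k] {A : Type*} [Ring A] [Algebra k A]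
  {M : Type*} [AddCommGroup M] [Module k M] [Module A M] [Module Aᵐᵒᵖ M]
  [SMulCommClass A Aᵐᵒᵖ M] [IsScalarTower k A M] [IsScalarTower k Aᵐᵒᵖ M]

/-- The cup product of cochains with respect to a product on the coefficients. -/
def cupB (β : M →ₗ[k] M →ₗ[k] M) {p q n : ℕ} (h : p + q = n) (f : Cochain k A M p)
    (g : Cochain k A M q) : Cochain k A M n :=
  lift (IsMulti.mul h ((isMulti_tp p).comp f) ((isMulti_tp q).comp g) β)

theorem cupB_tp (β : M →ₗ[k] M →ₗ[k] M) {p q n : ℕ} (h : p + q = n) (f : Cochain k A M p)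
    (g : Cochain k A M q) (a : ℕ → A) :
    cupB β h f g (tp k n a) = β (f (tp k p a)) (g (tp k q (shift p a))) := lift_tp _ a

/-- A product on a bimodule that is left linear, right linear and balanced. -/
structure IsBalanced (A : Type*) [Ring A] [Algebra k A] [Module A M] [Module Aᵐᵒᵖ M]
    (β : M →ₗ[k] M →ₗ[k] M) : Prop where
  left : ∀ (a : A) x y, β (a • x) y = a • β x y
  right : ∀ (a : A) x y, β x (MulOpposite.op a • y) = MulOpposite.op a • β x y
  mid : ∀ (a : A) x y, β (MulOpposite.op a • x) y = β x (a • y)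

variable {β : M →ₗ[k] M →ₗ[k] M}

theorem IsBalanced.d_cupB (hβ : IsBalanced A β) {p q n : ℕ} (h : p + q = n)
    (h1 : p + 1 + q = n + 1) (h2 : p + (q + 1) = n + 1) (f : Cochain k A M p)
    (g : Cochain k A M q) : d k A M n (cupB β h f g) =
      cupB β h1 (d k A M p f) g + (-1 : ℤ) ^ p • cupB β h2 f (d k A M q g) := by
  subst h
  apply hom_ext
  intro a
  simp only [d_tp, LinearMap.add_apply, LinearMap.smul_apply, cupB_tp, Finset.sum_range_add]
  have e1 : ∀ i ∈ Finset.range p, (-1 : ℤ) ^ (i + 1) • β (f (tp k p (merge i a)))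
      (g (tp k q (shift p (merge i a)))) =
      β ((-1 : ℤ) ^ (i + 1) • f (tp k p (merge i a))) (g (tp k q (shift (p + 1) a))) := by
    intro i hi
    rw [shift_merge (Finset.mem_range.1 hi), map_zsmul, LinearMap.smul_apply]
  have e2 : ∀ i ∈ Finset.range q, (-1 : ℤ) ^ (p + i + 1) • β (f (tp k p (merge (p + i) a)))
      (g (tp k q (shift p (merge (p + i) a)))) =
      (-1 : ℤ) ^ p • β (f (tp k p a)) ((-1 : ℤ) ^ (i + 1) • g (tp k q (merge i (shift p a)))) := by
    intro i hi
    rw [tp_merge_low (by omega), shift_merge', map_zsmul, smul_smul, ← pow_add, add_assoc]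
  have e5 : ∑ i ∈ Finset.range p, β ((-1 : ℤ) ^ (i + 1) • f (tp k p (merge i a)))
      (g (tp k q (shift (p + 1) a))) =
      β (∑ i ∈ Finset.range p, (-1 : ℤ) ^ (i + 1) • f (tp k p (merge i a)))
        (g (tp k q (shift (p + 1) a))) := by
    rw [map_sum, LinearMap.sum_apply]
  rw [Finset.sum_congr rfl e1, Finset.sum_congr rfl e2, e5, ← Finset.smul_sum,
    ← map_sum, shift_shift, shift_shift, add_comm 1 p]
  have e3 : shift p a 0 = a p := rfl
  have e4 : shift p a q = a (p + q) := rfl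
  rw [e3, e4]
  simp only [map_add, LinearMap.add_apply, map_zsmul, LinearMap.smul_apply, hβ.left, hβ.right,
    hβ.mid, smul_add, pow_succ, pow_add, mul_neg, mul_one, neg_smul, smul_neg, smul_smul, map_neg,
    LinearMap.neg_apply]
  abel

theorem cupB_zero_left {p q n : ℕ} (h : p + q = n) (g : Cochain k A M q) :
    cupB β h 0 g = 0 := hom_ext fun a => by
  rw [cupB_tp, LinearMap.zero_apply, LinearMap.zero_apply, map_zero, LinearMap.zero_apply]

theorem cupB_zero_right {p q n : ℕ} (h : p + q = n) (f : Cochain k A M p) :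
    cupB β h f 0 = 0 := hom_ext fun a => by
  rw [cupB_tp, LinearMap.zero_apply, LinearMap.zero_apply, map_zero]

theorem IsBalanced.cupB_mem_left (hβ : IsBalanced A β) {p q n : ℕ} (h : p + q = n)
    {f : Cochain k A M p} (hf : f ∈ coboundaries k A M p) {g : Cochain k A M q}
    (hg : d k A M q g = 0) : cupB β h f g ∈ coboundaries k A M n := by
  cases p with
  | zero =>
    have hf' : f = 0 := hf
    rw [hf', cupB_zero_left]
    exact AddSubgroup.zero_mem _
  | succ p =>
    obtain ⟨y, rfl⟩ := hf
    obtain ⟨n, rfl⟩ : ∃ n', n = n' + 1 := ⟨p + q, by omega⟩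
    refine ⟨cupB β (by omega : p + q = n) y g, ?_⟩
    rw [hβ.d_cupB _ h (by omega), hg, cupB_zero_right, smul_zero, add_zero]

theorem IsBalanced.cupB_mem_right (hβ : IsBalanced A β) {p q n : ℕ} (h : p + q = n)
    {f : Cochain k A M p} (hf : d k A M p f = 0) {g : Cochain k A M q}
    (hg : g ∈ coboundaries k A M q) : cupB β h f g ∈ coboundaries k A M n := by
  cases q with
  | zero =>
    have hg' : g = 0 := hg
    rw [hg', cupB_zero_right]
    exact AddSubgroup.zero_mem _
  | succ q =>
    obtain ⟨y, rfl⟩ := hg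
    obtain ⟨n, rfl⟩ : ∃ n', n = n' + 1 := ⟨p + q, by omega⟩
    refine ⟨(-1 : ℤ) ^ p • cupB β (by omega : p + q = n) f y, ?_⟩
    rw [map_zsmul, hβ.d_cupB _ (by omega) h, hf, cupB_zero_left, zero_add, smul_smul, sg_neg,
      one_smul]

theorem IsBalanced.cupB_sub_cupB_mem (hβ : IsBalanced A β) {p q n : ℕ} (h : p + q = n)
    {f f' : Cochain k A M p} (hff : -f + f' ∈ coboundaries k A M p) (hf : d k A M p f = 0)
    {g g' : Cochain k A M q} (hgg : -g + g' ∈ coboundaries k A M q) (hg : d k A M q g' = 0) :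
    -cupB β h f g + cupB β h f' g' ∈ coboundaries k A M n := by
  have e : -cupB β h f g + cupB β h f' g' =
      cupB β h (-f + f') g' + cupB β h f (-g + g') := hom_ext fun a => by
    simp only [LinearMap.add_apply, LinearMap.neg_apply, cupB_tp, map_add, map_neg]
    abel
  rw [e]
  exact add_mem (hβ.cupB_mem_left h hff hg) (hβ.cupB_mem_right h hf hgg)

end CupPairing

section TransferCup

variable {k : Type*} [CommRing k] {A : Type*} [Ring A] [Algebra k A] {B : Type*} [Ring B]
  [Algebra k B] {L : A →ₐ[k] B}

variable (L) in
/-- The product of `B`, on `B` viewed as an `A`-bimodule. -/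
def mulVia : Via L →ₗ[k] Via L →ₗ[k] Via L := (LinearMap.mul k B : B →ₗ[k] B →ₗ[k] B)

theorem isBalanced_mulVia : IsBalanced A (mulVia L) where
  left a x y := mul_assoc (L a) (show B from x) (show B from y)
  right a x y := (mul_assoc (show B from x) (show B from y) (L a)).symm
  mid a x y := mul_assoc (show B from x) (L a) (show B from y)

/-- The cup product of lifts of `L ∘ f` and `L ∘ f'` is a lift of `L ∘ (f ∪ f')`: both are cup
products with coefficients in `B`, which are well defined on cohomology by the Leibniz rule. -/
theorem restrict_cup {p q n : ℕ} (h : p + q = n) (x : HH k A A p) (x' : HH k A A q)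
    (y : HH k B B p) (y' : HH k B B q) (hy : restrict L p y = pushForward L p x)
    (hy' : restrict L q y' = pushForward L q x') :
    restrict L n (cupAdd h y y') = pushForward L n (cupAdd h x x') := by
  induction x using SQ.ind with
  | h f hf =>
  induction x' using SQ.ind with
  | h f' hf' =>
  induction y using SQ.ind with
  | h g hg =>
  induction y' using SQ.ind with
  | h g' hg' =>
  have h1 := (SQ.mk_eq _ _).1 hy
  have h2 := (SQ.mk_eq _ _).1 hy'
  have hg0 : d k B B p g = 0 := hg
  have hf0 : d k A A q f' = 0 := hf'
  have e1 : restrictC L n (cupC h g g') = cupB (mulVia L) h (restrictC L p g) (restrictC L q g') :=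
    hom_ext fun a => by
      rw [restrictC_tp, cupB_tp, restrictC_tp, restrictC_tp, cupC_tp]
      rfl
  have e2 : (toVia L ∘ₗ L.toLinearMap) ∘ₗ cupC h f f' = cupB (mulVia L) h
      ((toVia L ∘ₗ L.toLinearMap) ∘ₗ f) ((toVia L ∘ₗ L.toLinearMap) ∘ₗ f') :=
    hom_ext fun a => by
      rw [cupB_tp, LinearMap.comp_apply, cupC_tp]
      exact map_mul L _ _
  refine (SQ.mk_eq _ _).2 ?_
  show -restrictC L n (cupC h g g') + (toVia L ∘ₗ L.toLinearMap) ∘ₗ cupC h f f' ∈ _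
  rw [e1, e2]
  refine isBalanced_mulVia.cupB_sub_cupB_mem h h1 ?_ h2 ?_
  · exact (d_restrictC L p g).trans ((congrArg _ hg0).trans (map_zero _))
  · refine (d_comp (toVia L ∘ₗ L.toLinearMap) (fun a m => map_mul L a m)
      (fun a m => map_mul L m a.unop) q f').trans ?_
    rw [hf0, LinearMap.comp_zero]

end TransferCup

/-! ### The algebra `Â` -/

section LocAlgebra

variable {k : Type} [Field k] {A : Type u} [Ring A] [Algebra k A]
  {S : Submonoid (Subalgebra.center k A)}

theorem isLocalizedModule_mk (S : Submonoid (Subalgebra.center k A)) (M : Type*) [AddCommGroup M]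
    [Module (Subalgebra.center k A) M] :
    IsLocalizedModule S (TensorProduct.mk (Subalgebra.center k A) (Localization S) M 1) :=
  (isLocalizedModule_iff_isBaseChange S (Localization S) _).2 (TensorProduct.isBaseChange _ _ _)

theorem exists_smul_eq_one_tmul {M : Type*} [AddCommGroup M] [Module (Subalgebra.center k A) M]
    (z : Localization S ⊗[Subalgebra.center k A] M) :
    ∃ (s : S) (m : M), (s : Subalgebra.center k A) • z = 1 ⊗ₜ m := by
  have := isLocalizedModule_mk S M
  obtain ⟨⟨m, s⟩, h⟩ := IsLocalizedModule.surj S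
    (TensorProduct.mk (Subalgebra.center k A) (Localization S) M 1) z
  exact ⟨s, m, h⟩

theorem exists_smul_eq_zero_of_one_tmul {M : Type*} [AddCommGroup M]
    [Module (Subalgebra.center k A) M] (m : M)
    (h : (1 : Localization S) ⊗ₜ[Subalgebra.center k A] m = 0) :
    ∃ s : S, (s : Subalgebra.center k A) • m = 0 := by
  have := isLocalizedModule_mk S M
  obtain ⟨s, hs⟩ := (IsLocalizedModule.eq_zero_iff S
    (TensorProduct.mk (Subalgebra.center k A) (Localization S) M 1)).1 h
  exact ⟨s, hs⟩

theorem mk_mul_algebraMap (s : S) :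
    Localization.mk 1 s * algebraMap (Subalgebra.center k A) (Localization S) s = 1 := by
  rw [← Localization.mk_one_eq_algebraMap, Localization.mk_mul, one_mul, mul_one,
    Localization.mk_self]

section Modules

variable {M : Type*} [AddCommGroup M] [Module (Localization S) M]
  [Module (Subalgebra.center k A) M] [IsScalarTower (Subalgebra.center k A) (Localization S) M]

theorem mk_smul_smul (s : S) (m : M) :
    (Localization.mk 1 s : Localization S) • ((s : Subalgebra.center k A) • m) = m := by
  rw [← algebraMap_smul (Localization S) (s : Subalgebra.center k A) m, smul_smul,
    mk_mul_algebraMap, one_smul]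

theorem smul_mk_smul (s : S) (m : M) :
    (s : Subalgebra.center k A) • ((Localization.mk 1 s : Localization S) • m) = m := by
  rw [← algebraMap_smul (Localization S) (s : Subalgebra.center k A), smul_smul, mul_comm,
    mk_mul_algebraMap, one_smul]

theorem eq_zero_of_smul_eq_zero (s : S) (m : M) (h : (s : Subalgebra.center k A) • m = 0) :
    m = 0 := by
  rw [← mk_smul_smul s m, h, smul_zero]

end Modules

/-- The two images of a central element in `Â` agree. -/
theorem locMap_center (z : Subalgebra.center k A) :
    locMap S (z : A) = algebraMap (Localization S) (Loc S) (algebraMap _ _ z) := by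
  show (1 : Localization S) ⊗ₜ[Subalgebra.center k A] (z : A) =
    (algebraMap _ (Localization S) z) ⊗ₜ[Subalgebra.center k A] (1 : A)
  rw [Algebra.algebraMap_eq_smul_one, TensorProduct.smul_tmul, Algebra.smul_def, mul_one]
  rfl

theorem locMap_center_mul (z : Subalgebra.center k A) (b : Loc S) :
    locMap S (z : A) * b = z • b := by
  rw [locMap_center, ← Algebra.smul_def]
  exact algebraMap_smul (Localization S) z b

variable (S) in
/-- The map `A → Â` is a central localization, because `Â` is the localization of the module `A`
over the centre. -/
theorem isCentralLoc_locMap : IsCentralLoc S (locMap S) where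
  isUnit s := by
    rw [locMap_center]
    exact (IsLocalization.map_units (Localization S) s).map _
  comm s b := by
    rw [locMap_center]
    exact Algebra.commutes _ b
  surj b := by
    obtain ⟨s, a, h⟩ := exists_smul_eq_one_tmul (M := A) b
    exact ⟨s, a, (locMap_center_mul _ b).trans h⟩
  inj a ha := exists_smul_eq_zero_of_one_tmul a ha

variable (S) in
theorem restrict_locMap_bijective (p : ℕ) : Function.Bijective (restrict (locMap S) p) :=
  (isCentralLoc_locMap S).barExact.restrict_bijective p

/-! ### The map on Hochschild cohomology -/

theorem restrict_Lstar (p : ℕ) (f : HH k A A p) :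
    restrict (locMap S) p (Lstar S p f) = pushForward (locMap S) p f :=
  apply_invAdd_apply (restrict_locMap_bijective S p) _

theorem Lstar_eq {p : ℕ} {f : HH k A A p} {y : HH k (Loc S) (Loc S) p}
    (h : restrict (locMap S) p y = pushForward (locMap S) p f) : Lstar S p f = y :=
  (restrict_locMap_bijective S p).1 ((restrict_Lstar p f).trans h.symm)

theorem LHat_tmul (p : ℕ) (z : Localization S) (f : HH k A A p) :
    LHat S p (z ⊗ₜ f) = z • Lstar S p f := LinearMap.liftBaseChange_tmul _ _ _ _

theorem cup_scalarClass {R : Type*} [CommRing R] {B : Type*} [Ring B] [Algebra k B] [Algebra R B]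
    [SMulCommClass k R B] (p : ℕ) (f : HH k B B p) (r : R) :
    cup (k := k) (A := B) R p 0 f (scalarClass k B r) = r • f := by
  induction f using SQ.ind with
  | h f hf =>
    refine SQ.mk_congr _ (hom_ext fun a => ?_)
    show cupC (Nat.add_zero p) f (constC (algebraMap R B r)) (tp k p a) = r • f (tp k p a)
    rw [cupC_tp, constC_tp, Algebra.smul_def, Algebra.commutes]

theorem Lstar_scalarClass_one :
    Lstar S 0 (scalarClass k A (1 : Subalgebra.center k A)) =
      scalarClass k (Loc S) (1 : Localization S) :=
  Lstar_eq (SQ.mk_congr _ (hom_ext fun a => by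
    refine (restrictC_tp _ _ _ a).trans ?_
    show toVia (locMap S) (constC _ (tp k 0 _)) =
      toVia (locMap S) (locMap S (constC _ (tp k 0 a)))
    rw [constC_tp, constC_tp]
    exact congrArg (toVia (locMap S)) (by rw [map_one, map_one, map_one])))

theorem Lstar_cup (p q : ℕ) (f : HH k A A p) (g : HH k A A q) :
    Lstar S (p + q) (cup (k := k) (A := A) (Subalgebra.center k A) p q f g) =
      cup (k := k) (A := Loc S) (Localization S) p q (Lstar S p f) (Lstar S q g) :=
  Lstar_eq (restrict_cup rfl f g _ _ (restrict_Lstar p f) (restrict_Lstar q g))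

theorem LHat_locCup (p q : ℕ) (x : HHLoc S p) (y : HHLoc S q) :
    LHat S (p + q) (locCup S p q x y) =
      cup (k := k) (A := Loc S) (Localization S) p q (LHat S p x) (LHat S q y) := by
  induction x using TensorProduct.induction_on with
  | zero => simp only [map_zero, LinearMap.zero_apply]
  | add x x' hx hx' => simp only [map_add, LinearMap.add_apply, hx, hx']
  | tmul z f =>
    induction y using TensorProduct.induction_on with
    | zero => simp only [map_zero]
    | add y y' hy hy' => simp only [map_add, hy, hy']
    | tmul w g =>
      rw [locCup_tmul, LHat_tmul, LHat_tmul, LHat_tmul, Lstar_cup, map_smul, map_smul,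
        LinearMap.smul_apply, smul_smul, mul_comm]

theorem act_self (s t : Subalgebra.center k A) (p : ℕ) (x : HH k A A p) :
    HH.act s t p x = (s * t) • x := by
  induction x using SQ.ind with
  | h f hf =>
    refine SQ.mk_congr _ (LinearMap.ext fun z => ?_)
    show (s : A) * (f z * t) = s * t * f z
    rw [← center_comm t, mul_assoc]

/-- On the cohomology of `Â` the two-sided action of central elements is the action of their
product. -/
theorem act_cent (s t : S) (p : ℕ) (y : HH k (Loc S) (Loc S) p) :
    HH.act ((isCentralLoc_locMap S).cent s) ((isCentralLoc_locMap S).cent t) p y =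
      ((s * t : S) : Subalgebra.center k A) • y := by
  refine (act_self _ _ p y).trans ?_
  induction y using SQ.ind with
  | h f hf =>
    refine SQ.mk_congr _ (LinearMap.ext fun z => ?_)
    refine Eq.trans ?_ (locMap_center_mul _ (f z))
    exact congrArg (· * f z) (map_mul (locMap S) _ _).symm

/-- Both halves clear denominators: an element of the source is `f ⊗ r⁻¹`, and a class of `Â` is
`L^* f` after multiplication by an element of `S`. -/
theorem LHat_bijective (hA : HomologicallySmooth k A) (p : ℕ) :
    Function.Bijective (LHat S p) := by
  have h := isCentralLoc_locMap S
  constructor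
  · rw [injective_iff_map_eq_zero]
    intro z hz
    obtain ⟨r, x, hr⟩ := exists_smul_eq_one_tmul z
    have hx : Lstar S p x = 0 := by
      rw [← one_smul (Localization S) (Lstar S p x), ← LHat_tmul, ← hr,
        ← algebraMap_smul (Localization S), map_smul, hz, smul_zero]
    obtain ⟨s, t, hst⟩ := h.exists_act_eq_zero hA (isSemi_toLinearMap _) h.isBimLocal p x hx
    rw [act_self] at hst
    apply eq_zero_of_smul_eq_zero r
    apply eq_zero_of_smul_eq_zero (s * t)
    rw [hr, ← TensorProduct.tmul_smul]
    exact (congrArg ((1 : Localization S) ⊗ₜ[Subalgebra.center k A] ·) hst).trans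
      (TensorProduct.tmul_zero _ _)
  · intro y
    obtain ⟨s, t, x, hx⟩ := h.exists_transfer hA (isSemi_toLinearMap _) h.isBimLocal p y
    rw [act_cent] at hx
    refine ⟨Localization.mk 1 (s * t) ⊗ₜ x, ?_⟩
    rw [LHat_tmul]
    refine (congrArg (Localization.mk 1 (s * t) • ·) hx.symm).trans ?_
    exact mk_smul_smul (s * t) y

/-! ### The BV operator of the localization -/

section BV

variable {n : ℕ} {π : Homology k A A n}

/-- The isomorphism of cohomologies commutes with the BV operators, because `L_*` commutes with the
Connes differential and `L^*(f) ∩ L_*(π) = L_*(f ∩ π)`. -/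
theorem bvOp_Lstar (hπ : IsDualizing n π) (hπ' : IsDualizing n (homologyMap (locMap S) n π))
    (p : ℕ) (f : HH k A A (p + 1)) :
    bvOp n (homologyMap (locMap S) n π) p (Lstar S (p + 1) f) = Lstar S p (bvOp n π p f) := by
  have hc : ∀ {p q : ℕ} (h : p + q = n) (f : HH k A A p),
      cap h (Lstar S p f) (homologyMap (locMap S) n π) = homologyMap (locMap S) q (cap h f π) :=
    fun {p q} h f => cap_homologyMap (isSemi_toLinearMap (locMap S)) h
      ((isCentralLoc_locMap S).barExact.restr_bijective p) f π
  by_cases h : p + 1 ≤ n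
  · obtain ⟨q, hq⟩ : ∃ q, p + 1 + q = n := ⟨n - (p + 1), by omega⟩
    have hq' : p + (q + 1) = n := by omega
    apply (hπ'.1 p (q + 1) hq').1
    show cap _ _ _ = cap _ _ _
    rw [dual_bvOp hπ' hq, hc, hc, dual_bvOp hπ hq, connesHom_homologyMap]
  · have := hπ.2.1 (p + 1) (by omega)
    rw [Subsingleton.elim f 0, map_zero, map_zero, map_zero, map_zero]

theorem cent_smul (s : S) (p : ℕ) (y : HH k (Loc S) (Loc S) p) :
    (isCentralLoc_locMap S).cent s • y = (s : Subalgebra.center k A) • y := by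
  induction y using SQ.ind with
  | h f hf => exact SQ.mk_congr _ (LinearMap.ext fun z => locMap_center_mul _ (f z))

/-- The bracket with central elements is compatible with `L^*`, being expressible through the
BV operators. -/
theorem bracketCenter_Lstar (hπ : IsDualizing n π)
    (hπ' : IsDualizing n (homologyMap (locMap S) n π)) (s : S) (p : ℕ) (f : HH k A A (p + 1)) :
    bracketCenter ((isCentralLoc_locMap S).cent s) p (Lstar S (p + 1) f) =
      Lstar S p (bracketCenter (s : Subalgebra.center k A) p f) := by
  have h1 := bvOp_smul (s : Subalgebra.center k A) hπ p f
  have h2 := bvOp_smul ((isCentralLoc_locMap S).cent s) hπ' p (Lstar S (p + 1) f)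
  rw [cent_smul, cent_smul, ← map_smul, bvOp_Lstar hπ hπ', bvOp_Lstar hπ hπ', h1, map_sub,
    map_smul] at h2
  exact (sub_right_injective h2).symm

theorem bracketCenter_smul {R : Type*} [CommRing R] {B : Type*} [Ring B] [Algebra k B]
    [Algebra R B] [SMulCommClass k R B] (c : Subalgebra.center k B) (r : R) (p : ℕ)
    (f : HH k B B (p + 1)) : bracketCenter c p (r • f) = r • bracketCenter c p f := by
  induction f using SQ.ind with
  | h f hf =>
    refine SQ.mk_congr _ (hom_ext fun a => ?_)
    show bracketC (c : B) p (r • f) (tp k p a) = r • bracketC (c : B) p f (tp k p a)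
    rw [bracketC_tp, bracketC_tp]
    simp only [LinearMap.smul_apply, smul_comm _ r, ← Finset.smul_sum]

/-- The formula for the BV operator on fractions, obtained by applying the BV identity to
`s · (s⁻¹ L^* f) = L^* f`. -/
theorem bvOp_mk_smul_Lstar (hπ : IsDualizing n π)
    (hπ' : IsDualizing n (homologyMap (locMap S) n π)) (s : S) (p : ℕ) (f : HH k A A (p + 1)) :
    bvOp n (homologyMap (locMap S) n π) p (Localization.mk 1 s • Lstar S (p + 1) f) =
      Localization.mk 1 s • Lstar S p (bvOp n π p f) +
        (Localization.mk 1 s) ^ 2 • Lstar S p (bracketCenter (s : Subalgebra.center k A) p f) := by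
  have h2 := bvOp_smul ((isCentralLoc_locMap S).cent s) hπ' p
    ((Localization.mk 1 s : Localization S) • Lstar S (p + 1) f)
  rw [cent_smul, cent_smul, smul_mk_smul, bvOp_Lstar hπ hπ', bracketCenter_smul,
    bracketCenter_Lstar hπ hπ', eq_sub_iff_add_eq] at h2
  rw [← mk_smul_smul s (bvOp n _ p _), ← h2, smul_add, smul_smul, pow_two]

/-- The BV operator of `Â`, transported to the localization of `HH^*(A)` along `L̂^*`. -/
def bvLoc (π' : Homology k (Loc S) (Loc S) n) (p : ℕ) : HHLoc S (p + 1) →+ HHLoc S p where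
  toFun x := invAdd (LHat S p).toAddMonoidHom (bvOp n π' p (LHat S (p + 1) x))
  map_zero' := by rw [map_zero, map_zero, map_zero]
  map_add' x y := by rw [map_add, map_add, map_add]

theorem LHat_bvLoc (π' : Homology k (Loc S) (Loc S) n) {p : ℕ}
    (h : Function.Bijective (LHat S p)) (x : HHLoc S (p + 1)) :
    LHat S p (bvLoc π' p x) = bvOp n π' p (LHat S (p + 1) x) :=
  @apply_invAdd_apply (HHLoc S p) (HH k (Loc S) (Loc S) p) _ _ (LHat S p).toAddMonoidHom h _

end BV

end LocAlgebra

end Hoch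

end

theorem mainTheorem4 {A : Type u} [Ring A] [Algebra ℂ A]
    (S : Submonoid (Subalgebra.center ℂ A)) (hS : (0 : Subalgebra.center ℂ A) ∉ S) :
    -- restriction `HHᵖ(Â, Â) → HHᵖ(A, Â)` is invertible, so that `L^*` is the composite of
    -- `f ↦ L ∘ f` with its inverse
    (∀ p, Function.Bijective (restrict (locMap S) p)) ∧
    -- the `Ẑ`-linear map `L̂^*` is the stated one and is a morphism of graded algebras
    ((∀ (p : ℕ) (z : Localization S) (f : HH ℂ A A p),
        LHat S p (z ⊗ₜ f) = cup (k := ℂ) (A := Loc S) (Localization S) p 0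
          (Lstar S p f) (scalarClass ℂ (Loc S) z)) ∧
      LHat S 0 (1 ⊗ₜ scalarClass ℂ A (1 : Subalgebra.center ℂ A)) =
        scalarClass ℂ (Loc S) (1 : Localization S) ∧
      ∀ (p q : ℕ) (x : HHLoc S p) (y : HHLoc S q),
        LHat S (p + q) (locCup S p q x y) =
          cup (k := ℂ) (A := Loc S) (Localization S) p q (LHat S p x) (LHat S q y)) ∧
    -- it is an isomorphism if `A` is homologically smooth
    (HomologicallySmooth ℂ A → ∀ p, Function.Bijective (LHat S p)) ∧
    -- it is an isomorphism of BV algebras if `A` is Calabi–Yau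
    (∀ (n : ℕ) (π : Homology ℂ A A n), IsCY ℂ A n → IsNondegenerate n π →
      IsDualizing n π ∧
      IsCY ℂ (Loc S) n ∧
      IsNondegenerate n (homologyMap (locMap S) n π) ∧
      IsDualizing n (homologyMap (locMap S) n π) ∧
      (∀ p, Function.Bijective (LHat S p)) ∧
      ∃ Δ : ∀ p, HHLoc S (p + 1) →+ HHLoc S p,
        (∀ (p : ℕ) (s : S) (f : HH ℂ A A (p + 1)),
          Δ p (Localization.mk 1 s ⊗ₜ f) =
            Localization.mk 1 s ⊗ₜ bvOp n π p f +
              ((Localization.mk 1 s) ^ 2) ⊗ₜ bracketCenter (s : Subalgebra.center ℂ A) p f) ∧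
        (∀ (p : ℕ) (x : HHLoc S (p + 2)), Δ p (Δ (p + 1) x) = 0) ∧
        ∀ (p : ℕ) (x : HHLoc S (p + 1)),
          LHat S p (Δ p x) =
            bvOp n (homologyMap (locMap S) n π) p (LHat S (p + 1) x)) := by
  refine ⟨restrict_locMap_bijective S, ⟨fun p z f => ?_, ?_, LHat_locCup⟩, LHat_bijective,
    fun n π hA hπ => ?_⟩
  · exact (LHat_tmul p z f).trans (cup_scalarClass p (Lstar S p f) z).symm
  · exact (LHat_tmul 0 1 _).trans ((one_smul _ _).trans Lstar_scalarClass_one)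
  · have hL := isCentralLoc_locMap S
    have hD := hπ.isDualizing hA
    have hA' := hL.isCY hA hπ
    have hπ' := hL.isNondegenerate hA.1 hπ
    have hD' := hπ'.isDualizing hA'
    have hb : ∀ p, Function.Bijective (LHat S p) := LHat_bijective hA.1
    refine ⟨hD, hA', hπ', hD', hb, bvLoc (homologyMap (locMap S) n π),
      fun p s f => (hb p).1 ?_, fun p x => (hb p).1 ?_, fun p => LHat_bvLoc _ (hb p)⟩
    · rw [LHat_bvLoc _ (hb p), LHat_tmul, bvOp_mk_smul_Lstar hD hD', map_add, LHat_tmul, LHat_tmul]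
    · rw [LHat_bvLoc _ (hb p), LHat_bvLoc _ (hb (p + 1)), bvOp_bvOp hD', map_zero]
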